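/- **Setting.** Let $(M,g)$ be a pseudo-Riemannian spin manifold with Levi-Civita connection $\nabla$ and curvature $R(X,Y)=[\nabla_X,\nabla_Y]-\nabla_{[X,Y]}$, and let $S$ be the (real or complex) spinor bundle associated to the spin structure by a finite dimensional Clifford module, with Clifford relation $vw+wv=-2\kappa g(v,w)$, where $\kappa=1$ is the usual convention and $\kappa=-1$ is also allowed. Let $C$ be a charge conjugation on $S$ that gives rise to supersymmetry: a nondegenerate bilinear form, invariant under $\mathfrak{spin}$ and under the transition functions of the spin structure, with $C(\varphi,\gamma_i\psi)=C(\psi,\gamma_i\varphi)$. Let $\hat M$ be the special graded manifold with superalgebra of functions $\Gamma\Lambda S$, let $\mathfrak X(\hat M)=\mathfrak X(\hat M)_0\oplus\mathfrak X(\hat M)_1$ be the Lie superalgebra of its superderivations (fields), and write $f\otimes X$ for $h\mapsto f\wedge\nabla_Xh$ and $f\otimes\theta$ for $h\mapsto f\wedge(\theta\rfloor h)$, where $\theta\rfloor$ is the antiderivation with $\theta\rfloor\psi=C(\theta,\psi)$ for $\psi\in\Gamma S$. If $S$ is complex, vector fields are complexified. An endomorphism $B$ of $TM$ acts on $S$ as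 $\frac{\kappa}{4}g(Be_{[p},e_{q]})\gamma^p\gamma^q$, and on $\Lambda S$ as the corresponding derivation. Indices refer to a local orthonormal frame $(e_i)$, and $\gamma^i=g^{ij}\gamma_j$. Put $$\mathfrak e(X)=\nabla_X-\nabla X,\qquad \mathfrak o(\varphi)=\varphi\rfloor+\gamma^i\varphi\otimes e_i,$$ for a vector field $X$ and a spinor field $\varphi$ (in $\mathfrak e(X)$ only the skew part of $\nabla X$ acts), and $\{\varphi,\psi\}=2C(\varphi,\gamma^i\psi)e_i$. Let $\mathcal K_0$ be the space of Killing vector fields and $\mathcal K_1$ the space of parallel spinors. For a covariant tensor $A$ of degree $k$ with values in $\mathrm{End}(TM)$, respectively in $TM$, put $$\mathfrak B^{(k)}(A;\xi_1,\dots,\xi_k)=\gamma^{i_1}\xi_1\wedge\dots\wedge\gamma^{i_k}\xi_k\wedge A_{i_1\cdots i_k},\qquad \mathfrak D^{(k)}(A;\xi_1,\dots,\xi_k)=A_{i_1\cdots i_k}{}^j\,\gamma^{i_1}\xi_1\wedge\dots\wedge\gamma^{i_k}\xi_k\otimes\nabla_j .$$ An $\mathrm{End}(TM)$-valued tensor $A$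 of degree $k$ is also regarded as a $TM$-valued tensor of degree $k+1$ by $A_{i_1\cdots i_k}e_p=A_{i_1\cdots i_kp}{}^qe_q$. Consider the operations * (a) $(\nabla A)_{i_0i_1\cdots i_k}=(\nabla_{i_0}A)_{i_1\cdots i_k}$; * (b) $(A\rfloor^1R)_{i_1\cdots i_km}=A_{i_1\cdots i_k}{}^nR_{mn}$; * (c) $(A\bullet B)_{i_1\cdots i_kj_1\cdots j_l}=[A_{i_1\cdots i_k},B_{j_1\cdots j_l}]-\sum_\beta A_{i_1\cdots i_kj_\beta}{}^mB_{j_1\cdots m\cdots j_l}+\sum_\alpha B_{j_1\cdots j_li_\alpha}{}^mA_{i_1\cdots m\cdots i_k}$; * (d) $(A\rfloor^1B\rfloor^2R)_{i_1\cdots i_kj_1\cdots j_l}=A_{i_1\cdots i_k}{}^mB_{j_1\cdots j_l}{}^nR_{mn}$; * (e) $(\nabla_AB)_{i_1\cdots i_kj_1\cdots j_l}=A_{i_1\cdots i_k}{}^m\nabla_mB_{j_1\cdots j_l}$; * (f) $(A\circ B)_{i_1\cdots i_kj_1\cdots j_l}{}^m=\sum_\alpha B_{j_1\cdots j_li_\alpha}{}^nA_{i_1\cdots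 n\cdots i_k}{}^m$. Let $\mathcal T^{\mathrm{End}}$ and $\mathcal T^{TM}$ be the smallest families of tensors such that: $R\in\mathcal T^{\mathrm{End}}$ and $\mathcal T^{\mathrm{End}}\subset\mathcal T^{TM}$; both families are closed under (a); for $A,A'\in\mathcal T^{\mathrm{End}}$ and $D,D'\in\mathcal T^{TM}$ the tensors $A\bullet A'$, $D\rfloor^1R$, $D\rfloor^1D'\rfloor^2R$ and $\nabla_DA$ are in $\mathcal T^{\mathrm{End}}$; and $\nabla_DD'$ and $D\circ A$ are in $\mathcal T^{TM}$. **Theorem.** The tensors in $\mathcal T^{\mathrm{End}}$ take values in the skew-symmetric endomorphisms. For $A\in\mathcal T^{\mathrm{End}}$ of degree $k$, $\mathfrak B^{(k)}(A;\xi_1,\dots,\xi_k)$ is a well defined s-like field, given by a section of $\Lambda^{k+1}S\otimes S$, and for $A\in\mathcal T^{TM}$ of degree $k$, $\mathfrak D^{(k)}(A;\xi_1,\dots,\xi_k)$ is a well defined v-like field, given by a section of $\Lambda^kS\otimes TM$. Both have parity $k$ mod 2 and are multilinear in the spinor fields $\xi_1,\dots,\xi_k$. Let $\mathfrak Z$ be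 the span of all $\mathfrak B^{(k)}(A;\xi_1,\dots,\xi_k)$ with $A\in\mathcal T^{\mathrm{End}}$ and all $\mathfrak D^{(k)}(A;\xi_1,\dots,\xi_k)$ with $A\in\mathcal T^{TM}$, where $\xi_1,\dots,\xi_k\in\mathcal K_1$. Then $(\mathcal K_0\oplus\mathcal K_1,\mathfrak Z,\mathfrak e,\mathfrak o)$ is a supersymmetric Killing structure with centre $\mathfrak Z$: the maps $\mathfrak e$ and $\mathfrak o$ are linear with values in $\mathfrak X(\hat M)_0$ and $\mathfrak X(\hat M)_1$, $\mathfrak Z\subset\mathfrak X(\hat M)$ is a graded subspace, the sum $\mathfrak e(\mathcal K_0)\oplus\mathfrak Z\oplus\mathfrak o(\mathcal K_1)$ is direct, and $[\mathfrak e(\mathcal K_0),\mathfrak Z]$, $[\mathfrak o(\mathcal K_1),\mathfrak Z]$ and $[\mathfrak Z,\mathfrak Z]$ are contained in $\mathfrak Z$. For $X,Y\in\mathcal K_0$ and $\varphi,\psi\in\mathcal K_1$ one has $[X,Y]\in\mathcal K_0$, $\mathfrak e(X)\varphi=\nabla_X\varphi-(\nabla X)\varphi\in\mathcal K_1$, $\{\varphi,\psi\}\in\mathcal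 K_0$, and $$[\mathfrak e(X),\mathfrak e(Y)]=\mathfrak e([X,Y]),\quad[\mathfrak e(X),\mathfrak o(\varphi)]=\mathfrak o(\mathfrak e(X)\varphi),\quad[\mathfrak o(\varphi),\mathfrak o(\psi)]=\mathfrak e(\{\varphi,\psi\})+\mathfrak B^{(2)}(R;\varphi,\psi).$$ For $X\in\mathcal K_0$, for $\varphi,\xi_\alpha,\eta_\beta\in\mathcal K_1$, and for all tensors $A,B$ of the family required by the field in which they stand on the left hand side ($\mathcal T^{\mathrm{End}}$ in $\mathfrak B$, $\mathcal T^{TM}$ in $\mathfrak D$): 1. $[\mathfrak e(X),\mathfrak B^{(k)}(A;\xi_1,\dots,\xi_k)]=\sum_\alpha\mathfrak B^{(k)}(A;\xi_1,\dots,\mathfrak e(X)\xi_\alpha,\dots,\xi_k)$; 2. $[\mathfrak e(X),\mathfrak D^{(k)}(A;\xi_1,\dots,\xi_k)]=\sum_\alpha\mathfrak D^{(k)}(A;\xi_1,\dots,\mathfrak e(X)\xi_\alpha,\dots,\xi_k)$; 3. $[\mathfrak o(\varphi),\mathfrak B^{(k)}(A;\xi_1,\dots,\xi_k)]=\mathfrak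 B^{(k+1)}(\nabla A;\varphi,\xi_1,\dots,\xi_k)+(-1)^k\mathfrak D^{(k+1)}(A;\xi_1,\dots,\xi_k,\varphi)$; 4. $[\mathfrak o(\varphi),\mathfrak D^{(k)}(A;\xi_1,\dots,\xi_k)]=\mathfrak D^{(k+1)}(\nabla A;\varphi,\xi_1,\dots,\xi_k)+(-1)^k\mathfrak B^{(k+1)}(A\rfloor^1R;\xi_1,\dots,\xi_k,\varphi)$; 5. $[\mathfrak B^{(k)}(A;\xi_1,\dots,\xi_k),\mathfrak B^{(l)}(B;\eta_1,\dots,\eta_l)]=\mathfrak B^{(k+l)}(A\bullet B;\xi_1,\dots,\xi_k,\eta_1,\dots,\eta_l)$; 6. $[\mathfrak D^{(k)}(A;\xi_1,\dots,\xi_k),\mathfrak D^{(l)}(B;\eta_1,\dots,\eta_l)]=\mathfrak B^{(k+l)}(A\rfloor^1B\rfloor^2R;\xi_1,\dots,\xi_k,\eta_1,\dots,\eta_l)+\mathfrak D^{(k+l)}(\nabla_AB-\nabla_BA;\xi_1,\dots,\xi_k,\eta_1,\dots,\eta_l)$, where in $\nabla_BA$ the indices belonging to $A$ are put in front of those belonging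 to $B$; 7. $[\mathfrak D^{(k)}(A;\xi_1,\dots,\xi_k),\mathfrak B^{(l)}(B;\eta_1,\dots,\eta_l)]=\mathfrak B^{(k+l)}(\nabla_AB;\xi_1,\dots,\xi_k,\eta_1,\dots,\eta_l)+\mathfrak D^{(k+l)}(A\circ B;\xi_1,\dots,\xi_k,\eta_1,\dots,\eta_l)$. -/

import Mathlib

open scoped Manifold ContDiff TensorProduct

noncomputable section

namespace SGM

/-- The model space of an `n`-dimensional manifold. -/
abbrev Model (n : ℕ) : Type := EuclideanSpace ℝ (Fin n)

/-! ### Functions with values in a finite dimensional vector space -/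

section Smooth

variable (𝕜 : Type*) [RCLike 𝕜] {n : ℕ} {M : Type*} [TopologicalSpace M] [ChartedSpace (Model n) M]
  {W : Type*} [AddCommGroup W] [Module 𝕜 W]

/-- Smoothness on `U` of a function with values in a finite dimensional vector space:
all its components are smooth. -/
def SmoothOn (n : ℕ) {M : Type*} [TopologicalSpace M] [ChartedSpace (Model n) M]
    {W : Type*} [AddCommGroup W] [Module 𝕜 W] (f : M → W) (U : Set M) : Prop :=
  ∀ l : W →ₗ[𝕜] 𝕜, ContMDiffOn 𝓘(ℝ, Model n) 𝓘(ℝ, 𝕜) ∞ (fun x => l (f x)) U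

/-- The derivative `df_x(v)` of a scalar function. -/
def scalDeriv {n : ℕ} {M : Type*} [TopologicalSpace M] [ChartedSpace (Model n) M]
    (f : M → 𝕜) (x : M) (v : TangentSpace 𝓘(ℝ, Model n) x) : 𝕜 :=
  mfderiv 𝓘(ℝ, Model n) 𝓘(ℝ, 𝕜) f x v

/-- The derivative at `x`, in the direction `v`, of a function with values in a finite dimensional
vector space, computed componentwise in a basis. -/
def dirDeriv {n : ℕ} {M : Type*} [TopologicalSpace M] [ChartedSpace (Model n) M]
    {W : Type*} [AddCommGroup W] [Module 𝕜 W] [Module.Finite 𝕜 W]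
    (f : M → W) (x : M) (v : TangentSpace 𝓘(ℝ, Model n) x) : W :=
  ∑ b, scalDeriv 𝕜 (fun y => (Module.finBasis 𝕜 W).coord b (f y)) x v • Module.finBasis 𝕜 W b

variable {𝕜}

theorem SmoothOn.const (w : W) (U : Set M) : SmoothOn 𝕜 n (fun _ : M => w) U :=
  fun _ => contMDiffOn_const

theorem SmoothOn.add {f h : M → W} {U : Set M} (hf : SmoothOn 𝕜 n f U) (hh : SmoothOn 𝕜 n h U) :
    SmoothOn 𝕜 n (fun x => f x + h x) U := by
  intro l
  have := (hf l).add (hh l)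
  simp only [map_add]
  exact this

theorem SmoothOn.smul (c : 𝕜) {f : M → W} {U : Set M} (hf : SmoothOn 𝕜 n f U) :
    SmoothOn 𝕜 n (fun x => c • f x) U := by
  intro l
  have := hf (c • l)
  simpa using this

theorem SmoothOn.comp_linear {W' : Type*} [AddCommGroup W'] [Module 𝕜 W'] (T : W →ₗ[𝕜] W')
    {f : M → W} {U : Set M} (hf : SmoothOn 𝕜 n f U) : SmoothOn 𝕜 n (fun x => T (f x)) U :=
  fun l => hf (l ∘ₗ T)

theorem SmoothOn.mul {A : Type*} [Ring A] [Algebra 𝕜 A] [Module.Finite 𝕜 A]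
    {f h : M → A} {U : Set M} (hf : SmoothOn 𝕜 n f U) (hh : SmoothOn 𝕜 n h U) :
    SmoothOn 𝕜 n (fun x => f x * h x) U := by
  intro l
  set b := Module.finBasis 𝕜 A
  have key : (fun x => l (f x * h x)) =
      fun x => ∑ i, ∑ j, (b.coord i (f x) * b.coord j (h x)) * l (b i * b j) := by
    funext x
    conv_lhs => rw [← b.sum_repr (f x), ← b.sum_repr (h x)]
    simp only [Finset.sum_mul_sum, map_sum, smul_mul_smul_comm, map_smul, smul_eq_mul,
      Module.Basis.coord_apply]
  rw [key]
  refine contMDiffOn_finsetSum (fun i _ => contMDiffOn_finsetSum (fun j _ => ?_))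
  have e1 : ContMDiffOn 𝓘(ℝ, Model n) 𝓘(ℝ, 𝕜 × 𝕜) ∞
      (fun x => (b.coord i (f x), b.coord j (h x))) U :=
    (hf (b.coord i)).prodMk_space (hh (b.coord j))
  have e2 : ContMDiff 𝓘(ℝ, 𝕜 × 𝕜) 𝓘(ℝ, 𝕜) ∞
      (fun p : 𝕜 × 𝕜 => (p.1 * p.2) * l (b i * b j)) :=
    ((contDiff_fst.mul contDiff_snd).mul contDiff_const).contMDiff
  exact e2.comp_contMDiffOn e1

theorem scalDeriv_mul {f : M → 𝕜} {U : Set M} (hU : IsOpen U)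
    (hf : ContMDiffOn 𝓘(ℝ, Model n) 𝓘(ℝ, 𝕜) ∞ f U) {x : M} (hx : x ∈ U) (c : 𝕜)
    (v : TangentSpace 𝓘(ℝ, Model n) x) :
    scalDeriv 𝕜 (fun y => c * f y) x v = c * scalDeriv 𝕜 f x v := by
  have h1 : MDifferentiableAt 𝓘(ℝ, Model n) 𝓘(ℝ, 𝕜) f x :=
    ((hf x hx).contMDiffAt (hU.mem_nhds hx)).mdifferentiableAt (by simp)
  have h2 := (ContinuousLinearMap.mul ℝ 𝕜 c).hasMFDerivAt (x := f x)
  have h3 := (h2.comp x h1.hasMFDerivAt).mfderiv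
  have h4 : (fun y => c * f y) = (ContinuousLinearMap.mul ℝ 𝕜 c) ∘ f := by
    funext y; simp
  rw [h4]
  exact congrArg (fun T => T v) h3

theorem scalDeriv_add {f h : M → 𝕜} {U : Set M} (hU : IsOpen U)
    (hf : ContMDiffOn 𝓘(ℝ, Model n) 𝓘(ℝ, 𝕜) ∞ f U)
    (hh : ContMDiffOn 𝓘(ℝ, Model n) 𝓘(ℝ, 𝕜) ∞ h U) {x : M} (hx : x ∈ U)
    (v : TangentSpace 𝓘(ℝ, Model n) x) :
    scalDeriv 𝕜 (fun y => f y + h y) x v = scalDeriv 𝕜 f x v + scalDeriv 𝕜 h x v := by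
  have h1 : MDifferentiableAt 𝓘(ℝ, Model n) 𝓘(ℝ, 𝕜) f x :=
    ((hf x hx).contMDiffAt (hU.mem_nhds hx)).mdifferentiableAt (by simp)
  have h2 : MDifferentiableAt 𝓘(ℝ, Model n) 𝓘(ℝ, 𝕜) h x :=
    ((hh x hx).contMDiffAt (hU.mem_nhds hx)).mdifferentiableAt (by simp)
  exact congrArg (fun T => T v) (mfderiv_add h1 h2)

theorem dirDeriv_add [Module.Finite 𝕜 W] {f h : M → W} {U : Set M} (hU : IsOpen U)
    (hf : SmoothOn 𝕜 n f U) (hh : SmoothOn 𝕜 n h U) {x : M} (hx : x ∈ U)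
    (v : TangentSpace 𝓘(ℝ, Model n) x) :
    dirDeriv 𝕜 (fun y => f y + h y) x v = dirDeriv 𝕜 f x v + dirDeriv 𝕜 h x v := by
  unfold dirDeriv
  rw [← Finset.sum_add_distrib]
  refine Finset.sum_congr rfl (fun b _ => ?_)
  rw [← add_smul, ← scalDeriv_add hU (hf _) (hh _) hx v]
  simp only [map_add]

theorem dirDeriv_smul [Module.Finite 𝕜 W] {f : M → W} {U : Set M} (hU : IsOpen U)
    (hf : SmoothOn 𝕜 n f U) {x : M} (hx : x ∈ U) (c : 𝕜)
    (v : TangentSpace 𝓘(ℝ, Model n) x) :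
    dirDeriv 𝕜 (fun y => c • f y) x v = c • dirDeriv 𝕜 f x v := by
  unfold dirDeriv
  rw [Finset.smul_sum]
  refine Finset.sum_congr rfl (fun b _ => ?_)
  rw [smul_smul, ← scalDeriv_mul hU (hf _) hx c v]
  simp only [map_smul, smul_eq_mul]

theorem dirDeriv_zero [Module.Finite 𝕜 W] (x : M) (v : TangentSpace 𝓘(ℝ, Model n) x) :
    dirDeriv 𝕜 (fun _ : M => (0 : W)) x v = 0 := by
  have := dirDeriv_smul (𝕜 := 𝕜) (f := fun _ : M => (0 : W)) isOpen_univ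
    (SmoothOn.const 0 _) (Set.mem_univ x) 0 v
  simpa using this

end Smooth

/-! ### Linear algebra of the fibres -/

/-- A sign as a real number. -/
def sgn (u : ℤˣ) : ℝ := ((u : ℤ) : ℝ)

section Algebra

variable {n : ℕ}

/-- The quadratic form `-κ · g` of the flat metric `g = diag (ε 0, …, ε (n - 1))` on `ℝⁿ`. -/
def cliffordForm (κ : ℤˣ) (ε : Fin n → ℤˣ) : QuadraticForm ℝ (Fin n → ℝ) :=
  QuadraticMap.weightedSumSquares ℝ (fun i => -(sgn κ * sgn (ε i)))

/-- The Clifford algebra with defining relation `v w + w v = -2 κ g(v, w)`. -/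
abbrev Cl (κ : ℤˣ) (ε : Fin n → ℤˣ) : Type := CliffordAlgebra (cliffordForm κ ε)

/-- The generator of the Clifford algebra given by the `i`-th standard basis vector. -/
def gen (κ : ℤˣ) (ε : Fin n → ℤˣ) (i : Fin n) : Cl κ ε :=
  CliffordAlgebra.ι (cliffordForm κ ε) (Pi.single i 1)

/-- The spin group: even units of spinor norm `±1` that normalize the space of vectors. -/
def spinGroup (κ : ℤˣ) (ε : Fin n → ℤˣ) : Set (Cl κ ε)ˣ :=
  {s | (s : Cl κ ε) ∈ CliffordAlgebra.even (cliffordForm κ ε) ∧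
    (∀ v, ∃ w, (s : Cl κ ε) * CliffordAlgebra.ι (cliffordForm κ ε) v * (↑s⁻¹ : Cl κ ε) =
      CliffordAlgebra.ι (cliffordForm κ ε) w) ∧
    ((s : Cl κ ε) * CliffordAlgebra.reverse (s : Cl κ ε) = 1 ∨
      (s : Cl κ ε) * CliffordAlgebra.reverse (s : Cl κ ε) = -1)}

variable {𝕜 : Type*} [Field 𝕜] {S : Type*} [AddCommGroup S] [Module 𝕜 S]

instance finite_exteriorAlgebra [Module.Finite 𝕜 S] : Module.Finite 𝕜 (ExteriorAlgebra 𝕜 S) :=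
  Module.Finite.of_basis (Module.finBasis 𝕜 S).ExteriorAlgebra

/-- Interior multiplication of the exterior algebra by a linear form: the antiderivation with
`d ⌋ ψ = d ψ` for `ψ ∈ S`. -/
def interior (d : Module.Dual 𝕜 S) : ExteriorAlgebra 𝕜 S →ₗ[𝕜] ExteriorAlgebra 𝕜 S :=
  CliffordAlgebra.contractLeft d

/-- The grading involution of the exterior algebra, `(-1)^k` on `ΛᵏS`. -/
def gradeInv : ExteriorAlgebra 𝕜 S →ₐ[𝕜] ExteriorAlgebra 𝕜 S :=
  ExteriorAlgebra.map (-LinearMap.id)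

theorem map_gradeInv (T : S →ₗ[𝕜] S) (y : ExteriorAlgebra 𝕜 S) :
    ExteriorAlgebra.map T (gradeInv y) = gradeInv (ExteriorAlgebra.map T y) := by
  have : (ExteriorAlgebra.map T).comp gradeInv =
      (gradeInv (𝕜 := 𝕜) (S := S)).comp (ExteriorAlgebra.map T) := by
    unfold gradeInv
    rw [ExteriorAlgebra.map_comp_map, ExteriorAlgebra.map_comp_map]
    congr 1
    ext v
    simp
  exact DFunLike.congr_fun this y

/-- The extension of an endomorphism of `S` to the exterior algebra as a derivation,
`Φ = ∑_α Φ(θ_α) ∧ θ^α ⌋`. -/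
def derivExt [Module.Finite 𝕜 S] (Φ : Module.End 𝕜 S) :
    ExteriorAlgebra 𝕜 S →ₗ[𝕜] ExteriorAlgebra 𝕜 S :=
  ∑ b, LinearMap.mulLeft 𝕜 (ExteriorAlgebra.ι 𝕜 (Φ (Module.finBasis 𝕜 S b))) ∘ₗ
    interior ((Module.finBasis 𝕜 S).coord b)

end Algebra

/-! ### Pseudo-Riemannian spin manifolds -/

section Manifold

variable {n : ℕ} {M : Type*} [TopologicalSpace M] [ChartedSpace (Model n) M]
  [IsManifold 𝓘(ℝ, Model n) ∞ M] {J : Type*}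

/-- A smooth pseudo-Riemannian metric. -/
structure PseudoRiemannianMetric (n : ℕ) (M : Type*) [TopologicalSpace M]
    [ChartedSpace (Model n) M] [IsManifold 𝓘(ℝ, Model n) ∞ M] where
  /-- The scalar product of the tangent spaces. -/
  inner (x : M) : TangentSpace 𝓘(ℝ, Model n) x →L[ℝ] TangentSpace 𝓘(ℝ, Model n) x →L[ℝ] ℝ
  symm (x : M) (v w : TangentSpace 𝓘(ℝ, Model n) x) : inner x v w = inner x w v
  nondegenerate (x : M) (v : TangentSpace 𝓘(ℝ, Model n) x) (hv : ∀ w, inner x v w = 0) : v = 0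
  contMDiff : ContMDiff 𝓘(ℝ, Model n)
    (𝓘(ℝ, Model n).prod 𝓘(ℝ, Model n →L[ℝ] Model n →L[ℝ] ℝ)) ∞
    (fun x => Bundle.TotalSpace.mk' (Model n →L[ℝ] Model n →L[ℝ] ℝ) x (inner x))

/-- A pseudo-Riemannian spin manifold. The spin structure is given by local orthonormal frames
`frame a` over the members `dom a` of an open cover, and by a smooth cocycle `trans a b` with values
in the spin group which covers the transition matrices of the frames. -/
structure SpinManifold (n : ℕ) (M : Type*) [TopologicalSpace M]
    [ChartedSpace (Model n) M] [IsManifold 𝓘(ℝ, Model n) ∞ M] (J : Type*) where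
  metric : PseudoRiemannianMetric n M
  /-- The signature of the metric, as the list of the squares of an orthonormal basis. -/
  ε : Fin n → ℤˣ
  /-- The sign in the Clifford relation `v w + w v = -2 κ g(v, w)`. -/
  κ : ℤˣ
  dom : J → Set M
  isOpen_dom (a : J) : IsOpen (dom a)
  /-- A chosen member of the cover around each point. -/
  idx : M → J
  mem_dom_idx (x : M) : x ∈ dom (idx x)
  frame (a : J) (i : Fin n) (x : M) : TangentSpace 𝓘(ℝ, Model n) x
  frame_smooth (a : J) (i : Fin n) : ContMDiffOn 𝓘(ℝ, Model n) 𝓘(ℝ, Model n).tangent ∞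
    (fun x => (Bundle.TotalSpace.mk' (Model n) x (frame a i x) :
      TangentBundle 𝓘(ℝ, Model n) M)) (dom a)
  frame_orthonormal (a : J) (x : M) (hx : x ∈ dom a) (i j : Fin n) :
    metric.inner x (frame a i x) (frame a j x) = if i = j then sgn (ε i) else 0
  trans (a b : J) (x : M) : (Cl κ ε)ˣ
  trans_mem (a b : J) (x : M) (hx : x ∈ dom a ∩ dom b) : trans a b x ∈ spinGroup κ ε
  trans_smooth (a b : J) : SmoothOn ℝ n (fun x => (trans a b x : Cl κ ε)) (dom a ∩ dom b)
  trans_cocycle (a b c : J) (x : M) (hx : x ∈ dom a ∩ dom b ∩ dom c) :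
    trans a b x * trans b c x = trans a c x
  /-- The rotation covered by `trans a b x` is the transition matrix from `frame b` to
  `frame a`. -/
  trans_covers (a b : J) (x : M) (hx : x ∈ dom a ∩ dom b) (j : Fin n) :
    (trans a b x : Cl κ ε) * gen κ ε j =
      (∑ i, (sgn (ε i) * metric.inner x (frame b j x) (frame a i x)) • gen κ ε i) *
        (trans a b x : Cl κ ε)

namespace SpinManifold

variable (G : SpinManifold n M J)

/-- The transition matrix: `e_{b,j} = ∑_i L_{ij} e_{a,i}`, so that vectors with components `X_a`
and `X_b` agree if and only if `X_a = L X_b`. -/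
def frameChange (a b : J) (x : M) : Matrix (Fin n) (Fin n) ℝ :=
  fun i j => sgn (G.ε i) * G.metric.inner x (G.frame b j x) (G.frame a i x)

/-! Sections of the bundle with fibre `W` associated to the spin structure, where `τ a b x` is the
action of the transition function. A section is a function `M → W` that
gives the value at `x` in the frame with index `idx x`. -/

section Sections

variable {𝕜 : Type*} [RCLike 𝕜] {W : Type*} [AddCommGroup W] [Module 𝕜 W]

/-- The expression of a section in the frame with index `a`; meaningful on `dom a`. -/
def rep (τ : J → J → M → (W →ₗ[𝕜] W)) (a : J) (h : M → W) (x : M) : W :=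
  τ a (G.idx x) x (h x)

/-- The smooth sections. -/
def sections (τ : J → J → M → (W →ₗ[𝕜] W)) : Submodule 𝕜 (M → W) where
  carrier := {h | ∀ a, SmoothOn 𝕜 n (G.rep τ a h) (G.dom a)}
  add_mem' := by
    intro f h hf hh a
    have := (hf a).add (hh a)
    simpa [rep, SmoothOn] using this
  zero_mem' := by
    intro a
    have := SmoothOn.const (𝕜 := 𝕜) (n := n) (0 : W) (G.dom a)
    simpa [rep, SmoothOn] using this
  smul_mem' := by
    intro c f hf a
    have := (hf a).smul c
    simpa [rep, SmoothOn] using this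

/-- The section with the given expressions `σ a` in the frames, if there is one. -/
def glue (τ : J → J → M → (W →ₗ[𝕜] W)) (σ : J → M → W) : G.sections τ := by
  classical
  exact if h : ∃ s : G.sections τ, ∀ a, ∀ x ∈ G.dom a, G.rep τ a s x = σ a x then h.choose else 0

end Sections

/-! The Levi-Civita connection. -/

/-- `g([e_i, e_j], e_k)` in the frame `a`. -/
def bracketCoeff (a : J) (i j k : Fin n) (x : M) : ℝ :=
  G.metric.inner x
    (VectorField.mlieBracket 𝓘(ℝ, Model n) (G.frame a i) (G.frame a j) x) (G.frame a k x)

/-- `g(∇_{e_i} e_j, e_k)` for the Levi-Civita connection, by the Koszul formula for orthonormal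
frames. -/
def conn (a : J) (i j k : Fin n) (x : M) : ℝ :=
  (G.bracketCoeff a i j k x - G.bracketCoeff a j k i x + G.bracketCoeff a k i j x) / 2

theorem bracketCoeff_swap (a : J) (i j k : Fin n) (x : M) :
    G.bracketCoeff a i j k x = -G.bracketCoeff a j i k x := by
  unfold bracketCoeff
  rw [VectorField.mlieBracket_swap_apply]
  simp

/-- The connection is metric. -/
theorem conn_skew (a : J) (i j k : Fin n) (x : M) : G.conn a i j k x = -G.conn a i k j x := by
  unfold conn
  rw [G.bracketCoeff_swap a i k j, G.bracketCoeff_swap a k j i, G.bracketCoeff_swap a j i k]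
  ring

/-- The connection is torsion free. -/
theorem conn_torsion (a : J) (i j k : Fin n) (x : M) :
    G.conn a i j k x - G.conn a j i k x = G.bracketCoeff a i j k x := by
  unfold conn
  rw [G.bracketCoeff_swap a j i k, G.bracketCoeff_swap a i k j, G.bracketCoeff_swap a k j i]
  ring

/-- The `k`-th component of `∇_{e_i} e_j`. -/
def connUp (a : J) (i j k : Fin n) (x : M) : ℝ := sgn (G.ε k) * G.conn a i j k x

/-- The derivative of a real function along `e_i`. -/
def partialDeriv (a : J) (i : Fin n) (f : M → ℝ) (x : M) : ℝ := scalDeriv ℝ f x (G.frame a i x)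

end SpinManifold

/-! ### Tensors -/

/-- Components `A_{i_1 ⋯ i_k}{}^j` of `TM`-valued covariant tensors of degree `k` in all frames. A
covariant tensor of degree `k` with values in `End TM` is one of degree `k + 1`
with values in `TM`; the last lower index is the argument of the endomorphism, i.e.
`A_{i_1 ⋯ i_k} e_p = ∑_q A_{i_1 ⋯ i_k p}{}^q e_q`. -/
abbrev Tensor (n : ℕ) (M J : Type*) (k : ℕ) : Type _ := J → M → (Fin k → Fin n) → Fin n → ℝ

/-- The first `k` of `k + l` indices. -/
def fstIdx {k l : ℕ} (i : Fin (k + l) → Fin n) : Fin k → Fin n := fun α => i (Fin.castAdd l α)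

/-- The last `l` of `k + l` indices. -/
def sndIdx {k l : ℕ} (i : Fin (k + l) → Fin n) : Fin l → Fin n := fun β => i (Fin.natAdd k β)

namespace SpinManifold

variable (G : SpinManifold n M J)

/-- The components fit together to a smooth tensor field. -/
def IsTensorField {k : ℕ} (A : Tensor n M J k) : Prop :=
  (∀ a i q, ContMDiffOn 𝓘(ℝ, Model n) 𝓘(ℝ, ℝ) ∞ (fun x => A a x i q) (G.dom a)) ∧
  ∀ a b, ∀ x ∈ G.dom a ∩ G.dom b, ∀ (j : Fin k → Fin n) (q : Fin n),
    ∑ i : Fin k → Fin n, (∏ α, G.frameChange a b x (i α) (j α)) * A a x i q =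
      ∑ r, G.frameChange a b x q r * A b x j r

/-- An endomorphism valued tensor takes its values in the skew-symmetric endomorphisms. -/
def IsSkewValued {k : ℕ} (A : Tensor n M J (k + 1)) : Prop :=
  ∀ a, ∀ x ∈ G.dom a, ∀ (i : Fin k → Fin n) (p q : Fin n),
    sgn (G.ε q) * A a x (Fin.snoc i p) q + sgn (G.ε p) * A a x (Fin.snoc i q) p = 0

/-- The curvature `R(e_i, e_j) e_k = ([∇_{e_i}, ∇_{e_j}] - ∇_{[e_i, e_j]}) e_k
= ∑_l R_{ijk}{}^l e_l`. -/
def curv : Tensor n M J 3 := fun a x i l =>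
  G.partialDeriv a (i 0) (G.connUp a (i 1) (i 2) l) x
    - G.partialDeriv a (i 1) (G.connUp a (i 0) (i 2) l) x
    + ∑ m, (G.connUp a (i 1) (i 2) m x * G.connUp a (i 0) m l x
        - G.connUp a (i 0) (i 2) m x * G.connUp a (i 1) m l x)
    - ∑ m, sgn (G.ε m) * G.bracketCoeff a (i 0) (i 1) m x * G.connUp a m (i 2) l x

/-- `(∇A)_{i_0 i_1 ⋯ i_k} = (∇_{i_0} A)_{i_1 ⋯ i_k}`. -/
def nabla {k : ℕ} (A : Tensor n M J k) : Tensor n M J (k + 1) := fun a x i q =>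
  G.partialDeriv a (i 0) (fun y => A a y (Fin.tail i) q) x
    - ∑ α, ∑ m, G.connUp a (i 0) (Fin.tail i α) m x * A a x (Function.update (Fin.tail i) α m) q
    + ∑ m, G.connUp a (i 0) m q x * A a x (Fin.tail i) m

/-- `(A ⌋¹ R)_{i_1 ⋯ i_k m} = ∑_r A_{i_1 ⋯ i_k}{}^r R_{mr}`. -/
def contractR {k : ℕ} (A : Tensor n M J k) : Tensor n M J (k + 2) := fun a x i q =>
  ∑ r, A a x (fstIdx i) r * G.curv a x ![sndIdx (l := 2) i 0, r, sndIdx (l := 2) i 1] q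

/-- `(A • B)_{i_1 ⋯ i_k j_1 ⋯ j_l} = [A_{i_1 ⋯ i_k}, B_{j_1 ⋯ j_l}]
- ∑_β A_{i_1 ⋯ i_k j_β}{}^m B_{j_1 ⋯ m ⋯ j_l} + ∑_α B_{j_1 ⋯ j_l i_α}{}^m A_{i_1 ⋯ m ⋯ i_k}`. -/
def bulletOp {k l : ℕ} (A : Tensor n M J (k + 1)) (B : Tensor n M J (l + 1)) :
    Tensor n M J (k + l + 1) := fun a x idx q =>
  let i : Fin k → Fin n := fstIdx (Fin.init idx)
  let j : Fin l → Fin n := sndIdx (Fin.init idx)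
  let p : Fin n := idx (Fin.last (k + l))
  ∑ m, (B a x (Fin.snoc j p) m * A a x (Fin.snoc i m) q
      - A a x (Fin.snoc i p) m * B a x (Fin.snoc j m) q)
    - ∑ β, ∑ m, A a x (Fin.snoc i (j β)) m * B a x (Fin.snoc (Function.update j β m) p) q
    + ∑ α, ∑ m, B a x (Fin.snoc j (i α)) m * A a x (Fin.snoc (Function.update i α m) p) q

/-- `(A ⌋¹ B ⌋² R)_{i_1 ⋯ i_k j_1 ⋯ j_l} = ∑ A_{i_1 ⋯ i_k}{}^m B_{j_1 ⋯ j_l}{}^r R_{mr}`. -/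
def contractR₂ {k l : ℕ} (A : Tensor n M J k) (B : Tensor n M J l) :
    Tensor n M J (k + l + 1) := fun a x idx q =>
  ∑ m, ∑ r, A a x (fstIdx (Fin.init idx)) m * B a x (sndIdx (Fin.init idx)) r *
    G.curv a x ![m, r, idx (Fin.last (k + l))] q

/-- `(∇_A B)_{i_1 ⋯ i_k j_1 ⋯ j_l} = ∑_m A_{i_1 ⋯ i_k}{}^m (∇_m B)_{j_1 ⋯ j_l}`. -/
def nablaAlong {k l : ℕ} (A : Tensor n M J k) (B : Tensor n M J l) : Tensor n M J (k + l) :=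
  fun a x i q => ∑ m, A a x (fstIdx i) m * G.nabla B a x (Fin.cons m (sndIdx i)) q

/-- `(A ∘ B)_{i_1 ⋯ i_k j_1 ⋯ j_l}{}^q = ∑_α ∑_m B_{j_1 ⋯ j_l i_α}{}^m A_{i_1 ⋯ m ⋯ i_k}{}^q`. -/
def circOp {k l : ℕ} (A : Tensor n M J k) (B : Tensor n M J (l + 1)) : Tensor n M J (k + l) :=
  fun a x i q => ∑ α, ∑ m, B a x (Fin.snoc (sndIdx i) (fstIdx i α)) m *
    A a x (Function.update (fstIdx i) α m) q

/-- The tensor with the two blocks of indices `j_1 ⋯ j_l` and `i_1 ⋯ i_k` written in the order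
`i_1 ⋯ i_k j_1 ⋯ j_l`. -/
def swapBlocks {k l : ℕ} (A : Tensor n M J (l + k)) : Tensor n M J (k + l) :=
  fun a x i q => A a x (Fin.append (sndIdx i) (fstIdx i)) q

/- The tensors obtained recursively from the curvature: `CurvEnd k A` for the covariant tensors of
degree `k` with values in `End TM`, `CurvVec k A` for those of degree `k` with values in `TM`. -/
mutual

inductive CurvEnd (G : SpinManifold n M J) : (k : ℕ) → Tensor n M J (k + 1) → Prop
  | curv : CurvEnd G 2 G.curv
  | nabla {k : ℕ} {A : Tensor n M J (k + 1)} (hA : CurvEnd G k A) : CurvEnd G (k + 1) (G.nabla A)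
  | contractR {k : ℕ} {A : Tensor n M J k} (hA : CurvVec G k A) :
      CurvEnd G (k + 1) (G.contractR A)
  | bulletOp {k l : ℕ} {A : Tensor n M J (k + 1)} {B : Tensor n M J (l + 1)}
      (hA : CurvEnd G k A) (hB : CurvEnd G l B) : CurvEnd G (k + l) (bulletOp A B)
  | contractR₂ {k l : ℕ} {A : Tensor n M J k} {B : Tensor n M J l}
      (hA : CurvVec G k A) (hB : CurvVec G l B) : CurvEnd G (k + l) (G.contractR₂ A B)
  | nablaAlong {k l : ℕ} {A : Tensor n M J k} {B : Tensor n M J (l + 1)}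
      (hA : CurvVec G k A) (hB : CurvEnd G l B) : CurvEnd G (k + l) (G.nablaAlong (l := l + 1) A B)

inductive CurvVec (G : SpinManifold n M J) : (k : ℕ) → Tensor n M J k → Prop
  | ofEnd {k : ℕ} {A : Tensor n M J (k + 1)} (hA : CurvEnd G k A) : CurvVec G (k + 1) A
  | nabla {k : ℕ} {A : Tensor n M J k} (hA : CurvVec G k A) : CurvVec G (k + 1) (G.nabla A)
  | nablaAlong {k l : ℕ} {A : Tensor n M J k} {B : Tensor n M J l}
      (hA : CurvVec G k A) (hB : CurvVec G l B) : CurvVec G (k + l) (G.nablaAlong A B)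
  | circOp {k l : ℕ} {A : Tensor n M J k} {B : Tensor n M J (l + 1)}
      (hA : CurvVec G k A) (hB : CurvEnd G l B) : CurvVec G (k + l) (circOp A B)

end

end SpinManifold

end Manifold


/-! ### Special graded manifolds -/

section Graded

/-- A special graded manifold over a pseudo-Riemannian spin manifold: a (real or complex)
representation `S` of the Clifford algebra together with a charge conjugation `C`, i.e. a
nondegenerate bilinear form that is invariant under the Lie algebra of the spin group and under the
transition functions of the spin structure, and for which `C(φ, γ_i ψ)` is symmetric in `φ` and `ψ`,
so that it gives rise to supersymmetry. The functions of the graded manifold are the sections of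
the exterior bundle of the associated spinor bundle. -/
structure SpecialGradedManifold (𝕜 : Type*) [RCLike 𝕜] (n : ℕ) (M : Type*) [TopologicalSpace M]
    [ChartedSpace (Model n) M] [IsManifold 𝓘(ℝ, Model n) ∞ M] (S : Type*) [AddCommGroup S]
    [Module 𝕜 S] [Module ℝ S] [IsScalarTower ℝ 𝕜 S] (J : Type*) extends SpinManifold n M J where
  ρ : Cl κ ε →ₐ[ℝ] Module.End 𝕜 S
  C : S →ₗ[𝕜] S →ₗ[𝕜] 𝕜
  C_nondegenerate : C.Nondegenerate
  C_invariant (i j : Fin n) (hij : i ≠ j) (φ ψ : S) :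
    C (ρ (gen κ ε i * gen κ ε j) φ) ψ + C φ (ρ (gen κ ε i * gen κ ε j) ψ) = 0
  C_trans (a b : J) (x : M) (hx : x ∈ dom a ∩ dom b) (φ ψ : S) :
    C (ρ (trans a b x) φ) (ρ (trans a b x) ψ) = C φ ψ
  C_susy (i : Fin n) (φ ψ : S) : C φ (ρ (gen κ ε i) ψ) = C ψ (ρ (gen κ ε i) φ)

namespace SpecialGradedManifold

variable {𝕜 : Type*} [RCLike 𝕜] {n : ℕ} {M : Type*} [TopologicalSpace M]
  [ChartedSpace (Model n) M] [IsManifold 𝓘(ℝ, Model n) ∞ M] {S : Type*} [AddCommGroup S]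
  [Module 𝕜 S] [Module ℝ S] [IsScalarTower ℝ 𝕜 S] {J : Type*}
  (G : SpecialGradedManifold 𝕜 n M S J)

/-- The transition functions of the spinor bundle. -/
def spinorTrans (a b : J) (x : M) : S →ₗ[𝕜] S := G.ρ (G.trans a b x)

/-- The transition functions of the exterior bundle of the spinor bundle. -/
def extTrans (a b : J) (x : M) : ExteriorAlgebra 𝕜 S →ₗ[𝕜] ExteriorAlgebra 𝕜 S :=
  (ExteriorAlgebra.map (G.spinorTrans a b x)).toLinearMap

/-- The transition functions of the tangent bundle (complexified if `𝕜 = ℂ`). -/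
def vectorTrans (a b : J) (x : M) : (Fin n → 𝕜) →ₗ[𝕜] (Fin n → 𝕜) :=
  Matrix.mulVecLin ((G.frameChange a b x).map (fun r => (r : 𝕜)))

/-- The spinor fields `ΓS`. -/
abbrev Spinors : Type _ := G.sections G.spinorTrans

/-- The (complexified, if `𝕜 = ℂ`) vector fields on `M`, through their components in the frames. -/
abbrev VectorFields : Type _ := G.sections G.vectorTrans

/-- The expression of a spinor field in the frame `a`. -/
abbrev spinorRep (φ : G.Spinors) (a : J) : M → S := G.rep G.spinorTrans a φ

/-- The components of a vector field in the frame `a`. -/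
abbrev vectorRep (X : G.VectorFields) (a : J) : M → Fin n → 𝕜 := G.rep G.vectorTrans a X

theorem rep_add {W : Type*} [AddCommGroup W] [Module 𝕜 W] (τ : J → J → M → (W →ₗ[𝕜] W))
    (a : J) (f h : M → W) : G.rep τ a (f + h) = fun x => G.rep τ a f x + G.rep τ a h x := by
  funext x; simp [SpinManifold.rep]

theorem rep_smul {W : Type*} [AddCommGroup W] [Module 𝕜 W] (τ : J → J → M → (W →ₗ[𝕜] W))
    (a : J) (c : 𝕜) (f : M → W) : G.rep τ a (c • f) = fun x => c • G.rep τ a f x := by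
  funext x; simp [SpinManifold.rep]

theorem rep_zero {W : Type*} [AddCommGroup W] [Module 𝕜 W] (τ : J → J → M → (W →ₗ[𝕜] W))
    (a : J) : G.rep τ a (0 : M → W) = fun _ => 0 := by
  funext x; simp [SpinManifold.rep]

variable [Module.Finite 𝕜 S]

/-- The superalgebra `ΓΛS` of functions on the graded manifold. -/
def functions : Subalgebra 𝕜 (M → ExteriorAlgebra 𝕜 S) where
  carrier := G.sections G.extTrans
  add_mem' := (G.sections G.extTrans).add_mem
  mul_mem' := by
    intro f h hf hh a
    have := (hf a).mul (hh a)
    simpa [SpinManifold.rep, SmoothOn, extTrans] using this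
  algebraMap_mem' := by
    intro c a
    have := SmoothOn.const (𝕜 := 𝕜) (n := n) (algebraMap 𝕜 (ExteriorAlgebra 𝕜 S) c) (G.dom a)
    simpa [SpinManifold.rep, SmoothOn, extTrans] using this

/-- The expression of a function on the graded manifold in the frame `a`. -/
abbrev funRep (f : G.functions) (a : J) : M → ExteriorAlgebra 𝕜 S := G.rep G.extTrans a f

/-- The `ℤ/2`-grading of the functions: multiplication by `(-1)^k` on `ΓΛᵏS`. -/
def parity : Module.End 𝕜 G.functions where
  toFun f := ⟨fun x => gradeInv (f.1 x), by
    intro a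
    have h1 : SmoothOn 𝕜 n (G.rep G.extTrans a f.1) (G.dom a) := f.2 a
    have h2 := h1.comp_linear (gradeInv (𝕜 := 𝕜) (S := S)).toLinearMap
    have h4 : (G.rep G.extTrans a fun x => gradeInv (f.1 x)) =
        fun x => (gradeInv (𝕜 := 𝕜) (S := S)).toLinearMap (G.rep G.extTrans a f.1 x) := by
      funext x
      exact map_gradeInv _ _
    rw [h4]
    exact h2⟩
  map_add' f h := Subtype.ext (funext fun x => map_add gradeInv (f.1 x) (h.1 x))
  map_smul' c f := Subtype.ext (funext fun x => map_smul gradeInv c (f.1 x))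

/-! The fields of the graded manifold. -/

/-- Even fields: even derivations of the superalgebra of functions. -/
def evenFields : Submodule 𝕜 (Module.End 𝕜 G.functions) where
  carrier := {T | (∀ f, T (G.parity f) = G.parity (T f)) ∧ ∀ f h, T (f * h) = T f * h + f * T h}
  add_mem' := by
    rintro T U ⟨hT, hT'⟩ ⟨hU, hU'⟩
    refine ⟨fun f => by simp only [LinearMap.add_apply, hT, hU, map_add], fun f h => ?_⟩
    simp only [LinearMap.add_apply, hT', hU', add_mul, mul_add]
    exact add_add_add_comm _ _ _ _
  zero_mem' := ⟨fun f => by simp, fun f h => by simp⟩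
  smul_mem' := by
    rintro c T ⟨hT, hT'⟩
    refine ⟨fun f => by simp only [LinearMap.smul_apply, hT, map_smul], fun f h => ?_⟩
    simp only [LinearMap.smul_apply, hT', smul_add, smul_mul_assoc, mul_smul_comm]

/-- Odd fields: odd superderivations of the superalgebra of functions. -/
def oddFields : Submodule 𝕜 (Module.End 𝕜 G.functions) where
  carrier := {T | (∀ f, T (G.parity f) + G.parity (T f) = 0) ∧
    ∀ f h, T (f * h) = T f * h + G.parity f * T h}
  add_mem' := by
    rintro T U ⟨hT, hT'⟩ ⟨hU, hU'⟩
    refine ⟨fun f => ?_, fun f h => ?_⟩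
    · simp only [LinearMap.add_apply, map_add]
      rw [add_add_add_comm, hT, hU, add_zero]
    · simp only [LinearMap.add_apply, hT', hU', add_mul, mul_add]
      exact add_add_add_comm _ _ _ _
  zero_mem' := ⟨fun f => by simp, fun f h => by simp⟩
  smul_mem' := by
    rintro c T ⟨hT, hT'⟩
    refine ⟨fun f => ?_, fun f h => ?_⟩
    · simp only [LinearMap.smul_apply, map_smul]
      rw [← smul_add, hT, smul_zero]
    · simp only [LinearMap.smul_apply, hT', smul_add, smul_mul_assoc, mul_smul_comm]

/-- The fields of given parity. -/
def fieldsOfParity (k : ℕ) : Submodule 𝕜 (Module.End 𝕜 G.functions) :=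
  if Even k then G.evenFields else G.oddFields

/-- The odd part of an operator. -/
def oddPart (T : Module.End 𝕜 G.functions) : Module.End 𝕜 G.functions :=
  (1 / 2 : 𝕜) • (T - G.parity * T * G.parity)

/-- The super commutator: the bilinear extension of `T U - (-1)^{|T||U|} U T`. -/
def bracket (T U : Module.End 𝕜 G.functions) : Module.End 𝕜 G.functions :=
  T * U - U * T + (2 : 𝕜) • (G.oddPart U * G.oddPart T)

/-- The operator `T` has the expression `F a` in each frame `a`. -/
def IsGivenBy (T : Module.End 𝕜 G.functions)
    (F : J → (M → ExteriorAlgebra 𝕜 S) → M → ExteriorAlgebra 𝕜 S) : Prop :=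
  ∀ f : G.functions, ∀ a, ∀ x ∈ G.dom a, G.funRep (T f) a x = F a (G.funRep f a) x

/-- The operator with the given expressions in the frames, if there is one. -/
def glueOp (F : J → (M → ExteriorAlgebra 𝕜 S) → M → ExteriorAlgebra 𝕜 S) :
    Module.End 𝕜 G.functions := by
  classical
  exact if h : ∃ T, G.IsGivenBy T F then h.choose else 0

/-! Clifford multiplication and covariant derivatives in the frame `a`. -/

/-- Clifford multiplication by the dual frame vector, `γ^i = g^{ij} γ_j`. -/
def gammaUp (i : Fin n) : Module.End 𝕜 S :=
  ((sgn (G.ε i) : ℝ) : 𝕜) • (G.ρ (gen G.κ G.ε i) : Module.End 𝕜 S)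

/-- The endomorphism `(κ/4) B_{[pq]} γ^p γ^q` of `S` associated to an endomorphism of the tangent
space with components `B_{pq} = g(B e_p, e_q)`. -/
def spinEnd (B : Fin n → Fin n → 𝕜) : Module.End 𝕜 S :=
  ∑ p, ∑ q, ((sgn G.κ : ℝ) / 4 * ((B p q - B q p) / 2) : 𝕜) • (G.gammaUp p * G.gammaUp q)

/-- The connection form: `∇_{e_i} = e_i + connS i` on spinors. -/
def connS (a : J) (i : Fin n) (x : M) : Module.End 𝕜 S :=
  G.spinEnd (fun p q => ((G.conn a i p q x : ℝ) : 𝕜))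

/-- `∇_{e_i}` on spinor fields. -/
def covS (a : J) (i : Fin n) (φ : M → S) (x : M) : S :=
  dirDeriv 𝕜 φ x (G.frame a i x) + G.connS a i x (φ x)

/-- `∇_{e_i}` on functions of the graded manifold. -/
def covFun (a : J) (i : Fin n) (f : M → ExteriorAlgebra 𝕜 S) (x : M) : ExteriorAlgebra 𝕜 S :=
  dirDeriv 𝕜 f x (G.frame a i x) + derivExt (G.connS a i x) (f x)

/-- The components of `∇_{e_i} X`. -/
def covV (a : J) (i : Fin n) (X : M → Fin n → 𝕜) (x : M) (q : Fin n) : 𝕜 :=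
  dirDeriv 𝕜 X x (G.frame a i x) q + ∑ r, ((G.connUp a i r q x : ℝ) : 𝕜) * X x r

/-- The image of the skew part of `∇X` in the endomorphisms of `S`. -/
def nablaVS (a : J) (X : M → Fin n → 𝕜) (x : M) : Module.End 𝕜 S :=
  G.spinEnd (fun p q => ((sgn (G.ε q) : ℝ) : 𝕜) * G.covV a p X x q)

/-! Killing vector fields and parallel spinors. -/

/-- `g([X, e_i], e_j)`. -/
def lieFrame (a : J) (X : M → Fin n → 𝕜) (i j : Fin n) (x : M) : 𝕜 :=
  ∑ k, X x k * ((G.bracketCoeff a k i j x : ℝ) : 𝕜)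
    - ((sgn (G.ε j) : ℝ) : 𝕜) * dirDeriv 𝕜 X x (G.frame a i x) j

/-- The Killing vector fields: `(ℒ_X g)(e_i, e_j) = -g([X, e_i], e_j) - g(e_i, [X, e_j]) = 0`. -/
def killing : Submodule 𝕜 G.VectorFields where
  carrier := {X | ∀ a, ∀ x ∈ G.dom a, ∀ i j,
    G.lieFrame a (G.vectorRep X a) i j x + G.lieFrame a (G.vectorRep X a) j i x = 0}
  add_mem' := by
    intro X Y hX hY a x hx i j
    have key : ∀ i j, G.lieFrame a (G.vectorRep (X + Y) a) i j x =
        G.lieFrame a (G.vectorRep X a) i j x + G.lieFrame a (G.vectorRep Y a) i j x := by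
      intro i j
      have h1 : G.vectorRep (X + Y) a = fun x => G.vectorRep X a x + G.vectorRep Y a x :=
        G.rep_add _ a X.1 Y.1
      unfold lieFrame
      rw [h1, dirDeriv_add (G.isOpen_dom a) (X.2 a) (Y.2 a) hx]
      simp only [Pi.add_apply, add_mul, Finset.sum_add_distrib, mul_add, vectorRep]
      ring
    rw [key, key]
    linear_combination hX a x hx i j + hY a x hx i j
  zero_mem' := by
    intro a x hx i j
    have h1 : G.vectorRep (0 : G.VectorFields) a = fun _ => 0 := G.rep_zero _ a
    unfold lieFrame
    rw [h1, dirDeriv_zero, dirDeriv_zero]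
    simp
  smul_mem' := by
    intro c X hX a x hx i j
    have key : ∀ i j, G.lieFrame a (G.vectorRep (c • X) a) i j x =
        c * G.lieFrame a (G.vectorRep X a) i j x := by
      intro i j
      have h1 : G.vectorRep (c • X) a = fun x => c • G.vectorRep X a x :=
        G.rep_smul _ a c X.1
      unfold lieFrame
      rw [h1, dirDeriv_smul (G.isOpen_dom a) (X.2 a) hx]
      simp only [Pi.smul_apply, smul_eq_mul, mul_sub, Finset.mul_sum, vectorRep, mul_assoc]
      ring
    rw [key, key]
    linear_combination c * hX a x hx i j

/-- The parallel spinors. -/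
def parallelSpinors : Submodule 𝕜 G.Spinors where
  carrier := {φ | ∀ a, ∀ x ∈ G.dom a, ∀ i, G.covS a i (G.spinorRep φ a) x = 0}
  add_mem' := by
    intro φ ψ hφ hψ a x hx i
    have h1 : G.spinorRep (φ + ψ) a = fun x => G.spinorRep φ a x + G.spinorRep ψ a x :=
      G.rep_add _ a φ.1 ψ.1
    have h2 := hφ a x hx i
    have h3 := hψ a x hx i
    unfold covS at h2 h3 ⊢
    rw [h1, dirDeriv_add (G.isOpen_dom a) (φ.2 a) (ψ.2 a) hx, map_add, add_add_add_comm]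
    exact (congrArg₂ (· + ·) h2 h3).trans (add_zero 0)
  zero_mem' := by
    intro a x hx i
    have h1 : G.spinorRep (0 : G.Spinors) a = fun _ => 0 := G.rep_zero _ a
    unfold covS
    rw [h1, dirDeriv_zero]
    simp
  smul_mem' := by
    intro c φ hφ a x hx i
    have h1 : G.spinorRep (c • φ) a = fun x => c • G.spinorRep φ a x :=
      G.rep_smul _ a c φ.1
    have h2 := hφ a x hx i
    unfold covS at h2 ⊢
    rw [h1, dirDeriv_smul (G.isOpen_dom a) (φ.2 a) hx, map_smul, ← smul_add]
    exact (congrArg (c • ·) h2).trans (smul_zero c)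

/-! The fields from which the supersymmetric Killing structure is built. For each of them we give
the expression in the frames and then the global object. -/

/-- The expression of `e(X) = ∇_X - (∇X)_a`. -/
def evenExpr (X : G.VectorFields) (a : J) (f : M → ExteriorAlgebra 𝕜 S) (x : M) :
    ExteriorAlgebra 𝕜 S :=
  ∑ i, G.vectorRep X a x i • G.covFun a i f x
    - derivExt (G.nablaVS a (G.vectorRep X a) x) (f x)

/-- The even field `e(X) = ∇_X - (∇X)_a`. -/
def even (X : G.VectorFields) : Module.End 𝕜 G.functions := G.glueOp (G.evenExpr X)

/-- The expression of `o(φ) = φ ⌋ + γ^i φ ⊗ ∇_i`. -/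
def oddExpr (φ : G.Spinors) (a : J) (f : M → ExteriorAlgebra 𝕜 S) (x : M) :
    ExteriorAlgebra 𝕜 S :=
  interior (G.C (G.spinorRep φ a x)) (f x)
    + ∑ i, ExteriorAlgebra.ι 𝕜 (G.gammaUp i (G.spinorRep φ a x)) * G.covFun a i f x

/-- The odd field `o(φ) = φ ⌋ + γ^i φ ⊗ ∇_i`. -/
def odd (φ : G.Spinors) : Module.End 𝕜 G.functions := G.glueOp (G.oddExpr φ)

/-- `γ^{i_1} ξ_1 ∧ ⋯ ∧ γ^{i_k} ξ_k`. -/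
def wedge {k : ℕ} (ξ : Fin k → G.Spinors) (a : J) (i : Fin k → Fin n) (x : M) :
    ExteriorAlgebra 𝕜 S :=
  ExteriorAlgebra.ιMulti 𝕜 k (fun α => G.gammaUp (i α) (G.spinorRep (ξ α) a x))

/-- The endomorphism `A_{i_1 ⋯ i_k}` of `S`. -/
def tensorS {k : ℕ} (A : Tensor n M J (k + 1)) (a : J) (i : Fin k → Fin n) (x : M) :
    Module.End 𝕜 S :=
  G.spinEnd (fun p q => ((sgn (G.ε q) * A a x (Fin.snoc i p) q : ℝ) : 𝕜))

/-- The expression of `γ^{i_1} ξ_1 ∧ ⋯ ∧ γ^{i_k} ξ_k ∧ A_{i_1 ⋯ i_k}`. -/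
def fieldBExpr (k : ℕ) (A : Tensor n M J (k + 1)) (ξ : Fin k → G.Spinors) (a : J)
    (f : M → ExteriorAlgebra 𝕜 S) (x : M) : ExteriorAlgebra 𝕜 S :=
  ∑ i : Fin k → Fin n, G.wedge ξ a i x * derivExt (G.tensorS A a i x) (f x)

/-- The field `𝔅^{(k)}(A; ξ_1, …, ξ_k)`. -/
def fieldB (k : ℕ) (A : Tensor n M J (k + 1)) (ξ : Fin k → G.Spinors) :
    Module.End 𝕜 G.functions := G.glueOp (G.fieldBExpr k A ξ)

/-- The expression of `A_{i_1 ⋯ i_k}{}^j γ^{i_1} ξ_1 ∧ ⋯ ∧ γ^{i_k} ξ_k ⊗ ∇_j`. -/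
def fieldDExpr (k : ℕ) (A : Tensor n M J k) (ξ : Fin k → G.Spinors) (a : J)
    (f : M → ExteriorAlgebra 𝕜 S) (x : M) : ExteriorAlgebra 𝕜 S :=
  ∑ i : Fin k → Fin n, ∑ j, ((A a x i j : ℝ) : 𝕜) • (G.wedge ξ a i x * G.covFun a j f x)

/-- The field `𝔇^{(k)}(A; ξ_1, …, ξ_k)`. -/
def fieldD (k : ℕ) (A : Tensor n M J k) (ξ : Fin k → G.Spinors) :
    Module.End 𝕜 G.functions := G.glueOp (G.fieldDExpr k A ξ)

/-- The expression of the spinor field `e(X) φ = ∇_X φ - (∇X)_a φ`. -/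
def evenSpinorExpr (X : G.VectorFields) (φ : G.Spinors) (a : J) (x : M) : S :=
  ∑ i, G.vectorRep X a x i • G.covS a i (G.spinorRep φ a) x
    - G.nablaVS a (G.vectorRep X a) x (G.spinorRep φ a x)

/-- The spinor field `e(X) φ`. -/
def evenSpinor (X : G.VectorFields) (φ : G.Spinors) : G.Spinors :=
  G.glue G.spinorTrans (G.evenSpinorExpr X φ)

/-- The components of the commutator of two vector fields on `M`. -/
def lieExpr (X Y : G.VectorFields) (a : J) (x : M) : Fin n → 𝕜 := fun q =>
  ∑ i, (G.vectorRep X a x i * dirDeriv 𝕜 (G.vectorRep Y a) x (G.frame a i x) q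
      - G.vectorRep Y a x i * dirDeriv 𝕜 (G.vectorRep X a) x (G.frame a i x) q)
    + ∑ i, ∑ j, G.vectorRep X a x i * G.vectorRep Y a x j *
        ((sgn (G.ε q) * G.bracketCoeff a i j q x : ℝ) : 𝕜)

/-- The commutator of two vector fields on `M`. -/
def lie (X Y : G.VectorFields) : G.VectorFields := G.glue G.vectorTrans (G.lieExpr X Y)

/-- The components of the vector field `{φ, ψ} = 2 C(φ, γ^i ψ) e_i`. -/
def susyExpr (φ ψ : G.Spinors) (a : J) (x : M) : Fin n → 𝕜 := fun i =>
  2 * G.C (G.spinorRep φ a x) (G.gammaUp i (G.spinorRep ψ a x))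

/-- The vector field `{φ, ψ} = 2 C(φ, γ^i ψ) e_i`. -/
def susy (φ ψ : G.Spinors) : G.VectorFields := G.glue G.vectorTrans (G.susyExpr φ ψ)

/-! s-like and v-like fields. -/

/-- The operator `f ⊗ θ ↦ f ∧ θ ⌋ h`. -/
def contractS (h : ExteriorAlgebra 𝕜 S) : ExteriorAlgebra 𝕜 S ⊗[𝕜] S →ₗ[𝕜] ExteriorAlgebra 𝕜 S :=
  TensorProduct.lift (LinearMap.mk₂ 𝕜 (fun f θ => f * interior (G.C θ) h)
    (fun f f' θ => by simp [add_mul]) (fun c f θ => by simp)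
    (fun f θ θ' => by simp [interior, mul_add]) (fun c f θ => by simp [interior]))

/-- The operator `f ⊗ X ↦ f ∧ ∇_X h`, where `h i` stands for `∇_i h`. -/
def contractV (h : Fin n → ExteriorAlgebra 𝕜 S) :
    ExteriorAlgebra 𝕜 S ⊗[𝕜] (Fin n → 𝕜) →ₗ[𝕜] ExteriorAlgebra 𝕜 S :=
  TensorProduct.lift (LinearMap.mk₂ 𝕜 (fun f X => f * ∑ i, X i • h i)
    (fun f f' θ => by simp [add_mul]) (fun c f θ => by simp)
    (fun f θ θ' => by simp [add_smul, Finset.sum_add_distrib, mul_add])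
    (fun c f θ => by simp [Finset.smul_sum, Finset.mul_sum, smul_smul]))

/-- `T` is s-like of degree `d`: it is given by a section of `ΛᵈS ⊗ S`. -/
def IsSLike (d : ℕ) (T : Module.End 𝕜 G.functions) : Prop :=
  ∃ Φ : G.sections (fun a b x => TensorProduct.map (G.extTrans a b x) (G.spinorTrans a b x)),
    ∀ a, ∀ x ∈ G.dom a,
      G.rep (fun a b x => TensorProduct.map (G.extTrans a b x) (G.spinorTrans a b x)) a Φ x ∈
        LinearMap.range (TensorProduct.map (⋀[𝕜]^d S).subtype (LinearMap.id : S →ₗ[𝕜] S)) ∧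
      ∀ f : G.functions, G.funRep (T f) a x = G.contractS (G.funRep f a x)
        (G.rep (fun a b x => TensorProduct.map (G.extTrans a b x) (G.spinorTrans a b x)) a Φ x)

/-- `T` is v-like of degree `d`: it is given by a section of `ΛᵈS ⊗ TM`. -/
def IsVLike (d : ℕ) (T : Module.End 𝕜 G.functions) : Prop :=
  ∃ Φ : G.sections (fun a b x => TensorProduct.map (G.extTrans a b x) (G.vectorTrans a b x)),
    ∀ a, ∀ x ∈ G.dom a,
      G.rep (fun a b x => TensorProduct.map (G.extTrans a b x) (G.vectorTrans a b x)) a Φ x ∈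
        LinearMap.range (TensorProduct.map (⋀[𝕜]^d S).subtype
          (LinearMap.id : (Fin n → 𝕜) →ₗ[𝕜] (Fin n → 𝕜))) ∧
      ∀ f : G.functions, G.funRep (T f) a x =
        contractV (fun i => G.covFun a i (G.funRep f a) x)
          (G.rep (fun a b x => TensorProduct.map (G.extTrans a b x) (G.vectorTrans a b x)) a Φ x)

/-! Supersymmetric Killing structures. -/

/-- The tuple `(K₀ ⊕ K₁, Z, e, o)` is a supersymmetric Killing structure. -/
structure IsSSKS (K₀ : Submodule 𝕜 G.VectorFields) (K₁ : Submodule 𝕜 G.Spinors)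
    (Z : Submodule 𝕜 (Module.End 𝕜 G.functions))
    (e : G.VectorFields → Module.End 𝕜 G.functions)
    (o : G.Spinors → Module.End 𝕜 G.functions) : Prop where
  linear_e : IsLinearMap 𝕜 e
  linear_o : IsLinearMap 𝕜 o
  e_mem (X : G.VectorFields) : e X ∈ G.evenFields
  o_mem (φ : G.Spinors) : o φ ∈ G.oddFields
  Z_graded : Z = (Z ⊓ G.evenFields) ⊔ (Z ⊓ G.oddFields)
  lie_mem (X Y : G.VectorFields) (hX : X ∈ K₀) (hY : Y ∈ K₀) : G.lie X Y ∈ K₀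
  e_e (X Y : G.VectorFields) (hX : X ∈ K₀) (hY : Y ∈ K₀) :
    G.bracket (e X) (e Y) = e (G.lie X Y)
  e_o (X : G.VectorFields) (φ : G.Spinors) (hX : X ∈ K₀) (hφ : φ ∈ K₁) :
    ∃ ψ ∈ K₁, G.bracket (e X) (o φ) = o ψ
  o_o (φ ψ : G.Spinors) (hφ : φ ∈ K₁) (hψ : ψ ∈ K₁) :
    ∃ X ∈ K₀, ∃ T ∈ Z, G.bracket (o φ) (o ψ) = e X + T
  o_Z (φ : G.Spinors) (hφ : φ ∈ K₁) (T : Module.End 𝕜 G.functions) (hT : T ∈ Z) :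
    G.bracket (o φ) T ∈ Z
  e_Z (X : G.VectorFields) (hX : X ∈ K₀) (T : Module.End 𝕜 G.functions) (hT : T ∈ Z) :
    G.bracket (e X) T ∈ Z
  Z_Z (T U : Module.End 𝕜 G.functions) (hT : T ∈ Z) (hU : U ∈ Z) : G.bracket T U ∈ Z
  direct (X : G.VectorFields) (φ : G.Spinors) (T : Module.End 𝕜 G.functions) (hX : X ∈ K₀)
    (hφ : φ ∈ K₁) (hT : T ∈ Z) (h : e X + T + o φ = 0) : e X = 0 ∧ T = 0 ∧ o φ = 0

/-- The space spanned by the fields `𝔅` and `𝔇` for parallel spinors and tensors obtained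
recursively from the curvature. -/
def center : Submodule 𝕜 (Module.End 𝕜 G.functions) :=
  Submodule.span 𝕜
    ({T | ∃ (k : ℕ) (A : Tensor n M J (k + 1)) (ξ : Fin k → G.Spinors),
        SpinManifold.CurvEnd G.toSpinManifold k A ∧ (∀ α, ξ α ∈ G.parallelSpinors) ∧
        T = G.fieldB k A ξ} ∪
     {T | ∃ (k : ℕ) (A : Tensor n M J k) (ξ : Fin k → G.Spinors),
        SpinManifold.CurvVec G.toSpinManifold k A ∧ (∀ α, ξ α ∈ G.parallelSpinors) ∧
        T = G.fieldD k A ξ})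

end SpecialGradedManifold

end Graded

end SGM

end

noncomputable section

open Finset (sum_congr sum_comm mul_sum sum_sub_distrib smul_sum sum_neg_distrib sum_mul sum_smul sum_eq_zero sum_eq_single sum_const_zero mem_univ sum_ite_eq' sum_ite_eq sum_insert prod_congr univ)
open Function (update update_of_ne update_self)
open Fin (snoc append snoc_last snoc_castSucc natAdd castAdd)
open Module (End finBasis Dual)
open Matrix (mul_apply)
open CliffordAlgebra (involute reverse contractLeft equivExterior)
local notation "Mat(" n ")" => Matrix (Fin n) (Fin n)
local notation "Mod(" n ")" => 𝓘(ℝ, SGM.Model n)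
local notation "Tan(" n ")" => TangentSpace 𝓘(ℝ, SGM.Model n)
local notation "Lie(" n ")" => VectorField.mlieBracket 𝓘(ℝ, SGM.Model n)
local notation "Ext" => ExteriorAlgebra

namespace SGM

lemma sum_add {ι M : Type*} [AddCommMonoid M] {s : Finset ι} {f g : ι → M} :
    ∑ i ∈ s, (f i + g i) = ∑ i ∈ s, f i + ∑ i ∈ s, g i := Finset.sum_add_distrib

lemma sum_ext {ι M : Type*} [Fintype ι] [AddCommMonoid M] {f g : ι → M} (h : ∀ i, f i = g i) :
    ∑ i, f i = ∑ i, g i := Fintype.sum_congr f g h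

/-! ### Algebraic calculus of a metric, torsion free connection in a frame -/

def mDeriv {n : ℕ} {R : Type*} [CommRing R] (d : Derivation ℤ R R) (N : Mat(n) R) : Mat(n) R :=
    N.map d

section MatDeriv

variable {n : ℕ} {R : Type*} [CommRing R] (d : Derivation ℤ R R)

lemma mDeriv_apply (N : Mat(n) R) (i j : Fin n) : mDeriv d N i j = d (N i j) := rfl

end MatDeriv

/-- The algebraic data of a pseudo-Riemannian manifold in an orthonormal frame: the derivations
`D i` along the frame and the connection matrices `Γ i q p = g(∇_{e_i} e_p, e^q)` of the
Levi-Civita connection. -/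
structure FCalc (n : ℕ) (R : Type*) [CommRing R] where
  ε : Fin n → R
  D : Fin n → Derivation ℤ R R
  Γ : Fin n → Mat(n) R
  ε_mul_self (i : Fin n) : ε i * ε i = 1
  D_ε (i j : Fin n) : D i (ε j) = 0
  skew (i p q : Fin n) : ε q * Γ i q p + ε p * Γ i p q = 0
  comm (i j : Fin n) (f : R) : D i (D j f) - D j (D i f) = ∑ k, (Γ i k j - Γ j k i) * D k f
  jacobi (i j k l : Fin n) :
    (D i (Γ j l k - Γ k l j) + ∑ m, (Γ j m k - Γ k m j) * (Γ i l m - Γ m l i)) +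
    (D j (Γ k l i - Γ i l k) + ∑ m, (Γ k m i - Γ i m k) * (Γ j l m - Γ m l j)) +
    (D k (Γ i l j - Γ j l i) + ∑ m, (Γ i m j - Γ j m i) * (Γ k l m - Γ m l k)) = 0
  two_cancel (f : R) : 2 * f = 0 → f = 0

variable
  {n k l : ℕ} {R : Type*} [CommRing R] {F : FCalc n R} {V : Type*} [AddCommGroup V] [Module R V]

namespace FCalc

variable (F)

def IsSkew (N : Mat(n) R) : Prop := ∀ p q, F.ε q * N q p + F.ε p * N p q = 0

def c (i j k : Fin n) : R := F.Γ i k j - F.Γ j k i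

lemma c_swap (i j k : Fin n) : F.c i j k = -F.c j i k := by unfold c; ring

variable {F}

variable {N : Mat(n) R}

lemma IsSkew.add {M N : Mat(n) R} (hM : F.IsSkew M) (hN : F.IsSkew N) : F.IsSkew (M + N) := fun p q
    => by
  simp; linear_combination hM p q + hN p q

lemma IsSkew.sub {M N : Mat(n) R} (hM : F.IsSkew M) (hN : F.IsSkew N) : F.IsSkew (M - N) := fun p q
    => by
  simp; linear_combination hM p q - hN p q

lemma IsSkew.smul (f : R) (hN : F.IsSkew N) : F.IsSkew (f • N) := fun p q => by
  simp; linear_combination f * hN p q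

lemma IsSkew.zero : F.IsSkew 0 := fun p q => by simp

lemma IsSkew.sum {ι : Type*} (s : Finset ι) {N : ι → Mat(n) R} (h : ∀ i ∈ s, F.IsSkew (N i)) :
    F.IsSkew (∑ i ∈ s, N i) := by
  classical
  induction s using Finset.induction_on with
  | empty => simpa using IsSkew.zero
  | insert a s ha ih =>
    rw [sum_insert ha]
    exact (h a (by simp)).add (ih fun i hi => h i (by simp [hi]))

lemma isSkew_iff : F.IsSkew N ↔ Matrix.diagonal F.ε * N + N.transpose * Matrix.diagonal F.ε = 0 :=
    by
  constructor
  · intro h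
    ext q p
    simpa [Matrix.diagonal_mul, Matrix.mul_diagonal, mul_comm] using h p q
  · intro h p q
    have := congrFun (congrFun h q) p
    simpa [Matrix.diagonal_mul, Matrix.mul_diagonal, mul_comm] using this

lemma IsSkew.commutator {M N : Mat(n) R} (hM : F.IsSkew M) (hN : F.IsSkew N) :
    F.IsSkew (M * N - N * M) := by
  rw [isSkew_iff] at *
  have hM' := eq_neg_of_add_eq_zero_left hM
  have hN' := eq_neg_of_add_eq_zero_left hN
  rw [mul_sub, ← mul_assoc, ← mul_assoc, hM', hN', Matrix.transpose_sub, Matrix.transpose_mul,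
    Matrix.transpose_mul, neg_mul, neg_mul, mul_assoc, mul_assoc, hM', hN']
  noncomm_ring

lemma IsSkew.deriv (i : Fin n) (hN : F.IsSkew N) : F.IsSkew (mDeriv (F.D i) N) := fun p q => by
  have := congrArg (F.D i) (hN p q)
  simpa [Derivation.leibniz, F.D_ε, mDeriv_apply] using this

lemma isSkew_Γ (i : Fin n) : F.IsSkew (F.Γ i) := fun p q => F.skew i p q

variable (F)

def curvM (i j : Fin n) : Mat(n) R :=
  mDeriv (F.D i) (F.Γ j) - mDeriv (F.D j) (F.Γ i) + (F.Γ i * F.Γ j - F.Γ j * F.Γ i)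
    - ∑ k, F.c i j k • F.Γ k

lemma isSkew_curvM (i j : Fin n) : F.IsSkew (F.curvM i j) :=
  ((((isSkew_Γ j).deriv i).sub ((isSkew_Γ i).deriv j)).add
    ((isSkew_Γ i).commutator (isSkew_Γ j))).sub (IsSkew.sum _ fun k _ => (isSkew_Γ k).smul _)

lemma curvM_swap (i j : Fin n) : F.curvM i j = -F.curvM j i := by
  have : ∑ k, F.c i j k • F.Γ k = -∑ k, F.c j i k • F.Γ k := by
    rw [← sum_neg_distrib]
    exact sum_ext fun k => by rw [F.c_swap, neg_smul]
  unfold curvM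
  rw [this]
  abel

lemma bianchi (i j k l : Fin n) : F.curvM i j l k + F.curvM j k l i + F.curvM k i l j = 0 := by
  have h := F.jacobi i j k l
  simp at h
  simp [curvM, c, Matrix.sub_apply, Matrix.add_apply, mDeriv_apply, mul_apply, Matrix.sum_apply, Matrix.smul_apply, smul_eq_mul]
  rw [← h]
  have key : ∀ m, (F.Γ i l m * F.Γ j m k - F.Γ j l m * F.Γ i m k - (F.Γ i m j - F.Γ j m i) * F.Γ m l k)
      + (F.Γ j l m * F.Γ k m i - F.Γ k l m * F.Γ j m i - (F.Γ j m k - F.Γ k m j) * F.Γ m l i)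
      + (F.Γ k l m * F.Γ i m j - F.Γ i l m * F.Γ k m j - (F.Γ k m i - F.Γ i m k) * F.Γ m l j)
      = (F.Γ j m k - F.Γ k m j) * (F.Γ i l m - F.Γ m l i)
      + (F.Γ k m i - F.Γ i m k) * (F.Γ j l m - F.Γ m l j)
      + (F.Γ i m j - F.Γ j m i) * (F.Γ k l m - F.Γ m l k) := fun m => by ring
  have key2 := sum_congr (rfl : (univ : Finset (Fin n)) = univ)
    (fun m _ => key m)
  simp [sum_add] at key2
  linear_combination key2

end FCalc

/-! ### Modules with a connection -/

/-- A module with derivations along the frame and with an action of the matrices, which is an action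
of the Lie algebra of skew matrices. -/
structure FMod
    {n : ℕ} {R : Type*} [CommRing R] (F : FCalc n R) (V : Type*) [AddCommGroup V] [Module R V] where
  D : Fin n → V →+ V
  D_smul (i : Fin n) (f : R) (v : V) : D i (f • v) = F.D i f • v + f • D i v
  comm (i j : Fin n) (v : V) : D i (D j v) - D j (D i v) = ∑ k, F.c i j k • D k v
  r : Mat(n) R →ₗ[R] End R V
  D_r (i : Fin n) (N : Mat(n) R) (v : V) : D i (r N v) = r (mDeriv (F.D i) N) v + r N (D i v)
  r_lie (M N : Mat(n) R) (hM : F.IsSkew M) (v : V) : r (M * N - N * M) v = r M (r N v) - r N (r M v)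

namespace FMod

variable (E : FMod F V)

def cov (i : Fin n) (v : V) : V := E.D i v + E.r (F.Γ i) v

lemma cov_add (i : Fin n) (v w : V) : E.cov i (v + w) = E.cov i v + E.cov i w := by simp [cov]; abel

lemma cov_sub (i : Fin n) (v w : V) : E.cov i (v - w) = E.cov i v - E.cov i w := by simp [cov]; abel

lemma cov_smul (i : Fin n) (f : R) (v : V) : E.cov i (f • v) = F.D i f • v + f • E.cov i v := by
  simp [cov, E.D_smul]; abel

lemma cov_sum {ι : Type*} (i : Fin n) (s : Finset ι) (v : ι → V) :
    E.cov i (∑ a ∈ s, v a) = ∑ a ∈ s, E.cov i (v a) := by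
  simp [cov, sum_add]

lemma cov_r (i : Fin n) (N : Mat(n) R) (v : V) :
    E.cov i (E.r N v) = E.r (mDeriv (F.D i) N + (F.Γ i * N - N * F.Γ i)) v + E.r N (E.cov i v) := by
  simp only [cov, E.D_r, map_add, LinearMap.add_apply, E.r_lie _ _ (FCalc.isSkew_Γ i)]
  abel

lemma cov_comm (i j : Fin n) (v : V) : E.cov i (E.cov j v) - E.cov j (E.cov i v) =
    E.r (F.curvM i j) v + ∑ k, F.c i j k • E.cov k v := by
  have h := E.comm i j v
  have h2 := E.r_lie (F.Γ i) (F.Γ j) (FCalc.isSkew_Γ i) v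
  simp [cov, E.D_r, FCalc.curvM, LinearMap.sum_apply, sum_add] at *
  rw [← h, h2]
  abel

end FMod

namespace FCalc

variable (F)

def vec : FMod F (Fin n → R) where
  D i := AddMonoidHom.mk' (fun v q => F.D i (v q)) fun v w => by ext q; simp
  D_smul i f v := by
    ext q
    simp only [AddMonoidHom.mk'_apply, Pi.smul_apply, Derivation.leibniz, Pi.add_apply, smul_eq_mul]
    ring
  comm i j v := by
    ext q
    simpa [Finset.sum_apply, c] using F.comm i j (v q)
  r := (Matrix.toLin' : Mat(n) R ≃ₗ[R] _).toLinearMap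
  D_r i N v := by
    ext q
    simp only [AddMonoidHom.mk'_apply, LinearEquiv.coe_coe, Matrix.toLin'_apply, Matrix.mulVec,
      dotProduct, map_sum, Derivation.leibniz, Pi.add_apply, smul_eq_mul, mDeriv_apply,
      ← sum_add]
    exact sum_ext fun k => by ring
  r_lie M N _ v := by
    simp only [LinearEquiv.coe_coe, Matrix.toLin'_apply, Matrix.sub_mulVec, Matrix.mulVec_mulVec]

lemma vec_D (i : Fin n) (v : Fin n → R) (q : Fin n) : F.vec.D i v q = F.D i (v q) := rfl

lemma vec_r (N : Mat(n) R) (v : Fin n → R) : F.vec.r N v = N.mulVec v := rfl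

lemma vec_cov (i : Fin n) (v : Fin n → R) (q : Fin n) :
    F.vec.cov i v q = F.D i (v q) + ∑ m, F.Γ i q m * v m := rfl

def nablaV (X : Fin n → R) : Mat(n) R := fun q p => F.vec.cov p X q

def IsKilling (X : Fin n → R) : Prop := F.IsSkew (F.nablaV X)

def lieMat (X : Fin n → R) : Mat(n) R := ∑ i, X i • F.Γ i - F.nablaV X

def dirD (X : Fin n → R) : Derivation ℤ R R := ∑ i, X i • F.D i

lemma dirD_apply (X : Fin n → R) (f : R) : F.dirD X f = ∑ i, X i * F.D i f := by
  change Derivation.coeFnAddMonoidHom (∑ i, X i • F.D i) f = _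
  rw [map_sum, Finset.sum_apply]
  rfl

lemma mDeriv_dirD (X : Fin n → R) (N : Mat(n) R) :
    mDeriv (F.dirD X) N = ∑ i, X i • mDeriv (F.D i) N := by
  ext p q
  simp [mDeriv_apply, dirD_apply, Matrix.sum_apply]

variable {F}

lemma IsKilling.isSkew_lieMat {X : Fin n → R} (hX : F.IsKilling X) : F.IsSkew (F.lieMat X) :=
  (IsSkew.sum _ fun i _ => (isSkew_Γ i).smul _).sub hX

end FCalc

namespace FMod

variable (E : FMod F V)

def lieD (X : Fin n → R) (v : V) : V := ∑ i, X i • E.cov i v - E.r (F.nablaV X) v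

lemma lieD_eq (X : Fin n → R) (v : V) : E.lieD X v = ∑ i, X i • E.D i v + E.r (F.lieMat X) v := by
  simp [lieD, cov, sum_add, FCalc.lieMat, LinearMap.sum_apply]
  abel

lemma lieD_add (X : Fin n → R) (v w : V) : E.lieD X (v + w) = E.lieD X v + E.lieD X w := by
  simp [lieD, cov_add, sum_add]; abel

lemma lieD_sub (X : Fin n → R) (v w : V) : E.lieD X (v - w) = E.lieD X v - E.lieD X w := by
  simp [lieD, cov_sub, smul_sub]; abel

lemma lieD_sum {ι : Type*} (X : Fin n → R) (s : Finset ι) (v : ι → V) :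
    E.lieD X (∑ a ∈ s, v a) = ∑ a ∈ s, E.lieD X (v a) := by
  simp [lieD, cov_sum, smul_sum]
  rw [sum_comm]

lemma lieD_smul (X : Fin n → R) (f : R) (v : V) :
    E.lieD X (f • v) = F.dirD X f • v + f • E.lieD X v := by
  simp [lieD, cov_smul, sum_add, smul_sub, smul_sum, F.dirD_apply, sum_smul, smul_smul]
  simp [mul_comm f]
  abel

lemma lieD_r {X : Fin n → R} (hX : F.IsKilling X) (N : Mat(n) R) (v : V) : E.lieD X (E.r N v) =
    E.r (mDeriv (F.dirD X) N + (F.lieMat X * N - N * F.lieMat X)) v + E.r N (E.lieD X v) := by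
  rw [lieD_eq, lieD_eq, map_add, LinearMap.add_apply, E.r_lie _ _ hX.isSkew_lieMat]
  simp [E.D_r, sum_add, F.mDeriv_dirD, LinearMap.sum_apply]
  abel

end FMod

namespace FCalc

/-- Kostant's identity: the second covariant derivative of a Killing vector field. -/
lemma IsKilling.kostant {X : Fin n → R} (hX : F.IsKilling X) (j : Fin n) : mDeriv
    (F.D j) (F.nablaV X) + (F.Γ j * F.nablaV X - F.nablaV X * F.Γ j) = -∑ i, X i • F.curvM i j := by
  set Q : Fin n → Mat(n) R := fun j =>
    mDeriv (F.D j) (F.nablaV X) + (F.Γ j * F.nablaV X - F.nablaV X * F.Γ j) with hQ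
  have hskew : ∀ j, F.IsSkew (Q j) := fun j =>
    (IsSkew.deriv j hX).add ((isSkew_Γ j).commutator hX)
  have hcomm : ∀ j a b, Q j b a - Q a b j = ∑ m, F.curvM j a b m * X m := fun j a b => by
    have h := congrFun (F.vec.cov_comm j a X) b
    simp [vec_r, F.vec_cov j (F.vec.cov a X), F.vec_cov a (F.vec.cov j X), Matrix.mulVec, dotProduct] at h
    simp [hQ, Matrix.add_apply, Matrix.sub_apply, mDeriv_apply, mul_apply, nablaV]
    simp [mul_comm (F.vec.cov _ X b)]
    simp [c, sub_mul] at h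
    linear_combination h
  have sk := fun i j p q => F.isSkew_curvM i j p q
  have sw : ∀ i j p q, F.curvM i j p q = - F.curvM j i p q := fun i j p q => by
    rw [F.curvM_swap i j]; rfl
  -- the pair symmetry
  have pair : ∀ j a m b, F.ε b * F.curvM j a b m - F.ε j * F.curvM a b j m
      + F.ε a * F.curvM b j a m = - (2 * (F.ε b * F.curvM m j b a)) := fun j a m b => by
    have B := fun i j k l => congrArg (F.ε l * ·) (F.bianchi i j k l)
    have S := fun i j p q => congrArg (F.ε q * ·) (sw i j q p)
    linear_combination B m j a b - B m a b j - B m j b a + S b j m a + sk m j a b - S a m j b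
      + sk m a j b + sk b m a j
  ext b a
  have h2 : 2 * (F.ε b * Q j b a + ∑ m, F.ε b * (X m * F.curvM m j b a)) = 0 := by
    have e1 := congrArg (F.ε b * ·) (hcomm j a b)
    have e2 := congrArg (F.ε j * ·) (hcomm a b j)
    have e3 := congrArg (F.ε a * ·) (hcomm b j a)
    simp [mul_sum] at e1 e2 e3
    have e4 := sum_congr (rfl : (univ : Finset (Fin n)) = univ)
      (fun m _ => congrArg (X m * ·) (pair j a m b))
    simp [mul_add, mul_sub, sum_add] at e4
    have e1' : ∀ (u v w : Fin n), ∑ m, F.ε w * (F.curvM u v w m * X m) =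
      ∑ m, X m * (F.ε w * F.curvM u v w m) := fun u v w =>
        sum_ext fun m => by ring
    have e5 : ∑ m, X m * (2 * (F.ε b * F.curvM m j b a)) =
        2 * ∑ m, F.ε b * (X m * F.curvM m j b a) := by
      rw [mul_sum]; exact sum_ext fun m => by ring
    rw [e1'] at e1 e2 e3
    rw [e5] at e4
    linear_combination e1 - e2 + e3 + e4 + hskew j a b - hskew b a j + hskew a j b
  have h3 := congrArg (F.ε b * ·) (F.two_cancel _ h2)
  simp [mul_add, mul_sum, ← mul_assoc, F.ε_mul_self] at h3
  rw [Matrix.neg_apply, Matrix.sum_apply]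
  exact eq_neg_of_add_eq_zero_left h3
end FCalc

namespace FCalc

variable (F)

lemma lieMat_apply (X : Fin n → R) (l j : Fin n) :
    F.lieMat X l j = ∑ m, X m * F.c m j l - F.D j (X l) := by
  simp [lieMat, Matrix.sum_apply, nablaV, vec_cov, c, mul_sub]
  simp [mul_comm (F.Γ j _ _)]
  ring

lemma jacobi_lieMat (X : Fin n → R) (i j l : Fin n) : F.D
    i (F.lieMat X l j) - F.D j (F.lieMat X l i) + ∑ k, F.lieMat X k j * F.c i k l + ∑ k, F.lieMat
    X k i * F.c k j l - F.dirD X (F.c i j l) - ∑ k, F.c i j k * F.lieMat X l k = 0 := by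
  have hJ : ∀ m, X m * (F.D i (F.c m j l) - F.D j (F.c m i l) - F.D m (F.c i j l)
      + ∑ k, F.c m j k * F.c i k l + ∑ k, F.c m i k * F.c k j l - ∑ k, F.c i j k * F.c m k l) = 0 := fun m => by
    have h : (F.D m (F.c i j l) + ∑ k, F.c i j k * F.c m k l) +
      (F.D i (F.c j m l) + ∑ k, F.c j m k * F.c i k l) +
      (F.D j (F.c m i l) + ∑ k, F.c m i k * F.c j k l) = 0 := F.jacobi m i j l
    have e1 : F.c j m l = - F.c m j l := F.c_swap _ _ _
    have e2 : ∑ k, F.c j m k * F.c i k l = - ∑ k, F.c m j k * F.c i k l := by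
      rw [← sum_neg_distrib]
      exact sum_ext fun k => by rw [F.c_swap j m]; ring
    have e3 : ∑ k, F.c m i k * F.c j k l = - ∑ k, F.c m i k * F.c k j l := by
      rw [← sum_neg_distrib]
      exact sum_ext fun k => by rw [F.c_swap j k]; ring
    rw [e1, e2, e3, map_neg] at h
    linear_combination (- X m) * h
  have hJ' := sum_congr (rfl : (univ : Finset (Fin n)) = univ)
    (fun m _ => hJ m)
  have hc : F.D i (F.D j (X l)) - F.D j (F.D i (X l)) = ∑ k, F.c i j k * F.D k (X l) :=
    F.comm i j (X l)
  have h1 : ∀ a b : Fin n, ∀ g : Fin n → R, ∑ k, (∑ m, X m * F.c m a k) * g k =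
      ∑ m, X m * ∑ k, F.c m a k * g k := fun a b g => by
    simp [sum_mul, mul_sum, mul_assoc]
    exact sum_comm
  have h2 : ∑ k, F.c i j k * (∑ m, X m * F.c m k l) = ∑ m, X m * ∑ k, F.c i j k * F.c m k l := by
    simp [mul_sum]
    rw [sum_comm]
    exact sum_ext fun m => sum_ext fun k => by ring
  have h3 : ∑ k, F.D j (X k) * F.c i k l = - ∑ k, F.D j (X k) * F.c k i l := by
    rw [← sum_neg_distrib]
    exact sum_ext fun k => by rw [F.c_swap i k]; ring
  simp [lieMat_apply, dirD_apply, sub_mul, mul_sub, sum_add, h1 _ j, h2, h3]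
  simp [mul_add, mul_sub, sum_add] at hJ'
  simp [mul_comm (F.c _ _ _) (F.D _ (X _))] at hc ⊢
  linear_combination hJ' - hc
end FCalc

namespace FMod

variable (E : FMod F V)

/-- The Lie derivative along a Killing vector field commutes with the connection. -/
lemma lieD_cov {X : Fin n → R} (hX : F.IsKilling X) (j : Fin n) (v : V) :
    E.lieD X (E.cov j v) = E.cov j (E.lieD X v) + ∑ k, F.lieMat X k j • E.cov k v := by
  have hk := congrArg (fun N => E.r N v) (hX.kostant j)
  simp only [map_neg, map_sum, map_smul, LinearMap.neg_apply, LinearMap.sum_apply,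
    LinearMap.smul_apply] at hk
  have h1 : ∀ i, E.cov i (E.cov j v) =
      E.cov j (E.cov i v) + (E.r (F.curvM i j) v + ∑ k, F.c i j k • E.cov k v) := fun i => by
    rw [← E.cov_comm]; abel
  have h2 : ∑ i, X i • ∑ k, F.c i j k • E.cov k v = ∑ k, (∑ m, X m * F.c m j k) • E.cov k v := by
    simp [smul_sum, sum_smul, smul_smul]
    exact sum_comm
  simp only [lieD, cov_sub, cov_sum, cov_smul, cov_r, h1, hk, smul_add, sum_add, h2,
    F.lieMat_apply, sub_smul, sum_sub_distrib]
  abel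

end FMod

namespace FCalc

lemma vec_r_injective (F : FCalc n R) {M N : Mat(n) R} (h : ∀ v, F.vec.r M v = F.vec.r N v) :
    M = N :=
  Matrix.toLin'.injective (LinearMap.ext h)

lemma IsKilling.lie_nablaV {X : Fin n → R} (hX : F.IsKilling X) (Y : Fin n → R) :
    mDeriv (F.dirD X) (F.nablaV Y) +
    (F.lieMat X * F.nablaV Y - F.nablaV Y * F.lieMat X) = F.nablaV (F.vec.lieD X Y) := by
  ext q p
  have h := congrFun (F.vec.lieD_cov hX p Y) q
  rw [FMod.lieD_eq] at h
  simp [vec_D, vec_r, Matrix.mulVec, dotProduct, ← F.dirD_apply] at h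
  simp [Matrix.add_apply, Matrix.sub_apply, mDeriv_apply, mul_apply, nablaV]
  grind

lemma IsKilling.lie {X Y : Fin n → R} (hX : F.IsKilling X) (hY : F.IsKilling Y) :
    F.IsKilling (F.vec.lieD X Y) := by
  unfold IsKilling
  rw [← hX.lie_nablaV Y, F.mDeriv_dirD]
  exact (IsSkew.sum _ fun i _ => (IsSkew.deriv i hY).smul _).add (hX.isSkew_lieMat.commutator hY)

lemma IsKilling.lie_curvM {X : Fin n → R} (hX : F.IsKilling X) (i j : Fin n) :
    mDeriv (F.dirD X) (F.curvM i j) + (F.lieMat X * F.curvM i j - F.curvM i j * F.lieMat X) =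
    ∑ k, F.lieMat X k i • F.curvM k j + ∑ k, F.lieMat X k j • F.curvM i k := by
  refine F.vec_r_injective ?_
  intro v
  have key := congrArg (F.vec.lieD X) (F.vec.cov_comm i j v)
  have hJ : ∑ l, (F.D i (F.lieMat X l j) - F.D j (F.lieMat X l i) + ∑ k, F.lieMat X k j * F.c i k l
      + ∑ k, F.lieMat X k i * F.c k j l - F.dirD X (F.c i j l)
      - ∑ k, F.c i j k * F.lieMat X l k) • F.vec.cov l v = 0 := by
    simp [F.jacobi_lieMat]
  have sw : ∀ (f : Fin n → R) (g : Fin n → Fin n → R) (w : Fin n → Fin n → R),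
      ∑ k, f k • ∑ l, g k l • w l = ∑ l, (∑ k, f k * g k l) • w l := fun f g w => by
    simp [smul_sum, sum_smul, smul_smul]
    exact sum_comm
  have h1 : ∀ a b, F.vec.cov a (F.vec.cov b v) - F.vec.cov b (F.vec.cov a v)
      = F.vec.r (F.curvM a b) v + ∑ k, F.c a b k • F.vec.cov k v := fun a b => F.vec.cov_comm a b v
  have h2 : ∑ k, F.lieMat X k j • F.vec.cov i (F.vec.cov k v) -
      ∑ k, F.lieMat X k j • F.vec.cov k (F.vec.cov i v) =
      ∑ k, F.lieMat X k j • F.vec.r (F.curvM i k) v +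
        ∑ l, (∑ k, F.lieMat X k j * F.c i k l) • F.vec.cov l v := by
    rw [← sw, ← sum_sub_distrib, ← sum_add]
    exact sum_ext fun k => by rw [← smul_sub, h1, smul_add]
  have h3 : ∑ k, F.lieMat X k i • F.vec.cov k (F.vec.cov j v) -
      ∑ k, F.lieMat X k i • F.vec.cov j (F.vec.cov k v) =
      ∑ k, F.lieMat X k i • F.vec.r (F.curvM k j) v +
        ∑ l, (∑ k, F.lieMat X k i * F.c k j l) • F.vec.cov l v := by
    rw [← sw, ← sum_sub_distrib, ← sum_add]
    exact sum_ext fun k => by rw [← smul_sub, h1, smul_add]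
  have h4 := F.vec.cov_comm i j (F.vec.lieD X v)
  simp only [F.vec.lieD_sub, F.vec.lieD_add, F.vec.lieD_sum, F.vec.lieD_smul, F.vec.lieD_r hX,
    F.vec.lieD_cov hX, F.vec.cov_add, F.vec.cov_sum, F.vec.cov_smul, smul_add,
    sum_add, sw] at key
  simp [sub_smul, add_smul, sum_add] at hJ
  simp at key ⊢
  linear_combination hJ - key + h2 + h3 + h4

end FCalc

namespace FMod

variable (E : FMod F V)

lemma lieD_lieD {X Y : Fin n → R} (hX : F.IsKilling X) (v : V) :
    E.lieD X (E.lieD Y v) - E.lieD Y (E.lieD X v) = E.lieD (F.vec.lieD X Y) v := by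
  have h : ∀ k, F.vec.lieD X Y k = F.dirD X (Y k) + ∑ i, F.lieMat X k i * Y i := by
    rw [lieD_eq]
    simp [F.dirD_apply, F.vec_D, F.vec_r, Matrix.mulVec, dotProduct]
  have h2 : ∑ i, Y i • ∑ k, F.lieMat X k i • E.cov k v =
      ∑ k, (∑ i, F.lieMat X k i * Y i) • E.cov k v := by
    simp [smul_sum, sum_smul, smul_smul, mul_comm (Y _)]
    exact sum_comm
  rw [lieD.eq_1 E Y v, lieD.eq_1 E (F.vec.lieD X Y) v, ← hX.lie_nablaV Y]
  simp only [lieD_sub, lieD_sum, lieD_smul, E.lieD_cov hX, E.lieD_r hX, smul_add,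
    sum_add, h2, h, add_smul]
  rw [lieD.eq_1 E Y (E.lieD X v)]
  abel

end FMod

/-! ### Sums over multi-indices -/

section MultiIndex

lemma sum_append {Z : Type*} [AddCommMonoid Z] (f : (Fin (k + l) → Fin n) → Z) :
    ∑ K, f K = ∑ I : Fin k → Fin n, ∑ J : Fin l → Fin n, f (append I J) := by
  rw [← Fintype.sum_prod_type']
  exact (Fintype.sum_equiv (Fin.appendEquiv k l) _ _ fun p => rfl).symm

lemma sum_snoc {Z : Type*} [AddCommMonoid Z] (f : (Fin (k + 1) → Fin n) → Z) :
    ∑ K, f K = ∑ I : Fin k → Fin n, ∑ p, f (snoc I p) := by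
  rw [sum_comm, ← Fintype.sum_prod_type']
  exact (Fintype.sum_equiv (Fin.snocEquiv fun _ => Fin n) _ _ fun p => rfl).symm

lemma sum_cons {Z : Type*} [AddCommMonoid Z] (f : (Fin (k + 1) → Fin n) → Z) :
    ∑ K, f K = ∑ p, ∑ I : Fin k → Fin n, f (Fin.cons p I) := by
  rw [← Fintype.sum_prod_type']
  exact (Fintype.sum_equiv (Fin.consEquiv fun _ => Fin n) _ _ fun p => rfl).symm

@[simp] lemma fstIdx_append_eq (I : Fin k → Fin n) (J : Fin l → Fin n) : fstIdx (append I J) = I :=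
    by ext α; simp [fstIdx]

@[simp] lemma sndIdx_append_eq (I : Fin k → Fin n) (J : Fin l → Fin n) : sndIdx (append I J) = J :=
    by ext α; simp [sndIdx]

/-- Moving the action of a matrix on one index of a multilinear expression from the coefficients to
the arguments. -/
lemma sum_slot {R P Q V Z : Type*} [CommRing R] [AddCommGroup P] [Module R P] [AddCommGroup Q]
    [Module R Q] [AddCommGroup V] [Module R V] [AddCommGroup Z] [Module R Z] (μ : MultilinearMap R
    (fun _ : Fin k => P) Q) (β : Q →ₗ[R] V →ₗ[R] Z) (z : Fin k → Fin n → P) (g : Fin n → Fin n → R)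
    (α : Fin k) (A : (Fin k → Fin n) → V) : ∑ I, β (μ fun γ => z γ (I γ)) (∑ m, g (I α) m •
    A (update I α m)) = ∑ I, β (μ (update (fun γ => z γ (I γ)) α (∑ m, g m (I α) • z α m))) (A I) :=
    by
  simp [MultilinearMap.map_update_sum, LinearMap.sum_apply]
  rw [← Fintype.sum_prod_type', ← Fintype.sum_prod_type']
  refine Fintype.sum_bijective (fun p : (Fin k → Fin n) × Fin n => (update p.1 α p.2, p.1 α))
    (Function.Involutive.bijective ?_) _ _ ?_
  · rintro ⟨I, m⟩
    simp
  · rintro ⟨I, m⟩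
    have : (fun γ => z γ (I γ)) = update (fun γ => z γ (update I α m γ)) α (z α (I α)) := by
      funext γ
      by_cases h : γ = α
      · subst h; simp
      · simp [h]
    simp [this]

end MultiIndex

/-! ### Tensors over a commutative ring -/

/-- The components of a `TM`-valued covariant tensor of degree `k` in a frame. -/
abbrev Tens (n : ℕ) (R : Type*) (k : ℕ) : Type _ := (Fin k → Fin n) → Fin n → R

namespace Tens

def ev (A : Tens n R k) : MultilinearMap R (fun _ : Fin k => Fin n → R) (Fin n → R) :=
  ∑ I, ((MultilinearMap.mkPiAlgebra R (Fin k) R).compLinearMap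
    (fun α => LinearMap.proj (I α))).smulRight (A I)

lemma ev_apply (A : Tens n R k) (v : Fin k → Fin n → R) (q : Fin n) :
    A.ev v q = ∑ I, (∏ α, v α (I α)) * A I q := by
  simp [ev, Finset.sum_apply]

lemma ev_single (A : Tens n R k) (I : Fin k → Fin n) : A.ev (fun α => Pi.single (I α) 1) = A I := by
  ext q
  rw [ev_apply, sum_eq_single I]
  · simp
  · intro K _ hK
    obtain ⟨α, hα⟩ := Function.ne_iff.mp hK
    rw [Finset.prod_eq_zero (mem_univ α), zero_mul]
    simp [hα]
  · simp

lemma ev_update_single (A : Tens n R k) (I : Fin k → Fin n) (α : Fin k) (x : Fin n → R) :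
    A.ev (update (fun α => Pi.single (I α) 1) α x) = ∑ m, x m • A (update I α m) := by
  have hx : x = ∑ m, x m • Pi.single m (1 : R) := by
    ext q
    simp [Finset.sum_apply, Pi.single_apply]
  conv_lhs => rw [hx]
  rw [MultilinearMap.map_update_sum]
  refine sum_ext fun m => ?_
  rw [MultilinearMap.map_update_smul, ← ev_single A (update I α m)]
  congr 2
  funext γ
  by_cases h : γ = α
  · subst h; simp
  · simp [h]

lemma ev_slot (A : Tens n R k) (v : Fin k → Fin n → R) (g : Fin n → Fin n → R)
    (α : Fin k) (q : Fin n) : ∑ I, (∏ γ, v γ (I γ)) * ∑ m, g (I α) m * A (update I α m) q =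
    A.ev (update v α (fun m => ∑ i, g i m * v α i)) q := by
  have h := sum_slot (MultilinearMap.mkPiAlgebra R (Fin k) R) (LinearMap.mul R R)
    v g α (fun I => A I q)
  simp only [MultilinearMap.mkPiAlgebra_apply, LinearMap.mul_apply', smul_eq_mul] at h
  rw [h, ev_apply]
  refine sum_ext fun I => ?_
  congr 1
  refine prod_congr rfl fun γ _ => ?_
  by_cases hγ : γ = α
  · subst hγ; simp
  · simp [hγ]

lemma ev_snoc (A : Tens n R (k + 1)) (v : Fin k → Fin n → R) (x : Fin n → R) (q : Fin n) :
    A.ev (snoc v x) q = ∑ I, (∏ α, v α (I α)) * ∑ p, x p * A (snoc I p) q := by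
  rw [ev_apply, sum_snoc]
  simp [Fin.prod_univ_castSucc, mul_sum, mul_assoc]

lemma ev_cons (A : Tens n R (k + 1)) (v : Fin k → Fin n → R) (x : Fin n → R) (q : Fin n) :
    A.ev (Fin.cons x v) q = ∑ p, x p * ∑ I, (∏ α, v α (I α)) * A (Fin.cons p I) q := by
  rw [ev_apply, sum_cons]
  simp [Fin.prod_univ_succ, mul_sum, mul_assoc]

lemma ev_three (A : Tens n R 3) (x y z : Fin n → R) (q : Fin n) :
    A.ev ![x, y, z] q = ∑ i, ∑ j, ∑ m, x i * y j * z m * A ![i, j, m] q := by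
  have h : ![x, y, z] = Fin.cons x (Fin.cons y (Fin.cons z Fin.elim0)) := by
    ext i; fin_cases i <;> rfl
  have h2 : ∀ i j m : Fin n, (Fin.cons i (Fin.cons j (Fin.cons m Fin.elim0)) : Fin 3 → Fin n) =
      ![i, j, m] := fun i j m => by
    ext i; fin_cases i <;> rfl
  rw [h, ev_apply, sum_cons]
  simp [sum_cons (k := 1), sum_cons (k := 0), Fintype.sum_unique, Fin.prod_univ_three]
  refine sum_ext fun i => sum_ext fun j =>
    sum_ext fun m => ?_
  rw [show (default : Fin 0 → Fin n) = Fin.elim0 from Subsingleton.elim _ _, h2]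
  rfl

def contractR (T : Tens n R 3) (A : Tens n R k) : Tens n R (k + 2) := fun i q =>
  ∑ r, A (fstIdx i) r * T ![sndIdx (l := 2) i 0, r, sndIdx (l := 2) i 1] q

def contractR₂ (T : Tens n R 3) (A : Tens n R k) (B : Tens n R l) : Tens n R (k + l + 1) := fun i q
    =>
  ∑ m, ∑ r, A (fstIdx (Fin.init i)) m * B (sndIdx (Fin.init i)) r *
    T ![m, r, i (Fin.last (k + l))] q

def insert (A : Tens n R k) (C : Tens n R (l + 1)) : Tens n R (k + l) := fun i q =>
  ∑ m, A (fstIdx i) m * C (Fin.cons m (sndIdx i)) q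

def circ (A : Tens n R k) (B : Tens n R (l + 1)) : Tens n R (k + l) := fun i q =>
  ∑ α, ∑ m, B (snoc (sndIdx i) (fstIdx i α)) m * A (update (fstIdx i) α m) q

/-- The commutator of endomorphism valued tensors, corrected on the form indices. -/
def bullet (A : Tens n R (k + 1)) (B : Tens n R (l + 1)) : Tens n R (k + l + 1) := fun idx q =>
  let i : Fin k → Fin n := fstIdx (Fin.init idx)
  let j : Fin l → Fin n := sndIdx (Fin.init idx)
  let p : Fin n := idx (Fin.last (k + l))
  ∑ m, (B (snoc j p) m * A (snoc i m) q - A (snoc i p) m * B (snoc j m) q)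
    - ∑ β, ∑ m, A (snoc i (j β)) m * B (snoc (update j β m) p) q
    + ∑ α, ∑ m, B (snoc j (i α)) m * A (snoc (update i α m) p) q

lemma ev_append_mul {k l : ℕ} (v : Fin k → Fin n → R) (w : Fin l → Fin n → R)
    (f : (Fin k → Fin n) → (Fin l → Fin n) → R) : ∑ K : Fin (k + l) → Fin n, (∏ α, append v w
    α (K α)) * f (fstIdx K) (sndIdx K) = ∑ I, ∑ J, (∏ α, v α (I α)) * (∏ β, w β (J β)) * f I J := by
  rw [sum_append]
  simp [Fin.prod_univ_add]

lemma ev_contractR (T : Tens n R 3) (A : Tens n R k) (v : Fin k → Fin n → R) (x y : Fin n → R) :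
    (contractR T A).ev (append v ![x, y]) = T.ev ![x, A.ev v, y] := by
  ext q
  rw [ev_apply, ev_three]
  simp [contractR]
  rw [ev_append_mul v ![x, y] fun I J => ∑ r, A I r * T ![J 0, r, J 1] q]
  have h : ∀ g : (Fin 2 → Fin n) → R, ∑ J, g J = ∑ i, ∑ m, g ![i, m] := fun g => by
    rw [sum_cons]
    simp [sum_cons (k := 0), Fintype.sum_unique]
    refine sum_ext fun i => sum_ext fun m => congrArg g ?_
    ext a; fin_cases a <;> rfl
  simp [h, ev_apply]
  simp [mul_sum, sum_mul]
  simp [← Fintype.sum_prod_type']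
  refine Fintype.sum_equiv
    ⟨fun a => (a.2.1, a.2.2.2, a.2.2.1, a.1), fun a => (a.2.2.2, a.1, a.2.2.1, a.2.1),
      fun _ => rfl, fun _ => rfl⟩ _ _ fun a => ?_
  dsimp
  ring

lemma ev_contractR₂ (T : Tens n R 3) (A : Tens n R k)
    (B : Tens n R l) (v : Fin k → Fin n → R) (w : Fin l → Fin n → R) (x : Fin n → R) :
    (contractR₂ T A B).ev (snoc (append v w) x) = T.ev ![A.ev v, B.ev w, x] := by
  ext q
  rw [ev_snoc, ev_three]
  simp [contractR₂]
  rw [ev_append_mul v w fun I J => ∑ p, x p * ∑ m, ∑ r, A I m * B J r * T ![m, r, p] q]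
  simp [ev_apply, sum_mul, mul_sum]
  simp [← Fintype.sum_prod_type']
  refine Fintype.sum_equiv
    ⟨fun a => (a.2.2.2.1, a.2.2.2.2, a.2.2.1, a.2.1, a.1),
      fun a => (a.2.2.2.2, a.2.2.2.1, a.2.2.1, a.1, a.2.1), fun _ => rfl, fun _ => rfl⟩ _ _
      fun a => ?_
  dsimp
  ring

lemma ev_insert (A : Tens n R k) (C : Tens n R (l + 1)) (v : Fin k → Fin n → R)
    (w : Fin l → Fin n → R) : (insert A C).ev (append v w) = C.ev (Fin.cons (A.ev v) w) := by
  ext q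
  rw [ev_apply, ev_cons]
  simp [insert]
  rw [ev_append_mul v w fun I J => ∑ m, A I m * C (Fin.cons m J) q]
  simp [ev_apply, sum_mul, mul_sum]
  simp [← Fintype.sum_prod_type']
  refine Fintype.sum_equiv
      ⟨fun a => (a.2.2, a.2.1, a.1), fun a => (a.2.2, a.2.1, a.1), fun _ => rfl, fun _ => rfl⟩ _ _
      fun a => ?_
  dsimp
  ring

lemma sum_sum_circ (A : Tens n R k) (B : Tens n R (l + 1)) (v : Fin k → Fin n → R)
    (w : Fin l → Fin n → R) (q : Fin n) : ∑ I, ∑ J, (∏ α, v α (I α)) * (∏ β, w β (J β)) * ∑ α, ∑ m,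
    B (snoc J (I α)) m * A (update I α m) q = ∑ α, A.ev (update v α (B.ev (snoc w (v α)))) q := by
  have h : ∀ α, A.ev (update v α (B.ev (snoc w (v α)))) q = ∑ I, (∏ γ, v γ (I γ)) *
        ∑ m, (∑ J, (∏ β, w β (J β)) * B (snoc J (I α)) m) * A (update I α m) q := fun α => by
    rw [ev_slot A v (fun i m => ∑ J, (∏ β, w β (J β)) * B (snoc J i) m) α q]
    refine congrArg (fun y => A.ev (update v α y) q) (funext fun m => ?_)
    rw [ev_snoc]
    simp [mul_sum, sum_mul]
    rw [sum_comm]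
    exact sum_ext fun i => sum_ext fun J => by ring
  simp [h]
  simp [sum_mul, mul_sum]
  simp [← Fintype.sum_prod_type']
  refine Fintype.sum_equiv
      ⟨fun a => (a.2.2.1, a.1, a.2.2.2, a.2.1), fun a => (a.2.1, a.2.2.2, a.1, a.2.2.1),
        fun _ => rfl, fun _ => rfl⟩ _ _ fun a => ?_
  dsimp
  ring

lemma ev_circ (A : Tens n R k) (B : Tens n R (l + 1)) (v : Fin k → Fin n → R) (w : Fin
    l → Fin n → R) : (circ A B).ev (append v w) = ∑ α, A.ev (update v α (B.ev (snoc w (v α)))) := by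
  ext q
  rw [ev_apply, Finset.sum_apply, ← sum_sum_circ, ← ev_append_mul]
  rfl

def last (A : Tens n R (k + 1)) (x : Fin n → R) : Tens n R k := fun I q =>
  ∑ p, x p * A (snoc I p) q

lemma ev_last (A : Tens n R (k + 1)) (x : Fin n → R) (v : Fin k → Fin n → R) :
    (A.last x).ev v = A.ev (snoc v x) := by
  ext q
  rw [ev_snoc, ev_apply]
  rfl

lemma ev_bullet (A : Tens n R (k + 1)) (B : Tens n R (l + 1)) (v : Fin k → Fin n → R)
    (w : Fin l → Fin n → R) (x : Fin n → R) : (bullet A B).ev (snoc (append v w) x) =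
    A.ev (snoc v (B.ev (snoc w x))) - B.ev (snoc w (A.ev (snoc v x))) - ∑ β, B.ev (snoc (update
    w β (A.ev (snoc v (w β)))) x) + ∑ α, A.ev (snoc (update v α (B.ev (snoc w (v α)))) x) := by
  ext q
  have h1 : ∀ (a b : ℕ) (A : Tens n R (a + 1)) (B : Tens n R (b + 1))
      (v : Fin a → Fin n → R) (w : Fin b → Fin n → R),
      A.ev (snoc v (B.ev (snoc w x))) q = ∑ I, ∑ J, (∏ α, v α (I α)) * (∏ β, w β (J β)) *
        ∑ p, x p * ∑ m, B (snoc J p) m * A (snoc I m) q := fun a b A B v w => by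
    rw [ev_snoc]
    simp [ev_snoc, sum_mul, mul_sum]
    simp [← Fintype.sum_prod_type']
    refine Fintype.sum_equiv
      ⟨fun a => (a.1, a.2.2.1, a.2.2.2, a.2.1), fun a => (a.1, a.2.2.2, a.2.1, a.2.2.1),
        fun _ => rfl, fun _ => rfl⟩ _ _ fun a => ?_
    dsimp
    ring
  have h2 := sum_sum_circ (A.last x) B v w q
  have h3 := sum_sum_circ (B.last x) A w v q
  simp only [ev_last] at h2 h3
  have h4 := h1 k l A B v w
  have h5 := h1 l k B A w v
  rw [sum_comm] at h3 h5
  simp only [Pi.add_apply, Pi.sub_apply, Finset.sum_apply]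
  rw [ev_snoc]
  simp only [bullet, Fin.init_snoc, snoc_last]
  rw [← h2, ← h3, h4, h5, ev_append_mul v w fun I J => ∑ p, x p *
    (∑ m, (B (snoc J p) m * A (snoc I m) q - A (snoc I p) m * B (snoc J m) q)
    - ∑ β, ∑ m, A (snoc I (J β)) m * B (snoc (update J β m) p) q
    + ∑ α, ∑ m, B (snoc J (I α)) m * A (snoc (update I α m) p) q)]
  simp only [← sum_add, ← sum_sub_distrib]
  refine sum_ext fun I => sum_ext fun J => ?_
  simp only [last]
  have e1 : ∀ (ι : Type) [Fintype ι] (g : ι → Fin n → Fin n → R),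
      ∑ α, ∑ m, ∑ p, x p * g α m p = ∑ p, x p * ∑ α, ∑ m, g α m p := fun ι _ g => by
    simp [mul_sum]
    rw [sum_ext fun α => sum_comm, sum_comm]
  have e2 : ∑ α, ∑ m, B (snoc J (I α)) m * ∑ p, x p * A (snoc (update I α m) p) q =
      ∑ p, x p * ∑ α, ∑ m, B (snoc J (I α)) m * A (snoc (update I α m) p) q := by
    rw [← e1]
    simp [mul_sum]
    exact sum_ext fun _ => sum_ext fun _ =>
      sum_ext fun _ => by ring
  have e3 : ∑ α, ∑ m, A (snoc I (J α)) m * ∑ p, x p * B (snoc (update J α m) p) q =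
      ∑ p, x p * ∑ α, ∑ m, A (snoc I (J α)) m * B (snoc (update J α m) p) q := by
    rw [← e1]
    simp [mul_sum]
    exact sum_ext fun _ => sum_ext fun _ =>
      sum_ext fun _ => by ring
  rw [e2, e3]
  simp [mul_add, mul_sub, sum_add]
  ring

/-- The tensors `A` and `A'` correspond to each other under the linear map `L` on vectors. -/
def Equivar (L : Mat(n) R) (A A' : Tens n R k) : Prop :=
  ∀ v, A.ev (fun α => L.mulVec (v α)) = L.mulVec (A'.ev v)

lemma equivariant_iff {L : Mat(n) R} {A A' : Tens n R k} : Equivar L A A' ↔ ∀ (J : Fin k → Fin n)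
    (q : Fin n), ∑ I : Fin k → Fin n, (∏ α, L (I α) (J α)) * A I q = ∑ r, L q r * A' J r := by
  constructor
  · intro h J q
    have := congrFun (h fun α => Pi.single (J α) 1) q
    rw [ev_single, ev_apply] at this
    simpa [Matrix.mulVec, dotProduct, Pi.single_apply] using this
  · intro h
    have : A.ev.compLinearMap (fun _ => L.mulVecLin) = L.mulVecLin.compMultilinearMap A'.ev := by
      refine Module.Basis.ext_multilinear (fun _ => Pi.basisFun R (Fin n)) fun J => ?_
      ext q
      simp [ev_single]
      rw [ev_apply]
      simpa [Matrix.mulVec, dotProduct, Pi.single_apply] using h J q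
    intro v
    exact DFunLike.congr_fun this v

section Equivariance

variable {L : Mat(n) R}

variable {A A' : Tens n R k} {B B' : Tens n R (l + 1)}

lemma mulVec_update (L : Mat(n) R) (v : Fin k → Fin n → R) (α : Fin k) (x : Fin n → R) :
    update (fun α => L.mulVec (v α)) α (L.mulVec x) = fun β => L.mulVec (update v α x β) := by
  funext β
  by_cases h : β = α
  · subst h; simp
  · simp [h]

lemma mulVec_snoc (L : Mat(n) R) (v : Fin k → Fin n → R) (x : Fin n → R) :
    (snoc (fun α => L.mulVec (v α)) (L.mulVec x) : Fin (k + 1) → Fin n → R) =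
    fun β => L.mulVec ((snoc v x : Fin (k + 1) → Fin n → R) β) := by
  funext β
  refine Fin.lastCases ?_ (fun β => ?_) β <;> simp

lemma mulVec_cons (L : Mat(n) R) (v : Fin k → Fin n → R) (x : Fin n → R) :
    (Fin.cons (L.mulVec x) (fun α => L.mulVec (v α)) : Fin (k + 1) → Fin n → R) =
    fun β => L.mulVec ((Fin.cons x v : Fin (k + 1) → Fin n → R) β) := by
  funext β
  refine Fin.cases ?_ (fun β => ?_) β <;> simp

lemma mulVec_three (L : Mat(n) R) (x y z : Fin n → R) :
    ![L.mulVec x, L.mulVec y, L.mulVec z] = fun β => L.mulVec ((![x, y, z] : Fin 3 → _) β) := by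
  funext β
  fin_cases β <;> rfl

lemma append_fst_snd {X : Type*} (v : Fin (k + l) → X) :
    v = append (fun α => v (castAdd l α)) (fun β => v (natAdd k β)) :=
  (Fin.append_castAdd_natAdd (f := v)).symm

lemma Equivar.contractR {T T' : Tens n R 3} (hT : Equivar L T T') (hA : Equivar L A A') :
    Equivar L (contractR T A) (contractR T' A') := fun v => by
  rw [append_fst_snd v]
  generalize (fun α => v (castAdd 2 α)) = v₁
  have h2 : (fun β => v (natAdd k β)) = ![v (natAdd k 0), v (natAdd k 1)] := by
    funext β; fin_cases β <;> rfl
  rw [h2]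
  generalize v (natAdd k 0) = x
  generalize v (natAdd k 1) = y
  have h : (fun α => L.mulVec (append v₁ ![x, y] α)) =
      append (fun α => L.mulVec (v₁ α)) ![L.mulVec x, L.mulVec y] := by
    funext α
    refine Fin.addCases (fun α => ?_) (fun β => ?_) α
    · simp
    · rw [Fin.append_right, Fin.append_right]; fin_cases β <;> rfl
  rw [h, ev_contractR, ev_contractR, hA, mulVec_three, hT]

lemma mulVec_append (L : Mat(n) R) (v : Fin k → Fin n → R) (w : Fin l → Fin n → R) : (fun
    α => L.mulVec (append v w α)) = append (fun α => L.mulVec (v α)) (fun α => L.mulVec (w α)) := by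
  funext α
  refine Fin.addCases (fun α => ?_) (fun β => ?_) α <;> simp

lemma Equivar.contractR₂ {T T' : Tens n R 3} (hT : Equivar L T T') (hA : Equivar L A A') {B B' : Tens n R l}
    (hB : Equivar L B B') : Equivar L (contractR₂ T A B) (contractR₂ T' A' B') := fun v => by
  rw [← Fin.snoc_init_self v, append_fst_snd (Fin.init v), ← mulVec_snoc, mulVec_append,
    ev_contractR₂, ev_contractR₂, hA, hB, mulVec_three, hT]

lemma Equivar.insert (hA : Equivar L A A') {C C' : Tens n R (l + 1)} (hC : Equivar L C C') :
    Equivar L (insert A C) (insert A' C') := fun v => by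
  rw [append_fst_snd v, mulVec_append, ev_insert, ev_insert, hA, mulVec_cons, hC]

lemma mulVec_sum {ι : Type*} (L : Mat(n) R) (s : Finset ι) (f : ι → Fin n → R) :
    L.mulVec (∑ i ∈ s, f i) = ∑ i ∈ s, L.mulVec (f i) := map_sum L.mulVecLin f s

lemma Equivar.circ (hA : Equivar L A A') (hB : Equivar L B B') :
    Equivar L (circ A B) (circ A' B') := fun v => by
  rw [append_fst_snd v, mulVec_append, ev_circ, ev_circ, mulVec_sum]
  refine sum_ext fun α => ?_
  rw [mulVec_snoc, hB, mulVec_update, hA]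

lemma Equivar.bullet {A A' : Tens n R (k + 1)} (hA : Equivar L A A') (hB : Equivar L B B') :
    Equivar L (bullet A B) (bullet A' B') := fun v => by
  rw [← Fin.snoc_init_self v, append_fst_snd (Fin.init v), ← mulVec_snoc, mulVec_append,
    ev_bullet, ev_bullet, Matrix.mulVec_add, Matrix.mulVec_sub, Matrix.mulVec_sub, mulVec_sum,
    mulVec_sum]
  simp only [mulVec_snoc, hB _, hA _, mulVec_update]

end Equivariance

def Null (K : Fin n → R) (A : Tens n R k) : Prop := ∀ v, (∃ α, v α = K) → A.ev v = 0

section Null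

variable {K : Fin n → R}

variable {A : Tens n R k} {v : Fin k → Fin n → R}

lemma ev_eq_zero (A : Tens n R k) (α : Fin k) (h : v α = 0) : A.ev v = 0 := A.ev.map_coord_zero α h

lemma null_iff : Null
    K A ↔ ∀ (I : Fin k → Fin n) (α : Fin k) (q : Fin n), ∑ m, K m * A (update I α m) q = 0 := by
  constructor
  · intro h I α q
    have := congrFun (h (update (fun α => Pi.single (I α) 1) α K) ⟨α, by simp⟩) q
    rw [ev_update_single] at this
    simpa [Finset.sum_apply] using this
  · rintro h v ⟨α, rfl⟩
    ext q
    have h1 := ev_slot A (update v α (Pi.single q 1)) (fun _ m => v α m) α q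
    simp [h, ← mul_sum] at h1
    exact h1.symm

lemma Null.ev_update (hA : Null K A) (v : Fin k → Fin n → R)
    {α : Fin k} (h : v α = K) {β : Fin k} (hβ : α ≠ β) (x : Fin n → R) : A.ev (update v β x) = 0 :=
  hA _ ⟨α, by rw [update_of_ne hβ, h]⟩

lemma exists_append {X : Type*} {y : X} {v : Fin k → X}
    {w : Fin l → X} (h : ∃ α, append v w α = y) : (∃ α, v α = y) ∨ ∃ β, w β = y := by
  obtain ⟨α, hα⟩ := h
  revert hα
  refine Fin.addCases (fun α hα => Or.inl ⟨α, ?_⟩) (fun β hβ => Or.inr ⟨β, ?_⟩) α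
  · simpa using hα
  · simpa using hβ

lemma exists_snoc {X : Type*} {y : X} {v : Fin k → X}
    {x : X} (h : ∃ α, (snoc v x : Fin (k + 1) → X) α = y) : (∃ α, v α = y) ∨ x = y := by
  obtain ⟨α, hα⟩ := h
  revert hα
  refine Fin.lastCases (fun hα => Or.inr ?_) (fun β hβ => Or.inl ⟨β, ?_⟩) α
  · simpa using hα
  · simpa using hβ

lemma Null.on_snoc {A : Tens n R (k + 1)} (hA : Null K A) (h : ∃ α, v α = K) (x : Fin n → R) :
    A.ev (snoc v x) = 0 := by
  obtain ⟨α, hα⟩ := h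
  exact hA _ ⟨α.castSucc, by simpa using hα⟩

lemma Null.on_last {A : Tens n R (k + 1)} (hA : Null K A) (v : Fin k → Fin n → R) :
    A.ev (snoc v K) = 0 := hA _ ⟨Fin.last k, by simp⟩

lemma Null.contractR {T : Tens n R 3} (hT : Null K T) (hA : Null K A) : Null K (contractR T A) :=
    fun v h => by
  rw [append_fst_snd v] at h ⊢
  have h2 : (fun β => v (natAdd k β)) = ![v (natAdd k 0), v (natAdd k 1)] := by
    funext β; fin_cases β <;> rfl
  rw [h2] at h ⊢
  rw [ev_contractR]
  rcases exists_append h with h | ⟨β, hβ⟩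
  · rw [hA _ h]
    exact ev_eq_zero _ 1 rfl
  · revert hβ
    refine Fin.cases (fun hβ => ?_) (fun β => Fin.cases (fun hβ => ?_) (fun β => β.elim0) β) β
    · exact hT _ ⟨0, hβ⟩
    · exact hT _ ⟨2, hβ⟩

lemma Null.contractR₂ {T : Tens n R 3} (hT : Null K T)
    (hA : Null K A) {B : Tens n R l} (hB : Null K B) : Null K (contractR₂ T A B) := fun v h => by
  rw [← Fin.snoc_init_self v, append_fst_snd (Fin.init v)] at h ⊢
  rw [ev_contractR₂]
  rcases exists_snoc h with h | h
  · rcases exists_append h with h | h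
    · rw [hA _ h]
      exact ev_eq_zero _ 0 rfl
    · rw [hB _ h]
      exact ev_eq_zero _ 1 rfl
  · exact hT _ ⟨2, h⟩

lemma Null.insert (hA : Null K A) {C : Tens n R (l + 1)} (hC : Null K C) : Null K (insert A C) :=
    fun v h => by
  rw [append_fst_snd v] at h ⊢
  rw [ev_insert]
  rcases exists_append h with h | ⟨β, hβ⟩
  · rw [hA _ h]
    exact ev_eq_zero _ 0 rfl
  · exact hC _ ⟨β.succ, by simpa using hβ⟩

lemma Null.circ (hA : Null K A) {B : Tens n R (l + 1)} (hB : Null K B) : Null K (circ A B) := fun v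
    h => by
  rw [append_fst_snd v] at h ⊢
  rw [ev_circ]
  refine sum_eq_zero fun β _ => ?_
  rcases exists_append h with ⟨α, hα⟩ | h
  · by_cases hβ : α = β
    · subst hβ
      refine ev_eq_zero _ α ?_
      rw [update_self, hα, hB.on_last]
    · exact hA.ev_update _ hα hβ _
  · refine ev_eq_zero _ β ?_
    rw [update_self, hB.on_snoc h]

lemma Null.bullet {A : Tens n R (k + 1)} (hA : Null K A) {B : Tens n R (l + 1)} (hB : Null K B) :
    Null K (bullet A B) := fun v h => by
  rw [← Fin.snoc_init_self v, append_fst_snd (Fin.init v)] at h ⊢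
  generalize (fun α => Fin.init v (castAdd l α)) = v₁ at *
  generalize (fun α => Fin.init v (natAdd k α)) = v₂ at *
  generalize v (Fin.last (k + l)) = x at *
  have last0 : ∀ {a : ℕ} (C : Tens n R (a + 1)) (u : Fin a → Fin n → R),
      C.ev (snoc u 0) = 0 := fun C u => ev_eq_zero _ (Fin.last _) (by simp)
  have upd0 : ∀ {a : ℕ} (C : Tens n R (a + 1)) (u : Fin a → Fin n → R) (α : Fin a)
      (y : Fin n → R), C.ev (snoc (update u α 0) y) = 0 :=
    fun C u α y => ev_eq_zero _ α.castSucc (by simp)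
  have updK : ∀ {a : ℕ} {C : Tens n R (a + 1)} (_ : Null K C) {u : Fin a → Fin n → R} {α β : Fin a}
      (_ : u α = K) (_ : α ≠ β) (x y : Fin n → R),
      C.ev (snoc (update u β x) y) = 0 := fun hC _ α β h hn x y =>
    hC.on_snoc ⟨α, by rw [update_of_ne hn, h]⟩ _
  rw [ev_bullet]
  rcases exists_snoc h with h | h
  · rcases exists_append h with h | h
    · rw [hA.on_snoc h, hA.on_snoc h, last0, sum_eq_zero, sum_eq_zero]
      · simp
      · intro β _
        obtain ⟨α, hα⟩ := h
        by_cases hβ : α = β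
        · subst hβ
          rw [hα, hB.on_last, upd0]
        · exact updK hA hα hβ _ _
      · intro β _
        rw [hA.on_snoc h, upd0]
    · rw [hB.on_snoc h, hB.on_snoc h, last0, sum_eq_zero, sum_eq_zero]
      · simp
      · intro β _
        rw [hB.on_snoc h, upd0]
      · intro β _
        obtain ⟨α, hα⟩ := h
        by_cases hβ : α = β
        · subst hβ
          rw [hα, hA.on_last, upd0]
        · exact updK hB hα hβ _ _
  · subst h
    rw [hB.on_last, hA.on_last, last0, last0]
    simp only [hA.on_last, hB.on_last, sum_const_zero, sub_zero, add_zero]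

end Null

section Map

variable {R' : Type*} [CommRing R'] (h : R →+* R')

def map (A : Tens n R k) : Tens n R' k := fun I q => h (A I q)

lemma map_contractR (T : Tens n R 3) (A : Tens n R k) :
    map h (contractR T A) = contractR (map h T) (map h A) := by
  ext I q; simp [map, contractR]

lemma map_contractR₂ (T : Tens n R 3) (A : Tens n R k) (B : Tens n R l) :
    map h (contractR₂ T A B) = contractR₂ (map h T) (map h A) (map h B) := by
  ext I q; simp [map, contractR₂]

lemma map_insert (A : Tens n R k) (C : Tens n R (l + 1)) :
    map h (insert A C) = insert (map h A) (map h C) := by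
  ext I q; simp [map, insert]

lemma map_circ (A : Tens n R k) (B : Tens n R (l + 1)) :
    map h (circ A B) = circ (map h A) (map h B) := by
  ext I q; simp [map, circ]

lemma map_bullet (A : Tens n R (k + 1)) (B : Tens n R (l + 1)) :
    map h (bullet A B) = bullet (map h A) (map h B) := by
  ext I q; simp [map, bullet]

end Map

def actOut (N : Mat(n) R) : End R (Tens n R k) where
  toFun A I q := ∑ m, N q m * A I m
  map_add' A B := by ext I q; simp [mul_add, sum_add]
  map_smul' c A := by
    ext I q; simp only [Pi.smul_apply, smul_eq_mul, RingHom.id_apply, mul_sum]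
    exact sum_ext fun _ => by ring

def actSlot (α : Fin k) (N : Mat(n) R) : End R (Tens n R k) where
  toFun A I q := ∑ m, N m (I α) * A (update I α m) q
  map_add' A B := by ext I q; simp [mul_add, sum_add]
  map_smul' c A := by
    ext I q; simp only [Pi.smul_apply, smul_eq_mul, RingHom.id_apply, mul_sum]
    exact sum_ext fun _ => by ring

lemma actOut_mul (M N : Mat(n) R) (A : Tens n R k) : actOut (M * N) A = actOut M (actOut N A) := by
  ext I q
  simp [actOut, LinearMap.coe_mk, AddHom.coe_mk, mul_apply, sum_mul, mul_sum, mul_assoc]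
  exact sum_comm

lemma actSlot_mul (α : Fin k) (M N : Mat(n) R) (A : Tens n R k) :
    actSlot α (M * N) A = actSlot α N (actSlot α M A) := by
  ext I q
  simp [actSlot, LinearMap.coe_mk, AddHom.coe_mk, mul_apply, sum_mul, mul_sum, update_self, Function.update_idem]
  rw [sum_comm]
  exact sum_ext fun _ => sum_ext fun _ => by ring

lemma actSlot_actOut (α : Fin k) (M N : Mat(n) R) (A : Tens n R k) :
    actSlot α M (actOut N A) = actOut N (actSlot α M A) := by
  ext I q
  simp [actSlot, actOut, mul_sum]
  rw [sum_comm]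
  exact sum_ext fun _ => sum_ext fun _ => by ring

lemma actSlot_comm {α β : Fin k} (h : α ≠ β) (M N : Mat(n) R) (A : Tens n R k) :
    actSlot α M (actSlot β N A) = actSlot β N (actSlot α M A) := by
  ext I q
  simp [actSlot, mul_sum, update_of_ne h, update_of_ne h.symm]
  rw [sum_comm]
  refine sum_ext fun m => sum_ext fun p => ?_
  rw [Function.update_comm h]
  ring

lemma actOut_sub (M N : Mat(n) R) (A : Tens n R k) : actOut (M - N) A = actOut M A - actOut N A :=
    by
  ext I q
  simp [actOut, sub_mul, sum_sub_distrib]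

lemma actSlot_sub (α : Fin k) (M N : Mat(n) R) (A : Tens n R k) :
    actSlot α (M - N) A = actSlot α M A - actSlot α N A := by
  ext I q
  simp [actSlot, sub_mul, sum_sub_distrib]

def act : Mat(n) R →ₗ[R] End R (Tens n R k) where
  toFun N := actOut N - ∑ α, actSlot α N
  map_add' M N := by
    ext A I q
    simp [actOut, actSlot, add_mul, sum_add, Finset.sum_apply]
    ring
  map_smul' c N := by
    ext A I q
    simp [actOut, actSlot, Finset.sum_apply, mul_sum, mul_assoc, mul_sub]

lemma act_eq (N : Mat(n) R) (A : Tens n R k) : act N A = actOut N A - ∑ α, actSlot α N A := by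
  simp [act]

lemma act_apply (N : Mat(n) R) (A : Tens n R k) (I : Fin k → Fin n) (q : Fin n) :
    act N A I q = ∑ m, N q m * A I m - ∑ α, ∑ m, N m (I α) * A (update I α m) q := by
  simp [act_eq, actOut, actSlot, Finset.sum_apply]

lemma act_commutator (M N : Mat(n) R) (A : Tens n R k) :
    act (M * N - N * M) A = act M (act N A) - act N (act M A) := by
  have h : ∑ α : Fin k, ∑ β, (actSlot α M (actSlot β N A) - actSlot β N (actSlot α M A)) =
      ∑ α, (actSlot α (N * M) A - actSlot α (M * N) A) := by
    refine sum_ext fun α => ?_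
    rw [sum_eq_single α]
    · rw [actSlot_mul, actSlot_mul]
    · intro β _ hβ
      rw [actSlot_comm hβ.symm, sub_self]
    · simp
  have h2 : ∑ α : Fin k, ∑ β, actSlot β N (actSlot α M A) =
      ∑ α, ∑ β, actSlot α N (actSlot β M A) := sum_comm
  simp [h2] at h
  rw [act_eq (M * N - N * M), actOut_sub]
  simp [act_eq, map_sub, map_sum, actSlot_actOut, actSlot_sub, actOut_mul, sum_sub_distrib]
  have h3 : ∀ P Q : Mat(n) R, ∑ β : Fin k, ∑ α, actSlot α P (actSlot β Q A) =
      ∑ α, ∑ β, actSlot α P (actSlot β Q A) := fun P Q => sum_comm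
  rw [h3, h3]
  rw [← sub_eq_zero] at h ⊢
  rw [← neg_zero, ← h]
  abel

end Tens

namespace FCalc

variable (F)

def tens (k : ℕ) : FMod F (Tens n R k) where
  D i := AddMonoidHom.mk' (fun A I q => F.D i (A I q)) fun A B => by ext I q; simp
  D_smul i f A := by
    ext I q
    simp only [AddMonoidHom.mk'_apply, Pi.smul_apply, Derivation.leibniz, Pi.add_apply, smul_eq_mul]
    ring
  comm i j A := by
    ext I q
    simpa [Finset.sum_apply, c] using F.comm i j (A I q)
  r := Tens.act
  D_r i N A := by
    ext I q
    simp only [AddMonoidHom.mk'_apply, Tens.act_apply, map_sub, map_sum, Derivation.leibniz,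
      Pi.add_apply, smul_eq_mul, mDeriv_apply, sum_add]
    simp only [mul_comm (F.D i (N _ _))]
    ring
  r_lie M N _ A := Tens.act_commutator M N A

lemma tens_cov {k : ℕ} (i : Fin n) (A : Tens n R k) (I : Fin k → Fin n) (q : Fin n) :
    (F.tens k).cov i A I q =
    F.D i (A I q) + (∑ m, F.Γ i q m * A I m - ∑ α, ∑ m, F.Γ i m (I α) * A (update I α m) q) := by
  rw [← Tens.act_apply]; rfl

def nabla {k : ℕ} (A : Tens n R k) : Tens n R (k + 1) := fun i =>
  (F.tens k).cov (i 0) A (Fin.tail i)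

def curvT : Tens n R 3 := fun i l => F.curvM (i 0) (i 1) l (i 2)

end FCalc

namespace FCalc

variable {A : Tens n R k} {K : Fin n → R}

/-! ### Tensors invariant under Killing vector fields -/

def dualHom (d : Derivation ℤ R R) : R →+* DualNumber R where
  toFun f := TrivSqZeroExt.inl f + TrivSqZeroExt.inr (d f)
  map_one' := by simp
  map_zero' := by simp
  map_add' f g := by ext <;> simp
  map_mul' f g := by ext <;> simp; ring

lemma tens_lieD_apply (X : Fin n → R) (A : Tens n R k) (J : Fin k → Fin n) (q : Fin n) :
    (F.tens k).lieD X A J q = F.dirD X (A J q) +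
    (∑ m, F.lieMat X q m * A J m - ∑ α, ∑ m, F.lieMat X m (J α) * A (update J α m) q) := by
  rw [FMod.lieD_eq, ← Tens.act_apply, F.dirD_apply]
  simp
  rfl

lemma multilinear_eps {M N : Type*} [AddCommGroup M] [AddCommGroup N] [Module (DualNumber R) M]
    [Module (DualNumber R) N] (f : MultilinearMap (DualNumber R) (fun _ : Fin k => M) N)
    (x w : Fin k → M) : f (fun α => x α + (DualNumber.eps : DualNumber R) • w α) =
    f x + ∑ α, (DualNumber.eps : DualNumber R) • f (update x α (w α)) := by
  have h := f.map_add_eq_map_add_linearDeriv_add x fun α => (DualNumber.eps : DualNumber R) • w α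
  refine h.trans ?_
  rw [MultilinearMap.linearDeriv_apply, sum_eq_zero (s := {s : Finset (Fin k) | 2 ≤ s.card}),
    add_zero]
  · simp
  · intro s hs
    have h1 : s.piecewise (fun α => (DualNumber.eps : DualNumber R) • w α) x =
        s.piecewise (fun i => (DualNumber.eps : DualNumber R) • s.piecewise w x i)
          (s.piecewise w x) := by
      funext i
      by_cases hi : i ∈ s <;> simp [hi]
    rw [h1, f.map_piecewise_smul (fun _ => (DualNumber.eps : DualNumber R))]
    have h2 : ∏ _i ∈ s, (DualNumber.eps : DualNumber R) = 0 := by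
      rw [Finset.prod_const]
      obtain ⟨c, hc⟩ := Nat.exists_eq_add_of_le (Finset.mem_filter.mp hs).2
      rw [hc, pow_add, pow_two, DualNumber.eps_mul_eps, zero_mul]
    rw [h2, zero_smul]

def infMat (N : Mat(n) R) : Mat(n) (DualNumber R) :=
  fun i j => (if i = j then 1 else 0) + TrivSqZeroExt.inr (N i j)

lemma lieD_zero (X : Fin n → R) (A : Tens n R k) : (F.tens k).lieD X A = 0 ↔ Tens.Equivar (infMat
    (F.lieMat X)) (Tens.map (TrivSqZeroExt.inlHom R R) A) (Tens.map (dualHom (F.dirD X)) A) := by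
  rw [Tens.equivariant_iff]
  have key : ∀ (J : Fin k → Fin n) (q : Fin n),
      (∑ I : Fin k → Fin n, (∏ α, infMat (F.lieMat X) (I α) (J α)) *
        Tens.map (TrivSqZeroExt.inlHom R R) A I q =
      ∑ r, infMat (F.lieMat X) q r * Tens.map (dualHom (F.dirD X)) A J r) ↔
      (F.tens k).lieD X A J q = 0 := fun J q => by
    have h1 : ∀ α, (fun i => infMat (F.lieMat X) i (J α)) =
        Pi.single (J α) 1 + (DualNumber.eps : DualNumber R) •
          fun i => (TrivSqZeroExt.inl (F.lieMat X i (J α)) : DualNumber R) := fun α => by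
      ext i <;> simp [infMat, Pi.single_apply]
    have h2 := multilinear_eps (Tens.map (TrivSqZeroExt.inlHom R R) A).ev
      (fun α => Pi.single (J α) 1)
      (fun α i => (TrivSqZeroExt.inl (F.lieMat X i (J α)) : DualNumber R))
    have h3 := congrFun h2 q
    simp only [Tens.ev_single, Tens.ev_update_single] at h3
    have h4 := Tens.ev_apply (Tens.map (TrivSqZeroExt.inlHom R R) A)
      (fun α i => infMat (F.lieMat X) i (J α)) q
    rw [show (fun α i => infMat (F.lieMat X) i (J α)) = _ from funext h1] at h4
    rw [← h4, show (Tens.ev (Tens.map (TrivSqZeroExt.inlHom R R) A)) (fun α =>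
      (Pi.single (J α) 1 + (DualNumber.eps : DualNumber R) •
          fun i => (TrivSqZeroExt.inl (F.lieMat X i (J α)) : DualNumber R))) q = _ from h3,
      tens_lieD_apply]
    have h5 : ∑ r, infMat (F.lieMat X) q r * Tens.map (dualHom (F.dirD X)) A J r =
        TrivSqZeroExt.inl (A J q) + TrivSqZeroExt.inr (F.dirD X (A J q) +
          ∑ r, F.lieMat X q r * A J r) := by
      have : ∀ r, infMat (F.lieMat X) q r * Tens.map (dualHom (F.dirD X)) A J r =
          (if q = r then Tens.map (dualHom (F.dirD X)) A J r else 0) +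
            (TrivSqZeroExt.inr (F.lieMat X q r * A J r) : DualNumber R) := fun r => by
        unfold infMat
        rw [add_mul, ite_mul, one_mul, zero_mul]
        ext <;> simp [Tens.map, dualHom]
      rw [sum_ext fun r => this r, sum_add, sum_ite_eq]
      ext <;> simp [Tens.map, dualHom, TrivSqZeroExt.fst_sum, TrivSqZeroExt.snd_sum]
    have h6 : (Tens.map (TrivSqZeroExt.inlHom R R) A J + ∑ α, (DualNumber.eps : DualNumber R) •
        ∑ m, (TrivSqZeroExt.inl (F.lieMat X m (J α)) : DualNumber R) •
          Tens.map (TrivSqZeroExt.inlHom R R) A (update J α m)) q =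
        TrivSqZeroExt.inl (A J q) + TrivSqZeroExt.inr
          (∑ α, ∑ m, F.lieMat X m (J α) * A (update J α m) q) := by
      ext <;> simp [Tens.map, Finset.sum_apply, TrivSqZeroExt.fst_sum, TrivSqZeroExt.snd_sum]
    rw [h5, h6]
    constructor
    · intro h
      have := congrArg TrivSqZeroExt.snd h
      simp at this
      linear_combination -this
    · intro h
      congr 2
      linear_combination -h
  constructor
  · intro h J q
    rw [key, h]; rfl
  · intro h
    ext J q
    exact (key J q).mp (h J q)

/-- The tensor is invariant under all Killing vector fields and vanishes on all parallel vector
fields. -/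
structure GoodVec (F : FCalc n R) (A : Tens n R k) : Prop where
  lie (X : Fin n → R) (hX : F.IsKilling X) : (F.tens k).lieD X A = 0
  null (K : Fin n → R) (hK : ∀ i, F.vec.cov i K = 0) : Tens.Null K A

lemma nablaV_eq_zero (hK : ∀ i, F.vec.cov i K = 0) : F.nablaV K = 0 := by
  ext q p
  exact congrFun (hK p) q

lemma isKilling_of_parallel (hK : ∀ i, F.vec.cov i K = 0) : F.IsKilling K := by
  unfold IsKilling
  rw [nablaV_eq_zero hK]
  exact IsSkew.zero

lemma goodVec_curvT : GoodVec F F.curvT where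
  lie X hX := by
    ext J q
    rw [tens_lieD_apply]
    have h := congrFun (congrFun (hX.lie_curvM (J 0) (J 1)) q) (J 2)
    simp [Matrix.add_apply, Matrix.sub_apply, mDeriv_apply, mul_apply, Matrix.sum_apply, Matrix.smul_apply, smul_eq_mul] at h
    have e0 : ∀ m, F.curvT (update J 0 m) q = F.curvM m (J 1) q (J 2) := fun m => rfl
    have e1 : ∀ m, F.curvT (update J 1 m) q = F.curvM (J 0) m q (J 2) := fun m => rfl
    have e2 : ∀ m, F.curvT (update J 2 m) q = F.curvM (J 0) (J 1) q m := fun m => rfl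
    have e3 : ∀ m, F.curvT J m = F.curvM (J 0) (J 1) m (J 2) := fun m => rfl
    simp only [Fin.sum_univ_three, e0, e1, e2, e3]
    have e4 : ∑ m, F.lieMat X m (J 2) * F.curvM (J 0) (J 1) q m =
      ∑ m, F.curvM (J 0) (J 1) q m * F.lieMat X m (J 2) := sum_ext fun _ => mul_comm _ _
    rw [e4, Pi.zero_apply, Pi.zero_apply]
    linear_combination h
  null K hK := by
    have h0 := fun j => (isKilling_of_parallel hK).kostant j
    simp [nablaV_eq_zero hK] at h0
    have h1 : ∀ j p q, ∑ i, K i * F.curvM i j p q = 0 := fun j p q => by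
      have := congrFun (congrFun (h0 j) p) q
      simp only [mDeriv_apply, Matrix.zero_apply, map_zero, Matrix.neg_apply, Matrix.sum_apply,
        Matrix.smul_apply, smul_eq_mul] at this
      exact neg_eq_zero.mp this.symm
    have h2 : ∀ i j q, ∑ m, K m * F.curvM i j q m = 0 := fun i j q => by
      have h := congrFun (F.vec.cov_comm i j K) q
      simp [hK] at h
      simp [vec_r, Matrix.mulVec, dotProduct, vec_cov] at h
      rw [h]
      exact sum_ext fun _ => mul_comm _ _
    rw [Tens.null_iff]
    intro J α q
    fin_cases α
    · exact h1 (J 1) q (J 2)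
    · have : ∀ m, K m * F.curvM (J 0) m q (J 2) = -(K m * F.curvM m (J 0) q (J 2)) := fun m => by
        rw [F.curvM_swap (J 0) m, Matrix.neg_apply, mul_neg]
      change ∑ m, K m * F.curvM (J 0) m q (J 2) = 0
      rw [sum_ext fun m => this m, sum_neg_distrib, h1, neg_zero]
    · exact h2 (J 0) (J 1) q

lemma tens_lieD_nabla {X : Fin n → R} (hX : F.IsKilling X) (hA : (F.tens k).lieD X A = 0) :
    (F.tens (k + 1)).lieD X (F.nabla A) = 0 := by
  ext J q
  rw [tens_lieD_apply, Fin.sum_univ_succ]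
  have h := congrFun (congrFun ((F.tens k).lieD_cov hX (J 0) A) (Fin.tail J)) q
  rw [hA] at h
  rw [tens_lieD_apply, show (F.tens k).cov (J 0) 0 = 0 by simp [FMod.cov]] at h
  have e0 : ∀ m, F.nabla A (update J 0 m) q = (F.tens k).cov m A (Fin.tail J) q := fun m => by
    unfold nabla
    rw [update_self, Fin.tail_update_zero]
  have e1 : ∀ (α : Fin k) m, F.nabla A (update J α.succ m) q =
      (F.tens k).cov (J 0) A (update (Fin.tail J) α m) q := fun α m => by
    unfold nabla
    rw [update_of_ne (Fin.succ_ne_zero α).symm, Fin.tail_update_succ]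
  have e2 : ∀ m, F.nabla A J m = (F.tens k).cov (J 0) A (Fin.tail J) m := fun m => rfl
  have e3 : ∀ α : Fin k, J α.succ = Fin.tail J α := fun α => rfl
  simp [e0, e1, e2, e3]
  simp at h ⊢
  linear_combination h

lemma null_nabla (hK : ∀ i, F.vec.cov i K = 0) (hA : Tens.Null K A) (hL : (F.tens k).lieD K A = 0) :
    Tens.Null K (F.nabla A) := by
  rw [Tens.null_iff] at hA ⊢
  intro J α q
  refine Fin.cases ?_ (fun γ => ?_) α
  · simp [nabla]
    have h := congrFun (congrFun hL (Fin.tail J)) q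
    simpa [FMod.lieD, nablaV_eq_zero hK, Finset.sum_apply] using h
  · have e1 : ∀ m, F.nabla A (update J γ.succ m) q =
        (F.tens k).cov (J 0) A (update (Fin.tail J) γ m) q := fun m => by
      unfold nabla
      rw [update_of_ne (Fin.succ_ne_zero γ).symm, Fin.tail_update_succ]
    simp [e1]
    generalize Fin.tail J = I
    generalize J 0 = j
    simp [tens_cov, mul_add, mul_sub, sum_add]
    have h1 := congrArg (F.D j) (hA I γ q)
    simp [sum_add] at h1
    have h2 : ∑ m, K m * ∑ p, F.Γ j q p * A (update I γ m) p = 0 := by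
      have : ∑ m, K m * ∑ p, F.Γ j q p * A (update I γ m) p =
          ∑ p, F.Γ j q p * ∑ m, K m * A (update I γ m) p := by
        simp [mul_sum]
        rw [sum_comm]
        exact sum_ext fun _ => sum_ext fun _ => by ring
      rw [this]
      simp [hA]
    have h3 : ∑ m, K m * ∑ α, ∑ p, F.Γ j p (update I γ m α) * A (update (update I γ m) α p) q =
        ∑ p, (∑ m, F.Γ j p m * K m) * A (update I γ p) q := by
      simp [mul_sum]
      rw [sum_comm, sum_eq_single γ]
      · simp [sum_mul]
        rw [sum_comm]
        exact sum_ext fun _ => sum_ext fun _ => by ring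
      · intro α _ hα
        rw [sum_comm]
        refine sum_eq_zero fun p _ => ?_
        rw [← mul_zero (F.Γ j p (I α)), ← hA (update I α p) γ q, mul_sum]
        refine sum_ext fun m => ?_
        rw [update_of_ne hα, Function.update_comm hα]
        ring
      · simp
    have h4 : ∑ p, (F.D j (K p) + ∑ m, F.Γ j p m * K m) * A (update I γ p) q = 0 := by
      refine sum_eq_zero fun p _ => ?_
      rw [← vec_cov, hK, Pi.zero_apply, zero_mul]
    simp [add_mul, sum_add] at h4
    simp [mul_comm (A _ _) (F.D j (K _))] at h1
    rw [h2, h3]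
    linear_combination h1 - h4

lemma GoodVec.nabla (hA : GoodVec F A) : GoodVec F (F.nabla A) where
  lie X hX := tens_lieD_nabla hX (hA.lie X hX)
  null K hK := null_nabla hK (hA.null K hK) (hA.lie K (isKilling_of_parallel hK))

lemma GoodVec.contractR (hA : GoodVec F A) : GoodVec F (Tens.contractR F.curvT A) where
  lie X hX := by
    rw [lieD_zero, Tens.map_contractR, Tens.map_contractR]
    exact ((lieD_zero _ _).mp (goodVec_curvT.lie X hX)).contractR
      ((lieD_zero _ _).mp (hA.lie X hX))
  null K hK := (goodVec_curvT.null K hK).contractR (hA.null K hK)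

lemma GoodVec.contractR₂ (hA : GoodVec F A) {B : Tens n R l} (hB : GoodVec F B) :
    GoodVec F (Tens.contractR₂ F.curvT A B) where
  lie X hX := by
    rw [lieD_zero, Tens.map_contractR₂, Tens.map_contractR₂]
    exact ((lieD_zero _ _).mp (goodVec_curvT.lie X hX)).contractR₂
      ((lieD_zero _ _).mp (hA.lie X hX)) ((lieD_zero _ _).mp (hB.lie X hX))
  null K hK := (goodVec_curvT.null K hK).contractR₂ (hA.null K hK) (hB.null K hK)

lemma GoodVec.insert (hA : GoodVec F A) {C : Tens n R (l + 1)} (hC : GoodVec F C) :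
    GoodVec F (Tens.insert A C) where
  lie X hX := by
    rw [lieD_zero, Tens.map_insert, Tens.map_insert]
    exact ((lieD_zero _ _).mp (hA.lie X hX)).insert ((lieD_zero _ _).mp (hC.lie X hX))
  null K hK := (hA.null K hK).insert (hC.null K hK)

lemma GoodVec.circ (hA : GoodVec F A) {B : Tens n R (l + 1)} (hB : GoodVec F B) :
    GoodVec F (Tens.circ A B) where
  lie X hX := by
    rw [lieD_zero, Tens.map_circ, Tens.map_circ]
    exact ((lieD_zero _ _).mp (hA.lie X hX)).circ ((lieD_zero _ _).mp (hB.lie X hX))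
  null K hK := (hA.null K hK).circ (hB.null K hK)

lemma GoodVec.bullet {A : Tens n R (k + 1)}
    (hA : GoodVec F A) {B : Tens n R (l + 1)} (hB : GoodVec F B) : GoodVec F (Tens.bullet A B) where
  lie X hX := by
    rw [lieD_zero, Tens.map_bullet, Tens.map_bullet]
    exact ((lieD_zero _ _).mp (hA.lie X hX)).bullet ((lieD_zero _ _).mp (hB.lie X hX))
  null K hK := (hA.null K hK).bullet (hB.null K hK)

end FCalc

namespace Tens

def endM (A : Tens n R (k + 1)) (I : Fin k → Fin n) : Mat(n) R := fun q p => A (snoc I p) q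

lemma tail_snoc' {X : Type*} (i : Fin (k + 1) → X) (p : X) :
    Fin.tail (snoc i p : Fin (k + 2) → X) = snoc (Fin.tail i) p := by
  funext α
  refine Fin.lastCases ?_ (fun β => ?_) α
  · rw [snoc_last]; unfold Fin.tail; rw [Fin.succ_last, snoc_last]
  · rw [snoc_castSucc]; unfold Fin.tail; rw [Fin.succ_castSucc, snoc_castSucc]

lemma snoc_zero' {X : Type*} (i : Fin (k + 1) → X) (p : X) : (snoc i p : Fin (k + 2) → X) 0 = i 0 :=
    by
  rw [← Fin.castSucc_zero, snoc_castSucc]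

lemma endM_nabla (F : FCalc n R) (A : Tens n R (k + 1)) (i : Fin (k + 1) → Fin n) :
    endM (F.nabla A) i = mDeriv (F.D (i 0)) (endM A (Fin.tail i)) +
    (F.Γ (i 0) * endM A (Fin.tail i) - endM A (Fin.tail i) * F.Γ (i 0))
    - ∑ α, ∑ m, F.Γ (i 0) m (Fin.tail i α) • endM A (update (Fin.tail i) α m) := by
  ext q p
  simp [endM, FCalc.nabla, tail_snoc', snoc_zero', F.tens_cov, Fin.sum_univ_castSucc, snoc_castSucc, snoc_last, Matrix.add_apply, Matrix.sub_apply, mDeriv_apply, mul_apply, Matrix.sum_apply, Matrix.smul_apply, smul_eq_mul, ← Fin.snoc_update, Fin.update_snoc_last]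
  simp [mul_comm (F.Γ (i 0) _ p)]
  ring

lemma endM_contractR (F : FCalc n R) (A : Tens n R k) (i : Fin (k + 1) → Fin n) :
    endM (contractR F.curvT A) i = ∑ r, A (Fin.init i) r • F.curvM (i (Fin.last k)) r := by
  ext q p
  simp [endM, contractR, Matrix.sum_apply]
  have e1 : fstIdx (k := k) (l := 2) (snoc i p : Fin (k + 2) → Fin n) = Fin.init i := by
    funext α
    have : (castAdd 2 α : Fin (k + 2)) = (α.castSucc).castSucc := rfl
    unfold fstIdx
    rw [this, snoc_castSucc]
    rfl
  have e2 : sndIdx (k := k) (l := 2) (snoc i p : Fin (k + 2) → Fin n) 0 = i (Fin.last k) := by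
    have : (natAdd k (0 : Fin 2) : Fin (k + 2)) = (Fin.last k).castSucc := rfl
    unfold sndIdx
    rw [this, snoc_castSucc]
  have e3 : sndIdx (k := k) (l := 2) (snoc i p : Fin (k + 2) → Fin n) 1 = p := by
    have : (natAdd k (1 : Fin 2) : Fin (k + 2)) = Fin.last (k + 1) := rfl
    unfold sndIdx
    rw [this, snoc_last]
  rw [e1, e2, e3]
  rfl

lemma endM_contractR₂ (F : FCalc n R) (A : Tens n R k) (B : Tens n R l) (i : Fin (k + l) → Fin n) :
    endM (contractR₂ F.curvT A B) i = ∑ m, ∑ r, (A (fstIdx i) m * B (sndIdx i) r) • F.curvM m r :=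
    by
  ext q p
  simp [endM, contractR₂, Matrix.sum_apply]
  rfl

lemma fstIdx_snoc (i : Fin (k + l) → Fin n) (p : Fin n) : fstIdx (k := k) (l := l + 1) (snoc i p :
    Fin (k + l + 1) → Fin n) = fstIdx i := by
  funext α
  have : (castAdd (l + 1) α : Fin (k + (l + 1))) = (castAdd l α).castSucc := rfl
  unfold fstIdx
  rw [this]
  exact snoc_castSucc (α := fun _ => Fin n) p i _

lemma sndIdx_snoc (i : Fin (k + l) → Fin n) (p : Fin n) : sndIdx (k := k) (l := l + 1) (snoc i p :
    Fin (k + l + 1) → Fin n) = snoc (sndIdx i) p := by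
  funext β
  refine Fin.lastCases ?_ (fun β => ?_) β
  · rw [snoc_last]
    exact snoc_last (α := fun _ => Fin n) p i
  · rw [snoc_castSucc]
    exact snoc_castSucc (α := fun _ => Fin n) p i (natAdd k β)

lemma endM_insert (A : Tens n R k) (C : Tens n R (l + 2)) (i : Fin (k + l) → Fin n) : endM (insert
    (l := l + 1) A C) i = ∑ m, A (fstIdx i) m • endM (k := l + 1) C (Fin.cons m (sndIdx i)) := by
  ext q p
  simp [endM, insert, Matrix.sum_apply]
  rw [fstIdx_snoc, sndIdx_snoc]
  simp [Fin.cons_snoc_eq_snoc_cons]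

lemma endM_bullet (A : Tens n R (k + 1)) (B : Tens n R (l + 1)) (i : Fin (k + l) → Fin n) :
    endM (bullet A B) i = endM A (fstIdx i) * endM B (sndIdx i) - endM B (sndIdx i) * endM
    A (fstIdx i) - ∑ β, ∑ m, A (snoc (fstIdx i) (sndIdx i β)) m • endM B (update (sndIdx i) β m) +
    ∑ α, ∑ m, B (snoc (sndIdx i) (fstIdx i α)) m • endM A (update (fstIdx i) α m) := by
  ext q p
  simp [endM, bullet, Matrix.add_apply, Matrix.sub_apply, mul_apply, Matrix.sum_apply, Matrix.smul_apply, smul_eq_mul, Fin.init_snoc, snoc_last, sum_sub_distrib]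
  simp [mul_comm (A (snoc (fstIdx i) _) q), mul_comm (B (snoc (sndIdx i) _) q)]

end Tens

namespace FCalc

/-- The values of the tensor are skew endomorphisms which annihilate the parallel sections of `E`;
moreover, the tensor is invariant under Killing vector fields and vanishes on parallel vector
fields. -/
structure GoodEnd (E : FMod F V) (A : Tens n R (k + 1)) : Prop extends GoodVec F A where
  skew (I : Fin k → Fin n) : F.IsSkew (A.endM I)
  ann (I : Fin k → Fin n) (ξ : V) (hξ : ∀ i, E.cov i ξ = 0) : E.r (A.endM I) ξ = 0

variable {E : FMod F V}

variable {A : Tens n R k}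

lemma r_curvM_eq_zero {ξ : V} (hξ : ∀ i, E.cov i ξ = 0) (i j : Fin n) : E.r (F.curvM i j) ξ = 0 :=
    by
  have h := E.cov_comm i j ξ
  simpa [hξ, show ∀ i, E.cov i 0 = 0 by simp [FMod.cov]] using h.symm

lemma endM_curvT (I : Fin 2 → Fin n) : F.curvT.endM I = F.curvM (I 0) (I 1) := rfl

lemma goodEnd_curvT : GoodEnd E F.curvT where
  toGoodVec := goodVec_curvT
  skew _ := F.isSkew_curvM _ _
  ann _ _ hξ := r_curvM_eq_zero hξ _ _

lemma GoodEnd.nabla {A : Tens n R (k + 1)} (hA : GoodEnd E A) : GoodEnd E (F.nabla A) where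
  toGoodVec := hA.toGoodVec.nabla
  skew i := by
    rw [Tens.endM_nabla]
    exact (((hA.skew _).deriv _).add ((isSkew_Γ _).commutator (hA.skew _))).sub
      (IsSkew.sum _ fun α _ => IsSkew.sum _ fun m _ => (hA.skew _).smul _)
  ann i ξ hξ := by
    rw [Tens.endM_nabla]
    have h := E.cov_r (i 0) (A.endM (Fin.tail i)) ξ
    rw [hA.ann _ _ hξ, hξ, show E.cov (i 0) 0 = 0 by simp [FMod.cov], map_zero, add_zero] at h
    simp [LinearMap.sum_apply, hA.ann _ _ hξ] at h ⊢
    exact h.symm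

lemma GoodEnd.contractR (hA : GoodVec F A) : GoodEnd E (Tens.contractR F.curvT A) where
  toGoodVec := hA.contractR
  skew i := by
    rw [Tens.endM_contractR]
    exact IsSkew.sum _ fun m _ => (F.isSkew_curvM _ _).smul _
  ann i ξ hξ := by
    rw [Tens.endM_contractR]
    simp [r_curvM_eq_zero hξ]

lemma GoodEnd.contractR₂ (hA : GoodVec F A) {B : Tens n R l} (hB : GoodVec F B) :
    GoodEnd E (Tens.contractR₂ F.curvT A B) where
  toGoodVec := hA.contractR₂ hB
  skew i := by
    rw [Tens.endM_contractR₂]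
    exact IsSkew.sum _ fun m _ => IsSkew.sum _ fun r _ => (F.isSkew_curvM _ _).smul _
  ann i ξ hξ := by
    rw [Tens.endM_contractR₂]
    simp [r_curvM_eq_zero hξ]

lemma GoodEnd.insert (hA : GoodVec F A) {C : Tens n R (l + 2)} (hC : GoodEnd (k := l + 1) E C) :
    GoodEnd (k := k + l) E (Tens.insert (l := l + 1) A C) where
  toGoodVec := hA.insert hC.toGoodVec
  skew i := by
    rw [Tens.endM_insert]
    exact IsSkew.sum _ fun m _ => (hC.skew _).smul _
  ann i ξ hξ := by
    rw [Tens.endM_insert]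
    simp [hC.ann _ _ hξ]

lemma GoodEnd.bullet {A : Tens n R (k + 1)}
    (hA : GoodEnd E A) {B : Tens n R (l + 1)} (hB : GoodEnd E B) : GoodEnd E (Tens.bullet A B) where
  toGoodVec := hA.toGoodVec.bullet hB.toGoodVec
  skew i := by
    rw [Tens.endM_bullet]
    exact (((hA.skew _).commutator (hB.skew _)).sub
      (IsSkew.sum _ fun α _ => IsSkew.sum _ fun m _ => (hB.skew _).smul _)).add
      (IsSkew.sum _ fun α _ => IsSkew.sum _ fun m _ => (hA.skew _).smul _)
  ann i ξ hξ := by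
    rw [Tens.endM_bullet, map_add, map_sub, LinearMap.add_apply, LinearMap.sub_apply,
      E.r_lie _ _ (hA.skew _)]
    simp [hA.ann _ _ hξ, hB.ann _ _ hξ]

end FCalc

/-! ### Algebraic super calculus -/

/-- A module `S` of spinors and an algebra `O` of functions over a frame calculus. -/
structure SFrame {n : ℕ} {R : Type*} [CommRing R]
    (F : FCalc n R) (S O : Type*) [AddCommGroup S] [Module R S] [Ring O] [Algebra R O] where
  E : FMod F S
  Λ : FMod F O
  γ : Fin n → S →ₗ[R] S
  C : S →ₗ[R] S →ₗ[R] R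
  ι : S →ₗ[R] O
  int : S →ₗ[R] O →ₗ[R] O
  π : O →ₐ[R] O
  D_γ (i j : Fin n) (s : S) : E.D i (γ j s) = γ j (E.D i s)
  r_γ (N : Mat(n) R) (hN : F.IsSkew N) (j : Fin n) (s : S) :
    E.r N (γ j s) = γ j (E.r N s) - ∑ p, N j p • γ p s
  D_C (i : Fin n) (s t : S) : F.D i (C s t) = C (E.D i s) t + C s (E.D i t)
  C_r (N : Mat(n) R) (s t : S) : C (E.r N s) t + C s (E.r N t) = 0
  C_γ (i : Fin n) (s t : S) : C s (γ i t) = C t (γ i s)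
  ι_mul (s : S) (a : O) : ι s * a = π a * ι s
  π_ι (s : S) : π (ι s) = -ι s
  D_mul (i : Fin n) (a b : O) : Λ.D i (a * b) = Λ.D i a * b + a * Λ.D i b
  r_mul (N : Mat(n) R) (a b : O) : Λ.r N (a * b) = Λ.r N a * b + a * Λ.r N b
  D_ι (i : Fin n) (s : S) : Λ.D i (ι s) = ι (E.D i s)
  r_ι (N : Mat(n) R) (s : S) : Λ.r N (ι s) = ι (E.r N s)
  D_π (i : Fin n) (a : O) : Λ.D i (π a) = π (Λ.D i a)
  r_π (N : Mat(n) R) (a : O) : Λ.r N (π a) = π (Λ.r N a)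
  int_ι (s t : S) : int s (ι t) = algebraMap R O (C s t)
  int_mul (s : S) (a b : O) : int s (a * b) = int s a * b + π a * int s b
  int_int (s t : S) (a : O) : int s (int t a) + int t (int s a) = 0
  int_π (s : S) (a : O) : int s (π a) = -π (int s a)
  D_int (i : Fin n) (s : S) (a : O) : Λ.D i (int s a) = int (E.D i s) a + int s (Λ.D i a)
  r_int (N : Mat(n) R) (s : S) (a : O) : Λ.r N (int s a) = int (E.r N s) a + int s (Λ.r N a)

variable {S O : Type*} [AddCommGroup S] [Module R S] [Ring O] [Algebra R O]

namespace SFrame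

variable (Q : SFrame F S O)

def W (k : ℕ) : MultilinearMap R (fun _ : Fin k => S) O :=
  (MultilinearMap.mkPiAlgebraFin R k O).compLinearMap fun _ => Q.ι

lemma W_apply (z : Fin k → S) : Q.W k z = (List.ofFn fun α => Q.ι (z α)).prod := by
  simp [W, MultilinearMap.mkPiAlgebraFin_apply]

lemma W_cons (x : S) (z : Fin k → S) : Q.W (k + 1) (Fin.cons x z) = Q.ι x * Q.W k z := by
  simp [W_apply, List.ofFn_succ]

lemma W_append (z : Fin k → S) (w : Fin l → S) : Q.W (k + l) (append z w) = Q.W k z * Q.W l w := by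
  rw [W_apply, W_apply, W_apply, ← List.prod_append, ← List.ofFn_fin_append]
  congr 2
  funext α
  refine Fin.addCases (fun α => ?_) (fun β => ?_) α <;> simp

lemma W_snoc (z : Fin k → S) (x : S) : Q.W (k + 1) (snoc z x) = Q.W k z * Q.ι x := by
  rw [W_apply, W_apply, List.ofFn_succ']
  simp

lemma π_W (z : Fin k → S) : Q.π (Q.W k z) = (-1 : R) ^ k • Q.W k z := by
  induction k with
  | zero => simp [W_apply]
  | succ k ih =>
    rw [← Fin.cons_self_tail z, W_cons, map_mul, ih, Q.π_ι, pow_succ, mul_smul_comm, neg_mul,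
      mul_neg_one, smul_neg, neg_smul]

lemma W_mul (z : Fin k → S) {a : O} (ha : Q.π a = (-1 : R) ^ l • a) :
    Q.W k z * a = (-1 : R) ^ (k * l) • (a * Q.W k z) := by
  induction k with
  | zero => simp [W_apply]
  | succ k ih =>
    rw [← Fin.cons_self_tail z, W_cons, mul_assoc, ih, mul_smul_comm, ← mul_assoc, Q.ι_mul, ha,
      add_mul, one_mul, pow_add, mul_smul, smul_mul_assoc, smul_mul_assoc, mul_assoc]

def IsDer (P : O →+ O) : Prop := (∀ a b, P (a * b) = P a * b + a * P b) ∧ ∀ a, P (Q.π a) = Q.π (P a)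

variable {Q}

lemma IsDer.map_one {P : O →+ O} (hP : Q.IsDer P) : P 1 = 0 := by
  have := hP.1 1 1
  simpa using this

lemma IsDer.W {P : O →+ O} (hP : Q.IsDer P) {z z' : Fin k → S}
    (h : ∀ α, P (Q.ι (z α)) = Q.ι (z' α)) : P (Q.W k z) = ∑ α, Q.W k (update z α (z' α)) := by
  induction k with
  | zero => simp [W_apply, hP.map_one]
  | succ k ih =>
    have h2 : ∀ α : Fin k, update z α.succ (z' α.succ) =
        Fin.cons (z 0) (update (Fin.tail z) α (Fin.tail z' α)) := fun α => by
      rw [← Fin.cons_self_tail z, ← Fin.cons_update]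
      rfl
    have h3 : update z 0 (z' 0) = Fin.cons (z' 0) (Fin.tail z) := by
      conv_lhs => rw [← Fin.cons_self_tail z]
      rw [Fin.update_cons_zero]
    rw [Fin.sum_univ_succ, h3]
    simp only [h2, W_cons]
    conv_lhs => rw [← Fin.cons_self_tail z]
    rw [W_cons, hP.1, h 0, ih (z := Fin.tail z) (z' := Fin.tail z') fun α => h α.succ, mul_sum]

variable (Q)

def u (ξ : Fin k → S) (I : Fin k → Fin n) : O := Q.W k fun α => Q.γ (I α) (ξ α)

lemma u_append (ξ : Fin k → S) (η : Fin l → S) (I : Fin k → Fin n) (J : Fin l → Fin n) :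
    Q.u (append ξ η) (append I J) = Q.u ξ I * Q.u η J := by
  unfold u
  rw [← W_append]
  congr 1
  funext α
  refine Fin.addCases (fun α => ?_) (fun β => ?_) α <;> simp

lemma u_cons (φ : S) (ξ : Fin k → S) (p : Fin n) (I : Fin k → Fin n) :
    Q.u (Fin.cons φ ξ : Fin (k + 1) → S) (Fin.cons p I) = Q.ι (Q.γ p φ) * Q.u ξ I := by
  unfold u
  rw [← W_cons]
  congr 1
  funext α
  refine Fin.cases ?_ (fun β => ?_) α <;> simp

lemma u_snoc (φ : S) (ξ : Fin k → S) (p : Fin n) (I : Fin k → Fin n) :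
    Q.u (snoc ξ φ : Fin (k + 1) → S) (snoc I p) = Q.u ξ I * Q.ι (Q.γ p φ) := by
  unfold u
  rw [← W_snoc]
  congr 1
  funext α
  refine Fin.lastCases ?_ (fun β => ?_) α <;> simp

lemma u_mul_ι (φ : S) (ξ : Fin k → S) (I : Fin k → Fin n) :
    Q.u ξ I * Q.ι φ = (-1 : R) ^ k • (Q.ι φ * Q.u ξ I) := by
  have := Q.W_mul (l := 1) (a := Q.ι φ) (fun α => Q.γ (I α) (ξ α)) (by simp [Q.π_ι])
  simpa [u] using this

variable {Q}

lemma IsDer.sum_u {P : O →+ O} (hP : Q.IsDer P) {M : Mat(n) R} {ξ ξ' : Fin k → S}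
    (h : ∀ α i, P (Q.ι (Q.γ i (ξ α))) = Q.ι (Q.γ i (ξ' α) - ∑ p, M i p • Q.γ p (ξ α)))
    {V : Type*} [AddCommGroup V] [Module R V] (L : V →ₗ[R] O) (A : (Fin k → Fin n) → V) :
    ∑ I, P (Q.u ξ I) * L (A I) = ∑ α, ∑ I, Q.u (update ξ α (ξ' α))
    I * L (A I) - ∑ I, Q.u ξ I * L (∑ α, ∑ m, M m (I α) • A (update I α m)) := by
  have h1 : ∀ I, P (Q.u ξ I) = ∑ α, (Q.u (update ξ α (ξ' α)) I -
      Q.W k (update (fun γ => Q.γ (I γ) (ξ γ)) α (∑ p, M (I α) p • Q.γ p (ξ α)))) := fun I => by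
    unfold u
    rw [hP.W fun α => h α (I α)]
    refine sum_ext fun α => ?_
    rw [MultilinearMap.map_update_sub]
    congr 2
    funext β
    by_cases hβ : β = α
    · subst hβ; simp
    · simp [hβ]
  simp only [h1, sum_mul, sub_mul, sum_sub_distrib]
  rw [sum_comm]
  congr 1
  simp only [map_sum L, mul_sum]
  rw [sum_comm, sum_comm (s := univ (α := Fin k → Fin n))]
  refine sum_ext fun α => ?_
  have := sum_slot (Q.W k) ((LinearMap.mul R O).compl₂ L) (fun γ i => Q.γ i (ξ γ))
    (fun i m => M m i) α A
  simp only [LinearMap.compl₂_apply, LinearMap.mul_apply'] at this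
  rw [← this]
  refine sum_ext fun I => ?_
  rw [map_sum, mul_sum]
  rfl

lemma u_update_zero (ξ : Fin k → S) (α : Fin k) (I : Fin k → Fin n) : Q.u (update ξ α 0) I = 0 := by
  unfold u
  exact (Q.W k).map_coord_zero α (by simp)

lemma IsDer.sum_u_parallel {P : O →+ O} (hP : Q.IsDer P) {M : Mat(n) R}
    {ξ : Fin k → S} (h : ∀ α i, P (Q.ι (Q.γ i (ξ α))) = -Q.ι (∑ p, M i p • Q.γ p (ξ α)))
    {V : Type*} [AddCommGroup V] [Module R V] (L : V →ₗ[R] O) (A : (Fin k → Fin n) → V) :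
    ∑ I, P (Q.u ξ I) * L (A I) = - ∑ I, Q.u ξ I * L (∑ α, ∑ m, M m (I α) • A (update I α m)) := by
  rw [hP.sum_u (M := M) (ξ' := fun _ => 0) fun α i => by rw [h, map_zero, zero_sub, map_neg]]
  simp [u_update_zero]

lemma sum_bracket {ι₁ ι₂ : Type*} [Fintype ι₁] [Fintype ι₂] {a : ι₁ → O} {b : ι₂ → O}
    {P : ι₁ → O →+ O} {P' : ι₂ → O →+ O} (hP : ∀ I, Q.IsDer (P I)) (hP' : ∀ J, Q.IsDer (P' J))
    {k l : ℕ} (h1 : ∀ J c, Q.π c = (-1 : R) ^ k • c → b J * c = (-1 : R) ^ (k * l) • (c * b J))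
    (h2 : ∀ I, Q.π (a I) = (-1 : R) ^ k • a I) (hlin : ∀ J (c : O), P' J ((-1 : R) ^ k • c) =
    (-1 : R) ^ k • P' J c) (f : O) : ∑ I, a I * P I (∑ J, b J * P' J f) - (-1 : R) ^ (k * l) •
    ∑ J, b J * P' J (∑ I, a I * P I f) = ∑ I, ∑ J, a I * b J * (P I (P' J f) - P' J (P I f)) +
    ∑ I, a I * ∑ J, P I (b J) * P' J f - ∑ J, ∑ I, P' J (a I) * (b J * P I f) := by
  have h3 : ∀ I J, b J * a I = (-1 : R) ^ (k * l) • (a I * b J) := fun I J => h1 J _ (h2 I)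
  have h4 : ∀ I J, b J * P' J (a I) = (-1 : R) ^ (k * l) • (P' J (a I) * b J) := fun I J =>
    h1 J _ (by rw [← (hP' J).2, h2, hlin])
  have h5 : (-1 : R) ^ (k * l) * (-1 : R) ^ (k * l) = 1 := by rw [← mul_pow]; simp
  simp [(hP _).1, (hP' _).1, mul_add, sum_add, mul_sum, smul_sum, ← mul_assoc, h3, h4, smul_mul_assoc, smul_smul, h5, mul_sub]
  rw [sum_comm (s := univ (α := ι₂)) (f := fun J I => a I * b J * P' J (P I f))]
  abel

variable (Q)

def rHom (N : Mat(n) R) : O →+ O := (Q.Λ.r N).toAddMonoidHom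

/-- The covariant derivative along a vector field, as a linear function of the vector field. -/
def covL (f : O) : (Fin n → R) →ₗ[R] O := ∑ j, (LinearMap.proj j).smulRight (Q.Λ.cov j f)

lemma covL_apply (f : O) (X : Fin n → R) : Q.covL f X = ∑ j, X j • Q.Λ.cov j f := by simp [covL]

def covHom (X : Fin n → R) : O →+ O := AddMonoidHom.mk' (fun f => Q.covL f X) fun f g => by
    simp [covL_apply, FMod.cov_add, sum_add]

def lieHom (X : Fin n → R) : O →+ O := AddMonoidHom.mk' (Q.Λ.lieD X) (Q.Λ.lieD_add X)

lemma rHom_apply (N : Mat(n) R) (f : O) : Q.rHom N f = Q.Λ.r N f := rfl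

lemma covHom_apply (X : Fin n → R) (f : O) : Q.covHom X f = ∑ j, X j • Q.Λ.cov j f :=
  Q.covL_apply f X

lemma covHom_single (i : Fin n) (f : O) : Q.covHom (Pi.single i 1) f = Q.Λ.cov i f := by
  rw [covHom_apply, sum_eq_single i]
  · simp
  · intro j _ h; simp [h]
  · simp

lemma cov_mul (i : Fin n) (a b : O) : Q.Λ.cov i (a * b) = Q.Λ.cov i a * b + a * Q.Λ.cov i b := by
  simp [FMod.cov, Q.D_mul, Q.r_mul, add_mul, mul_add]; abel

lemma cov_ι (i : Fin n) (s : S) : Q.Λ.cov i (Q.ι s) = Q.ι (Q.E.cov i s) := by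
  simp [FMod.cov, Q.D_ι, Q.r_ι]

lemma cov_π (i : Fin n) (a : O) : Q.Λ.cov i (Q.π a) = Q.π (Q.Λ.cov i a) := by
  simp [FMod.cov, Q.D_π, Q.r_π]

lemma cov_int (i : Fin n) (s : S) (a : O) :
    Q.Λ.cov i (Q.int s a) = Q.int (Q.E.cov i s) a + Q.int s (Q.Λ.cov i a) := by
  simp [FMod.cov, Q.D_int, Q.r_int]; abel

lemma cov_γ (i j : Fin n) (s : S) :
    Q.E.cov i (Q.γ j s) = Q.γ j (Q.E.cov i s) - ∑ p, F.Γ i j p • Q.γ p s := by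
  simp [FMod.cov, Q.D_γ, Q.r_γ _ (FCalc.isSkew_Γ i)]; abel

lemma isDer_rHom (N : Mat(n) R) : Q.IsDer (Q.rHom N) := ⟨Q.r_mul N, Q.r_π N⟩

lemma isDer_covHom (X : Fin n → R) : Q.IsDer (Q.covHom X) := by
  refine ⟨fun a b => ?_, fun a => ?_⟩
  · simp [covHom_apply, cov_mul, sum_add, sum_mul, mul_sum, smul_mul_assoc, mul_smul_comm]
  · simp [covHom_apply, cov_π]

lemma lieD_ι (X : Fin n → R) (s : S) : Q.Λ.lieD X (Q.ι s) = Q.ι (Q.E.lieD X s) := by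
  simp [FMod.lieD, cov_ι, Q.r_ι]

lemma lieD_mul (X : Fin n → R) (a b : O) :
    Q.Λ.lieD X (a * b) = Q.Λ.lieD X a * b + a * Q.Λ.lieD X b := by
  simp [FMod.lieD, cov_mul, Q.r_mul, sum_add, sub_mul, mul_sub, sum_mul, mul_sum, smul_mul_assoc, mul_smul_comm]
  abel

lemma isDer_lieHom (X : Fin n → R) : Q.IsDer (Q.lieHom X) := by
  refine ⟨Q.lieD_mul X, fun a => ?_⟩
  change Q.Λ.lieD X _ = Q.π (Q.Λ.lieD X a)
  simp [FMod.lieD, cov_π, Q.r_π]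

lemma lieD_γ {X : Fin n → R} (hX : F.IsKilling X) (j : Fin n) (s : S) :
    Q.E.lieD X (Q.γ j s) = Q.γ j (Q.E.lieD X s) - ∑ p, F.lieMat X j p • Q.γ p s := by
  simp [FMod.lieD_eq, Q.D_γ, Q.r_γ _ hX.isSkew_lieMat]
  abel

lemma lieD_int (X : Fin n → R) (s : S) (a : O) :
    Q.Λ.lieD X (Q.int s a) = Q.int (Q.E.lieD X s) a + Q.int s (Q.Λ.lieD X a) := by
  simp [FMod.lieD, cov_int, Q.r_int, LinearMap.sum_apply, sum_add]
  abel

def IsParallel (ξ : S) : Prop := ∀ i, Q.E.cov i ξ = 0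

variable {Q}

variable {ξ : S}

lemma IsParallel.cov_ι_γ (hξ : Q.IsParallel ξ) (i j : Fin n) :
    Q.Λ.cov i (Q.ι (Q.γ j ξ)) = -Q.ι (∑ p, F.Γ i j p • Q.γ p ξ) := by
  rw [cov_ι, cov_γ, hξ, map_zero, zero_sub, map_neg]

lemma IsParallel.covHom_ι_γ (hξ : Q.IsParallel ξ) (X : Fin n → R) (j : Fin n) :
    Q.covHom X (Q.ι (Q.γ j ξ)) = -Q.ι (∑ p, (∑ i, X i • F.Γ i) j p • Q.γ p ξ) := by
  simp [covHom_apply, hξ.cov_ι_γ, Matrix.sum_apply, sum_smul, smul_sum, mul_smul]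
  rw [sum_comm]

lemma rHom_ι_γ {N : Mat(n) R} (hN : F.IsSkew N) (hξ : Q.E.r N ξ = 0) (j : Fin n) :
    Q.rHom N (Q.ι (Q.γ j ξ)) = -Q.ι (∑ p, N j p • Q.γ p ξ) := by
  rw [rHom_apply, Q.r_ι, Q.r_γ N hN, hξ, map_zero, zero_sub, map_neg]

lemma lieHom_ι_γ {X : Fin n → R} (hX : F.IsKilling X) (j : Fin n) (ξ : S) :
    Q.lieHom X (Q.ι (Q.γ j ξ)) = Q.ι (Q.γ j (Q.E.lieD X ξ) - ∑ p, F.lieMat X j p • Q.γ p ξ) := by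
  rw [← Q.lieD_γ hX]
  exact Q.lieD_ι X _

lemma IsParallel.lieD {X : Fin n → R} (hX : F.IsKilling X) (hξ : Q.IsParallel ξ) :
    Q.IsParallel (Q.E.lieD X ξ) := fun j => by
  have h := Q.E.lieD_cov hX j ξ
  have h0 : Q.E.lieD X 0 = 0 := by simp [FMod.lieD, FMod.cov]
  simpa [hξ _, h0] using h.symm

lemma IsParallel.parallel_susy {φ ψ : S} (hφ : Q.IsParallel φ) (hψ : Q.IsParallel ψ) (i : Fin n) :
    F.vec.cov i (fun m => Q.C φ (Q.γ m ψ)) = 0 := by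
  ext m
  have h1 : Q.E.D i φ = -Q.E.r (F.Γ i) φ := eq_neg_of_add_eq_zero_left (hφ i)
  have h2 : Q.E.D i ψ = -Q.E.r (F.Γ i) ψ := eq_neg_of_add_eq_zero_left (hψ i)
  rw [F.vec_cov, Q.D_C, Q.D_γ, h1, h2]
  have h3 := Q.C_r (F.Γ i) φ (Q.γ m ψ)
  rw [Q.r_γ _ (FCalc.isSkew_Γ i)] at h3
  simp at h3 ⊢
  linear_combination -h3

end SFrame

namespace SFrame

variable (Q : SFrame F S O)

def fB (A : Tens n R (k + 1)) (ξ : Fin k → S) (f : O) : O := ∑ I, Q.u ξ I * Q.Λ.r (A.endM I) f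

/-- The v-like field `A_{i_1 ⋯ i_k}{}^j γ^{i_1} ξ_1 ∧ ⋯ ∧ γ^{i_k} ξ_k ⊗ ∇_j`. -/
def fD (A : Tens n R k) (ξ : Fin k → S) (f : O) : O := ∑ I, Q.u ξ I * Q.covL f (A I)

def fO (φ : S) (f : O) : O := Q.int φ f + ∑ i, Q.ι (Q.γ i φ) * Q.Λ.cov i f

variable {Q}

variable {X : Fin n → R} {ξ : Fin k → S} {η : Fin l → S}

lemma π_u (ξ : Fin k → S) (I : Fin k → Fin n) : Q.π (Q.u ξ I) = (-1 : R) ^ k • Q.u ξ I := Q.π_W _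

lemma u_mul (η : Fin l → S) (J : Fin l → Fin n) (c : O) (hc : Q.π c = (-1 : R) ^ k • c) :
    Q.u η J * c = (-1 : R) ^ (k * l) • (c * Q.u η J) := by
  rw [mul_comm k l]
  exact Q.W_mul _ hc

lemma covHom_smul_neg_one_pow (X : Fin n → R) (k : ℕ) (c : O) :
    Q.covHom X ((-1 : R) ^ k • c) = (-1 : R) ^ k • Q.covHom X c := by
  rcases neg_one_pow_eq_or R k with h | h <;> simp [h]

def mulR (Q : SFrame F S O) (a f : O) : Mat(n) R →ₗ[R] O := LinearMap.mulLeft R a ∘ₗ Q.Λ.r.flip f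

def mulCov (Q : SFrame F S O) (a f : O) : (Fin n → R) →ₗ[R] O := LinearMap.mulLeft R a ∘ₗ Q.covL f

lemma mulR_apply (a f : O) (N : Mat(n) R) : Q.mulR a f N = a * Q.Λ.r N f := rfl

lemma mulCov_apply (a f : O) (X : Fin n → R) : Q.mulCov a f X = a * Q.covL f X := rfl

lemma bracket_fB_fB {A : Tens n R (k + 1)} {B : Tens n R (l + 1)}
    (hA : FCalc.GoodEnd Q.E A) (hB : FCalc.GoodEnd Q.E B) (hξ : ∀ α, Q.IsParallel (ξ α))
    (hη : ∀ β, Q.IsParallel (η β)) (f : O) : Q.fB A ξ (Q.fB B η f) - (-1 : R) ^ (k * l) •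
    Q.fB B η (Q.fB A ξ f) = Q.fB (Tens.bullet A B) (append ξ η) f := by
  have h := sum_bracket (Q := Q) (a := Q.u ξ) (b := Q.u η) (P := fun I => Q.rHom (A.endM I))
    (P' := fun J => Q.rHom (B.endM J)) (fun _ => Q.isDer_rHom _) (fun _ => Q.isDer_rHom _)
    (k := k) (l := l) (u_mul η) (π_u ξ) (fun J c => map_smul (Q.Λ.r _) _ _) f
  refine h.trans ?_
  have h1 : ∀ I, ∑ J, Q.rHom (A.endM I) (Q.u η J) * Q.rHom (B.endM J) f = _ := fun I =>
    (Q.isDer_rHom (A.endM I)).sum_u_parallel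
      (fun β j => rHom_ι_γ (hA.skew I) (hA.ann I _ (hη β)) j) (Q.Λ.r.flip f) (fun J => B.endM J)
  have h2 : ∀ J, ∑ I, Q.rHom (B.endM J) (Q.u ξ I) * (Q.u η J * Q.rHom (A.endM I) f) = _ := fun J =>
    (Q.isDer_rHom (B.endM J)).sum_u_parallel
      (fun α j => rHom_ι_γ (hB.skew J) (hB.ann J _ (hξ α)) j) (Q.mulR (Q.u η J) f)
      (fun I => A.endM I)
  rw [sum_ext fun I => congrArg (Q.u ξ I * ·) (h1 I), sum_ext fun J => h2 J]
  simp only [fB]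
  rw [sum_append]
  simp only [u_append, Tens.endM_bullet, fstIdx_append_eq, sndIdx_append_eq, mulR_apply,
    LinearMap.flip_apply, sum_neg_distrib, mul_neg, mul_sum, sub_neg_eq_add]
  rw [sum_comm (s := univ (α := Fin l → Fin n)) (f := fun J I => Q.u ξ I * (_ * _))]
  simp only [← sum_neg_distrib, ← sum_add]
  refine sum_ext fun I => sum_ext fun J => ?_
  rw [map_add, map_sub, LinearMap.add_apply, LinearMap.sub_apply, Q.Λ.r_lie _ _ (hA.skew I)]
  simp [rHom_apply, Tens.endM, mul_sub, mul_add, mul_assoc]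
  abel

lemma lin_covL_comm (X Y : Fin n → R) (f : O) :
    Q.covHom X (Q.covL f Y) - Q.covHom Y (Q.covL f X) = Q.covL f (∑ p, X p • F.vec.cov p Y)
    - Q.covL f (∑ q, Y q • F.vec.cov q X) + Q.Λ.r (∑ p, ∑ q, (X p * Y q) • F.curvM p q) f := by
  have h1 : ∀ X Y : Fin n → R, Q.covHom X (Q.covL f Y) =
      Q.covL f (∑ p, X p • F.vec.D p Y) + ∑ p, ∑ q, (X p * Y q) • Q.Λ.cov p (Q.Λ.cov q f) := fun X Y => by
    simp only [covHom_apply, covL_apply, FMod.cov_sum, FMod.cov_smul,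
      Finset.sum_apply, Pi.smul_apply, FCalc.vec_D, smul_add, smul_sum, smul_smul,
      sum_add, sum_smul, smul_eq_mul]
    rw [sum_comm (f := fun i j => (X i * F.D i (Y j)) • Q.Λ.cov j f)]
  have h2 : ∀ X Y : Fin n → R, Q.covL f (∑ p, X p • F.vec.cov p Y) =
      Q.covL f (∑ p, X p • F.vec.D p Y) + ∑ p, ∑ q, (X p * Y q) • ∑ m, F.Γ p m q • Q.Λ.cov m f := fun X Y => by
    rw [← sub_eq_iff_eq_add', ← map_sub, ← sum_sub_distrib]
    simp only [← smul_sub, FMod.cov, add_sub_cancel_left, FCalc.vec_r]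
    simp only [covL_apply, Finset.sum_apply, Pi.smul_apply, Matrix.mulVec, dotProduct, smul_eq_mul,
      sum_smul, smul_sum, mul_sum, smul_smul]
    rw [sum_comm]
    refine sum_ext fun p => ?_
    rw [sum_comm]
    refine sum_ext fun q => sum_ext fun m => ?_
    congr 1; ring
  have h3 : ∀ g : Fin n → Fin n → O, ∑ p, ∑ q, (Y p * X q) • g p q =
      ∑ p, ∑ q, (X p * Y q) • g q p := fun g => by
    rw [sum_comm]
    simp [mul_comm]
  have h4 : ∀ p q, Q.Λ.cov p (Q.Λ.cov q f) = Q.Λ.cov q (Q.Λ.cov p f) + Q.Λ.r (F.curvM p q) f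
      + ∑ m, F.Γ p m q • Q.Λ.cov m f - ∑ m, F.Γ q m p • Q.Λ.cov m f := fun p q => by
    have := Q.Λ.cov_comm p q f
    simp [FCalc.c, sub_smul] at this
    rw [sub_eq_iff_eq_add] at this
    rw [this]
    abel
  have h5 : ∑ p, ∑ q, (X p * Y q) • Q.Λ.cov p (Q.Λ.cov q f) = _ :=
    sum_ext fun p => sum_ext fun q => congrArg (_ • ·) (h4 p q)
  rw [h1 X Y, h1 Y X, h2 X Y, h2 Y X, h3, h3, h5]
  simp [smul_sub, sum_add, LinearMap.sum_apply]
  abel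

lemma nabla_apply_cons (A : Tens n R k) (m : Fin n) (I : Fin k → Fin n) :
    F.nabla A (Fin.cons m I) = F.vec.cov m (A I) - ∑ α, ∑ p, F.Γ m p (I α) • A (update I α p) := by
  ext q
  simp [FCalc.nabla, F.tens_cov, F.vec_cov]
  ring

lemma sum_smul_slot {V : Type*} [AddCommGroup V] [Module R V] (X : Fin n → R)
    (A : (Fin k → Fin n) → V) (I : Fin k → Fin n) : ∑ α, ∑ m, (∑ p, X p • F.Γ p) m (I α) •
    A (update I α m) = ∑ p, X p • ∑ α, ∑ m, F.Γ p m (I α) • A (update I α m) := by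
  simp [Matrix.sum_apply, sum_smul, smul_sum, smul_smul]
  rw [sum_comm, sum_ext fun m => sum_comm, sum_comm, sum_comm, sum_comm]
  exact sum_ext fun _ => sum_comm

lemma insert_apply_append (A : Tens n R k) (C : Tens n R (l + 1)) (I : Fin k → Fin n)
    (J : Fin l → Fin n) : Tens.insert A C (append I J) = ∑ m, A I m • C (Fin.cons m J) := by
  ext q
  simp [Tens.insert, Finset.sum_apply]

def _root_.SGM.Tens.swap (A : Tens n R (l + k)) : Tens n R (k + l) :=
  fun i q => A (append (sndIdx i) (fstIdx i)) q

lemma bracket_fD_fD (A : Tens n R k) (B : Tens n R l) (hξ : ∀ α, Q.IsParallel (ξ α))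
    (hη : ∀ β, Q.IsParallel (η β)) (f : O) : Q.fD A ξ (Q.fD B η f) - (-1 : R) ^ (k * l) •
    Q.fD B η (Q.fD A ξ f) = Q.fB (Tens.contractR₂ F.curvT A B) (append ξ η) f +
    Q.fD (Tens.insert A (F.nabla B) - Tens.swap (Tens.insert B (F.nabla A))) (append ξ η) f := by
  have h := sum_bracket (Q := Q) (a := Q.u ξ) (b := Q.u η) (P := fun I => Q.covHom (A I))
    (P' := fun J => Q.covHom (B J)) (fun _ => Q.isDer_covHom _) (fun _ => Q.isDer_covHom _)
    (k := k) (l := l) (u_mul η) (π_u ξ) (fun J c => covHom_smul_neg_one_pow _ _ _) f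
  refine h.trans ?_
  have h1 : ∀ I, ∑ J, Q.covHom (A I) (Q.u η J) * Q.covHom (B J) f = _ := fun I =>
    (Q.isDer_covHom (A I)).sum_u_parallel
      (fun β j => (hη β).covHom_ι_γ (A I) j) (Q.covL f) B
  have h2 : ∀ J, ∑ I, Q.covHom (B J) (Q.u ξ I) * (Q.u η J * Q.covHom (A I) f) = _ := fun J =>
    (Q.isDer_covHom (B J)).sum_u_parallel
      (fun α j => (hξ α).covHom_ι_γ (B J) j) (Q.mulCov (Q.u η J) f) A
  rw [sum_ext fun I => congrArg (Q.u ξ I * ·) (h1 I), sum_ext fun J => h2 J]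
  simp only [fB, fD]
  rw [sum_append, sum_append]
  simp only [u_append, Tens.endM_contractR₂, fstIdx_append_eq, sndIdx_append_eq, mulCov_apply,
    sum_neg_distrib, mul_neg, mul_sum, sub_neg_eq_add, sum_smul_slot,
    Pi.sub_apply, insert_apply_append, nabla_apply_cons]
  rw [sum_comm (s := univ (α := Fin l → Fin n)) (f := fun J I => Q.u ξ I * (_ * _))]
  simp only [← sum_neg_distrib, ← sum_add]
  refine sum_ext fun I => sum_ext fun J => ?_
  have e : Tens.swap (Tens.insert B (F.nabla A)) (append I J) =
      ∑ m, B J m • (F.vec.cov m (A I) - ∑ α, ∑ p, F.Γ m p (I α) • A (update I α p)) := by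
    ext q
    simp [Tens.swap, insert_apply_append, nabla_apply_cons]
  have h3 := lin_covL_comm (Q := Q) (A I) (B J) f
  have h4 : Q.covHom (A I) (Q.covHom (B J) f) - Q.covHom (B J) (Q.covHom (A I) f) = _ := h3
  rw [h4, e]
  simp [smul_sub, mul_sub, mul_add, mul_assoc]
  abel

lemma bracket_fD_fB (A : Tens n R k) {B : Tens n R (l + 1)} (hB : FCalc.GoodEnd Q.E B) (hξ : ∀ α,
    Q.IsParallel (ξ α)) (hη : ∀ β, Q.IsParallel (η β)) (f : O) : Q.fD A ξ (Q.fB B η f) - (-1 : R)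
    ^ (k * l) • Q.fB B η (Q.fD A ξ f) = Q.fB (k := k + l) (Tens.insert (l := l + 1) A (F.nabla B))
    (append ξ η) f + Q.fD (Tens.circ A B) (append ξ η) f := by
  have h := sum_bracket (Q := Q) (a := Q.u ξ) (b := Q.u η) (P := fun I => Q.covHom (A I))
    (P' := fun J => Q.rHom (B.endM J)) (fun _ => Q.isDer_covHom _) (fun _ => Q.isDer_rHom _)
    (k := k) (l := l) (u_mul η) (π_u ξ) (fun J c => map_smul (Q.Λ.r _) _ _) f
  refine h.trans ?_
  have h1 : ∀ I, ∑ J, Q.covHom (A I) (Q.u η J) * Q.rHom (B.endM J) f = _ := fun I =>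
    (Q.isDer_covHom (A I)).sum_u_parallel
      (fun β j => (hη β).covHom_ι_γ (A I) j) (Q.Λ.r.flip f) (fun J => B.endM J)
  have h2 : ∀ J, ∑ I, Q.rHom (B.endM J) (Q.u ξ I) * (Q.u η J * Q.covHom (A I) f) = _ := fun J =>
    (Q.isDer_rHom (B.endM J)).sum_u_parallel
      (fun α j => rHom_ι_γ (hB.skew J) (hB.ann J _ (hξ α)) j) (Q.mulCov (Q.u η J) f) A
  rw [sum_ext fun I => congrArg (Q.u ξ I * ·) (h1 I), sum_ext fun J => h2 J]
  have e1 : ∀ I J, Tens.endM (Tens.insert (l := l + 1) A (F.nabla B)) (append I J) =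
      ∑ m, A I m • (mDeriv (F.D m) (B.endM J) + (F.Γ m * B.endM J - B.endM J * F.Γ m)) -
        ∑ m, A I m • ∑ β, ∑ p, F.Γ m p (J β) • B.endM (update J β p) := fun I J => by
    rw [Tens.endM_insert, ← sum_sub_distrib]
    simp only [fstIdx_append_eq, sndIdx_append_eq, ← smul_sub]
    refine sum_ext fun m => ?_
    rw [Tens.endM_nabla]
    simp
  have e2 : ∀ I J, Tens.circ A B (append I J) =
      ∑ α, ∑ m, B.endM J m (I α) • A (update I α m) := fun I J => by
    ext q
    simp [Tens.circ, Finset.sum_apply, Tens.endM]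
  simp only [fB, fD]
  rw [sum_append, sum_append]
  simp only [u_append, mulCov_apply, LinearMap.flip_apply, e1, e2,
    sum_neg_distrib, mul_neg, mul_sum, sub_neg_eq_add, sum_smul_slot]
  rw [sum_comm (s := univ (α := Fin l → Fin n)) (f := fun J I => Q.u ξ I * (_ * _))]
  simp only [← sum_neg_distrib, ← sum_add]
  refine sum_ext fun I => sum_ext fun J => ?_
  have h3 : Q.covHom (A I) (Q.rHom (B.endM J) f) - Q.rHom (B.endM J) (Q.covHom (A I) f) =
      Q.Λ.r (∑ m, A I m • (mDeriv (F.D m) (B.endM J) +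
        (F.Γ m * B.endM J - B.endM J * F.Γ m))) f := by
    simp [covHom_apply, rHom_apply, FMod.cov_r, LinearMap.sum_apply, ← sum_sub_distrib, ← smul_sub]
  rw [h3]
  simp [mul_sub, mul_assoc]
  abel

lemma bracket_lieD_fB (hX : F.IsKilling X)
    {A : Tens n R (k + 1)} (hA : (F.tens (k + 1)).lieD X A = 0) (ξ : Fin k → S) (f : O) : Q.Λ.lieD
    X (Q.fB A ξ f) - Q.fB A ξ (Q.Λ.lieD X f) = ∑ α, Q.fB A (update ξ α (Q.E.lieD X (ξ α))) f := by
  have h1 := (Q.isDer_lieHom X).sum_u (fun α i => lieHom_ι_γ hX i (ξ α)) (Q.mulR 1 f)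
    (fun I => A.endM I)
  simp only [mulR_apply, one_mul] at h1
  have h2 : ∀ I, mDeriv (F.dirD X) (A.endM I) + (F.lieMat X * A.endM I - A.endM I * F.lieMat X) =
      ∑ α, ∑ m, F.lieMat X m (I α) • A.endM (update I α m) := fun I => by
    ext q p
    have h := congrFun (congrFun hA (snoc I p)) q
    rw [FCalc.tens_lieD_apply, Fin.sum_univ_castSucc] at h
    simp [← Fin.snoc_update, Fin.update_snoc_last] at h
    simp only [Tens.endM, Matrix.add_apply, Matrix.sub_apply, mDeriv_apply,
      mul_apply, Matrix.sum_apply, Matrix.smul_apply, smul_eq_mul]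
    simp only [mul_comm (A (snoc I _) q)]
    linear_combination h
  have h3 : ∀ I, Q.Λ.lieD X (Q.Λ.r (A.endM I) f) = _ := fun I => Q.Λ.lieD_r hX (A.endM I) f
  unfold fB
  rw [FMod.lieD_sum]
  simp only [lieD_mul, h3, h2, sum_add, mul_add]
  have h4 : ∀ I, Q.Λ.lieD X (Q.u ξ I) = Q.lieHom X (Q.u ξ I) := fun _ => rfl
  simp only [h4]
  rw [h1]
  abel

lemma lieD_covL (hX : F.IsKilling X) (Y : Fin n → R) (f : O) :
    Q.Λ.lieD X (Q.covL f Y) = Q.covL (Q.Λ.lieD X f) Y + Q.covL f (F.vec.lieD X Y) := by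
  have h : ∀ q, F.vec.lieD X Y q = F.dirD X (Y q) + ∑ m, F.lieMat X q m * Y m := fun q => by
    rw [FMod.lieD_eq]
    simp [F.dirD_apply, F.vec_D, F.vec_r, Matrix.mulVec, dotProduct]
  simp [covL_apply, FMod.lieD_sum, FMod.lieD_smul, FMod.lieD_cov _ hX, h, add_smul, sum_add, sum_smul, smul_sum, smul_smul]
  rw [sum_comm (f := fun j m => (Y j * F.lieMat X m j) • Q.Λ.cov m f)]
  simp [mul_comm (F.lieMat X _ _)]
  abel

lemma bracket_lieD_fD (hX : F.IsKilling X) {A : Tens n R k} (hA : (F.tens k).lieD X A = 0)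
    (ξ : Fin k → S) (f : O) : Q.Λ.lieD X (Q.fD A ξ f) - Q.fD A ξ (Q.Λ.lieD X f) =
    ∑ α, Q.fD A (update ξ α (Q.E.lieD X (ξ α))) f := by
  have h1 := (Q.isDer_lieHom X).sum_u (fun α i => lieHom_ι_γ hX i (ξ α)) (Q.mulCov 1 f) A
  simp only [mulCov_apply, one_mul] at h1
  have h2 : ∀ I, F.vec.lieD X (A I) = ∑ α, ∑ m, F.lieMat X m (I α) • A (update I α m) := fun I => by
    ext q
    have h := congrFun (congrFun hA I) q
    rw [FCalc.tens_lieD_apply] at h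
    rw [FMod.lieD_eq]
    simp [F.vec_D, F.vec_r, Matrix.mulVec, dotProduct, ← F.dirD_apply]
    simp at h
    linear_combination h
  unfold fD
  rw [FMod.lieD_sum]
  simp only [lieD_mul, lieD_covL hX, h2, sum_add, mul_add]
  have h4 : ∀ I, Q.Λ.lieD X (Q.u ξ I) = Q.lieHom X (Q.u ξ I) := fun _ => rfl
  simp only [h4]
  rw [h1]
  abel

lemma bracket_lieD_fO (hX : F.IsKilling X) (φ : S) (f : O) :
    Q.Λ.lieD X (Q.fO φ f) - Q.fO φ (Q.Λ.lieD X f) = Q.fO (Q.E.lieD X φ) f := by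
  unfold fO
  have h1 : ∑ i, Q.ι (∑ p, F.lieMat X i p • Q.γ p φ) * Q.Λ.cov i f =
      ∑ i, Q.ι (Q.γ i φ) * ∑ m, F.lieMat X m i • Q.Λ.cov m f := by
    simp [sum_mul, mul_sum, smul_mul_assoc, mul_smul_comm]
    exact sum_comm
  simp only [FMod.lieD_add, FMod.lieD_sum, lieD_int, lieD_mul, lieD_ι, lieD_γ Q hX,
    FMod.lieD_cov _ hX, map_sub, sub_mul, mul_add, sum_add,
    sum_sub_distrib, h1]
  abel

end SFrame

namespace SFrame

variable {Q : SFrame F S O}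

lemma sum_int_u_eq_zero (φ : S) {V : Type*} [AddCommGroup V] [Module R V] (L : V →ₗ[R] O) (ξ : Fin
    k → S) (A : (Fin k → Fin n) → V) (h : ∀ α I, ∑ m, Q.C φ (Q.γ m (ξ α)) • A (update I α m) = 0) :
    ∑ I, Q.int φ (Q.u ξ I) * L (A I) = 0 := by
  induction k with
  | zero =>
    have h1 : Q.int φ 1 = 0 := by
      have := Q.int_mul φ 1 1
      simpa using this
    simp [u, W_apply, h1]
  | succ k ih =>
    have h2 : ∀ p I, Q.u ξ (Fin.cons p I) = Q.ι (Q.γ p (ξ 0)) * Q.u (Fin.tail ξ) I := fun p I => by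
      rw [← u_cons, Fin.cons_self_tail]
    rw [sum_cons]
    simp only [h2, Q.int_mul, Q.int_ι, Q.π_ι, add_mul, sum_add]
    have h3 : ∀ p, ∑ I, -Q.ι (Q.γ p (ξ 0)) * Q.int φ (Q.u (Fin.tail ξ) I) *
        L (A (Fin.cons p I)) = 0 := fun p => by
      have := ih (Fin.tail ξ) (fun I => A (Fin.cons p I)) fun α I => by
        have := h α.succ (Fin.cons p I)
        simpa only [← Fin.cons_update, Fin.tail] using this
      simp [mul_assoc, ← mul_sum, this]
    simp only [h3, sum_const_zero, add_zero]
    rw [sum_comm]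
    refine sum_eq_zero fun I _ => ?_
    rcases isEmpty_or_nonempty (Fin n) with hn | ⟨⟨p⟩⟩
    · simp
    have := congrArg (fun x => Q.u (Fin.tail ξ) I * L x) (h 0 (Fin.cons p I))
    simp [mul_sum, mul_smul_comm] at this
    simpa only [Algebra.algebraMap_eq_smul_one, smul_mul_assoc, one_mul] using this

lemma sum_bracket_int (φ : S) {V : Type*} [AddCommGroup V] [Module R V] (L : O → V →ₗ[R] O)
    (ξ : Fin k → S) (A : (Fin k → Fin n) → V) (h : ∀ α I, ∑ m, Q.C φ (Q.γ m (ξ α)) •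
    A (update I α m) = 0) (hL : ∀ I f, L (Q.int φ f) (A I) = Q.int φ (L f (A I))) (f : O) :
    Q.int φ (∑ I, Q.u ξ I * L f (A I)) = (-1 : R) ^ k • ∑ I, Q.u ξ I * L (Q.int φ f) (A I) := by
  simp [Q.int_mul, sum_add, sum_int_u_eq_zero φ (L f) ξ A h, π_u, hL, smul_mul_assoc, smul_sum]

lemma bracket_fO_fB {A : Tens n R (k + 1)} (hA : FCalc.GoodEnd Q.E A) {φ : S} {ξ : Fin k → S}
    (hφ : Q.IsParallel φ) (hξ : ∀ α, Q.IsParallel (ξ α)) (f : O) : Q.fO φ (Q.fB A ξ f)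
    - (-1 : R) ^ k • Q.fB A ξ (Q.fO φ f) = Q.fB (k := k + 1) (F.nabla A) (Fin.cons φ ξ) f +
        (-1 : R) ^ k • Q.fD (k := k + 1) A (snoc ξ φ) f := by
  have hint : Q.int φ (Q.fB A ξ f) = (-1 : R) ^ k • Q.fB A ξ (Q.int φ f) := by
    refine sum_bracket_int φ (fun f => Q.Λ.r.flip f) ξ (fun I => A.endM I) (fun α I => ?_)
      (fun I f => ?_) f
    · ext q p
      have h := Tens.null_iff.mp (hA.null _ fun i => hφ.parallel_susy (hξ α) i) (snoc I p)
        α.castSucc q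
      simpa [Matrix.sum_apply, Tens.endM, ← Fin.snoc_update] using h
    · simp [Q.r_int, hA.ann I φ hφ]
  have h := sum_bracket (Q := Q) (a := fun i => Q.ι (Q.γ i φ)) (b := Q.u ξ)
    (P := fun i => Q.covHom (Pi.single i 1))
    (P' := fun J => Q.rHom (A.endM J)) (fun _ => Q.isDer_covHom _) (fun _ => Q.isDer_rHom _)
    (k := 1) (l := k) (u_mul ξ) (fun i => by simp [Q.π_ι]) (fun J c => map_smul (Q.Λ.r _) _ _) f
  simp only [covHom_single, one_mul] at h
  have h1 : ∀ i, ∑ J, Q.covHom (Pi.single i 1) (Q.u ξ J) * Q.rHom (A.endM J) f = _ := fun i =>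
    (Q.isDer_covHom (Pi.single i 1)).sum_u_parallel (M := F.Γ i)
      (fun β j => by rw [covHom_single, (hξ β).cov_ι_γ]) (Q.Λ.r.flip f)
      (fun J => A.endM J)
  simp only [covHom_single] at h1
  have h2 : ∀ J i, Q.rHom (A.endM J) (Q.ι (Q.γ i φ)) = _ := fun J i =>
    rHom_ι_γ (hA.skew J) (hA.ann J _ hφ) i
  have h3 : Q.fO φ (Q.fB A ξ f) - (-1 : R) ^ k • Q.fB A ξ (Q.fO φ f) =
      ∑ i, Q.ι (Q.γ i φ) * Q.Λ.cov i (∑ J, Q.u ξ J * Q.rHom (A.endM J) f) -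
        (-1 : R) ^ k • ∑ J, Q.u ξ J * Q.rHom (A.endM J) (∑ i, Q.ι (Q.γ i φ) * Q.Λ.cov i f) := by
    have hO : Q.fO φ (Q.fB A ξ f) = Q.int φ (Q.fB A ξ f) +
      ∑ i, Q.ι (Q.γ i φ) * Q.Λ.cov i (Q.fB A ξ f) := rfl
    rw [hO, hint]
    simp only [fB, fO, map_add, mul_add, sum_add, smul_add, rHom_apply]
    abel
  rw [h3, h, sum_ext fun i => congrArg (Q.ι (Q.γ i φ) * ·) (h1 i)]
  simp only [h2, fB, fD]
  rw [sum_cons, sum_snoc]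
  have e : ∀ (J : Fin k → Fin n), ∑ i, -Q.ι (∑ p, A.endM J i p • Q.γ p φ) *
      (Q.u ξ J * Q.Λ.cov i f) = - ∑ p, Q.ι (Q.γ p φ) * (Q.u ξ J * Q.covL f (A (snoc J p))) := fun J => by
    simp [covL_apply, mul_sum, sum_mul, smul_mul_assoc, mul_smul_comm]
    rw [sum_comm]
    rfl
  have e2 : (-1 : R) ^ k * (-1 : R) ^ k = 1 := by rw [← mul_pow]; simp
  simp only [e, u_cons, u_snoc, u_mul_ι, smul_mul_assoc, smul_sum, smul_smul, e2, one_smul,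
    Tens.endM_nabla, Fin.cons_zero, Fin.tail_cons, sum_neg_distrib, sub_neg_eq_add]
  rw [← sum_add]
  congr 1
  · refine sum_ext fun i => ?_
    rw [mul_neg, mul_sum, ← sub_eq_add_neg, ← sum_sub_distrib]
    refine sum_ext fun J => ?_
    rw [rHom_apply, FMod.cov_r, rHom_apply, add_sub_cancel_right, map_sub,
      LinearMap.sub_apply, mul_sub, LinearMap.flip_apply, mul_assoc, mul_assoc]
  · simp [mul_assoc]

lemma bracket_fO_fD {A : Tens n R k} (hA : FCalc.GoodVec F A) {φ : S} {ξ : Fin k → S}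
    (hφ : Q.IsParallel φ) (hξ : ∀ α, Q.IsParallel (ξ α)) (f : O) : Q.fO φ (Q.fD A ξ f)
    - (-1 : R) ^ k • Q.fD A ξ (Q.fO φ f) = Q.fD (k := k + 1) (F.nabla A) (Fin.cons φ ξ) f +
        (-1 : R) ^ k • Q.fB (k := k + 1) (Tens.contractR F.curvT A) (snoc ξ φ) f := by
  have hcov : ∀ X f, Q.covL (Q.int φ f) X = Q.int φ (Q.covL f X) := fun X f => by
    simp [covL_apply, cov_int, hφ _]
  have hint : Q.int φ (Q.fD A ξ f) = (-1 : R) ^ k • Q.fD A ξ (Q.int φ f) := by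
    refine sum_bracket_int φ Q.covL ξ A (fun α I => ?_) (fun I f => hcov _ _) f
    ext q
    have h := Tens.null_iff.mp (hA.null _ fun i => hφ.parallel_susy (hξ α) i) I α q
    simpa [Finset.sum_apply] using h
  have h := sum_bracket (Q := Q) (a := fun i => Q.ι (Q.γ i φ)) (b := Q.u ξ)
    (P := fun i => Q.covHom (Pi.single i 1))
    (P' := fun J => Q.covHom (A J)) (fun _ => Q.isDer_covHom _) (fun _ => Q.isDer_covHom _)
    (k := 1) (l := k) (u_mul ξ) (fun i => by simp [Q.π_ι])
    (fun J c => covHom_smul_neg_one_pow _ _ _) f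
  simp only [one_mul] at h
  have h1 : ∀ i, ∑ J, Q.covHom (Pi.single i 1) (Q.u ξ J) * Q.covHom (A J) f = _ := fun i =>
    (Q.isDer_covHom (Pi.single i 1)).sum_u_parallel (M := F.Γ i)
      (fun β j => by rw [covHom_single, (hξ β).cov_ι_γ]) (Q.covL f) A
  have h2 : ∀ J i, Q.covHom (A J) (Q.ι (Q.γ i φ)) = _ := fun J i => hφ.covHom_ι_γ (A J) i
  have hO : ∀ g, Q.fO φ g = Q.int φ g + ∑ i, Q.ι (Q.γ i φ) * Q.covHom (Pi.single i 1) g := by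
    intro g; simp [covHom_single]; rfl
  have h3 : Q.fO φ (Q.fD A ξ f) - (-1 : R) ^ k • Q.fD A ξ (Q.fO φ f) =
      ∑ i, Q.ι (Q.γ i φ) * Q.covHom (Pi.single i 1) (∑ J, Q.u ξ J * Q.covHom (A J) f) -
        (-1 : R) ^ k • ∑ J, Q.u ξ J * Q.covHom (A J)
          (∑ i, Q.ι (Q.γ i φ) * Q.covHom (Pi.single i 1) f) := by
    have e : ∀ g, Q.fD A ξ g = ∑ J, Q.u ξ J * Q.covHom (A J) g := fun g => rfl
    rw [hO, hint]
    simp only [e, hO, map_add, mul_add, sum_add, smul_add]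
    abel
  have hcomm : ∀ i J, Q.covHom (Pi.single i 1) (Q.covHom (A J) f) -
      Q.covHom (A J) (Q.covHom (Pi.single i 1) f) =
      Q.covL f (F.vec.cov i (A J)) -
        ∑ m, (∑ q, A J q • F.Γ q) m i • Q.Λ.cov m f + Q.Λ.r (∑ q, A J q • F.curvM i q) f := fun i J => by
    have h4 := lin_covL_comm (Q := Q) (Pi.single i 1) (A J) f
    have h5 : ∑ p, (Pi.single i 1 : Fin n → R) p • F.vec.cov p (A J) = F.vec.cov i (A J) := by
      rw [sum_eq_single i] <;> simp +contextual
    have h6 : ∑ p, ∑ q, ((Pi.single i 1 : Fin n → R) p * A J q) • F.curvM p q =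
        ∑ q, A J q • F.curvM i q := by
      rw [sum_eq_single i] <;> simp +contextual
    have h7 : Q.covL f (∑ q, A J q • F.vec.cov q (Pi.single i 1)) =
        ∑ m, (∑ q, A J q • F.Γ q) m i • Q.Λ.cov m f := by
      rw [covL_apply]
      refine sum_ext fun m => ?_
      congr 1
      rw [Finset.sum_apply, Matrix.sum_apply]
      refine sum_ext fun q => ?_
      rw [Pi.smul_apply, F.vec_cov, sum_eq_single i, Matrix.smul_apply]
      · by_cases hm : m = i
        · subst hm; simp
        · simp [hm]
      · simp +contextual
      · simp
    rw [h5, h6, h7] at h4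
    exact h4
  have e : ∀ (J : Fin k → Fin n), ∑ i, -Q.ι (∑ p, (∑ q, A J q • F.Γ q) i p • Q.γ p φ) *
      (Q.u ξ J * Q.covHom (Pi.single i 1) f) =
      - ∑ p, Q.ι (Q.γ p φ) * (Q.u ξ J * ∑ m, (∑ q, A J q • F.Γ q) m p • Q.Λ.cov m f) := fun J => by
    simp [covHom_single, mul_sum, sum_mul, smul_mul_assoc, mul_smul_comm]
    rw [sum_comm]
  have e2 : (-1 : R) ^ k * (-1 : R) ^ k = 1 := by rw [← mul_pow]; simp
  rw [h3, h, sum_ext fun i => congrArg (Q.ι (Q.γ i φ) * ·) (h1 i)]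
  simp only [h2, fB, fD, e, hcomm]
  rw [sum_cons, sum_snoc]
  simp only [u_cons, u_snoc, u_mul_ι, smul_mul_assoc, smul_sum, smul_smul, e2, one_smul,
    Tens.endM_contractR, Fin.init_snoc, snoc_last, nabla_apply_cons,
    sum_neg_distrib, sub_neg_eq_add, mul_neg, mul_sum]
  rw [sum_comm (s := univ (α := Fin k → Fin n)), sum_comm (s := univ (α := Fin k → Fin n))]
  simp only [← sum_neg_distrib, ← sum_add]
  refine sum_ext fun i => sum_ext fun J => ?_
  simp only [map_sub, mul_sub, mul_add, mul_assoc, ← mul_sum]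
  abel

lemma bracket_fO_fO {φ ψ : S} (hφ : Q.IsParallel φ) (hψ : Q.IsParallel ψ) (f : O) : Q.fO φ (Q.fO ψ
    f) + Q.fO ψ (Q.fO φ f) = Q.Λ.lieD (fun i => 2 * Q.C φ (Q.γ i ψ)) f + Q.fB (k := 2) F.curvT ![φ,
    ψ] f := by
  have hK : F.nablaV (fun i => 2 * Q.C φ (Q.γ i ψ)) = 0 := by
    ext q p
    have h := congrFun (hφ.parallel_susy hψ p) q
    have h2 := F.vec.cov_add p (fun m => Q.C φ (Q.γ m ψ)) (fun m => Q.C φ (Q.γ m ψ))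
    have h3 : (fun i => 2 * Q.C φ (Q.γ i ψ)) =
      (fun m => Q.C φ (Q.γ m ψ)) + (fun m => Q.C φ (Q.γ m ψ)) := by
      ext i; simp [two_mul]
    unfold FCalc.nablaV
    rw [h3, h2, hφ.parallel_susy hψ]
    simp
  have hcov : ∀ φ, Q.IsParallel φ → ∀ i f, Q.Λ.cov i (Q.int φ f) = Q.int φ (Q.Λ.cov i f) := fun φ hφ i f => by
    rw [cov_int, hφ, map_zero, LinearMap.zero_apply, zero_add]
  have hone : ∀ φ ψ, Q.IsParallel φ → Q.IsParallel ψ → Q.fO φ (Q.fO ψ f) =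
      Q.int φ (Q.int ψ f) + ∑ i, Q.C φ (Q.γ i ψ) • Q.Λ.cov i f
        - ∑ i, Q.ι (Q.γ i ψ) * Q.int φ (Q.Λ.cov i f) + ∑ i, Q.ι (Q.γ i φ) * Q.int ψ (Q.Λ.cov i f)
        - ∑ i, ∑ j, Q.ι (Q.γ i φ) * Q.ι (∑ p, F.Γ i j p • Q.γ p ψ) * Q.Λ.cov j f
        + ∑ i, ∑ j, Q.ι (Q.γ i φ) * Q.ι (Q.γ j ψ) * Q.Λ.cov i (Q.Λ.cov j f) := fun φ ψ hφ hψ => by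
    simp [fO, Q.int_mul, Q.int_ι, Q.π_ι, FMod.cov_add, FMod.cov_sum, cov_mul, hcov ψ hψ, mul_add, sum_add, hψ.cov_ι_γ, Algebra.algebraMap_eq_smul_one, smul_mul_assoc, mul_sum, ← mul_assoc]
    abel
  have e1 : ∑ i, ∑ j, Q.ι (Q.γ i φ) * Q.ι (∑ p, F.Γ i j p • Q.γ p ψ) * Q.Λ.cov j f =
      ∑ i, ∑ j, Q.ι (Q.γ i φ) * Q.ι (Q.γ j ψ) * ∑ m, F.Γ i m j • Q.Λ.cov m f := by
    refine sum_ext fun i => ?_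
    simp [mul_sum, sum_mul, mul_smul_comm, smul_mul_assoc]
    exact sum_comm
  have anti : ∀ s t, Q.ι s * Q.ι t = -(Q.ι t * Q.ι s) := fun s t => by rw [Q.ι_mul, Q.π_ι, neg_mul]
  have e2 : ∑ i, ∑ j, Q.ι (Q.γ i ψ) * Q.ι (∑ p, F.Γ i j p • Q.γ p φ) * Q.Λ.cov j f =
      - ∑ i, ∑ j, Q.ι (Q.γ i φ) * Q.ι (Q.γ j ψ) * ∑ m, F.Γ j m i • Q.Λ.cov m f := by
    rw [sum_comm (f := fun i j => Q.ι (Q.γ i φ) * Q.ι (Q.γ j ψ) * ∑ m, F.Γ j m i • Q.Λ.cov m f)]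
    simp [← sum_neg_distrib]
    refine sum_ext fun i => ?_
    simp only [map_sum, map_smul, mul_sum, sum_mul, mul_smul_comm, smul_mul_assoc]
    rw [sum_comm]
    refine sum_ext fun j => ?_
    rw [← sum_neg_distrib]
    refine sum_ext fun m => ?_
    rw [anti, neg_mul, smul_neg]
  have e3 : ∑ i, ∑ j, Q.ι (Q.γ i ψ) * Q.ι (Q.γ j φ) * Q.Λ.cov i (Q.Λ.cov j f) =
      - ∑ i, ∑ j, Q.ι (Q.γ i φ) * Q.ι (Q.γ j ψ) * Q.Λ.cov j (Q.Λ.cov i f) := by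
    rw [sum_comm]
    simp [← sum_neg_distrib]
    refine sum_ext fun i => sum_ext fun j => ?_
    rw [anti, neg_mul]
  have e4 : Q.fB (k := 2) F.curvT ![φ, ψ] f =
      ∑ i, ∑ j, Q.ι (Q.γ i φ) * Q.ι (Q.γ j ψ) * Q.Λ.r (F.curvM i j) f := by
    unfold fB
    rw [sum_cons]
    refine sum_ext fun i => ?_
    rw [sum_cons]
    simp
    refine sum_ext fun j => ?_
    simp only [u, W_apply, FCalc.endM_curvT, List.ofFn_succ, List.ofFn_zero, List.prod_cons,
      List.prod_nil, mul_one, mul_assoc]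
    rfl
  have h5 : ∀ i j, Q.Λ.cov i (Q.Λ.cov j f) = Q.Λ.cov j (Q.Λ.cov i f) + Q.Λ.r (F.curvM i j) f
      + ∑ m, F.Γ i m j • Q.Λ.cov m f - ∑ m, F.Γ j m i • Q.Λ.cov m f := fun p q => by
    have := Q.Λ.cov_comm p q f
    simp [FCalc.c, sub_smul] at this
    rw [sub_eq_iff_eq_add] at this
    rw [this]
    abel
  have h6 : ∑ i, ∑ j, Q.ι (Q.γ i φ) * Q.ι (Q.γ j ψ) * Q.Λ.cov i (Q.Λ.cov j f) = _ :=
    sum_ext fun i => sum_ext fun j =>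
      congrArg (Q.ι (Q.γ i φ) * Q.ι (Q.γ j ψ) * ·) (h5 i j)
  rw [hone φ ψ hφ hψ, hone ψ φ hψ hφ, e1, e2, e3, e4, h6]
  unfold FMod.lieD
  rw [hK, map_zero, LinearMap.zero_apply, sub_zero]
  have h7 : ∀ i, Q.C ψ (Q.γ i φ) = Q.C φ (Q.γ i ψ) := fun i => Q.C_γ i ψ φ
  have h8 := Q.int_int φ ψ f
  rw [← eq_neg_iff_add_eq_zero] at h8
  simp [h7, h8, two_mul, add_smul, mul_add, mul_sub, sum_add]
  abel

end SFrame

variable {K : Type*} [RCLike K] {n : ℕ} {M : Type*} [TopologicalSpace M] [ChartedSpace (Model n) M]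

/-! ### Calculus of scalar functions -/

section Scalar

variable {x : M} {f g : M → K} {U : Set M}

abbrev DiffAt (n : ℕ) {M : Type*} [TopologicalSpace M] [ChartedSpace (Model n) M]
    (f : M → K) (x : M) : Prop :=
  MDifferentiableAt Mod(n) 𝓘(ℝ, K) f x

abbrev CSmooth (n : ℕ) {M : Type*} [TopologicalSpace M] [ChartedSpace (Model n) M]
    (f : M → K) (U : Set M) : Prop :=
  ContMDiffOn Mod(n) 𝓘(ℝ, K) ∞ f U

abbrev VecField (n : ℕ) (M : Type*) [TopologicalSpace M] [ChartedSpace (Model n) M] : Type _ :=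
  (x : M) → Tan(n) x

lemma CSmooth.diffAt {f : M → K} (hf : CSmooth n f U) (hU : IsOpen U) (hx : x ∈ U) : DiffAt n f x :=
  ((hf x hx).contMDiffAt (hU.mem_nhds hx)).mdifferentiableAt (by simp)

lemma scalDeriv_congr (h : f =ᶠ[nhds x] g) (v : Tan(n) x) : scalDeriv K f x v = scalDeriv K g x v :=
  congrArg (fun T : Tan(n) x →L[ℝ] K => T v) h.mfderiv_eq

lemma scalDeriv_congr_on (hU : IsOpen U) (h : ∀ y ∈ U, f y = g y) (hx : x ∈ U) (v : Tan(n) x) :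
    scalDeriv K f x v = scalDeriv K g x v :=
  scalDeriv_congr (Filter.eventuallyEq_of_mem (hU.mem_nhds hx) h) v

lemma scalDeriv_const (c : K) (x : M) (v : Tan(n) x) : scalDeriv K (fun _ : M => c) x v = 0 := by
  unfold scalDeriv
  rw [mfderiv_const]
  rfl

lemma scalDeriv_vsmul (f : M → K) (x : M) (c : ℝ) (v : Tan(n) x) :
    scalDeriv K f x (c • v) = (c : K) * scalDeriv K f x v :=
  (map_smul (mfderiv Mod(n) 𝓘(ℝ, K) f x) c v).trans
    (RCLike.real_smul_eq_coe_mul c (scalDeriv K f x v))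

lemma scalDeriv_vsum {ι : Type*} (s : Finset ι) (f : M → K) (x : M) (v : ι → Tan(n) x) :
    scalDeriv K f x (∑ i ∈ s, v i) = ∑ i ∈ s, scalDeriv K f x (v i) :=
  map_sum (mfderiv Mod(n) 𝓘(ℝ, K) f x) v s

lemma scalDeriv_clm {K' : Type*} [RCLike K'] (T : K →L[ℝ] K') {f : M → K} (hf : DiffAt n f x)
    (v : Tan(n) x) : scalDeriv K' (fun y => T (f y)) x v = T (scalDeriv K f x v) :=
  congrArg (fun T : Tan(n) x →L[ℝ] K' => T v)
    ((T.hasMFDerivAt (x := f x)).comp x hf.hasMFDerivAt).mfderiv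

lemma DiffAt.clm {K' : Type*} [RCLike K'] (T : K →L[ℝ] K') {f : M → K} (hf : DiffAt n f x) :
    DiffAt n (fun y => T (f y)) x :=
  ((T.hasMFDerivAt (x := f x)).comp x hf.hasMFDerivAt).mdifferentiableAt

lemma CSmooth.clm {K' : Type*} [RCLike K'] (T : K →L[ℝ] K') {f : M → K} (hf : CSmooth n f U) :
    CSmooth n (fun y => T (f y)) U :=
  T.contDiff.contMDiff.comp_contMDiffOn hf

lemma DiffAt.add' (hf : DiffAt n f x) (hg : DiffAt n g x) : DiffAt n (fun y => f y + g y) x :=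
  (hf.hasMFDerivAt.add hg.hasMFDerivAt).mdifferentiableAt

lemma DiffAt.mul' (hf : DiffAt n f x) (hg : DiffAt n g x) : DiffAt n (fun y => f y * g y) x :=
  (hf.hasMFDerivAt.mul hg.hasMFDerivAt).mdifferentiableAt

lemma scalDeriv_add' (hf : DiffAt n f x) (hg : DiffAt n g x) (v : Tan(n) x) :
    scalDeriv K (fun y => f y + g y) x v = scalDeriv K f x v + scalDeriv K g x v :=
  congrArg (fun T : Tan(n) x →L[ℝ] K => T v)
    (hf.hasMFDerivAt.add hg.hasMFDerivAt).mfderiv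

lemma scalDeriv_mul' (hf : DiffAt n f x) (hg : DiffAt n g x) (v : Tan(n) x) :
    scalDeriv K (fun y => f y * g y) x v = scalDeriv K f x v * g x + f x * scalDeriv K g x v := by
  have h := congrArg (fun T : Tan(n) x →L[ℝ] K => T v)
    (hf.hasMFDerivAt.mul hg.hasMFDerivAt).mfderiv
  refine h.trans ?_
  change f x * scalDeriv K g x v + g x * scalDeriv K f x v = _
  ring

lemma scalDeriv_sum {ι : Type*} (s : Finset ι)
    {f : ι → M → K} (hf : ∀ i, DiffAt n (f i) x) (v : Tan(n) x) : DiffAt n (fun y => ∑ i ∈ s, f i y)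
    x ∧ scalDeriv K (fun y => ∑ i ∈ s, f i y) x v = ∑ i ∈ s, scalDeriv K (f i) x v := by
  classical
  induction s using Finset.induction_on with
  | empty =>
    simp [scalDeriv_const]
    exact mdifferentiableAt_const
  | insert a s ha ih =>
    simp [sum_insert ha]
    exact ⟨(hf a).add' ih.1, by rw [scalDeriv_add' (hf a) ih.1, ih.2]⟩

lemma CSmooth.mul' (hf : CSmooth n f U) (hg : CSmooth n g U) : CSmooth n (fun y => f y * g y) U :=
    by
  have e1 : ContMDiffOn Mod(n) 𝓘(ℝ, K × K) ∞ (fun x => (f x, g x)) U := hf.prodMk_space hg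
  have e2 : ContMDiff 𝓘(ℝ, K × K) 𝓘(ℝ, K) ∞ (fun p : K × K => p.1 * p.2) :=
    (contDiff_fst.mul contDiff_snd).contMDiff
  exact e2.comp_contMDiffOn e1

lemma CSmooth.cast {f : M → ℝ} (hf : CSmooth n f U) : CSmooth n (fun y => ((f y : ℝ) : K)) U :=
  hf.clm RCLike.ofRealCLM

lemma scalDeriv_cast {f : M → ℝ} (hf : DiffAt n f x) (v : Tan(n) x) :
    scalDeriv K (fun y => ((f y : ℝ) : K)) x v = ((scalDeriv ℝ f x v : ℝ) : K) :=
  scalDeriv_clm (RCLike.ofRealCLM (K := K)) hf v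

lemma re_scalDeriv {f : M → K} (hf : DiffAt n f x) (v : Tan(n) x) :
    RCLike.re (scalDeriv K f x v) = scalDeriv ℝ (fun y => RCLike.re (f y)) x v :=
  (scalDeriv_clm (RCLike.reCLM (K := K)) hf v).symm

lemma im_scalDeriv {f : M → K} (hf : DiffAt n f x) (v : Tan(n) x) :
    RCLike.im (scalDeriv K f x v) = scalDeriv ℝ (fun y => RCLike.im (f y)) x v :=
  (scalDeriv_clm (RCLike.imCLM (K := K)) hf v).symm

lemma lie_congr {V V' W W' : VecField n M} (hU : IsOpen U) (hV : ∀ x ∈ U, V x = V' x)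
    (hW : ∀ x ∈ U, W x = W' x) (hx : x ∈ U) : Lie(n) V W x = Lie(n) V' W' x :=
  Filter.EventuallyEq.mlieBracket_vectorField_eq
    (Filter.eventuallyEq_of_mem (hU.mem_nhds hx) hV) (Filter.eventuallyEq_of_mem (hU.mem_nhds hx) hW)

end Scalar

section Fields

variable [IsManifold Mod(n) ∞ M]

variable {U : Set M} {V W : VecField n M} {x : M} {f : M → ℝ}

def SmField (V : VecField n M) (U : Set M) : Prop := ContMDiffOn Mod(n) Mod(n).tangent ∞
    (fun x => (Bundle.TotalSpace.mk' (Model n) x (V x) : TangentBundle Mod(n) M)) U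

lemma SmField.contMDiffAt {V : VecField n M} (hV : SmField V U) (hU : IsOpen U) (hx : x ∈ U) :
    ContMDiffAt Mod(n) Mod(n).tangent
    ∞ (fun x => (Bundle.TotalSpace.mk' (Model n) x (V x) : TangentBundle Mod(n) M)) x :=
  (hV x hx).contMDiffAt (hU.mem_nhds hx)

lemma SmField.mdiffAt {V : VecField n M} (hV : SmField V U) (hU : IsOpen U) (hx : x ∈ U) :
    MDifferentiableAt Mod(n) Mod(n).tangent
    (fun x => (Bundle.TotalSpace.mk' (Model n) x (V x) : TangentBundle Mod(n) M)) x :=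
  (hV.contMDiffAt hU hx).mdifferentiableAt (by simp)

lemma CSmooth.scalDeriv {f : M → K} {V : VecField n M} (hU : IsOpen U)
    (hf : CSmooth n f U) (hV : SmField V U) : CSmooth n (fun x => scalDeriv K f x (V x)) U := by
  have : IsManifold Mod(n) 1 M := IsManifold.of_le (n := ∞) (by simp)
  have h1 : ContMDiffOn Mod(n).tangent 𝓘(ℝ, K).tangent ∞
      (tangentMapWithin Mod(n) 𝓘(ℝ, K) f U) _ :=
    hf.contMDiffOn_tangentMapWithin (m := ∞) (by simp) hU.uniqueMDiffOn
  have h2 := h1.comp hV (fun x hx => hx)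
  have h3 := (contMDiff_snd_tangentBundle_modelSpace (n := ∞) K 𝓘(ℝ, K)).comp_contMDiffOn h2
  refine h3.congr fun x hx => ?_
  change mfderiv Mod(n) 𝓘(ℝ, K) f x (V x) = mfderivWithin Mod(n) 𝓘(ℝ, K) f U x (V x)
  rw [mfderivWithin_of_isOpen hU hx]

lemma SmField.smul {V : VecField n M} (hf : CSmooth n f U) (hV : SmField V U) :
    SmField (fun x => f x • V x) U :=
  hf.smul_section hV

lemma SmField.add (hV : SmField V U) (hW : SmField W U) : SmField (fun x => V x + W x) U :=
  hV.add_section hW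

lemma SmField.lie (hU : IsOpen U) (hV : SmField V U) (hW : SmField W U) : SmField (Lie(n) V W) U :=
    fun x hx => by
  have : IsManifold Mod(n) (minSmoothness ℝ 2) M :=
    IsManifold.of_le (n := ∞) (by simpa using (ENat.LEInfty.out : (2 : WithTop ℕ∞) ≤ ∞))
  have : IsManifold Mod(n) ((⊤ : ℕ∞) + 1) M := by simpa using! ‹IsManifold Mod(n) ∞ M›
  exact (ContMDiffAt.mlieBracket_vectorField (m := ⊤) (n := ⊤) (hV.contMDiffAt hU hx)
    (hW.contMDiffAt hU hx) (by simp)).contMDiffWithinAt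

lemma lie_smul_right (V : VecField n M)
    {W : VecField n M} (hU : IsOpen U) (hf : CSmooth n f U) (hW : SmField W U) (hx : x ∈ U) :
    Lie(n) V (fun x => f x • W x) x = scalDeriv ℝ f x (V x) • W x + f x • Lie(n) V W x := by
  have : IsManifold Mod(n) 2 M := IsManifold.of_le (n := ∞) ENat.LEInfty.out
  exact VectorField.mlieBracket_smul_right (hf.diffAt hU hx) (hW.mdiffAt hU hx)

lemma lie_add_right (V : VecField n M)
    {W W' : VecField n M} (hU : IsOpen U) (hW : SmField W U) (hW' : SmField W' U) (hx : x ∈ U) :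
    Lie(n) V (fun x => W x + W' x) x = Lie(n) V W x + Lie(n) V W' x := by
  have : IsManifold Mod(n) 2 M := IsManifold.of_le (n := ∞) ENat.LEInfty.out
  exact VectorField.mlieBracket_add_right (hW.mdiffAt hU hx) (hW'.mdiffAt hU hx)

lemma SmField.zero (U : Set M) : SmField (fun x => (0 : Tan(n) x)) U :=
  (Bundle.contMDiff_zeroSection ℝ (Tan(n))).contMDiffOn

lemma SmField.sum {ι : Type*} (s : Finset ι) {f : ι → M → ℝ} {W : ι → VecField n M} (hf : ∀ i,
    CSmooth n (f i) U) (hW : ∀ i, SmField (W i) U) : SmField (fun x => ∑ i ∈ s, f i x • W i x) U :=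
    by
  classical
  induction s using Finset.induction_on with
  | empty => exact SmField.zero U
  | insert a s ha ih =>
    simp [sum_insert ha]
    exact ((hW a).smul (hf a)).add ih

lemma lie_sum_right {ι : Type*} (s : Finset ι) (V : VecField n M)
    {f : ι → M → ℝ} {W : ι → VecField n M} (hU : IsOpen U) (hf : ∀ i, CSmooth n (f i) U)
    (hW : ∀ i, SmField (W i) U) (hx : x ∈ U) : Lie(n) V (fun x => ∑ i ∈ s, f i x • W i x) x =
    ∑ i ∈ s, (scalDeriv ℝ (f i) x (V x) • W i x + f i x • Lie(n) V (W i) x) := by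
  classical
  induction s using Finset.induction_on with
  | empty =>
    simp
    exact congrFun VectorField.mlieBracket_zero_right x
  | insert a s ha ih =>
    simp [sum_insert ha]
    rw [lie_add_right V hU ((hW a).smul (hf a)) (SmField.sum s hf hW) hx, ih,
      lie_smul_right V hU (hf a) (hW a) hx]

lemma lie_sum_left {ι : Type*} (s : Finset ι) (V : VecField n M)
    {f : ι → M → ℝ} {W : ι → VecField n M} (hU : IsOpen U) (hf : ∀ i, CSmooth n (f i) U)
    (hW : ∀ i, SmField (W i) U) (hx : x ∈ U) : Lie(n) (fun x => ∑ i ∈ s, f i x • W i x) V x =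
    ∑ i ∈ s, (f i x • Lie(n) (W i) V x - scalDeriv ℝ (f i) x (V x) • W i x) := by
  rw [VectorField.mlieBracket_swap_apply, lie_sum_right s V hU hf hW hx, ← sum_neg_distrib]
  refine sum_congr rfl fun i _ => ?_
  rw [VectorField.mlieBracket_swap_apply (V := W i), smul_neg]
  abel

lemma lie_jacobi {V W Z : VecField n M}
    (hU : IsOpen U) (hV : SmField V U) (hW : SmField W U) (hZ : SmField Z U) (hx : x ∈ U) :
    Lie(n) V (Lie(n) W Z) x = Lie(n) (Lie(n) V W) Z x + Lie(n) W (Lie(n) V Z) x := by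
  have : IsManifold Mod(n) (minSmoothness ℝ 3) M :=
    IsManifold.of_le (n := ∞) (by simpa using (ENat.LEInfty.out : (3 : WithTop ℕ∞) ≤ ∞))
  have h : minSmoothness ℝ 2 ≤ (∞ : WithTop ℕ∞) := by
    simpa using (ENat.LEInfty.out : (2 : WithTop ℕ∞) ≤ ∞)
  exact VectorField.leibniz_identity_mlieBracket_apply ((hV.contMDiffAt hU hx).of_le h)
    ((hW.contMDiffAt hU hx).of_le h) ((hZ.contMDiffAt hU hx).of_le h)

lemma scalDeriv_comm_real (hU : IsOpen U) (hf : CSmooth n f U) (hV : SmField V U) (hW : SmField W U)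
    (hx : x ∈ U) (h0 : V x ≠ 0) : scalDeriv ℝ (fun y => scalDeriv ℝ f y (W y)) x (V x)
    - scalDeriv ℝ (fun y => scalDeriv ℝ f y (V y)) x (W x) = scalDeriv ℝ f x (Lie(n) V W x) := by
  have hVW := hV.lie hU hW
  have hWV := hW.lie hU hV
  have hVV := hV.lie hU hV
  have hfW := CSmooth.scalDeriv hU hf hW
  have hfV := CSmooth.scalDeriv hU hf hV
  have key := lie_jacobi hU hV hW (hV.smul hf) hx
  have e1 : Lie(n) V (Lie(n) W (fun x => f x • V x)) x = _ :=
    (lie_congr hU (fun _ _ => rfl) (fun y hy => lie_smul_right W hU hf hV hy) hx).trans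
      (lie_add_right V hU (hV.smul hfW) (hWV.smul hf) hx)
  have e2 : Lie(n) W (Lie(n) V (fun x => f x • V x)) x = _ :=
    (lie_congr hU (fun _ _ => rfl) (fun y hy => lie_smul_right V hU hf hV hy) hx).trans
      (lie_add_right W hU (hV.smul hfV) (hVV.smul hf) hx)
  rw [e1, e2, lie_smul_right V hU hfW hV hx, lie_smul_right V hU hf hWV hx,
    lie_smul_right W hU hfV hV hx, lie_smul_right W hU hf hVV hx, lie_smul_right _ hU hf hV hx,
    lie_jacobi hU hV hW hV hx, VectorField.mlieBracket_self] at key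
  have h2 : (scalDeriv ℝ (fun y => scalDeriv ℝ f y (W y)) x (V x) -
      scalDeriv ℝ (fun y => scalDeriv ℝ f y (V y)) x (W x) -
      scalDeriv ℝ f x (Lie(n) V W x)) • V x = 0 := by
    simp at key
    simp [sub_smul]
    rw [← sub_eq_zero] at key
    rw [← key]
    abel
  have h3 := (smul_eq_zero.mp h2).resolve_right h0
  linarith

lemma scalDeriv_comm {f : M → K} (hU : IsOpen U) (hf : CSmooth n f U) (hV : SmField V U) (hW :
    SmField W U) (hx : x ∈ U) (h0 : V x ≠ 0) : scalDeriv K (fun y => scalDeriv K f y (W y)) x (V x)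
    - scalDeriv K (fun y => scalDeriv K f y (V y)) x (W x) = scalDeriv K f x (Lie(n) V W x) := by
  have hfW := CSmooth.scalDeriv hU hf hW
  have hfV := CSmooth.scalDeriv hU hf hV
  have hre : CSmooth n (fun y => RCLike.re (f y)) U := hf.clm RCLike.reCLM
  have him : CSmooth n (fun y => RCLike.im (f y)) U := hf.clm RCLike.imCLM
  refine RCLike.ext ?_ ?_
  · rw [map_sub, re_scalDeriv (hfW.diffAt hU hx), re_scalDeriv (hfV.diffAt hU hx),
      re_scalDeriv (hf.diffAt hU hx), ← scalDeriv_comm_real hU hre hV hW hx h0]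
    congr 1
    · exact scalDeriv_congr_on hU (fun y hy => re_scalDeriv (hf.diffAt hU hy) _) hx _
    · exact scalDeriv_congr_on hU (fun y hy => re_scalDeriv (hf.diffAt hU hy) _) hx _
  · rw [map_sub, im_scalDeriv (hfW.diffAt hU hx), im_scalDeriv (hfV.diffAt hU hx),
      im_scalDeriv (hf.diffAt hU hx), ← scalDeriv_comm_real hU him hV hW hx h0]
    congr 1
    · exact scalDeriv_congr_on hU (fun y hy => im_scalDeriv (hf.diffAt hU hy) _) hx _
    · exact scalDeriv_congr_on hU (fun y hy => im_scalDeriv (hf.diffAt hU hy) _) hx _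

end Fields

/-! ### Calculus of functions with values in a finite dimensional vector space -/

section Vector

variable {W W' W'' : Type*}
  [AddCommGroup W] [Module K W] [AddCommGroup W'] [Module K W'] [AddCommGroup W''] [Module K W'']

variable {U : Set M}
variable (K) in
lemma dual_ext {v w : W} (h : ∀ l : W →ₗ[K] K, l v = l w) : v = w := by
  rw [← sub_eq_zero, ← Module.forall_dual_apply_eq_zero_iff K]
  intro l
  rw [map_sub, h, sub_self]

lemma SmoothOn.congr {f g : M → W} (hf : SmoothOn K n f U) (h : ∀ x ∈ U, g x = f x) :
    SmoothOn K n g U :=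
  fun l => (hf l).congr fun x hx => by simp [h x hx]

lemma SmoothOn.mono {f : M → W} {U V : Set M} (hf : SmoothOn K n f U) (h : V ⊆ U) :
    SmoothOn K n f V := fun l => (hf l).mono h

lemma SmoothOn.smul_vec {g : M → K} (hg : CSmooth n g U) (w : W) :
    SmoothOn K n (fun x => g x • w) U := fun l => by
  simp
  exact CSmooth.mul' hg contMDiffOn_const

lemma SmoothOn.sum {ι : Type*} (s : Finset ι) {f : ι → M → W} (hf : ∀ i, SmoothOn K n (f i) U) :
    SmoothOn K n (fun x => ∑ i ∈ s, f i x) U := fun l => by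
  simp
  exact contMDiffOn_finsetSum fun i _ => hf i l

lemma SmoothOn.csmooth {f : M → K} (hf : SmoothOn K n f U) : CSmooth n f U := hf LinearMap.id

lemma CSmooth.smoothOn {f : M → K} (hf : CSmooth n f U) : SmoothOn K n f U := by
  have := SmoothOn.smul_vec hf (1 : K)
  simpa using this

variable [Module.Finite K W] [Module.Finite K W']

lemma SmoothOn.bilin (β : W →ₗ[K] W' →ₗ[K] W'') {f : M → W} {g : M → W'} {U : Set M}
    (hf : SmoothOn K n f U) (hg : SmoothOn K n g U) : SmoothOn K n (fun x => β (f x) (g x)) U := by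
  have h : (fun x => β (f x) (g x)) = fun x => ∑ i, ∑ j,
      ((finBasis K W).coord i (f x) * (finBasis K W').coord j (g x)) •
        β (finBasis K W i) (finBasis K W' j) := by
    funext x
    conv_lhs => rw [← (finBasis K W).sum_repr (f x), ← (finBasis K W').sum_repr (g x)]
    simp only [map_sum, map_smul, LinearMap.sum_apply, LinearMap.smul_apply, smul_sum,
      smul_smul, Module.Basis.coord_apply]
    rw [sum_comm]
    simp [mul_comm]
  rw [h]
  exact SmoothOn.sum _ fun i => SmoothOn.sum _ fun j =>
    SmoothOn.smul_vec (CSmooth.mul' (hf _) (hg _)) _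

variable [Module.Finite K W'']

variable {U : Set M} {f : M → W} {x : M}

lemma dirDeriv_congr {f g : M → W} (hU : IsOpen U)
    (h : ∀ y ∈ U, f y = g y) (hx : x ∈ U) (v : Tan(n) x) : dirDeriv K f x v = dirDeriv K g x v := by
  unfold dirDeriv
  refine sum_ext fun b => ?_
  rw [scalDeriv_congr_on hU (fun y hy => by rw [h y hy]) hx v]

lemma map_dirDeriv_dual (l : W →ₗ[K] K) (hU : IsOpen U) (hf : SmoothOn K n f U)
    (hx : x ∈ U) (v : Tan(n) x) : l (dirDeriv K f x v) = scalDeriv K (fun y => l (f y)) x v := by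
  have h : (fun y => l (f y)) = fun y => ∑ b, (finBasis K W).coord b (f y) *
      l (finBasis K W b) := by
    funext y
    conv_lhs => rw [← (finBasis K W).sum_repr (f y)]
    simp only [map_sum, map_smul, smul_eq_mul, Module.Basis.coord_apply]
  have hb : ∀ b, DiffAt n (fun y => (finBasis K W).coord b (f y)) x := fun b =>
    CSmooth.diffAt (hf _) hU hx
  have hc : ∀ b, DiffAt n (fun _ : M => l (finBasis K W b)) x := fun b =>
    mdifferentiableAt_const
  rw [h, (scalDeriv_sum _ (fun b => (hb b).mul' (hc b)) v).2]
  simp only [dirDeriv, map_sum, map_smul, smul_eq_mul, scalDeriv_mul' (hb _) (hc _),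
    scalDeriv_const, mul_zero, add_zero]

lemma dirDeriv_scalar {f : M → K} (hU : IsOpen U)
    (hf : SmoothOn K n f U) (hx : x ∈ U) (v : Tan(n) x) : dirDeriv K f x v = scalDeriv K f x v :=
  map_dirDeriv_dual LinearMap.id hU hf hx v

lemma map_dirDeriv (T : W →ₗ[K] W') (hU : IsOpen U) (hf : SmoothOn K n f U)
    (hx : x ∈ U) (v : Tan(n) x) : T (dirDeriv K f x v) = dirDeriv K (fun y => T (f y)) x v := by
  refine dual_ext K fun l => ?_
  rw [map_dirDeriv_dual l hU (hf.comp_linear T) hx, ← LinearMap.comp_apply,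
    map_dirDeriv_dual (l ∘ₗ T) hU hf hx]
  rfl

lemma dirDeriv_bilin (β : W →ₗ[K] W' →ₗ[K] W'') {g : M → W'} (hU : IsOpen U) (hf : SmoothOn K n f U)
    (hg : SmoothOn K n g U) (hx : x ∈ U) (v : Tan(n) x) : dirDeriv K (fun y => β (f y) (g y)) x v =
    β (dirDeriv K f x v) (g x) + β (f x) (dirDeriv K g x v) := by
  refine dual_ext K fun l => ?_
  rw [map_dirDeriv_dual l hU (hf.bilin β hg) hx]
  have h : (fun y => l (β (f y) (g y))) = fun y => ∑ i, ∑ j,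
      ((finBasis K W).coord i (f y) * (finBasis K W').coord j (g y)) *
        l (β (finBasis K W i) (finBasis K W' j)) := by
    funext x
    conv_lhs => rw [← (finBasis K W).sum_repr (f x), ← (finBasis K W').sum_repr (g x)]
    simp only [map_sum, map_smul, LinearMap.sum_apply, LinearMap.smul_apply, mul_sum,
      mul_assoc, Module.Basis.coord_apply, smul_eq_mul]
    rw [sum_comm]
    simp [mul_left_comm]
  have h1 : ∀ b, DiffAt n (fun y => (finBasis K W).coord b (f y)) x := fun b =>
    CSmooth.diffAt (hf _) hU hx
  have h2 : ∀ b, DiffAt n (fun y => (finBasis K W').coord b (g y)) x := fun b =>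
    CSmooth.diffAt (hg _) hU hx
  have hc : ∀ c : K, DiffAt n (fun _ : M => c) x := fun b => mdifferentiableAt_const
  have h3 : ∀ (F : M → W) (e : Tan(n) x) (w : W'),
      l (β (dirDeriv K F x e) w) = ∑ i, ∑ j, scalDeriv K (fun y => (finBasis K W).coord i (F y)) x e *
        (finBasis K W').coord j w * l (β (finBasis K W i) (finBasis K W' j)) := fun F e w => by
    conv_lhs => rw [← (finBasis K W').sum_repr w]
    simp only [dirDeriv, map_sum, map_smul, LinearMap.sum_apply, LinearMap.smul_apply,
      mul_sum, Module.Basis.coord_apply, smul_eq_mul]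
    rw [sum_comm]
    exact sum_ext fun _ => sum_ext fun _ => by ring
  have h4 : ∀ (F : M → W') (e : Tan(n) x) (w : W),
      l (β w (dirDeriv K F x e)) = ∑ i, ∑ j, (finBasis K W).coord i w *
        scalDeriv K (fun y => (finBasis K W').coord j (F y)) x e *
        l (β (finBasis K W i) (finBasis K W' j)) := fun F e w => by
    conv_lhs => rw [← (finBasis K W).sum_repr w]
    simp only [dirDeriv, map_sum, map_smul, LinearMap.sum_apply, LinearMap.smul_apply,
      mul_sum, Module.Basis.coord_apply, smul_eq_mul]
    rw [sum_comm]
    exact sum_ext fun _ => sum_ext fun _ => by ring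
  rw [map_add, h3, h4, h]
  have h5 : ∀ i, _ := fun i => scalDeriv_sum (univ) (fun j => ((h1 i).mul' (h2 j)).mul'
    (hc (l (β (finBasis K W i) (finBasis K W' j))))) v
  rw [(scalDeriv_sum _ (fun i => (h5 i).1) v).2, ← sum_add]
  refine sum_ext fun i => ?_
  rw [(h5 i).2, ← sum_add]
  refine sum_ext fun j => ?_
  rw [scalDeriv_mul' ((h1 i).mul' (h2 j)) (hc _), scalDeriv_mul' (h1 i) (h2 j), scalDeriv_const]
  ring

lemma dirDeriv_vsum {ι : Type*} (s : Finset ι) (f : M → W) (x : M) (c : ι → ℝ) (v : ι → Tan(n) x) :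
    dirDeriv K f x (∑ i ∈ s, c i • v i) = ∑ i ∈ s, (c i : K) • dirDeriv K f x (v i) := by
  simp [dirDeriv, scalDeriv_vsum, scalDeriv_vsmul, sum_smul, smul_sum, smul_smul]
  rw [sum_comm]

variable [IsManifold Mod(n) ∞ M]

lemma SmoothOn.dirDeriv {f : M → W} {V : VecField n M} {U : Set M} (hU : IsOpen U)
    (hf : SmoothOn K n f U) (hV : SmField V U) : SmoothOn K n (fun x => dirDeriv K f x (V x)) U :=
  SmoothOn.sum _ fun _ => SmoothOn.smul_vec (CSmooth.scalDeriv hU (hf _) hV) _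

lemma dirDeriv_comm {f : M → W} {V V' : VecField n M}
    {U : Set M} (hU : IsOpen U) (hf : SmoothOn K n f U) (hV : SmField V U) (hV' : SmField V' U)
    {x : M} (hx : x ∈ U) (h0 : V x ≠ 0) : dirDeriv K (fun y => dirDeriv K f y (V' y)) x (V x)
    - dirDeriv K (fun y => dirDeriv K f y (V y)) x (V' x) = dirDeriv K f x (Lie(n) V V' x) := by
  refine dual_ext K fun l => ?_
  rw [map_sub, map_dirDeriv_dual l hU (hf.dirDeriv hU hV') hx,
    map_dirDeriv_dual l hU (hf.dirDeriv hU hV) hx, map_dirDeriv_dual l hU hf hx,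
    ← scalDeriv_comm hU (hf l) hV hV' hx h0]
  congr 1
  · exact scalDeriv_congr_on hU (fun y hy => map_dirDeriv_dual l hU hf hy _) hx _
  · exact scalDeriv_congr_on hU (fun y hy => map_dirDeriv_dual l hU hf hy _) hx _

end Vector

section RealLinear

variable {W W' : Type*} [AddCommGroup W] [Module ℝ W]
  [Module.Finite ℝ W] [AddCommGroup W'] [Module K W'] [Module ℝ W'] [IsScalarTower ℝ K W']

lemma SmoothOn.real_linear (T : W →ₗ[ℝ] W') {f : M → W} {U : Set M} (hf : SmoothOn ℝ n f U) :
    SmoothOn K n (fun x => T (f x)) U := by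
  have h : (fun x => T (f x)) = fun x => ∑ b, (((finBasis ℝ W).coord b (f x) : ℝ) : K) •
      T (finBasis ℝ W b) := by
    funext x
    conv_lhs => rw [← (finBasis ℝ W).sum_repr (f x)]
    simp only [map_sum, map_smul, Module.Basis.coord_apply]
    exact sum_ext fun b => (algebraMap_smul K _ _).symm
  rw [h]
  exact SmoothOn.sum _ fun b => SmoothOn.smul_vec (CSmooth.cast (hf _)) _

lemma dirDeriv_real_linear [Module.Finite K W'] (T : W →ₗ[ℝ] W') {f : M → W}
    {U : Set M} (hU : IsOpen U) (hf : SmoothOn ℝ n f U) {x : M} (hx : x ∈ U) (v : Tan(n) x) :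
    dirDeriv K (fun y => T (f y)) x v = T (dirDeriv ℝ f x v) := by
  refine dual_ext K fun l => ?_
  rw [map_dirDeriv_dual l hU (hf.real_linear T) hx]
  have h : (fun x => l (T (f x))) = fun x => ∑ b, (((finBasis ℝ W).coord b (f x) : ℝ) : K) *
      l (T (finBasis ℝ W b)) := by
    funext x
    conv_lhs => rw [← (finBasis ℝ W).sum_repr (f x)]
    simp only [map_sum, map_smul, Module.Basis.coord_apply]
    refine sum_ext fun b => ?_
    rw [← algebraMap_smul K, map_smul, smul_eq_mul, RCLike.algebraMap_eq_ofReal]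
  have hb : ∀ b, DiffAt n (fun y => (finBasis ℝ W).coord b (f y)) x := fun b =>
    CSmooth.diffAt (hf _) hU hx
  have hb' : ∀ b, DiffAt n (fun y => (((finBasis ℝ W).coord b (f y) : ℝ) : K)) x := fun b =>
    (hb b).clm RCLike.ofRealCLM
  have hc : ∀ c : K, DiffAt n (fun _ : M => c) x := fun b => mdifferentiableAt_const
  rw [h, (scalDeriv_sum _ (fun b => (hb' b).mul' (hc _)) v).2]
  simp only [dirDeriv, map_sum, map_smul]
  refine sum_ext fun b => ?_
  rw [scalDeriv_mul' (hb' b) (hc _), scalDeriv_cast (hb b), scalDeriv_const, mul_zero, add_zero,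
    ← algebraMap_smul K, map_smul, smul_eq_mul, RCLike.algebraMap_eq_ofReal]

end RealLinear

/-! ### The space of smooth functions on an open set -/

@[ext]
structure Sm (K : Type*) [RCLike K] (n : ℕ) {M : Type*} [TopologicalSpace M] [ChartedSpace
    (Model n) M] (U : TopologicalSpace.Opens M) (W : Type*) [AddCommGroup W] [Module K W] where
  val : M → W
  smooth : SmoothOn K n val U
  zero_off : ∀ x ∉ U, val x = 0

namespace Sm

variable {U : TopologicalSpace.Opens M} {W W' W'' : Type*}
  [AddCommGroup W] [Module K W] [AddCommGroup W'] [Module K W'] [AddCommGroup W''] [Module K W'']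

lemma ext_on {f g : Sm K n U W} (h : ∀ x ∈ U, f.val x = g.val x) : f = g := by
  refine Sm.ext (funext fun x => ?_)
  by_cases hx : x ∈ U
  · exact h x hx
  · rw [f.zero_off x hx, g.zero_off x hx]

def mk' (f : M → W) (hf : SmoothOn K n f U) : Sm K n U W where
  val := (U : Set M).indicator f
  smooth := hf.congr fun x hx => Set.indicator_of_mem hx f
  zero_off x hx := Set.indicator_of_notMem hx f

lemma mk'_apply (f : M → W) (hf : SmoothOn K n f U) {x : M} (hx : x ∈ U) : (mk' f hf).val x = f x :=
    Set.indicator_of_mem (show x ∈ (U : Set M) from hx) f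

instance : Zero (Sm K n U W) := ⟨⟨fun _ => 0, SmoothOn.const 0 _, fun _ _ => rfl⟩⟩

instance : Add (Sm K n U W) := ⟨fun f g => ⟨fun x => f.val x + g.val x, f.smooth.add g.smooth,
  fun x hx => by rw [f.zero_off x hx, g.zero_off x hx, add_zero]⟩⟩

instance : Neg (Sm K n U W) := ⟨fun f => ⟨fun x => -f.val x,
  by simpa using f.smooth.smul (-1 : K), fun x hx => by rw [f.zero_off x hx, neg_zero]⟩⟩

lemma zero_val (x : M) : (0 : Sm K n U W).val x = 0 := rfl

lemma add_val (f g : Sm K n U W) (x : M) : (f + g).val x = f.val x + g.val x := rfl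

lemma neg_val (f : Sm K n U W) (x : M) : (-f).val x = -f.val x := rfl

instance : AddCommGroup (Sm K n U W) where
  add_assoc f g h := ext_on fun x _ => add_assoc _ _ _
  zero_add f := ext_on fun x _ => zero_add _
  add_zero f := ext_on fun x _ => add_zero _
  neg_add_cancel f := ext_on fun x _ => neg_add_cancel _
  add_comm f g := ext_on fun x _ => add_comm _ _
  nsmul := nsmulRec
  zsmul := zsmulRec

lemma sub_val (f g : Sm K n U W) (x : M) : (f - g).val x = f.val x - g.val x := by
  rw [sub_eq_add_neg, add_val, neg_val, sub_eq_add_neg]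

def evalHom (x : M) : Sm K n U W →+ W where
  toFun f := f.val x
  map_zero' := rfl
  map_add' _ _ := rfl

lemma sum_val {ι : Type*} (s : Finset ι) (f : ι → Sm K n U W) (x : M) :
    (∑ i ∈ s, f i).val x = ∑ i ∈ s, (f i).val x := map_sum (evalHom (K := K) x) f s

def map (T : W →ₗ[K] W') (f : Sm K n U W) : Sm K n U W' :=
  ⟨fun x => T (f.val x), f.smooth.comp_linear T, fun x hx => by rw [f.zero_off x hx, map_zero]⟩

lemma map_val (T : W →ₗ[K] W') (f : Sm K n U W) (x : M) : (map T f).val x = T (f.val x) := rfl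

def map₂ [Module.Finite K W] [Module.Finite K W']
    (β : W →ₗ[K] W' →ₗ[K] W'') (f : Sm K n U W) (g : Sm K n U W') : Sm K n U W'' :=
  ⟨fun x => β (f.val x) (g.val x), f.smooth.bilin β g.smooth,
    fun x hx => by rw [f.zero_off x hx, map_zero, LinearMap.zero_apply]⟩

lemma map₂_val [Module.Finite K W] [Module.Finite K W'] (β : W →ₗ[K] W' →ₗ[K] W'')
    (f : Sm K n U W) (g : Sm K n U W') (x : M) : (map₂ β f g).val x = β (f.val x) (g.val x) := rfl

section Algebra

variable {A : Type*} [Ring A] [Algebra K A] [Module.Finite K A]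

instance : Mul (Sm K n U A) := ⟨map₂ (LinearMap.mul K A)⟩

instance : One (Sm K n U A) := ⟨mk' (fun _ => 1) (SmoothOn.const 1 _)⟩

lemma mul_val (f g : Sm K n U A) (x : M) : (f * g).val x = f.val x * g.val x := rfl

lemma one_val {x : M} (hx : x ∈ U) : (1 : Sm K n U A).val x = 1 := mk'_apply _ _ hx

instance : Ring (Sm K n U A) where
  mul_assoc f g h := ext_on fun x _ => mul_assoc _ _ _
  one_mul f := ext_on fun x hx => by rw [mul_val, one_val hx, one_mul]
  mul_one f := ext_on fun x hx => by rw [mul_val, one_val hx, mul_one]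
  left_distrib f g h := ext_on fun x _ => mul_add _ _ _
  right_distrib f g h := ext_on fun x _ => add_mul _ _ _
  zero_mul f := ext_on fun x _ => zero_mul _
  mul_zero f := ext_on fun x _ => mul_zero _
  neg_add_cancel f := neg_add_cancel f
  zsmul := zsmulRec

end Algebra

instance : CommRing (Sm K n U K) where
  mul_comm f g := ext_on fun x _ => mul_comm _ _

instance (priority := 50) instSMul : SMul (Sm K n U K) (Sm K n U W) := ⟨fun f g => ⟨fun x => f.val x • g.val x, by
    intro l
    simp only [map_smul, smul_eq_mul]
    exact CSmooth.mul' f.smooth.csmooth (g.smooth l),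
  fun x hx => by rw [g.zero_off x hx, smul_zero]⟩⟩

lemma smul_val (f : Sm K n U K) (g : Sm K n U W) (x : M) : (f • g).val x = f.val x • g.val x := rfl

instance (priority := 50) instModule : Module (Sm K n U K) (Sm K n U W) where
  one_smul f := ext_on fun x hx => by rw [smul_val, one_val hx, one_smul]
  mul_smul f g h := ext_on fun x _ => mul_smul _ _ _
  smul_zero f := ext_on fun x _ => smul_zero _
  smul_add f g h := ext_on fun x _ => smul_add _ _ _
  add_smul f g h := ext_on fun x _ => add_smul _ _ _
  zero_smul f := ext_on fun x _ => zero_smul _ _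

section Algebra

variable {A : Type*} [Ring A] [Algebra K A] [Module.Finite K A]

instance (priority := 50) instAlgebra : Algebra (Sm K n U K) (Sm K n U A) :=
  Algebra.ofModule (fun f g h => ext_on fun x _ => smul_mul_assoc _ _ _)
    (fun f g h => ext_on fun x _ => mul_smul_comm _ _ _)

lemma algebraMap_val (f : Sm K n U K) {x : M} (hx : x ∈ U) :
    (algebraMap (Sm K n U K) (Sm K n U A) f).val x = algebraMap K A (f.val x) := by
  rw [Algebra.algebraMap_eq_smul_one, smul_val, one_val hx, Algebra.algebraMap_eq_smul_one]

end Algebra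

def const (w : W) : Sm K n U W := mk' (fun _ => w) (SmoothOn.const w _)

lemma const_val (w : W) {x : M} (hx : x ∈ U) : (const w : Sm K n U W).val x = w := mk'_apply _ _ hx

def mapL (T : W →ₗ[K] W') : Sm K n U W →ₗ[Sm K n U K] Sm K n U W' where
  toFun := map T
  map_add' f g := ext_on fun x _ => map_add T _ _
  map_smul' f g := ext_on fun x _ => map_smul T _ _

lemma mapL_val (T : W →ₗ[K] W') (f : Sm K n U W) (x : M) : (mapL T f).val x = T (f.val x) := rfl

def map₂L [Module.Finite K W] [Module.Finite K W'] (β : W →ₗ[K] W' →ₗ[K] W'') :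
    Sm K n U W →ₗ[Sm K n U K] Sm K n U W' →ₗ[Sm K n U K] Sm K n U W'' :=
  LinearMap.mk₂ _ (map₂ β)
    (fun f f' g => ext_on fun x _ => LinearMap.map_add₂ β _ _ _)
    (fun c f g => ext_on fun x _ => LinearMap.map_smul₂ β _ _ _)
    (fun f g g' => ext_on fun x _ => map_add (β _) _ _)
    (fun c f g => ext_on fun x _ => map_smul (β _) _ _)

def mapA {A : Type*} [Ring A] [Algebra K A] [Module.Finite K A] (T : A →ₐ[K] A) :
    Sm K n U A →ₐ[Sm K n U K] Sm K n U A :=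
  AlgHom.ofLinearMap (mapL T.toLinearMap)
    (ext_on fun x hx => by rw [mapL_val, one_val hx]; exact map_one T)
    (fun f g => ext_on fun x _ => map_mul T _ _)

def matVal (N : Mat(n) (Sm K n U K)) (x : M) : Mat(n) K := N.map fun f => f.val x

lemma matVal_mul (N N' : Mat(n) (Sm K n U K)) (x : M) :
    matVal (N * N') x = matVal N x * matVal N' x := by
  ext i j
  simp [matVal, mul_apply, sum_val, mul_val]

lemma matVal_sub (N N' : Mat(n) (Sm K n U K)) (x : M) :
    matVal (N - N') x = matVal N x - matVal N' x := by
  ext i j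
  simp [matVal, sub_val]

/-- The pointwise action of matrix valued functions, given a linear action of matrices. -/
def action (β : Mat(n) K →ₗ[K] End K W) :
    Mat(n) (Sm K n U K) →ₗ[Sm K n U K] End (Sm K n U K) (Sm K n U W) where
  toFun N := ∑ i, ∑ j, N i j • mapL (β (Matrix.single i j 1))
  map_add' N N' := by simp only [Matrix.add_apply, add_smul, sum_add]
  map_smul' f N := by
    simp only [Matrix.smul_apply, smul_eq_mul, mul_smul, smul_sum, RingHom.id_apply]

lemma action_val (β : Mat(n) K →ₗ[K] End K W) (N : Mat(n) (Sm K n U K)) (f : Sm K n U W) (x : M) :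
    (action β N f).val x = β (matVal N x) (f.val x) := by
  conv_rhs => rw [Matrix.matrix_eq_sum_single (matVal N x)]
  simp only [action, LinearMap.coe_mk, AddHom.coe_mk, LinearMap.sum_apply, sum_val, map_sum]
  refine sum_ext fun i => sum_ext fun j => ?_
  rw [LinearMap.smul_apply, smul_val, mapL_val, ← LinearMap.smul_apply, ← map_smul, Matrix.smul_single,
    smul_eq_mul, mul_one]
  rfl

section Deriv

variable [IsManifold Mod(n) ∞ M] [Module.Finite K W] [Module.Finite K W'] [Module.Finite K W'']

def deriv (V : VecField n M) (hV : SmField V (U : Set M)) : Sm K n U W →+ Sm K n U W :=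
  AddMonoidHom.mk' (fun f => mk' (fun x => dirDeriv K f.val x (V x)) (f.smooth.dirDeriv U.2 hV))
    fun f g => ext_on fun x hx => by
      rw [add_val, mk'_apply _ _ hx, mk'_apply _ _ hx, mk'_apply _ _ hx]
      exact dirDeriv_add U.2 f.smooth g.smooth hx _

variable {V V' : VecField n M} (hV : SmField V (U : Set M)) (hV' : SmField V' (U : Set M))

lemma deriv_val (f : Sm K n U W) {x : M} (hx : x ∈ U) :
    (deriv V hV f).val x = dirDeriv K f.val x (V x) :=
  mk'_apply _ (f.smooth.dirDeriv U.2 hV) hx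

lemma deriv_map (T : W →ₗ[K] W') (f : Sm K n U W) : deriv V hV (map T f) = map T (deriv V hV f) :=
  ext_on fun x hx => by
    rw [map_val, deriv_val hV _ hx, deriv_val hV _ hx, map_dirDeriv T U.2 f.smooth hx]
    rfl

lemma deriv_map₂ (β : W →ₗ[K] W' →ₗ[K] W'') (f : Sm K n U W) (g : Sm K n U W') :
    deriv V hV (map₂ β f g) = map₂ β (deriv V hV f) g + map₂ β f (deriv V hV g) :=
  ext_on fun x hx => by
    rw [add_val, map₂_val, map₂_val, deriv_val hV _ hx, deriv_val hV _ hx, deriv_val hV _ hx,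
      ← dirDeriv_bilin β U.2 f.smooth g.smooth hx]
    rfl

lemma deriv_smul (f : Sm K n U K) (g : Sm K n U W) :
    deriv V hV (f • g) = deriv V hV f • g + f • deriv V hV g :=
  deriv_map₂ hV (LinearMap.lsmul K W) f g

lemma deriv_const (w : W) : deriv V hV (const w) = (0 : Sm K n U W) := ext_on fun x hx => by
    rw [deriv_val hV _ hx, dirDeriv_congr U.2 (fun y hy => const_val w hy) hx]
    simp [dirDeriv, scalDeriv_const, zero_val]

lemma deriv_one {A : Type*} [Ring A] [Algebra K A] [Module.Finite K A] :
    deriv V hV 1 = (0 : Sm K n U A) := deriv_const hV 1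

def derivation (V : VecField n M) (hV : SmField V (U : Set M)) :
    Derivation ℤ (Sm K n U K) (Sm K n U K) where
  toLinearMap := (deriv V hV).toIntLinearMap
  map_one_eq_zero' := deriv_one hV
  leibniz' f g := by
    change deriv V hV (map₂ (LinearMap.mul K K) f g) = _
    rw [deriv_map₂]
    change deriv V hV f * g + f * deriv V hV g = f * deriv V hV g + g * deriv V hV f
    ring

lemma derivation_apply (f : Sm K n U K) : derivation (K := K) V hV f = deriv V hV f := rfl

lemma deriv_action (β : Mat(n) K →ₗ[K] End K W) (N : Mat(n) (Sm K n U K)) (f : Sm K n U W) : deriv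
    V hV (action β N f) = action β (mDeriv (derivation V hV) N) f + action β N (deriv V hV f) := by
  simp [action, LinearMap.sum_apply, ← sum_add, deriv_smul, mDeriv_apply, derivation_apply]
  refine sum_ext fun i => sum_ext fun j => ?_
  congr 2
  exact deriv_map hV _ f

end Deriv

end Sm

open Sm (ext_on mul_val add_val sub_val sum_val const_val action_val deriv_val zero_val neg_val)

variable [IsManifold Mod(n) ∞ M] {J : Type*}

lemma sgn_mul_self (u : ℤˣ) : sgn u * sgn u = 1 := by
  rcases Int.units_eq_one_or u with h | h <;> simp [sgn, h]

lemma sgn_ne_zero (u : ℤˣ) : sgn u ≠ 0 := fun h => by simpa [h] using sgn_mul_self u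

namespace SpinManifold

variable (G : SpinManifold n M J)

variable {a : J} {x : M}

/-! ### Orthonormal frames -/

def domO (a : J) : TopologicalSpace.Opens M := ⟨G.dom a, G.isOpen_dom a⟩

lemma smField_frame (a : J) (i : Fin n) : SmField (G.frame a i) (G.dom a) := G.frame_smooth a i

lemma csmooth_inner {V W : VecField n M} {U : Set M} (hV : SmField V U) (hW : SmField W U) :
    CSmooth n (fun x => G.metric.inner x (V x) (W x)) U := by
  have h := ContMDiffOn.clm_bundle_apply₂ (F₁ := Model n) (F₂ := Model n) (F₃ := ℝ)
    (E₁ := fun x : M => Tan(n) x) (E₂ := fun x : M => Tan(n) x)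
    (E₃ := fun _ : M => ℝ) (G.metric.contMDiff.contMDiffOn (s := U)) hV hW
  intro x hx
  have h2 := h x hx
  simp [Bundle.contMDiffWithinAt_totalSpace] at h2
  exact h2.2

lemma inner_sum_left {ι : Type*} (s : Finset ι) (x : M) (c : ι → ℝ) (v : ι → Tan(n) x) (w : Tan(n)
    x) : G.metric.inner x (∑ i ∈ s, c i • v i) w = ∑ i ∈ s, c i * G.metric.inner x (v i) w := by
  rw [map_sum, ContinuousLinearMap.sum_apply]
  simp

lemma frame_expansion (hx : x ∈ G.dom a) (v : Tan(n) x) :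
    v = ∑ m, (sgn (G.ε m) * G.metric.inner x v (G.frame a m x)) • G.frame a m x := by
  let T : Tan(n) x →ₗ[ℝ] (Fin n → ℝ) := LinearMap.pi fun m =>
      { toFun := fun w => G.metric.inner x w (G.frame a m x)
        map_add' := fun w w' => by rw [map_add, ContinuousLinearMap.add_apply]
        map_smul' := fun c w => by rw [map_smul, ContinuousLinearMap.smul_apply, RingHom.id_apply] }
  have hT : ∀ w m, T w m = G.metric.inner x w (G.frame a m x) := fun w m => rfl
  have hd : Module.finrank ℝ (Tan(n) x) = Module.finrank ℝ (Fin n → ℝ) := by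
    change Module.finrank ℝ (Model n) = _
    simp
  have : FiniteDimensional ℝ (Tan(n) x) := inferInstanceAs (FiniteDimensional ℝ (Model n))
  have hs : Function.Surjective T := fun c => by
    refine ⟨∑ m, (sgn (G.ε m) * c m) • G.frame a m x, funext fun m => ?_⟩
    rw [hT, inner_sum_left]
    simp [G.frame_orthonormal a x hx]
    linear_combination c m * sgn_mul_self (G.ε m)
  have hi := (LinearMap.injective_iff_surjective_of_finrank_eq_finrank hd).mpr hs
  refine hi (funext fun m => ?_)
  rw [hT, hT, inner_sum_left]
  simp [G.frame_orthonormal a x hx]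
  linear_combination -G.metric.inner x v (G.frame a m x) * sgn_mul_self (G.ε m)

lemma frame_ne_zero (hx : x ∈ G.dom a) (i : Fin n) : G.frame a i x ≠ 0 := fun h => by
  have := G.frame_orthonormal a x hx i i
  rw [h, map_zero, if_pos rfl] at this
  exact sgn_ne_zero _ this.symm

lemma csmooth_bracketCoeff (a : J) (i j k : Fin n) : CSmooth n (G.bracketCoeff a i j k) (G.dom a) :=
  G.csmooth_inner ((G.smField_frame a i).lie (G.isOpen_dom a) (G.smField_frame a j))
    (G.smField_frame a k)

lemma csmooth_conn (a : J) (i j k : Fin n) : CSmooth n (G.conn a i j k) (G.dom a) := by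
  have h := CSmooth.mul' (((G.csmooth_bracketCoeff a i j k).sub (G.csmooth_bracketCoeff a j k i)).add
    (G.csmooth_bracketCoeff a k i j)) (contMDiffOn_const (c := (1 / 2 : ℝ)))
  refine h.congr fun x _ => ?_
  simp [conn]
  ring

lemma csmooth_connUp (a : J) (i j k : Fin n) : CSmooth n (G.connUp a i j k) (G.dom a) :=
  CSmooth.mul' contMDiffOn_const (G.csmooth_conn a i j k)

lemma connUp_sub (a : J) (i j k : Fin n) (x : M) :
    G.connUp a i j k x - G.connUp a j i k x = sgn (G.ε k) * G.bracketCoeff a i j k x := by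
  rw [← G.conn_torsion]; unfold connUp; ring

lemma lie_frame (hx : x ∈ G.dom a) (i j : Fin n) : Lie(n) (G.frame a i) (G.frame a j) x =
    ∑ m, (G.connUp a i j m x - G.connUp a j i m x) • G.frame a m x := by
  rw [G.frame_expansion hx (Lie(n) (G.frame a i) (G.frame a j) x)]
  exact sum_ext fun m => by rw [connUp_sub]; rfl

lemma inner_frame_sum (hx : x ∈ G.dom a) (c : Fin n → ℝ) (l : Fin n) :
    G.metric.inner x (∑ m, c m • G.frame a m x) (G.frame a l x) = sgn (G.ε l) * c l := by
  rw [inner_sum_left]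
  simp [G.frame_orthonormal a x hx]
  ring

lemma frame_coeff_eq (hx : x ∈ G.dom a)
    {c c' : Fin n → ℝ} (h : ∑ m, c m • G.frame a m x = ∑ m, c' m • G.frame a m x) : c = c' := by
  funext l
  have := congrArg (fun v => G.metric.inner x v (G.frame a l x)) h
  simp only [G.inner_frame_sum hx] at this
  exact mul_left_cancel₀ (sgn_ne_zero _) this

lemma csmooth_c (a : J) (i j k : Fin n) :
    CSmooth n (fun x => G.connUp a i j k x - G.connUp a j i k x) (G.dom a) :=
  (G.csmooth_connUp a i j k).sub (G.csmooth_connUp a j i k)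

lemma lie_lie_frame (hx : x ∈ G.dom a) (i j k : Fin n) :
    Lie(n) (G.frame a i) (Lie(n) (G.frame a j) (G.frame a k)) x = ∑ l, (scalDeriv
    ℝ (fun y => G.connUp a j k l y - G.connUp a k j l y) x (G.frame a i x) + ∑ m, (G.connUp a
    j k m x - G.connUp a k j m x) * (G.connUp a i m l x - G.connUp a m i l x)) • G.frame a l x := by
  rw [lie_congr (G.isOpen_dom a) (fun _ _ => rfl) (fun y hy => G.lie_frame hy j k) hx,
    lie_sum_right _ _ (G.isOpen_dom a) (fun m => G.csmooth_c a j k m) (G.smField_frame a) hx]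
  simp only [G.lie_frame hx, add_smul, sum_add, smul_sum, sum_smul, smul_smul]
  congr 1
  exact sum_comm

lemma jacobi_frame (hx : x ∈ G.dom a) (i j k l : Fin n) :
    (scalDeriv ℝ (fun y => G.connUp a j k l y - G.connUp a k j l y) x (G.frame a i x) +
    ∑ m, (G.connUp a j k m x - G.connUp a k j m x) * (G.connUp a i m l x - G.connUp a m i l x)) +
    (scalDeriv ℝ (fun y => G.connUp a k i l y - G.connUp a i k l y) x (G.frame a j x) +
    ∑ m, (G.connUp a k i m x - G.connUp a i k m x) * (G.connUp a j m l x - G.connUp a m j l x)) +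
    (scalDeriv ℝ (fun y => G.connUp a i j l y - G.connUp a j i l y) x (G.frame a k x) + ∑ m,
    (G.connUp a i j m x - G.connUp a j i m x) * (G.connUp a k m l x - G.connUp a m k l x)) = 0 := by
  have hf := G.smField_frame a
  have h := lie_jacobi (G.isOpen_dom a) (hf i) (hf j) (hf k) hx
  rw [VectorField.mlieBracket_swap_apply (V := VectorField.mlieBracket _ _ _),
    lie_congr (W := VectorField.mlieBracket _ (G.frame a i) (G.frame a k))
      (W' := fun y => (-1 : ℝ) • Lie(n) (G.frame a k) (G.frame a i) y)
      (G.isOpen_dom a) (fun _ _ => rfl)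
      (fun y _ => by rw [VectorField.mlieBracket_swap_apply, neg_one_smul]) hx,
    lie_smul_right (f := fun _ => (-1 : ℝ)) _ (G.isOpen_dom a) contMDiffOn_const
      ((hf k).lie (G.isOpen_dom a) (hf i)) hx, scalDeriv_const, zero_smul, zero_add, neg_one_smul,
    G.lie_lie_frame hx, G.lie_lie_frame hx, G.lie_lie_frame hx] at h
  rw [← sum_neg_distrib, ← sum_neg_distrib, ← sum_add] at h
  simp [← neg_smul, ← add_smul] at h
  have := congrFun (G.frame_coeff_eq hx h) l
  linear_combination this

/-! ### The calculus of a frame -/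

variable (K : Type*) [RCLike K] {U : TopologicalSpace.Opens M} {a : J}

variable (n) in
def realSm (U : TopologicalSpace.Opens M) (f : M → ℝ) : Sm K n U K := by
  classical
  exact if h : CSmooth n f U then Sm.mk' (fun x => (f x : K)) (CSmooth.smoothOn (CSmooth.cast h)) else 0

variable {K}

lemma realSm_val {f : M → ℝ} (h : CSmooth n f U) {x : M} (hx : x ∈ U) :
    (realSm n K U f).val x = (f x : K) := by
  rw [realSm, dif_pos h, Sm.mk'_apply _ _ hx]

lemma deriv_realSm {f : M → ℝ} (h : CSmooth n f U) {V : VecField n M} (hV : SmField V (U : Set M))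
    {x : M} (hx : x ∈ U) : (Sm.derivation (K := K) V hV (realSm n K U f)).val x = ((scalDeriv ℝ f x
    (V x) : ℝ) : K) := by
  rw [Sm.derivation_apply, deriv_val hV _ hx, dirDeriv_congr U.2 (fun y hy => realSm_val h hy) hx,
    dirDeriv_scalar U.2 (CSmooth.smoothOn (CSmooth.cast h)) hx, scalDeriv_cast (h.diffAt U.2 hx)]

lemma smField_frame' (hU : U ≤ G.domO a) (i : Fin n) : SmField (G.frame a i) (U : Set M) :=
    (G.smField_frame a i).mono hU

lemma comm_frame {W : Type*} [AddCommGroup W] [Module K W] [Module.Finite K W]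
    (hU : U ≤ G.domO a) (i j : Fin n) (f : Sm K n U W) : Sm.deriv _ (G.smField_frame' hU i)
    (Sm.deriv _ (G.smField_frame' hU j) f) - Sm.deriv _ (G.smField_frame' hU j)
    (Sm.deriv _ (G.smField_frame' hU i) f) = ∑ k, (realSm n K U (G.connUp a i j k)
    - realSm n K U (G.connUp a j i k)) • Sm.deriv _ (G.smField_frame' hU k) f := by
  refine ext_on fun x hx => ?_
  rw [sub_val, deriv_val _ _ hx, deriv_val _ _ hx,
    dirDeriv_congr U.2 (fun y hy => deriv_val _ _ hy) hx,
    dirDeriv_congr U.2 (fun y hy => deriv_val _ _ hy) hx,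
    dirDeriv_comm U.2 f.smooth (G.smField_frame' hU i) (G.smField_frame' hU j) hx
      (G.frame_ne_zero (hU hx) i), G.lie_frame (hU hx), dirDeriv_vsum, sum_val]
  refine sum_ext fun k => ?_
  rw [Sm.smul_val, sub_val, deriv_val _ _ hx, realSm_val ((G.csmooth_connUp a i j k).mono hU) hx,
    realSm_val ((G.csmooth_connUp a j i k).mono hU) hx]
  push_cast
  rfl

lemma realSm_sub_eq {f g : M → ℝ} (hf : CSmooth n f U) (hg : CSmooth n g U) :
    realSm n K U f - realSm n K U g = realSm n K U (fun x => f x - g x) :=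
  ext_on fun x hx => by
    rw [sub_val, realSm_val hf hx, realSm_val hg hx, realSm_val (hf.sub hg) hx]
    push_cast
    rfl

/-- The frame calculus of the Levi-Civita connection in the frame `a` over `U`. -/
def fCalc (hU : U ≤ G.domO a) : FCalc n (Sm K n U K) where
  ε i := Sm.const ((sgn (G.ε i) : ℝ) : K)
  D i := Sm.derivation (G.frame a i) (G.smField_frame' hU i)
  Γ i q p := realSm n K U (G.connUp a i p q)
  ε_mul_self i := ext_on fun x hx => by
    rw [mul_val, const_val _ hx, Sm.one_val hx, ← RCLike.ofReal_mul, sgn_mul_self,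
      RCLike.ofReal_one]
  D_ε i j := Sm.deriv_const (G.smField_frame' hU i) _
  skew i p q := ext_on fun x hx => by
    have h1 : CSmooth n (G.connUp a i p q) (U : Set M) := (G.csmooth_connUp a i p q).mono hU
    have h2 : CSmooth n (G.connUp a i q p) (U : Set M) := (G.csmooth_connUp a i q p).mono hU
    rw [add_val, mul_val, mul_val, const_val _ hx, const_val _ hx, realSm_val h1 hx,
      realSm_val h2 hx, zero_val]
    have : sgn (G.ε q) * G.connUp a i p q x + sgn (G.ε p) * G.connUp a i q p x = 0 := by
      unfold connUp
      rw [G.conn_skew a i q p]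
      linear_combination G.conn a i p q x * (sgn_mul_self (G.ε q) - sgn_mul_self (G.ε p))
    exact_mod_cast this
  comm i j f := G.comm_frame hU i j f
  jacobi i j k l := by
    have h : ∀ i p q, CSmooth n (G.connUp a i p q) (U : Set M) := fun i p q =>
      (G.csmooth_connUp a i p q).mono hU
    have h' : ∀ i p q, CSmooth n (fun x => G.connUp a i p q x - G.connUp a p i q x) (U : Set M) :=
      fun i p q => (G.csmooth_c a i p q).mono hU
    refine ext_on fun x hx => ?_
    have := G.jacobi_frame (hU hx) i j k l
    simp only [realSm_sub_eq (h _ _ _) (h _ _ _), add_val, deriv_realSm (h' _ _ _) _ hx, sum_val,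
      mul_val, realSm_val (h' _ _ _) hx, zero_val]
    exact_mod_cast this
  two_cancel f h := ext_on fun x hx => by
    have := congrArg (fun g => Sm.val g x) h
    simp only [two_mul, add_val, zero_val] at this ⊢
    rw [← two_mul] at this
    simpa using this

/-- The calculus of functions with values in a representation of the orthogonal Lie algebra. -/
def frameModule {W : Type*} [AddCommGroup W] [Module K W] [Module.Finite K W] (hU : U ≤ G.domO a)
    (β : Mat(n) K →ₗ[K] End K W) (hβ : ∀ N N' : Mat(n) K, (∀ p q, ((sgn (G.ε q) : ℝ) : K) * N q p +
    ((sgn (G.ε p) : ℝ) : K) * N p q = 0) → ∀ w, β (N * N' - N' * N) w = β N (β N' w) - β N' (β N w))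
    : FMod (G.fCalc (K := K) hU) (Sm K n U W) where
  D i := Sm.deriv (G.frame a i) (G.smField_frame' hU i)
  D_smul i f v := Sm.deriv_smul _ f v
  comm i j v := G.comm_frame hU i j v
  r := Sm.action β
  D_r i N v := Sm.deriv_action (G.smField_frame' hU i) β N v
  r_lie N N' hN v := ext_on fun x hx => by
    rw [sub_val]
    simp only [action_val, Sm.matVal_sub, Sm.matVal_mul]
    refine hβ _ _ (fun p q => ?_) _
    have := congrArg (fun g => Sm.val g x) (hN p q)
    simp only [add_val, mul_val, zero_val] at this
    rw [← this]
    congr 2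
    · exact (const_val (K := K) (n := n) (W := K) _ hx).symm
    · exact (const_val (K := K) (n := n) (W := K) _ hx).symm

end SpinManifold

lemma derivation_prod {R : Type*} [CommRing R] (d : Derivation ℤ R R) {k : ℕ} (f : Fin k → R) :
    d (∏ α, f α) = ∑ α, ∏ β, update f α (d (f α)) β := by
  induction k with
  | zero => simp
  | succ k ih =>
    rw [Fin.prod_univ_succ, Derivation.leibniz, ih, Fin.sum_univ_succ, smul_eq_mul, smul_eq_mul,
      mul_sum, add_comm]
    congr 1
    · rw [Fin.prod_univ_succ, update_self]
      simp [Fin.succ_ne_zero, mul_comm]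
    · refine sum_ext fun α => ?_
      rw [Fin.prod_univ_succ, update_of_ne (Fin.succ_ne_zero α).symm]
      congr 1
      refine prod_congr rfl fun β _ => ?_
      by_cases h : β = α
      · subst h; simp
      · rw [update_of_ne h, update_of_ne (by simpa using h)]

namespace FCalc

variable {n : ℕ} {R : Type*} [CommRing R] {F F' : FCalc n R} {k : ℕ}

lemma cov_ev (i : Fin n) (A : Tens n R k) (v : Fin k → Fin n → R) : F.vec.cov i (A.ev v) =
    ((F.tens k).cov i A).ev v + ∑ α, A.ev (update v α (F.vec.cov i (v α))) := by
  ext q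
  have h1 : ∀ α, A.ev (update v α (F.vec.cov i (v α))) q =
      (∑ I, (∏ β, update (fun β => v β (I β)) α (F.D i (v α (I α))) β) * A I q) +
      ∑ I, (∏ β, v β (I β)) * ∑ m, F.Γ i m (I α) * A (update I α m) q := fun α => by
    rw [show F.vec.cov i (v α) = F.vec.D i (v α) + fun m => ∑ p, F.Γ i m p * v α p from rfl,
      MultilinearMap.map_update_add, Pi.add_apply, Tens.ev_slot (g := fun p m => F.Γ i m p), Tens.ev_apply]
    congr 1
    refine sum_ext fun I => ?_
    congr 1
    refine prod_congr rfl fun β _ => ?_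
    by_cases h : β = α
    · subst h; simp [vec_D]
    · simp [h]
  rw [vec_cov, Pi.add_apply, Finset.sum_apply, sum_ext fun α => h1 α,
    sum_add, Tens.ev_apply, Tens.ev_apply]
  simp [tens_cov, derivation_prod, mul_add, mul_sub, sum_add, mul_sum, sum_mul, Tens.ev_apply]
  have e1 : ∑ I, ∑ α, A I q * ∏ β, update (fun β => v β (I β)) α (F.D i (v α (I α))) β =
      ∑ α, ∑ I, (∏ β, update (fun β => v β (I β)) α (F.D i (v α (I α))) β) * A I q := by
    rw [sum_comm]
    exact sum_ext fun _ => sum_ext fun _ => mul_comm _ _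
  have e2 : ∑ m, ∑ I, F.Γ i q m * ((∏ α, v α (I α)) * A I m) =
      ∑ I, ∑ m, (∏ α, v α (I α)) * (F.Γ i q m * A I m) := by
    rw [sum_comm]
    exact sum_ext fun _ => sum_ext fun _ => by ring
  have e3 : ∑ α, ∑ I, ∑ m, (∏ β, v β (I β)) * (F.Γ i m (I α) * A (update I α m) q) =
      ∑ I, ∑ α, ∑ m, (∏ β, v β (I β)) * (F.Γ i m (I α) * A (update I α m) q) :=
    sum_comm
  rw [e1, e2, e3]
  ring

/-- The relation between the calculi of two orthonormal frames, where `L` is the transition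
matrix. -/
structure Change (F F' : FCalc n R) (L : Mat(n) R) : Prop where
  ε_eq (i : Fin n) : F'.ε i = F.ε i
  orth (j k : Fin n) : ∑ i, F.ε i * L i j * L i k = if j = k then F.ε j else 0
  D_eq (j : Fin n) (f : R) : F'.D j f = ∑ i, L i j * F.D i f
  bracket (j k m : Fin n) : ∑ r, L m r * F'.c j k r =
    (∑ i, ∑ l, L i j * L l k * F.c i l m) + (F'.D j (L m k) - F'.D k (L m j))

namespace Change

variable {L : Mat(n) R} (h : Change F F' L)
include h

/-- The transformation of the connection, before multiplication by the inverse of `L`. -/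
lemma pairing (j k q : Fin n) : ∑ m, F.ε
    m * L m q * ((∑ i, L i j • F.Γ i) * L + mDeriv (F'.D j) L) m k = F.ε q * F'.Γ j q k := by
  set X : Fin n → Mat(n) R := fun j =>
    (∑ i, L i j • F.Γ i) * L + mDeriv (F'.D j) L with hX
  have hXa : ∀ j m k, X j m k = (∑ i, ∑ l, L i j * L l k * F.Γ i m l) + F'.D j (L m k) := fun j m k => by
    simp only [hX, Matrix.add_apply, mul_apply, Matrix.sum_apply, Matrix.smul_apply,
      smul_eq_mul, sum_mul, mDeriv_apply]
    refine congrArg₂ (· + ·) ?_ rfl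
    exact sum_ext fun _ => sum_ext fun _ => by ring
  have hskew : ∀ j k q, (∑ m, F.ε m * L m q * X j m k) + ∑ m, F.ε m * L m k * X j m q = 0 := fun j k q => by
    have h1 : (∑ m, ∑ i, ∑ l, F.ε m * L m q * (L i j * L l k * F.Γ i m l)) +
        ∑ m, ∑ i, ∑ l, F.ε m * L m k * (L i j * L l q * F.Γ i m l) = 0 := by
      have e : ∑ m, ∑ i, ∑ l, F.ε m * L m k * (L i j * L l q * F.Γ i m l) =
          ∑ m, ∑ i, ∑ l, F.ε l * L l k * (L i j * L m q * F.Γ i l m) := by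
        rw [sum_comm, sum_comm (s := univ (α := Fin n))
          (f := fun m i => ∑ l, F.ε l * L l k * (L i j * L m q * F.Γ i l m))]
        exact sum_ext fun _ => sum_comm
      rw [e, ← sum_add]
      refine sum_eq_zero fun m _ => ?_
      rw [← sum_add]
      refine sum_eq_zero fun i _ => ?_
      rw [← sum_add]
      refine sum_eq_zero fun l _ => ?_
      linear_combination L m q * L l k * L i j * F.skew i m l
    have h2 : (∑ m, F.ε m * L m q * F'.D j (L m k)) + ∑ m, F.ε m * L m k * F'.D j (L m q) = 0 := by
      have h3 := congrArg (F'.D j) (h.orth q k)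
      have h4 : F'.D j (if q = k then F.ε q else 0) = 0 := by
        split_ifs
        · rw [← h.ε_eq]; exact F'.D_ε j q
        · exact map_zero _
      rw [h4, map_sum] at h3
      rw [← h3, ← sum_add]
      refine sum_ext fun m => ?_
      have h5 : F'.D j (F.ε m) = 0 := by rw [← h.ε_eq]; exact F'.D_ε j m
      simp [h5]
      ring
    simp [hXa, mul_add, sum_add, mul_sum]
    linear_combination h1 + h2
  have htor : ∀ j k q, (∑ m, F.ε m * L m q * X j m k) - ∑ m, F.ε m * L m q * X k m j =
      F.ε q * F'.c j k q := fun j k q => by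
    have e : ∀ m, X j m k - X k m j = ∑ r, L m r * F'.c j k r := fun m => by
      rw [h.bracket, hXa, hXa]
      have : ∑ i, ∑ l, L i k * L l j * F.Γ i m l = ∑ i, ∑ l, L i j * L l k * F.Γ l m i := by
        rw [sum_comm]
        exact sum_ext fun _ => sum_ext fun _ => by ring
      rw [this]
      simp [c, mul_sub]
      ring
    rw [← sum_sub_distrib]
    simp [← mul_sub, e, mul_sum]
    rw [sum_comm]
    have : ∀ r, ∑ m, F.ε m * L m q * (L m r * F'.c j k r) =
        (if q = r then F.ε q else 0) * F'.c j k r := fun r => by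
      rw [← h.orth, sum_mul]
      exact sum_ext fun _ => by ring
    simp [this]
  set T : Fin n → Fin n → Fin n → R := fun j k q =>
    (∑ m, F.ε m * L m q * X j m k) - F.ε q * F'.Γ j q k with hT
  have ts : ∀ j k q, T j k q = T k j q := fun j k q => by
    have := htor j k q
    simp [c] at this
    simp [hT]
    linear_combination this
  have ta : ∀ j k q, T j k q = -T j q k := fun j k q => by
    have h1 := hskew j k q
    have h2 := F'.skew j k q
    rw [h.ε_eq, h.ε_eq] at h2
    simp [hT]
    linear_combination h1 - h2
  have : T j k q = 0 := by
    refine F.two_cancel _ ?_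
    have : T j k q = -T j k q := by
      calc T j k q = T k j q := ts _ _ _
        _ = -T k q j := ta _ _ _
        _ = -T q k j := by rw [ts]
        _ = T q j k := by rw [ta q j k]
        _ = T j q k := ts _ _ _
        _ = -T j k q := ta _ _ _
    linear_combination this
  exact sub_eq_zero.mp this

lemma orth' (i k : Fin n) : ∑ j, F.ε j * L i j * L k j = if i = k then F.ε i else 0 := by
  have h1 : (Matrix.diagonal F.ε * L.transpose * Matrix.diagonal F.ε) * L = 1 := by
    ext p q
    rw [mul_apply]
    simp
    have := congrArg (F.ε p * ·) (h.orth p q)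
    simp only [mul_sum] at this
    rw [show ∑ j, F.ε p * L j p * F.ε j * L j q = ∑ i, F.ε p * (F.ε i * L i p * L i q) from
      sum_ext fun _ => by ring, this, Matrix.one_apply]
    split_ifs
    · exact F.ε_mul_self p
    · exact mul_zero _
  have h2 := mul_eq_one_comm.mp h1
  have h3 := congrFun (congrFun h2 i) k
  rw [mul_apply] at h3
  simp at h3
  have := congrArg (F.ε k * ·) h3
  simp only [mul_sum, Matrix.one_apply] at this
  rw [show ∑ j, F.ε j * L i j * L k j = ∑ j, F.ε k * (L i j * (F.ε j * L k j * F.ε k)) from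
    sum_ext fun j => by linear_combination (-F.ε j * L i j * L k j) * F.ε_mul_self k,
    this]
  split_ifs with hik
  · rw [hik, mul_one]
  · exact mul_zero _

lemma Γ_eq (j : Fin n) : L * F'.Γ j = (∑ i, L i j • F.Γ i) * L + mDeriv (F'.D j) L := by
  ext p k
  rw [mul_apply]
  have e : ∀ q, L p q * F'.Γ j q k = ∑ m, (F.ε m * (F.ε q * L m q * L p q)) *
      ((∑ i, L i j • F.Γ i) * L + mDeriv (F'.D j) L) m k := fun q => by
    have := congrArg (L p q * F.ε q * ·) (h.pairing j k q)
    simp only [mul_sum] at this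
    rw [show L p q * F'.Γ j q k = L p q * F.ε q * (F.ε q * F'.Γ j q k) by
      linear_combination (-L p q * F'.Γ j q k) * F.ε_mul_self q, ← this]
    exact sum_ext fun m => by ring
  rw [sum_ext fun q => e q, sum_comm]
  simp [← sum_mul, ← mul_sum, h.orth', F.ε_mul_self]

lemma cov_mulVec (j : Fin n) (v : Fin n → R) :
    L.mulVec (F'.vec.cov j v) = ∑ i, L i j • F.vec.cov i (L.mulVec v) := by
  have h1 : L.mulVec (F'.vec.cov j v) = L.mulVec (F'.vec.D j v) + (L * F'.Γ j).mulVec v := by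
    rw [← Matrix.mulVec_mulVec, ← Matrix.mulVec_add]; rfl
  rw [h1, h.Γ_eq]
  ext p
  simp [vec_cov, mul_add, sum_add, ← h.D_eq, Matrix.add_mulVec, ← Matrix.mulVec_mulVec, Matrix.sum_mulVec, Matrix.smul_mulVec]
  have e : F'.D j (L.mulVec v p) = L.mulVec (F'.vec.D j v) p + (mDeriv (F'.D j) L).mulVec v p := by
    simp [Matrix.mulVec, dotProduct, mDeriv_apply, vec_D, ← sum_add]
    exact sum_ext fun _ => by ring
  rw [e]
  simp [Matrix.mulVec, dotProduct]
  ring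

lemma curvM_mulVec (j k : Fin n) (v : Fin n → R) : L.mulVec ((F'.curvM j k).mulVec v) =
    ∑ i, ∑ l, (L i j * L l k) • (F.curvM i l).mulVec (L.mulVec v) := by
  have e1 : ∀ j k, L.mulVec (F'.vec.cov j (F'.vec.cov k v)) =
      ∑ l, F'.D j (L l k) • F.vec.cov l (L.mulVec v) +
        ∑ i, ∑ l, (L i j * L l k) • F.vec.cov i (F.vec.cov l (L.mulVec v)) := fun j k => by
    rw [h.cov_mulVec, h.cov_mulVec k]
    simp only [F.vec.cov_sum, F.vec.cov_smul, smul_sum, smul_add, sum_add,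
      smul_smul, h.D_eq, sum_smul]
    congr 1
    exact sum_comm
  have e2 := congrArg L.mulVec (F'.vec.cov_comm j k v)
  rw [Matrix.mulVec_sub, e1, e1, Matrix.mulVec_add, vec_r, Tens.mulVec_sum] at e2
  have e3 : ∑ i, L.mulVec (F'.c j k i • F'.vec.cov i v) =
      ∑ m, (∑ r, L m r * F'.c j k r) • F.vec.cov m (L.mulVec v) := by
    simp [Matrix.mulVec_smul, h.cov_mulVec, smul_sum, sum_smul, smul_smul]
    rw [sum_comm]
    exact sum_ext fun _ => sum_ext fun _ => by rw [mul_comm]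
  have e4 : ∑ i, ∑ l, (L i k * L l j) • F.vec.cov i (F.vec.cov l (L.mulVec v)) =
      ∑ i, ∑ l, (L i j * L l k) • F.vec.cov l (F.vec.cov i (L.mulVec v)) := by
    rw [sum_comm]
    exact sum_ext fun _ => sum_ext fun _ => by rw [mul_comm]
  have e5 : ∑ i, ∑ l, (L i j * L l k) • (F.vec.cov i (F.vec.cov l (L.mulVec v)) -
      F.vec.cov l (F.vec.cov i (L.mulVec v))) =
      (∑ i, ∑ l, (L i j * L l k) • (F.curvM i l).mulVec (L.mulVec v)) +
      ∑ m, (∑ i, ∑ l, L i j * L l k * F.c i l m) • F.vec.cov m (L.mulVec v) := by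
    simp only [F.vec.cov_comm, vec_r, smul_add, sum_add, smul_sum, smul_smul, sum_smul]
    congr 1
    rw [Finset.sum_comm' (t' := univ) (s' := fun _ => univ) (by simp)]
    rw [sum_ext fun l => sum_comm, sum_comm]
    exact sum_ext fun _ => sum_comm
  rw [e3, e4] at e2
  simp only [h.bracket, add_smul, sub_smul, smul_sub, sum_add, sum_sub_distrib] at e2 e5
  linear_combination (norm := abel) e5 - e2

lemma curvT : Tens.Equivar L F.curvT F'.curvT := by
  rw [Tens.equivariant_iff]
  intro J q
  have := congrFun (h.curvM_mulVec (J 0) (J 1) (Pi.single (J 2) 1)) q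
  have e : ∀ i l, ((F.curvM i l).mulVec (L.mulVec (Pi.single (J 2) 1))) q =
      ∑ m, L m (J 2) * F.curvM i l q m := fun i l => by
    rw [Matrix.mulVec_single_one]
    simp [Matrix.mulVec, dotProduct, mul_comm]
  simp only [Finset.sum_apply, Pi.smul_apply, smul_eq_mul, e, mul_sum] at this
  have e2 : L.mulVec ((F'.curvM (J 0) (J 1)).mulVec (Pi.single (J 2) 1)) q =
      ∑ r, L q r * F'.curvT J r := by
    rw [Matrix.mulVec_single_one]
    simp [Matrix.mulVec, dotProduct, FCalc.curvT]
  rw [← e2, this, SGM.sum_cons]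
  refine sum_ext fun i => ?_
  rw [SGM.sum_cons]
  refine sum_ext fun l => ?_
  rw [SGM.sum_cons]
  refine sum_ext fun m => ?_
  rw [Fintype.sum_unique, Fin.prod_univ_three]
  simp [FCalc.curvT, mul_assoc]
  rfl

lemma nabla {A A' : Tens n R k} (hA : Tens.Equivar L A A') :
    Tens.Equivar L (F.nabla A) (F'.nabla A') := fun v => by
  have hA' : ∀ v, L.mulVec (A'.ev v) = A.ev fun α => L.mulVec (v α) := fun v => (hA v).symm
  have e : ∀ (F : FCalc n R) (A : Tens n R k) (v : Fin (k + 1) → Fin n → R),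
      (F.nabla A).ev v = ∑ i, v 0 i • ((F.tens k).cov i A).ev (Fin.tail v) := fun F A v => by
    conv_lhs => rw [← Fin.cons_self_tail v]
    ext q
    rw [Tens.ev_cons, Finset.sum_apply]
    refine sum_ext fun p => ?_
    rw [Pi.smul_apply, smul_eq_mul, Tens.ev_apply]
    rfl
  rw [e, e, Tens.mulVec_sum]
  have e2 : ∀ j, L.mulVec (((F'.tens k).cov j A').ev (Fin.tail v)) =
      ∑ i, L i j • ((F.tens k).cov i A).ev (fun α => L.mulVec (Fin.tail v α)) := fun j => by
    have h1 := congrArg L.mulVec (F'.cov_ev j A' (Fin.tail v))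
    rw [h.cov_mulVec, hA', Matrix.mulVec_add, Tens.mulVec_sum] at h1
    simp [cov_ev, sum_add, hA'] at h1
    have h2 : ∑ i, L i j • ∑ α, A.ev (update (fun α => L.mulVec (Fin.tail v α)) α
        (F.vec.cov i (L.mulVec (Fin.tail v α)))) =
        ∑ α, A.ev fun β => L.mulVec (update (Fin.tail v) α (F'.vec.cov j (Fin.tail v α)) β) := by
      simp [smul_sum]
      rw [sum_comm]
      refine sum_ext fun α => ?_
      rw [← Tens.mulVec_update, h.cov_mulVec, MultilinearMap.map_update_sum]
      simp
    rw [h2] at h1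
    exact (add_right_cancel h1).symm
  simp [Matrix.mulVec_smul, e2, smul_sum, smul_smul]
  rw [sum_comm]
  refine sum_ext fun i => ?_
  rw [← sum_smul]
  congr 1
  simp [Matrix.mulVec, dotProduct, mul_comm]

lemma nablaV (X : Fin n → R) : L * F'.nablaV X = F.nablaV (L.mulVec X) * L := by
  ext q p
  have := congrFun (h.cov_mulVec p X) q
  rw [Finset.sum_apply] at this
  rw [mul_apply, mul_apply]
  simp at this
  rw [show ∑ j, L q j * F'.nablaV X j p = L.mulVec (F'.vec.cov p X) q from rfl, this]
  exact sum_ext fun i => mul_comm _ _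

end Change

end FCalc

/-! ### Derivations of the exterior algebra -/

section Exterior

variable {K : Type*} [Field K] {S : Type*} [AddCommGroup S] [Module K S]

lemma gradeInv_ι (s : S) : gradeInv (ExteriorAlgebra.ι K s) = -ExteriorAlgebra.ι K s := by
  simp [gradeInv]

lemma gradeInv_gradeInv (a : Ext K S) : gradeInv (gradeInv a) = a := by
  induction a using ExteriorAlgebra.induction with
  | algebraMap r => simp
  | ι s => simp [gradeInv_ι]
  | mul a b ha hb => rw [map_mul, map_mul, ha, hb]
  | add a b ha hb => rw [map_add, map_add, ha, hb]

lemma ι_mul_eq (s : S) (a : Ext K S) :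
    ExteriorAlgebra.ι K s * a = gradeInv a * ExteriorAlgebra.ι K s := by
  induction a using ExteriorAlgebra.induction with
  | algebraMap r => rw [AlgHom.commutes]; exact (Algebra.commutes _ _).symm
  | ι t =>
    rw [gradeInv_ι, neg_mul, eq_neg_iff_add_eq_zero]
    exact ExteriorAlgebra.ι_add_mul_swap s t
  | mul a b ha hb => rw [map_mul, ← mul_assoc, ha, mul_assoc, hb, mul_assoc]
  | add a b ha hb => rw [mul_add, ha, hb, map_add, add_mul]

lemma interior_ι (d : Dual K S) (s : S) :
    interior d (ExteriorAlgebra.ι K s) = algebraMap K _ (d s) :=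
  CliffordAlgebra.contractLeft_ι _ _ _

lemma interior_algebraMap (d : Dual K S) (r : K) : interior d (algebraMap K (Ext K S) r) = 0 :=
  CliffordAlgebra.contractLeft_algebraMap _ _ _

lemma interior_ι_mul (d : Dual K S) (s : S) (a : Ext K S) :
    interior d (ExteriorAlgebra.ι K s * a) = d s • a - ExteriorAlgebra.ι K s * interior d a :=
  CliffordAlgebra.contractLeft_ι_mul _ _ _

lemma interior_mul (d : Dual K S) (a b : Ext K S) :
    interior d (a * b) = interior d a * b + gradeInv a * interior d b := by
  induction a using ExteriorAlgebra.induction generalizing b with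
  | algebraMap r =>
    rw [interior_algebraMap, zero_mul, zero_add, AlgHom.commutes, ← Algebra.smul_def, map_smul,
      Algebra.smul_def]
  | ι s =>
    rw [interior_ι_mul, interior_ι, gradeInv_ι, neg_mul, ← sub_eq_add_neg, ← Algebra.smul_def]
  | mul a a' ha ha' =>
    rw [mul_assoc, ha, ha', ha, map_mul, mul_add, add_mul, mul_assoc, mul_assoc, mul_assoc, add_assoc]
  | add a a' ha ha' => rw [add_mul, map_add, ha, ha', map_add, map_add, add_mul, add_mul]; abel

lemma interior_interior (d d' : Dual K S) (a : Ext K S) :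
    interior d (interior d' a) + interior d' (interior d a) = 0 := by
  rw [add_eq_zero_iff_eq_neg]
  exact CliffordAlgebra.contractLeft_comm d d' a

lemma interior_gradeInv (d : Dual K S) (a : Ext K S) :
    interior d (gradeInv a) = -gradeInv (interior d a) := by
  induction a using ExteriorAlgebra.induction with
  | algebraMap r => rw [AlgHom.commutes, interior_algebraMap, map_zero, neg_zero]
  | ι s => rw [gradeInv_ι, map_neg, interior_ι, AlgHom.commutes]
  | mul a b ha hb =>
    rw [map_mul, interior_mul, interior_mul, ha, hb, map_add, map_mul, map_mul]
    simp
    abel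
  | add a b ha hb => rw [map_add, map_add, ha, hb, map_add, map_add, neg_add]

lemma interior_add (d d' : Dual K S) (a : Ext K S) :
    interior (d + d') a = interior d a + interior d' a := by simp [interior]

lemma interior_smul (c : K) (d : Dual K S) (a : Ext K S) : interior (c • d) a = c • interior d a :=
    by simp [interior]

variable [Module.Finite K S]

lemma derivExt_apply (Φ : End K S) (a : Ext K S) : derivExt Φ a =
    ∑ b, ExteriorAlgebra.ι K (Φ (finBasis K S b)) * interior ((finBasis K S).coord b) a := by
  simp [derivExt]

lemma derivExt_ι (Φ : End K S) (s : S) :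
    derivExt Φ (ExteriorAlgebra.ι K s) = ExteriorAlgebra.ι K (Φ s) := by
  rw [derivExt_apply]
  conv_rhs => rw [← (finBasis K S).sum_repr s]
  simp only [map_sum, map_smul, interior_ι, Module.Basis.coord_apply]
  refine sum_ext fun b => ?_
  rw [← Algebra.commutes, ← Algebra.smul_def]

lemma derivExt_alg (Φ : End K S) (r : K) : derivExt Φ (algebraMap K _ r) = 0 := by
  simp [derivExt_apply, interior_algebraMap]

lemma derivExt_mul (Φ : End K S) (a b : Ext K S) :
    derivExt Φ (a * b) = derivExt Φ a * b + a * derivExt Φ b := by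
  simp only [derivExt_apply, interior_mul, mul_add, sum_add, sum_mul, mul_sum, ← mul_assoc]
  congr 1
  refine sum_ext fun c => ?_
  rw [ι_mul_eq _ (gradeInv a), gradeInv_gradeInv]

/-- Two linear maps that satisfy the same twisted Leibniz rule agree if they agree on the
generators. -/
lemma derivation_ext {A : Type*} [Ring A] [Algebra K A] (T : Ext K S →ₐ[K] A)
    {U V : Ext K S → A} (hU : ∀ a b, U (a + b) = U a + U b) (hV : ∀ a b, V (a + b) = V a + V b)
    (hUm : ∀ a b, U (a * b) = U a * T b + T a * U b) (hVm : ∀ a b, V (a * b) = V a * T b +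
    T a * V b) (h0 : ∀ r, U (algebraMap K _ r) = 0) (h0' : ∀ r, V (algebraMap K _ r) = 0)
    (h : ∀ s, U (ExteriorAlgebra.ι K s) = V (ExteriorAlgebra.ι K s)) (a : Ext K S) : U a = V a := by
  induction a using ExteriorAlgebra.induction with
  | algebraMap r => rw [h0, h0']
  | ι s => exact h s
  | mul a b ha hb => rw [hUm, hVm, ha, hb]
  | add a b ha hb => rw [hU, hV, ha, hb]

lemma derivExt_gradeInv (Φ : End K S) (a : Ext K S) :
    derivExt Φ (gradeInv a) = gradeInv (derivExt Φ a) := by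
  refine derivation_ext gradeInv (U := fun a => derivExt Φ (gradeInv a))
    (V := fun a => gradeInv (derivExt Φ a)) (fun a b => by simp)
    (fun a b => by simp) (fun a b => by simp [derivExt_mul])
    (fun a b => by simp [derivExt_mul])
    (fun r => by simp [derivExt_alg]) (fun r => by simp [derivExt_alg])
    (fun s => by simp [gradeInv_ι, derivExt_ι]) a

lemma map_derivExt (T Φ Ψ : End K S) (h : ∀ s, T (Φ s) = Ψ (T s)) (a : Ext K S) :
    ExteriorAlgebra.map T (derivExt Φ a) = derivExt Ψ (ExteriorAlgebra.map T a) := by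
  refine derivation_ext (ExteriorAlgebra.map T) (U := fun a => ExteriorAlgebra.map T (derivExt Φ a))
    (V := fun a => derivExt Ψ (ExteriorAlgebra.map T a))
    (fun a b => by simp) (fun a b => by simp) (fun a b => by simp [derivExt_mul])
    (fun a b => by simp [derivExt_mul])
    (fun r => by simp [derivExt_alg]) (fun r => by simp [derivExt_alg])
    (fun s => by simp [derivExt_ι, h]) a

lemma derivExt_lie (Φ Ψ : End K S) (a : Ext K S) :
    derivExt (Φ * Ψ - Ψ * Φ) a = derivExt Φ (derivExt Ψ a) - derivExt Ψ (derivExt Φ a) := by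
  refine derivation_ext (AlgHom.id K _) (U := fun a => derivExt (Φ * Ψ - Ψ * Φ) a)
    (V := fun a => derivExt Φ (derivExt Ψ a) - derivExt Ψ (derivExt Φ a))
    (fun a b => by simp) (fun a b => by simp; abel)
    (fun a b => by simp [id, derivExt_mul])
    (fun a b => by simp [id, derivExt_mul, sub_mul, mul_sub]; abel)
    (fun r => by simp [derivExt_alg]) (fun r => by simp [derivExt_alg])
    (fun s => by simp [derivExt_ι]) a

lemma derivExt_add (Φ Ψ : End K S) : derivExt (Φ + Ψ) = derivExt Φ + derivExt Ψ := by
  refine LinearMap.ext fun a => ?_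
  simp [derivExt_apply, add_mul, sum_add]

lemma derivExt_smul (c : K) (Φ : End K S) : derivExt (c • Φ) = c • derivExt Φ := by
  refine LinearMap.ext fun a => ?_
  simp [derivExt_apply, smul_sum]

variable (K S) in
/-- The extension of endomorphisms to the exterior algebra as derivations, as a linear map. -/
def derivExtL : End K S →ₗ[K] End K (Ext K S) where
  toFun Φ := derivExt Φ
  map_add' := derivExt_add
  map_smul' := derivExt_smul

lemma derivExt_interior (Φ : End K S) (d : Dual K S) (a : Ext K S) :
    derivExt Φ (interior d a) = interior d (derivExt Φ a) - interior (d ∘ₗ Φ) a := by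
  induction a using ExteriorAlgebra.induction with
  | algebraMap r => simp [derivExt_alg, interior_algebraMap]
  | ι s => simp [interior_ι, derivExt_ι, derivExt_alg]
  | mul a b ha hb =>
    simp [interior_mul, derivExt_mul, ha, hb, derivExt_gradeInv, sub_mul, mul_sub]
    abel
  | add a b ha hb => simp [ha, hb]; abel

lemma map_interior (T : End K S) (d d' : Dual K S) (h : ∀ s, d' (T s) = d s) (a : Ext K S) :
    ExteriorAlgebra.map T (interior d a) = interior d' (ExteriorAlgebra.map T a) := by
  induction a using ExteriorAlgebra.induction with
  | algebraMap r => simp [interior_algebraMap]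
  | ι s => simp [interior_ι, h]
  | mul a b ha hb => simp [interior_mul, ha, hb, map_gradeInv]
  | add a b ha hb => simp [ha, hb]

end Exterior

/-! ### Quadratic elements of a Clifford algebra -/

section Quadratic

variable {K : Type*} [Field K] [CharZero K] {A : Type*} [Ring A] [Algebra K A] {n : ℕ}

def quadElt (κ : K) (g : Fin n → A) (B : Fin n → Fin n → K) : A :=
  ∑ p, ∑ q, (κ / 4 * ((B p q - B q p) / 2)) • (g p * g q)

def IsCliffordFamily (κ : K) (ε : Fin n → K) (g : Fin n → A) : Prop :=
  ∀ p q, g p * g q + g q * g p = (if p = q then -(2 * κ * ε p) else 0) • 1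

variable {κ : K} {ε : Fin n → K} {g : Fin n → A}

lemma IsCliffordFamily.quadElt_commutator
    (hg : IsCliffordFamily κ ε g) (hκ : κ * κ = 1) (B : Fin n → Fin n → K) (j : Fin n) :
    quadElt κ g B * g j - g j * quadElt κ g B = -∑ p, (ε j * ((B p j - B j p) / 2)) • g p := by
  have h1 : ∀ p q, g p * g q * g j - g j * (g p * g q) =
      (if q = j then -(2 * κ * ε q) else 0) • g p - (if p = j then -(2 * κ * ε p) else 0) • g q := fun p q => by
    have h2 := congrArg (g p * ·) (hg q j)
    have h3 := congrArg (· * g q) (hg p j)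
    simp only [mul_smul_comm, smul_mul_assoc, mul_one, one_mul] at h2 h3
    rw [← h2, ← h3]
    noncomm_ring
  have h2 : quadElt κ g B * g j - g j * quadElt κ g B =
      ∑ p, ∑ q, (κ / 4 * ((B p q - B q p) / 2)) • (g p * g q * g j - g j * (g p * g q)) := by
    simp [quadElt, sum_mul, mul_sum, smul_mul_assoc, mul_smul_comm, smul_sub]
  rw [h2]
  simp only [h1, smul_sub, sum_sub_distrib, ite_smul, zero_smul, smul_ite, smul_zero,
    sum_ite_eq', mem_univ, if_true, smul_smul]
  rw [sum_comm]
  simp only [sum_ite_eq', mem_univ, if_true]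
  rw [← sum_sub_distrib, ← sum_neg_distrib]
  refine sum_ext fun p => ?_
  rw [← sub_smul, ← neg_smul]
  congr 1
  linear_combination (-(ε j * (B p j - B j p) / 2)) * hκ

def low (ε : Fin n → K) (N : Mat(n) K) : Fin n → Fin n → K := fun p q => ε q * N q p

def IsSkewMat (ε : Fin n → K) (N : Mat(n) K) : Prop := ∀ p q, ε q * N q p + ε p * N p q = 0

lemma IsCliffordFamily.commutator_of_isSkew (hg : IsCliffordFamily κ ε g)
    (hκ : κ * κ = 1) (hε : ∀ i, ε i * ε i = 1) {N : Mat(n) K} (hN : IsSkewMat ε N) (j : Fin n) :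
    quadElt κ g (low ε N) * g j - g j * quadElt κ g (low ε N) = -∑ p, N j p • g p := by
  rw [hg.quadElt_commutator hκ]
  congr 1
  refine sum_ext fun p => ?_
  congr 1
  simp [low]
  linear_combination (-(ε j) / 2) * hN p j + N j p * hε j

lemma quadElt_commutator_of_commutator {X : A} {N : Mat(n) K} (hX : ∀ j, X * g j - g j * X =
    -∑ p, N j p • g p) (hN : IsSkewMat ε N) (N' : Mat(n) K) : X * quadElt
    κ g (low ε N') - quadElt κ g (low ε N') * X = quadElt κ g (low ε (N * N' - N' * N)) := by
  have h1 : ∀ p q, X * (g p * g q) - g p * g q * X =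
      -((∑ m, N p m • (g m * g q)) + ∑ m, N q m • (g p * g m)) := fun p q => by
    have : X * (g p * g q) - g p * g q * X = (X * g p - g p * X) * g q + g p * (X * g q - g q * X) := by
      noncomm_ring
    rw [this, hX, hX]
    simp [sum_mul, mul_sum, smul_mul_assoc, mul_smul_comm]
    abel
  set c : Fin n → Fin n → K := fun p q => κ / 4 * ((low ε N' p q - low ε N' q p) / 2)
  have h2 : X * quadElt κ g (low ε N') - quadElt κ g (low ε N') * X =
      ∑ p, ∑ q, c p q • (X * (g p * g q) - g p * g q * X) := by
    simp [quadElt, sum_mul, mul_sum, smul_mul_assoc, mul_smul_comm, smul_sub]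
    rfl
  have h3 : ∑ p, ∑ q, c p q • (X * (g p * g q) - g p * g q * X) =
      -((∑ p, ∑ q, (∑ m, c m q * N m p) • (g p * g q)) +
        ∑ p, ∑ q, (∑ m, c p m * N m q) • (g p * g q)) := by
    simp only [h1, smul_neg, smul_add, smul_sum, smul_smul, sum_neg_distrib, sum_add, sum_smul]
    congr 2
    · rw [sum_comm, sum_ext fun q => sum_comm, sum_comm]
    · exact sum_ext fun p => sum_comm
  rw [h2, h3, quadElt, ← sum_add, ← sum_neg_distrib]
  refine sum_ext fun p => ?_
  rw [← sum_add, ← sum_neg_distrib]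
  refine sum_ext fun q => ?_
  rw [← add_smul, ← neg_smul]
  congr 1
  simp [c, low, Matrix.sub_apply, mul_apply, mul_sum, ← sum_sub_distrib, ← sum_add, Finset.sum_div, ← sum_neg_distrib]
  refine sum_ext fun m => ?_
  linear_combination (-κ / 8) * (N' m p * hN m q - N' m q * hN m p)

lemma mul_quadElt {T : A} {m : Mat(n) K} (h : ∀ p, T * g p = (∑ i, m i p • g i) * T) (B : Fin n →
    Fin n → K) : T * quadElt κ g B = quadElt κ g (fun i j => ∑ p, ∑ q, m i p * m j q * B p q) * T :=
    by
  have h2 : ∀ p q, T * (g p * g q) = ∑ i, ∑ j, (m i p * m j q) • (g i * g j * T) := fun p q => by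
    rw [← mul_assoc, h, mul_assoc, h]
    simp [sum_mul, mul_sum, smul_mul_assoc, mul_smul_comm, smul_smul, mul_assoc, smul_sum]
    rw [sum_comm]
    simp [mul_comm]
  simp [quadElt, mul_sum, mul_smul_comm, h2, smul_sum, smul_smul, sum_mul, smul_mul_assoc]
  have e : ∀ f : Fin n → Fin n → Fin n → Fin n → A, ∑ p, ∑ q, ∑ i, ∑ j, f p q i j =
      ∑ i, ∑ j, ∑ p, ∑ q, f p q i j := fun f => by
    rw [sum_ext fun p => sum_comm, sum_comm]
    refine sum_ext fun i => ?_
    rw [sum_ext fun p => sum_comm, sum_comm]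
  rw [e]
  refine sum_ext fun i => sum_ext fun j => ?_
  simp [← sum_smul]
  congr 1
  have e2 : ∑ p, ∑ q, m j p * m i q * B p q = ∑ p, ∑ q, m i p * m j q * B q p := by
    rw [sum_comm]
    exact sum_ext fun _ => sum_ext fun _ => by ring
  rw [e2]
  simp [← sum_sub_distrib, Finset.sum_div, mul_sum]
  exact sum_ext fun _ => sum_ext fun _ => by ring

end Quadratic

/-! ### Elements annihilated by all contractions -/

section Number

variable {K : Type*} [Field K] {S : Type*} [AddCommGroup S] [Module K S] [Module.Finite K S]

variable {a : Ext K S}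

lemma derivExt_id_of_mem {k : ℕ} (ha : a ∈ ⋀[K]^k S) : derivExt LinearMap.id a = (k : K) • a := by
  induction ha using Submodule.pow_induction_on_left' with
  | algebraMap r => rw [derivExt_alg, Nat.cast_zero, zero_smul]
  | add x y i hx hy ihx ihy => rw [map_add, ihx, ihy, smul_add]
  | mem_mul m hm i x hx ih =>
    obtain ⟨s, rfl⟩ := hm
    rw [derivExt_mul, derivExt_ι, ih, LinearMap.id_apply, mul_smul_comm, Nat.cast_succ, add_smul,
      one_smul, add_comm]

def gradeProj (K : Type*) [Field K] {S : Type*} [AddCommGroup S] [Module K S] (k : ℕ) :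
    Ext K S →ₗ[K] Ext K S :=
  GradedAlgebra.proj (fun i : ℕ => ⋀[K]^i S) k

lemma gradeProj_of_mem {k : ℕ} (ha : a ∈ ⋀[K]^k S) (j : ℕ) :
    gradeProj K j a = if k = j then a else 0 := by
  rw [gradeProj, GradedAlgebra.proj_apply]
  split_ifs with h
  · subst h; exact DirectSum.decompose_of_mem_same _ ha
  · exact DirectSum.decompose_of_mem_ne _ ha h

lemma gradeProj_derivExt_id (k : ℕ) (a : Ext K S) :
    gradeProj K k (derivExt LinearMap.id a) = (k : K) • gradeProj K k a := by
  induction a using DirectSum.Decomposition.inductionOn (fun i : ℕ => ⋀[K]^i S) with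
  | zero => simp
  | @homogeneous i m =>
    rw [derivExt_id_of_mem m.2, map_smul, gradeProj_of_mem m.2]
    split_ifs with h
    · subst h; rfl
    · rw [smul_zero, smul_zero]
  | add a b ha hb => rw [map_add, map_add, ha, hb, map_add, smul_add]

lemma exists_algebraMap_of_interior_eq_zero [CharZero K] (h : ∀ d, interior d a = 0) :
    ∃ r, a = algebraMap K _ r := by
  have h1 : ∀ k, k ≠ 0 → gradeProj K k a = 0 := fun k hk => by
    have h2 := gradeProj_derivExt_id k a
    rw [derivExt_apply] at h2
    simp [h] at h2
    exact (smul_eq_zero.mp h2.symm).resolve_left (Nat.cast_ne_zero.mpr hk)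
  have h2 : a = gradeProj K 0 a := by
    classical
    conv_lhs => rw [← DirectSum.sum_support_decompose (fun i : ℕ => ⋀[K]^i S) a]
    refine sum_eq_single 0 (fun k _ hk => h1 k hk) fun h0 => ?_
    simpa using h0
  have h3 : gradeProj K 0 a ∈ ⋀[K]^0 S := by
    rw [gradeProj, GradedAlgebra.proj_apply]
    exact (DirectSum.decompose (fun i : ℕ => ⋀[K]^i S) a 0).2
  rw [← h2] at h3
  have h4 : a ∈ (1 : Submodule K (Ext K S)) := by
    have := h3
    rw [ExteriorAlgebra.exteriorPower, pow_zero] at this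
    exact this
  obtain ⟨r, hr⟩ := Submodule.mem_one.mp h4
  exact ⟨r, hr.symm⟩

end Number

/-! ### The Clifford algebra of a diagonal form -/

section Clifford

variable {n : ℕ} {κ : ℤˣ} {ε : Fin n → ℤˣ}

instance finite_cl : Module.Finite ℝ (Cl κ ε) :=
  have : Invertible (2 : ℝ) := invertibleOfNonzero two_ne_zero
  Module.Finite.equiv (equivExterior (cliffordForm κ ε)).symm

lemma polar_cliffordForm (i : Fin n) (w : Fin n → ℝ) :
    QuadraticMap.polar (cliffordForm κ ε) (Pi.single i 1) w = -(2 * sgn κ * sgn (ε i)) * w i := by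
  simp only [QuadraticMap.polar, cliffordForm, QuadraticMap.weightedSumSquares_apply, Pi.add_apply,
    smul_eq_mul, ← sum_sub_distrib]
  rw [sum_eq_single i]
  · simp; ring
  · intro j _ hj
    simp [hj]
  · simp

lemma gen_mul_gen (i j : Fin n) : gen κ ε i * gen κ ε j +
    gen κ ε j * gen κ ε i = (if i = j then -(2 * sgn κ * sgn (ε i)) else 0 : ℝ) • 1 := by
  rw [gen, gen, CliffordAlgebra.ι_mul_ι_add_swap, polar_cliffordForm, Algebra.algebraMap_eq_smul_one]
  by_cases h : i = j
  · subst h; simp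
  · simp [h, Pi.single_apply]

def genUp (κ : ℤˣ) (ε : Fin n → ℤˣ) (i : Fin n) : Cl κ ε := sgn (ε i) • gen κ ε i

lemma gen_eq (i : Fin n) : gen κ ε i = sgn (ε i) • genUp κ ε i := by
  rw [genUp, smul_smul, sgn_mul_self, one_smul]

lemma isCliffordFamily_genUp : IsCliffordFamily (sgn κ) (fun i => sgn (ε i)) (genUp κ ε) := fun p q => by
  have h : genUp κ ε p * genUp κ ε q + genUp κ ε q * genUp κ ε p =
      (sgn (ε p) * sgn (ε q)) • (gen κ ε p * gen κ ε q + gen κ ε q * gen κ ε p) := by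
    simp only [genUp, smul_mul_smul_comm, smul_add, mul_comm (sgn (ε q))]
  rw [h, gen_mul_gen, smul_smul]
  congr 1
  split_ifs with hpq
  · subst hpq; rw [sgn_mul_self, one_mul]
  · rw [mul_zero]

lemma ι_mul_sub_involute (v : Fin n → ℝ) (a : Cl κ ε) :
    CliffordAlgebra.ι (cliffordForm κ ε) v * a - involute a * CliffordAlgebra.ι
    (cliffordForm κ ε) v = contractLeft (QuadraticMap.polarBilin (cliffordForm κ ε) v) a := by
  induction a using CliffordAlgebra.left_induction with
  | algebraMap r =>
    rw [CliffordAlgebra.contractLeft_algebraMap, AlgHom.commutes, Algebra.commutes, sub_self]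
  | add x y hx hy => rw [mul_add, map_add, map_add, add_mul, ← hx, ← hy]; abel
  | ι_mul x w hx =>
    rw [CliffordAlgebra.contractLeft_ι_mul, ← hx, map_mul, CliffordAlgebra.involute_ι,
      QuadraticMap.polarBilin_apply_apply, Algebra.smul_def, ← CliffordAlgebra.ι_mul_ι_add_swap]
    noncomm_ring

lemma exists_algebraMap_of_commute {z : Cl κ ε} (hz : involute z = z)
    (h : ∀ i, z * gen κ ε i = gen κ ε i * z) : ∃ r : ℝ, z = algebraMap ℝ _ r := by
  have : Invertible (2 : ℝ) := invertibleOfNonzero two_ne_zero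
  have h1 : ∀ i, contractLeft (LinearMap.proj i : (Fin n → ℝ) →ₗ[ℝ] ℝ) z = 0 := fun i => by
    have h2 := ι_mul_sub_involute (Pi.single i 1) z
    rw [hz, show CliffordAlgebra.ι (cliffordForm κ ε) (Pi.single i 1) = gen κ ε i from rfl, h,
      sub_self] at h2
    have h3 : QuadraticMap.polarBilin (cliffordForm κ ε) (Pi.single i 1) =
        (-(2 * sgn κ * sgn (ε i))) • (LinearMap.proj i : (Fin n → ℝ) →ₗ[ℝ] ℝ) := by
      refine LinearMap.ext fun w => ?_
      rw [QuadraticMap.polarBilin_apply_apply, polar_cliffordForm]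
      rfl
    rw [h3, map_smul, LinearMap.smul_apply] at h2
    refine (smul_eq_zero.mp h2.symm).resolve_left ?_
    have := sgn_ne_zero κ
    have := sgn_ne_zero (ε i)
    simp [*]
  have h2 : ∀ d : Dual ℝ (Fin n → ℝ), contractLeft d z = 0 := fun d => by
    have : d = ∑ i, d (Pi.single i 1) • (LinearMap.proj i : (Fin n → ℝ) →ₗ[ℝ] ℝ) := by
      refine LinearMap.pi_ext' fun j => ?_
      ext
      simp [Pi.single_apply]
    rw [this, map_sum, LinearMap.sum_apply]
    exact sum_eq_zero fun i _ => by rw [map_smul, LinearMap.smul_apply, h1, smul_zero]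
  obtain ⟨r, hr⟩ := exists_algebraMap_of_interior_eq_zero
    (a := equivExterior (cliffordForm κ ε) z) fun d => by
      have := CliffordAlgebra.changeForm_contractLeft
        (CliffordAlgebra.changeForm.associated_neg_proof (Q := cliffordForm κ ε)) d z
      rw [h2, map_zero] at this
      exact this.symm
  refine ⟨r, (equivExterior (cliffordForm κ ε)).injective ?_⟩
  rw [hr]
  exact (CliffordAlgebra.changeForm_algebraMap
    (CliffordAlgebra.changeForm.associated_neg_proof (Q := cliffordForm κ ε)) r).symm

lemma involute_quadElt (B : Fin n → Fin n → ℝ) :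
    involute (quadElt (sgn κ) (genUp κ ε) B) = quadElt (sgn κ) (genUp κ ε) B := by
  simp [quadElt, genUp, gen]

lemma reverse_quadElt (B : Fin n → Fin n → ℝ) :
    reverse (quadElt (sgn κ) (genUp κ ε) B) = -quadElt (sgn κ) (genUp κ ε) B := by
  have h : ∀ p, reverse (genUp κ ε p) = genUp κ ε p := by intro p; simp [genUp, gen]
  simp [quadElt, h]
  rw [sum_comm, ← sum_neg_distrib]
  refine sum_ext fun p => ?_
  rw [← sum_neg_distrib]
  refine sum_ext fun q => ?_
  rw [← neg_smul]
  congr 1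
  ring

/-- The logarithmic derivative of a curve in the spin group is determined by the one of the
rotations it covers. -/
lemma spin_derivative (s : (Cl κ ε)ˣ) {D : Cl κ ε} {L dL : Mat(n) ℝ} (hs : involute (s : Cl κ ε) =
    s) (hr : (s : Cl κ ε) * reverse (s : Cl κ ε) = 1 ∨ (s : Cl κ ε) * reverse (s : Cl κ ε) = -1)
    (hL : ∀ j, (s : Cl κ ε) * gen κ ε j = (∑ i, L i j • gen κ ε i) * s)
    (ho : ∀ i k, ∑ j, sgn (ε j) * L i j * L k j = if i = k then sgn (ε i) else 0)
    (hdL : ∀ i k, ∑ j, sgn (ε j) * (dL i j * L k j + L i j * dL k j) = 0) (hD : involute D = D)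
    (hDr : D * reverse (s : Cl κ ε) + s * reverse D = 0) (hDL : ∀ j, D * gen κ ε j =
    (∑ i, dL i j • gen κ ε i) * s + (∑ i, L i j • gen κ ε i) * D) : D = quadElt (sgn κ) (genUp κ ε)
    (low (fun i => sgn (ε i)) fun q p => ∑ j, dL q j * (sgn (ε j) * L p j * sgn (ε p))) * s := by
  set N : Mat(n) ℝ := fun q p => ∑ j, dL q j * (sgn (ε j) * L p j * sgn (ε p)) with hN
  have hNs : IsSkewMat (fun i => sgn (ε i)) N := fun p q => by
    have := congrArg (sgn (ε p) * sgn (ε q) * ·) (hdL q p)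
    simp [hN, mul_sum, ← sum_add] at this ⊢
    rw [← this]
    exact sum_ext fun j => by ring
  set w : Cl κ ε := D * (↑s⁻¹ : Cl κ ε) with hw
  have hDw : D = w * s := by rw [hw, mul_assoc, Units.inv_mul, mul_one]
  have h1 : ∀ j, ∑ i, L i j • (w * gen κ ε i - gen κ ε i * w) = ∑ i, dL i j • gen κ ε i := fun j => by
    have h2 := hDL j
    rw [hDw, mul_assoc, hL, ← mul_assoc, ← mul_assoc, ← add_mul] at h2
    have h3 := s.isUnit.mul_left_injective h2
    simp [mul_sum, sum_mul, mul_smul_comm, smul_mul_assoc] at h3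
    simp only [smul_sub, sum_sub_distrib, h3]
    abel
  have h2 : ∀ k, w * gen κ ε k - gen κ ε k * w = ∑ i, N i k • gen κ ε i := fun k => by
    have h3 : ∑ j, (sgn (ε j) * L k j * sgn (ε k)) • ∑ i, L i j • (w * gen κ ε i - gen κ ε i * w) =
        w * gen κ ε k - gen κ ε k * w := by
      simp [smul_sum, smul_smul]
      rw [sum_comm]
      simp [← sum_smul]
      have : ∀ i, ∑ j, sgn (ε j) * L k j * sgn (ε k) * L i j = if k = i then 1 else 0 := fun i => by
        have := congrArg (sgn (ε k) * ·) (ho k i)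
        simp only [mul_sum] at this
        rw [show ∑ j, sgn (ε j) * L k j * sgn (ε k) * L i j =
          ∑ j, sgn (ε k) * (sgn (ε j) * L k j * L i j) from
          sum_ext fun _ => by ring, this]
        split_ifs
        · exact sgn_mul_self _
        · exact mul_zero _
      simp [this]
    rw [← h3]
    simp [h1, smul_sum, smul_smul]
    rw [sum_comm]
    simp [← sum_smul, hN]
    exact sum_ext fun i => by congr 1; exact sum_ext fun _ => by ring
  set ν : Cl κ ε := quadElt (sgn κ) (genUp κ ε) (low (fun i => sgn (ε i)) N) with hν
  have h3 : ∀ k, ν * gen κ ε k - gen κ ε k * ν = ∑ i, N i k • gen κ ε i := fun k => by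
    have h4 := isCliffordFamily_genUp.commutator_of_isSkew (sgn_mul_self κ)
      (fun i => sgn_mul_self (ε i)) hNs k
    rw [gen_eq, mul_smul_comm, smul_mul_assoc, ← smul_sub, h4, smul_neg, smul_sum,
      ← sum_neg_distrib]
    refine sum_ext fun i => ?_
    rw [gen_eq, smul_smul, smul_smul, ← neg_smul]
    congr 1
    have := hNs k i
    simp only at this
    linear_combination -this
  have hsi : involute (↑s⁻¹ : Cl κ ε) = (↑s⁻¹ : Cl κ ε) := by
    have h4 := congrArg involute (Units.mul_inv s)
    rw [map_mul, hs, map_one] at h4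
    exact (Units.inv_eq_of_mul_eq_one_right h4).symm
  have hz : involute (w - ν) = w - ν := by rw [map_sub, hw, map_mul, hD, hsi, hν, involute_quadElt]
  obtain ⟨r, hr'⟩ := exists_algebraMap_of_commute hz fun i => by
    have h4 := h2 i
    rw [← h3 i] at h4
    rw [sub_mul, mul_sub]
    linear_combination (norm := abel) h4
  have hwr : w + reverse w = 0 := by
    rw [hDw, CliffordAlgebra.reverse.map_mul, mul_assoc, ← mul_assoc (s : Cl κ ε)] at hDr
    rcases hr with h | h
    · rw [h, mul_one, one_mul] at hDr
      exact hDr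
    · rw [h, mul_neg, neg_mul, mul_one, one_mul, ← neg_add, neg_eq_zero] at hDr
      exact hDr
  have hzr : reverse (w - ν) = -(w - ν) := by
    rw [map_sub, hν, reverse_quadElt, ← hν, (neg_eq_of_add_eq_zero_right hwr).symm]
    abel
  have hzz : w - ν = 0 := by
    rw [hr', CliffordAlgebra.reverse.commutes, ← hr'] at hzr
    have : (2 : ℝ) • (w - ν) = 0 := by
      rw [two_smul]
      nth_rewrite 1 [hzr]
      exact neg_add_cancel _
    exact (smul_eq_zero.mp this).resolve_left two_ne_zero
  rw [hDw, sub_eq_zero.mp hzz]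

end Clifford

section Calculus

variable {W : Type*} [AddCommGroup W] [Module K W] [Module.Finite K W]

lemma dirDeriv_sum_smul_vec {ι : Type*} [Fintype ι] {g : ι → M → K} {U : Set M}
    (hU : IsOpen U) (hg : ∀ i, CSmooth n (g i) U) (w : ι → W) {x : M} (hx : x ∈ U) (v : Tan(n) x) :
    dirDeriv K (fun y => ∑ i, g i y • w i) x v = ∑ i, scalDeriv K (g i) x v • w i := by
  refine dual_ext K fun l => ?_
  rw [map_dirDeriv_dual l hU (SmoothOn.sum _ fun i => SmoothOn.smul_vec (hg i) (w i)) hx]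
  simp
  have hc : ∀ i, DiffAt n (fun _ : M => l (w i)) x := fun i => CSmooth.diffAt
    (U := Set.univ) contMDiffOn_const isOpen_univ trivial
  rw [(scalDeriv_sum univ (fun i => ((hg i).diffAt hU hx).mul' (hc i)) v).2]
  refine sum_ext fun i => ?_
  rw [scalDeriv_mul' ((hg i).diffAt hU hx) (hc i), scalDeriv_const, mul_zero, add_zero]

end Calculus

namespace SpinManifold

variable (G : SpinManifold n M J)

/-! ### Changes of frames -/

section Change

variable {a b : J}

variable {x : M}

lemma frame_change (hx : x ∈ G.dom a) (j : Fin n) :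
    G.frame b j x = ∑ i, G.frameChange a b x i j • G.frame a i x :=
  G.frame_expansion hx (G.frame b j x)

lemma csmooth_frameChange (a b : J) (i j : Fin n) :
    CSmooth n (fun x => G.frameChange a b x i j) (G.dom a ∩ G.dom b) :=
  CSmooth.mul' contMDiffOn_const (G.csmooth_inner
    ((G.smField_frame b j).mono Set.inter_subset_right)
    ((G.smField_frame a i).mono Set.inter_subset_left))

lemma frameChange_orth (hx : x ∈ G.dom a ∩ G.dom b) (j k : Fin n) : ∑ i, sgn (G.ε i)
    * G.frameChange a b x i j * G.frameChange a b x i k = if j = k then sgn (G.ε j) else 0 := by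
  rw [← G.frame_orthonormal b x hx.2 j k, G.frame_change hx.1 j, G.inner_sum_left]
  refine sum_ext fun i => ?_
  rw [G.metric.symm, mul_comm (sgn _), mul_assoc]
  congr 1
  rw [frameChange, ← mul_assoc, sgn_mul_self, one_mul]

lemma frameChange_orth' (hx : x ∈ G.dom a ∩ G.dom b) (i k : Fin n) : ∑ j, sgn (G.ε j)
    * G.frameChange a b x i j * G.frameChange a b x k j = if i = k then sgn (G.ε i) else 0 := by
  have h := G.frame_orthonormal a x hx.1 i k
  rw [G.frame_expansion hx.2 (G.frame a i x), G.inner_sum_left] at h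
  have h2 := congrArg (sgn (G.ε i) * sgn (G.ε k) * ·) h
  simp only [mul_sum] at h2
  rw [show (∑ j, sgn (G.ε j) * G.frameChange a b x i j * G.frameChange a b x k j) = _ from
    (sum_ext fun j => ?_).trans h2]
  · split_ifs with hik
    · subst hik
      rw [mul_assoc, sgn_mul_self, mul_one]
    · rw [mul_zero]
  · simp [frameChange]
    rw [G.metric.symm x (G.frame a i x)]
    ring

lemma lie_frameChange (hx : x ∈ G.dom a ∩ G.dom b) (j k m : Fin n) : ∑ r, G.frameChange a b x m r *
    (G.connUp b j k r x - G.connUp b k j r x) = (∑ i, ∑ l, G.frameChange a b x i j * G.frameChange a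
    b x l k * (G.connUp a i l m x - G.connUp a l i m x)) + (scalDeriv ℝ (fun y => G.frameChange a b
    y m k) x (G.frame b j x) - scalDeriv ℝ (fun y => G.frameChange a b y m j) x (G.frame b k x)) :=
    by
  have ho : IsOpen (G.dom a ∩ G.dom b) := (G.isOpen_dom a).inter (G.isOpen_dom b)
  have hL := G.csmooth_frameChange a b
  have hF : ∀ i, SmField (G.frame a i) (G.dom a ∩ G.dom b) := fun i =>
    (G.smField_frame a i).mono Set.inter_subset_left
  have hF' : ∀ i, SmField (G.frame b i) (G.dom a ∩ G.dom b) := fun i =>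
    (G.smField_frame b i).mono Set.inter_subset_right
  have h1 := G.lie_frame hx.2 j k
  have e : ∀ k, ∀ y ∈ G.dom a ∩ G.dom b, G.frame b k y =
      ∑ i, G.frameChange a b y i k • G.frame a i y := fun k y hy => G.frame_change hy.1 k
  have h2 : ∀ i, Lie(n) (G.frame a i) (G.frame b k) x =
      ∑ m, (scalDeriv ℝ (fun y => G.frameChange a b y m k) x (G.frame a i x) +
        ∑ l, G.frameChange a b x l k * (G.connUp a i l m x - G.connUp a l i m x)) •
          G.frame a m x := fun i => by
    rw [lie_congr ho (fun _ _ => rfl) (e k) hx, lie_sum_right _ _ ho (fun l => hL l k) hF hx]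
    simp only [sum_add, add_smul, G.lie_frame hx.1, smul_sum, smul_smul, sum_smul]
    congr 1
    rw [sum_comm]
  rw [lie_congr ho (e j) (fun _ _ => rfl) hx, lie_sum_left _ _ ho (fun l => hL l j) hF hx] at h1
  have h3 : ∑ m, (∑ i, G.frameChange a b x i j *
      (scalDeriv ℝ (fun y => G.frameChange a b y m k) x (G.frame a i x) +
        ∑ l, G.frameChange a b x l k * (G.connUp a i l m x - G.connUp a l i m x)) -
        scalDeriv ℝ (fun y => G.frameChange a b y m j) x (G.frame b k x)) • G.frame a m x =
      ∑ m, (∑ r, G.frameChange a b x m r * (G.connUp b j k r x - G.connUp b k j r x)) •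
        G.frame a m x := by
    have e2 : ∑ r, (G.connUp b j k r x - G.connUp b k j r x) • G.frame b r x =
        ∑ m, (∑ r, G.frameChange a b x m r * (G.connUp b j k r x - G.connUp b k j r x)) •
          G.frame a m x := by
      simp [G.frame_change (b := b) hx.1, smul_sum, smul_smul, sum_smul]
      rw [sum_comm]
      simp [mul_comm]
    rw [← e2, ← h1]
    simp only [h2, sub_smul, sum_sub_distrib, smul_sum, smul_smul, sum_smul]
    congr 1
    rw [sum_comm]
  have h4 := congrFun (G.frame_coeff_eq hx.1 h3) m
  rw [← h4]
  have h5 : scalDeriv ℝ (fun y => G.frameChange a b y m k) x (G.frame b j x) =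
      ∑ i, G.frameChange a b x i j *
        scalDeriv ℝ (fun y => G.frameChange a b y m k) x (G.frame a i x) := by
    rw [G.frame_change (b := b) hx.1 j, scalDeriv_vsum]
    exact sum_ext fun i => scalDeriv_vsmul _ _ _ _
  rw [h5]
  simp [mul_add, sum_add, mul_sum, mul_assoc]
  ring

variable {K : Type*} [RCLike K] {U : TopologicalSpace.Opens M}

variable (K U a b) in
/-- The transition matrix of two frames, as a matrix of smooth functions on `U`. -/
def changeSm : Mat(n) (Sm K n U K) := fun i j =>
  realSm n K U fun x => G.frameChange a b x i j

lemma csmooth_frameChange' (ha : U ≤ G.domO a) (hb : U ≤ G.domO b) (i j : Fin n) :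
    CSmooth n (fun x => G.frameChange a b x i j) (U : Set M) :=
  (G.csmooth_frameChange a b i j).mono fun _ hx => ⟨ha hx, hb hx⟩

lemma changeSm_val (ha : U ≤ G.domO a) (hb : U ≤ G.domO b) (i j : Fin n) {x : M} (hx : x ∈ U) :
    (G.changeSm a b K U i j).val x = (G.frameChange a b x i j : K) :=
  realSm_val (G.csmooth_frameChange' ha hb i j) hx

lemma change (ha : U ≤ G.domO a) (hb : U ≤ G.domO b) : (G.fCalc (K := K) ha).Change (G.fCalc hb)
    (G.changeSm a b K U) where
  ε_eq _ := rfl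
  orth j k := ext_on fun x hx => by
    have h := G.frameChange_orth ⟨ha hx, hb hx⟩ j k
    have h2 := congrArg (RCLike.ofReal (K := K)) h
    rw [sum_val]
    simp [mul_val, G.changeSm_val ha hb _ _ hx, fCalc, const_val _ hx]
    split_ifs at h2 ⊢ with hjk
    · rw [const_val _ hx, ← h2]; push_cast; rfl
    · rw [zero_val, ← RCLike.ofReal_zero, ← h2]; push_cast; rfl
  D_eq j f := ext_on fun x hx => by
    rw [sum_val]
    simp [mul_val, G.changeSm_val ha hb _ _ hx, fCalc]
    have h := dirDeriv_vsum (K := K) univ f.val x (fun i => G.frameChange a b x i j)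
      fun i => G.frame a i x
    rw [← G.frame_change (b := b) (ha hx) j] at h
    exact (deriv_val (G.smField_frame' hb j) f hx).trans (h.trans (sum_ext fun i =>
      congrArg (((G.frameChange a b x i j : ℝ) : K) * ·) 
        (deriv_val (G.smField_frame' ha i) f hx).symm))
  bracket j k m := ext_on fun x hx => by
    have h := congrArg (RCLike.ofReal (K := K)) (G.lie_frameChange ⟨ha hx, hb hx⟩ j k m)
    have hc : ∀ i p q, CSmooth n (G.connUp a i p q) (U : Set M) := fun i p q =>
      (G.csmooth_connUp a i p q).mono ha
    have hc' : ∀ i p q, CSmooth n (G.connUp b i p q) (U : Set M) := fun i p q =>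
      (G.csmooth_connUp b i p q).mono hb
    have hd : ∀ j m k, ((G.fCalc (K := K) hb).D j (G.changeSm a b K U m k)).val x =
        ((scalDeriv ℝ (fun y => G.frameChange a b y m k) x (G.frame b j x) : ℝ) : K) :=
      fun j m k => deriv_realSm (G.csmooth_frameChange' ha hb m k) _ hx
    simp [add_val, sub_val, sum_val, mul_val, hd, G.changeSm_val ha hb _ _ hx, FCalc.c]
    simp [fCalc, realSm_val (hc _ _ _) hx, realSm_val (hc' _ _ _) hx]
    simpa using h

end Change

/-! ### The derivative of the transition functions of the spin structure -/

section Trans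

variable {a b : J}

lemma involute_trans {x : M} (hx : x ∈ G.dom a ∩ G.dom b) :
    involute (G.trans a b x : Cl G.κ G.ε) = G.trans a b x :=
  CliffordAlgebra.involute_eq_of_mem_even (G.trans_mem a b x hx).1

lemma trans_mul_gen {x : M} (hx : x ∈ G.dom a ∩ G.dom b) (j : Fin n) :
    (G.trans a b x : Cl G.κ G.ε) * gen G.κ G.ε j =
    (∑ i, G.frameChange a b x i j • gen G.κ G.ε i) * (G.trans a b x : Cl G.κ G.ε) :=
  G.trans_covers a b x hx j

def logDeriv (a b : J) (x : M) (v : Tan(n) x) : Mat(n) ℝ :=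
  fun q p => ∑ j, scalDeriv ℝ (fun y => G.frameChange a b y q j) x v *
    (sgn (G.ε j) * G.frameChange a b x p j * sgn (G.ε p))

lemma dirDeriv_trans {x : M} (hx : x ∈ G.dom a ∩ G.dom b) (v : Tan(n) x) :
    dirDeriv ℝ (fun y => (G.trans a b y : Cl G.κ G.ε)) x v = quadElt (sgn G.κ)
    (genUp G.κ G.ε) (low (fun i => sgn (G.ε i)) (G.logDeriv a b x v)) * G.trans a b x := by
  have ho : IsOpen (G.dom a ∩ G.dom b) := (G.isOpen_dom a).inter (G.isOpen_dom b)
  have hs := G.trans_smooth a b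
  have hL := G.csmooth_frameChange a b
  have hLd : ∀ i j, DiffAt n (fun y => G.frameChange a b y i j) x := fun i j => (hL i j).diffAt ho hx
  set s : M → Cl G.κ G.ε := fun y => (G.trans a b y : Cl G.κ G.ε) with hsdef
  set rv : Cl G.κ G.ε →ₗ[ℝ] Cl G.κ G.ε := reverse with hrv
  set dL : Mat(n) ℝ := fun i j => scalDeriv ℝ (fun y => G.frameChange a b y i j) x v
    with hdL
  refine spin_derivative (G.trans a b x) (L := G.frameChange a b x) (dL := dL)
    (G.involute_trans hx) (G.trans_mem a b x hx).2.2 (G.trans_mul_gen hx)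
    (fun i k => G.frameChange_orth' hx i k) (fun i k => ?_) ?_ ?_ fun j => ?_
  · have h1 : scalDeriv ℝ (fun y => ∑ j, sgn (G.ε j) *
        (G.frameChange a b y i j * G.frameChange a b y k j)) x v = 0 := by
      rw [scalDeriv_congr_on ho (g := fun _ => if i = k then sgn (G.ε i) else 0) (fun y hy => ?_) hx,
        scalDeriv_const]
      simp [← mul_assoc]
      exact G.frameChange_orth' hy i k
    have hc : ∀ j, DiffAt n (fun _ : M => sgn (G.ε j)) x := fun j => CSmooth.diffAt
      (U := Set.univ) contMDiffOn_const isOpen_univ trivial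
    rw [(scalDeriv_sum univ (fun j => (hc j).mul' ((hLd i j).mul' (hLd k j))) v).2] at h1
    rw [← h1]
    refine sum_ext fun j => ?_
    rw [scalDeriv_mul' (hc j) ((hLd i j).mul' (hLd k j)), scalDeriv_const, zero_mul, zero_add,
      scalDeriv_mul' (hLd i j) (hLd k j)]
  · have h1 := map_dirDeriv (involute (Q := cliffordForm G.κ G.ε)).toLinearMap ho hs
      hx v
    exact h1.trans (dirDeriv_congr ho (g := s) (fun y hy => G.involute_trans hy) hx v)
  · have hsr : SmoothOn ℝ n (fun y => rv (s y)) (G.dom a ∩ G.dom b) := hs.comp_linear rv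
    set P : M → Cl G.κ G.ε := fun y => s y * rv (s y) with hP
    have hPs : SmoothOn ℝ n P (G.dom a ∩ G.dom b) := hs.mul hsr
    have hdP : dirDeriv ℝ P x v = dirDeriv ℝ s x v * rv (s x) + s x * rv (dirDeriv ℝ s x v) := by
      have := dirDeriv_bilin (LinearMap.mul ℝ (Cl G.κ G.ε)) ho hs hsr hx v
      rw [← map_dirDeriv rv ho hs hx] at this
      exact this
    have hP1 : ∀ y ∈ G.dom a ∩ G.dom b, P y = 1 ∨ P y = -1 := fun y hy =>
      (G.trans_mem a b y hy).2.2
    have h1 := dirDeriv_bilin (LinearMap.mul ℝ (Cl G.κ G.ε)) ho hPs hPs hx v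
    rw [dirDeriv_congr ho (g := fun _ => 1) (fun y hy => ?_) hx] at h1
    · have h2 : dirDeriv ℝ (fun _ : M => (1 : Cl G.κ G.ε)) x v = 0 := by
        simp [dirDeriv, scalDeriv_const]
      rw [h2] at h1
      simp at h1
      rw [hdP] at h1
      rcases hP1 x hx with h | h
      · rw [h, mul_one, one_mul, ← two_smul ℝ] at h1
        exact (smul_eq_zero.mp h1.symm).resolve_left two_ne_zero
      · rw [h, mul_neg, neg_mul, mul_one, one_mul, ← neg_add, ← two_smul ℝ] at h1
        exact (smul_eq_zero.mp (neg_eq_zero.mp h1.symm)).resolve_left two_ne_zero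
    · rcases hP1 y hy with h | h <;> simp [h]
  · have h1 := map_dirDeriv (LinearMap.mulRight ℝ (gen G.κ G.ε j)) ho hs hx v
    have hg : SmoothOn ℝ n (fun y => ∑ i, G.frameChange a b y i j • gen G.κ G.ε i)
        (G.dom a ∩ G.dom b) := SmoothOn.sum _ fun i => SmoothOn.smul_vec (hL i j) _
    have h2 := dirDeriv_bilin (LinearMap.mul ℝ (Cl G.κ G.ε)) ho hg hs hx v
    rw [dirDeriv_sum_smul_vec ho (fun i => hL i j) _ hx] at h2
    exact (h1.trans (dirDeriv_congr ho (fun y hy => G.trans_mul_gen hy j) hx v)).trans h2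

end Trans

end SpinManifold

section Calculus

variable {W : Type*} [AddCommGroup W] [Module K W] [Module.Finite K W]

lemma SmoothOn.end_of_apply {T : M → End K W}
    {U : Set M} (hT : ∀ w, SmoothOn K n (fun y => T y w) U) : SmoothOn K n T U := by
  have h : T = fun y => ∑ b, LinearMap.smulRightₗ ((finBasis K W).coord b)
      (T y (finBasis K W b)) := by
    funext y
    refine (finBasis K W).ext fun c => ?_
    rw [LinearMap.sum_apply, sum_eq_single c]
    · simp
    · intro b _ hb
      simp [Finsupp.single_apply, hb.symm]
    · simp
  rw [h]
  exact SmoothOn.sum _ fun b => (hT _).comp_linear _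

/-- The derivative of the value of a variable endomorphism with logarithmic derivative `Ω`. -/
lemma dirDeriv_apply_end {T : M → End K W} {U : Set M} (hU : IsOpen U)
    (hT : ∀ w, SmoothOn K n (fun y => T y w) U) {f : M → W} (hf : SmoothOn K n f U) {x : M} (hx
    : x ∈ U) {v : Tan(n) x} {Ω : End K W} (hΩ : ∀ w, dirDeriv K (fun y => T y w) x v = Ω (T x w)) :
    dirDeriv K (fun y => T y (f y)) x v = Ω (T x (f x)) + T x (dirDeriv K f x v) := by
  have hTs := SmoothOn.end_of_apply hT
  have h := dirDeriv_bilin (LinearMap.id : End K W →ₗ[K] W →ₗ[K] W) hU hTs hf hx v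
  have h2 := map_dirDeriv (LinearMap.applyₗ (f x) : End K W →ₗ[K] W) hU hTs hx v
  exact h.trans (congrArg (· + _) (h2.trans (hΩ (f x))))

end Calculus

namespace SpinManifold

variable (G : SpinManifold n M J) (K : Type*) [RCLike K] {a b : J} {x : M}

def εK (i : Fin n) : K := ((sgn (G.ε i) : ℝ) : K)

lemma εK_mul_self (i : Fin n) : G.εK K i * G.εK K i = 1 := by
  rw [εK, ← RCLike.ofReal_mul, sgn_mul_self, RCLike.ofReal_one]

def chK (a b : J) (x : M) : Mat(n) K := (G.frameChange a b x).map fun r => (r : K)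

def connM (a : J) (i : Fin n) (x : M) : Mat(n) K := fun q p => ((G.connUp a i p q x : ℝ) : K)

variable {K}

lemma chK_orth' (hx : x ∈ G.dom a ∩ G.dom b) (i k : Fin n) :
    ∑ j, G.εK K j * G.chK K a b x i j * G.chK K a b x k j = if i = k then G.εK K i else 0 := by
  have h := congrArg (RCLike.ofReal (K := K)) (G.frameChange_orth' hx i k)
  split_ifs at h ⊢ <;> simpa [εK, chK] using h

lemma logDeriv_mul (hx : x ∈ G.dom a ∩ G.dom b) (v : Tan(n) x) (q k : Fin n) : ∑ p, G.logDeriv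
    a b x v q p * G.frameChange a b x p k = scalDeriv ℝ (fun y => G.frameChange a b y q k) x v := by
  simp [logDeriv, sum_mul]
  rw [sum_comm]
  have : ∀ j, ∑ p, scalDeriv ℝ (fun y => G.frameChange a b y q j) x v *
      (sgn (G.ε j) * G.frameChange a b x p j * sgn (G.ε p)) * G.frameChange a b x p k =
      scalDeriv ℝ (fun y => G.frameChange a b y q j) x v * if j = k then 1 else 0 := fun j => by
    have h := congrArg (sgn (G.ε j) * ·) (G.frameChange_orth hx j k)
    rw [show (if j = k then (1 : ℝ) else 0) = sgn (G.ε j) * if j = k then sgn (G.ε j) else 0 by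
      split_ifs <;> simp [sgn_mul_self], ← h]
    simp [mul_sum]
    exact sum_ext fun p => by ring
  simp [this]

variable (K) in
def logDerivK (a b : J) (x : M) (v : Tan(n) x) : Mat(n) K :=
  (G.logDeriv a b x v).map fun r => (r : K)

lemma logDerivK_mul (hx : x ∈ G.dom a ∩ G.dom b) (v : Tan(n) x) : G.logDerivK K a b x v *
    G.chK K a b x = fun q k => ((scalDeriv ℝ (fun y => G.frameChange a b y q k) x v : ℝ) : K) := by
  ext q k
  rw [← G.logDeriv_mul hx, mul_apply]
  push_cast
  rfl

lemma chK_mul_connM (hx : x ∈ G.dom a ∩ G.dom b) (j : Fin n) : G.chK K a b x * G.connM K b j x =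
    ((∑ i, G.chK K a b x i j • G.connM K a i x) + G.logDerivK K a b x (G.frame b j x))
    * G.chK K a b x := by
  rw [add_mul, G.logDerivK_mul hx]
  have ha : G.domO a ⊓ G.domO b ≤ G.domO a := inf_le_left
  have hb : G.domO a ⊓ G.domO b ≤ G.domO b := inf_le_right
  have hxU : x ∈ G.domO a ⊓ G.domO b := hx
  ext q p
  have h := congrArg (fun m : Mat(n) (Sm K n (G.domO a ⊓ G.domO b) K) =>
    (m q p).val x) ((G.change (K := K) ha hb).Γ_eq j)
  have hc : ∀ i p q, CSmooth n (G.connUp a i p q) ((G.domO a ⊓ G.domO b : TopologicalSpace.Opens M) :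
      Set M) := fun i p q => (G.csmooth_connUp a i p q).mono ha
  have hc' : ∀ i p q, CSmooth n (G.connUp b i p q) ((G.domO a ⊓ G.domO b : TopologicalSpace.Opens M) :
      Set M) := fun i p q => (G.csmooth_connUp b i p q).mono hb
  have hd : (mDeriv ((G.fCalc (K := K) hb).D j) (G.changeSm a b K _) q p).val x =
      ((scalDeriv ℝ (fun y => G.frameChange a b y q p) x (G.frame b j x) : ℝ) : K) :=
    deriv_realSm (G.csmooth_frameChange' ha hb q p) (G.smField_frame' hb j) hxU
  change _ = ((∑ i, G.chK K a b x i j • G.connM K a i x) * G.chK K a b x) q p +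
    ((scalDeriv ℝ (fun y => G.frameChange a b y q p) x (G.frame b j x) : ℝ) : K)
  simp [mul_apply, Matrix.add_apply, Matrix.sum_apply, Matrix.smul_apply, add_val, sum_val, mul_val, smul_eq_mul, hd, G.changeSm_val ha hb _ _ hxU] at h ⊢
  simp [fCalc, realSm_val (hc _ _ _) hxU, realSm_val (hc' _ _ _) hxU] at h
  exact h

/-- Covariance of the covariant derivative in an associated bundle, if the transition functions
have the right logarithmic derivative. -/
lemma cov_covariant {W : Type*} [AddCommGroup W] [Module K W] [Module.Finite K W] {T : M → End K W}
    (β : Mat(n) K →ₗ[K] End K W) (hT : ∀ w, SmoothOn K n (fun y => T y w) (G.dom a ∩ G.dom b))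
    (hx : x ∈ G.dom a ∩ G.dom b) (hΩ : ∀ v w, dirDeriv K (fun y => T y w) x v = β (G.logDerivK K
    a b x v) (T x w)) (hβ : ∀ N N', G.chK K a b x * N = N' * G.chK K a b x → T x * β N = β N' * T x)
    {f g : M → W} (hf : SmoothOn K n f (G.dom a ∩ G.dom b)) (hg : ∀ y ∈ G.dom a ∩ G.dom b, g y =
    T y (f y)) (j : Fin n) : T x (dirDeriv K f x (G.frame b j x) + β (G.connM K b j x) (f x)) =
    ∑ i, G.chK K a b x i j • (dirDeriv K g x (G.frame a i x) + β (G.connM K a i x) (g x)) := by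
  have ho : IsOpen (G.dom a ∩ G.dom b) := (G.isOpen_dom a).inter (G.isOpen_dom b)
  have h1 := dirDeriv_apply_end ho hT hf hx (hΩ (G.frame b j x))
  have h2 := LinearMap.congr_fun (hβ _ _ (G.chK_mul_connM hx j)) (f x)
  rw [Module.End.mul_apply, Module.End.mul_apply] at h2
  have h3 : dirDeriv K g x (G.frame b j x) =
      ∑ i, G.chK K a b x i j • dirDeriv K g x (G.frame a i x) := by
    have h := dirDeriv_vsum (K := K) univ g x (fun i => G.frameChange a b x i j)
      fun i => G.frame a i x
    rw [← G.frame_change (b := b) hx.1 j] at h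
    exact h
  rw [map_add, h2, map_add, LinearMap.add_apply, map_sum, LinearMap.sum_apply, ← hg x hx]
  simp [sum_add, ← h3]
  rw [dirDeriv_congr ho hg hx, h1, ← hg x hx]
  abel

end SpinManifold

variable {S : Type*} [AddCommGroup S] [Module K S] [Module ℝ S] [IsScalarTower ℝ K S]

namespace SpecialGradedManifold

variable (G : SpecialGradedManifold K n M S J)

/-! ### Linear algebra of the spinor representation -/

lemma ofReal_smul_end (r : ℝ) (Φ : End K S) : ((r : ℝ) : K) • Φ = r • Φ := by
  refine LinearMap.ext fun s => ?_
  rw [LinearMap.smul_apply, LinearMap.smul_apply, ← RCLike.real_smul_eq_coe_smul]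

lemma gammaUp_eq (i : Fin n) : G.gammaUp i = G.ρ (genUp G.κ G.ε i) := by
  rw [gammaUp, ofReal_smul_end, genUp, map_smul]

lemma isCliffordFamily_gammaUp : IsCliffordFamily ((sgn G.κ : ℝ) : K) (G.εK K) G.gammaUp := fun p q => by
  have h := congrArg G.ρ (isCliffordFamily_genUp (κ := G.κ) (ε := G.ε) p q)
  rw [map_add, map_mul, map_mul, ← gammaUp_eq, ← gammaUp_eq, map_smul, map_one] at h
  rw [h, ← ofReal_smul_end]
  congr 1
  split_ifs
  · rw [SpinManifold.εK]; push_cast; rfl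
  · exact RCLike.ofReal_zero

lemma ρ_quadElt (B : Fin n → Fin n → ℝ) :
    G.ρ (quadElt (sgn G.κ) (genUp G.κ G.ε) B) = G.spinEnd fun p q => ((B p q : ℝ) : K) := by
  simp [quadElt, spinEnd, ← gammaUp_eq, ← ofReal_smul_end]
  push_cast
  rfl

def spinL : Mat(n) K →ₗ[K] End K S where
  toFun N := G.spinEnd (low (G.εK K) N)
  map_add' N N' := by
    simp only [spinEnd, ← sum_add, ← add_smul]
    refine sum_ext fun p => sum_ext fun q => ?_
    congr 1
    simp only [low, Matrix.add_apply]
    ring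
  map_smul' c N := by
    simp only [spinEnd, smul_sum, smul_smul, RingHom.id_apply]
    refine sum_ext fun p => sum_ext fun q => ?_
    congr 1
    simp only [low, Matrix.smul_apply, smul_eq_mul]
    ring

lemma spinL_eq (N : Mat(n) K) : G.spinL N = G.spinEnd (low (G.εK K) N) := rfl

lemma connS_eq (a : J) (i : Fin n) (x : M) : G.connS a i x = G.spinL (G.connM K a i x) := by
  rw [spinL_eq, connS]
  congr 1
  funext p q
  rw [low, SpinManifold.connM, SpinManifold.connUp, SpinManifold.εK, ← RCLike.ofReal_mul,
    ← mul_assoc, sgn_mul_self, one_mul]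

variable {G} {a b : J} {x : M}

lemma spinorTrans_mul_gammaUp (hx : x ∈ G.dom a ∩ G.dom b) (p : Fin n) :
    G.spinorTrans a b x * G.gammaUp p =
    (∑ i, (G.εK K p * G.chK K a b x i p * G.εK K i) • G.gammaUp i) * G.spinorTrans a b x := by
  have h := congrArg G.ρ (G.trans_mul_gen hx p)
  simp at h
  rw [gammaUp, mul_smul_comm]
  have h' : G.spinorTrans a b x * G.ρ (gen G.κ G.ε p) = _ := h
  rw [h', ← smul_mul_assoc, smul_sum]
  congr 1
  refine sum_ext fun i => ?_
  rw [gammaUp, ← ofReal_smul_end, smul_smul, smul_smul]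
  congr 1
  have := G.εK_mul_self K i
  simp [SpinManifold.εK, SpinManifold.chK] at this ⊢
  linear_combination (-((sgn (G.ε p) : ℝ) : K) * (G.frameChange a b x i p : K)) * this

lemma spinorTrans_mul_spinL (hx : x ∈ G.dom a ∩ G.dom b) {N N' : Mat(n) K} (h : G.chK K a b x * N =
    N' * G.chK K a b x) : G.spinorTrans a b x * G.spinL N = G.spinL N' * G.spinorTrans a b x := by
  have h1 := mul_quadElt (κ := ((sgn G.κ : ℝ) : K)) (g := G.gammaUp) (T := G.spinorTrans a b x)
    (m := fun i p => G.εK K p * G.chK K a b x i p * G.εK K i)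
    (fun p => spinorTrans_mul_gammaUp hx p) (low (G.εK K) N)
  refine h1.trans ?_
  congr 2
  funext i j
  have h2 : ∀ p, ∑ q, G.chK K a b x j q * N q p = ∑ r, N' j r * G.chK K a b x r p :=
    fun p => congrFun (congrFun h j) p
  have h3 : ∀ p, ∑ q, G.εK K p * G.chK K a b x i p * G.εK K i *
      (G.εK K q * G.chK K a b x j q * G.εK K j) * low (G.εK K) N p q =
      ∑ r, G.εK K i * G.εK K j * N' j r *
        (G.εK K p * G.chK K a b x i p * G.chK K a b x r p) := fun p => by
    have := congrArg (G.εK K p * G.chK K a b x i p * G.εK K i * G.εK K j * ·) (h2 p)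
    simp [mul_sum] at this
    refine (sum_ext fun q => ?_).trans (this.trans (sum_ext fun r => ?_))
    · simp [low]
      linear_combination (G.εK K p * G.chK K a b x i p * G.εK K i * G.εK K j *
        G.chK K a b x j q * N q p) * G.εK_mul_self K q
    · ring
  simp [h3]
  rw [sum_comm]
  simp [← mul_sum, G.chK_orth' hx]
  simp [low]
  linear_combination (G.εK K j * N' j i) * G.εK_mul_self K i

end SpecialGradedManifold

namespace SpinManifold

variable (G : SpinManifold n M J)

/-! ### Glueing of sections -/

section Glue

variable {K : Type*} [RCLike K] {W : Type*} [AddCommGroup W] [Module K W]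

structure IsCocycle (τ : J → J → M → (W →ₗ[K] W)) : Prop where
  self (a : J) (x : M) (hx : x ∈ G.dom a) : τ a a x = LinearMap.id
  comp (a b c : J) (x : M) (hx : x ∈ G.dom a ∩ G.dom b ∩ G.dom c) : τ a b x ∘ₗ τ b c x = τ a c x

variable {G} {τ : J → J → M → (W →ₗ[K] W)}

lemma IsCocycle.tensor {W' : Type*} [AddCommGroup W']
    [Module K W'] {τ' : J → J → M → (W' →ₗ[K] W')} (h : G.IsCocycle τ) (h' : G.IsCocycle τ') :
    G.IsCocycle fun a b x => TensorProduct.map (τ a b x) (τ' a b x) where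
  self a x hx := by rw [h.self a x hx, h'.self a x hx, TensorProduct.map_id]
  comp a b c x hx := by rw [← TensorProduct.map_comp, h.comp a b c x hx, h'.comp a b c x hx]

lemma IsCocycle.rep_trans (h : G.IsCocycle τ) (s : M → W)
    {a b : J} {x : M} (hx : x ∈ G.dom a ∩ G.dom b) : τ a b x (G.rep τ b s x) = G.rep τ a s x :=
  LinearMap.congr_fun (h.comp a b (G.idx x) x ⟨hx, G.mem_dom_idx x⟩) (s x)

lemma IsCocycle.rep_idx (h : G.IsCocycle τ) (s : M → W) (x : M) : G.rep τ (G.idx x) s x = s x := by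
  rw [rep, h.self _ x (G.mem_dom_idx x), LinearMap.id_apply]

lemma IsCocycle.sections_ext (h : G.IsCocycle τ)
    {s t : G.sections τ} (hst : ∀ a, ∀ x ∈ G.dom a, G.rep τ a s x = G.rep τ a t x) : s = t := by
  refine Subtype.ext (funext fun x => ?_)
  rw [← h.rep_idx s.1 x, hst _ x (G.mem_dom_idx x), h.rep_idx]

lemma IsCocycle.exists_section (h : G.IsCocycle τ) {σ : J → M → W} (hs : ∀ a, SmoothOn
    K n (σ a) (G.dom a)) (hc : ∀ a b, ∀ x ∈ G.dom a ∩ G.dom b, τ a b x (σ b x) = σ a x) :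
    ∃ s : G.sections τ, ∀ a, ∀ x ∈ G.dom a, G.rep τ a s x = σ a x := by
  have h1 : ∀ a, ∀ x ∈ G.dom a, G.rep τ a (fun x => σ (G.idx x) x) x = σ a x := fun a x hx =>
    hc a _ x ⟨hx, G.mem_dom_idx x⟩
  exact ⟨⟨fun x => σ (G.idx x) x, fun a => (hs a).congr (h1 a)⟩, h1⟩

lemma IsCocycle.rep_glue (h : G.IsCocycle τ) {σ : J → M → W}
    (hs : ∀ a, SmoothOn K n (σ a) (G.dom a)) (hc : ∀ a b, ∀ x ∈ G.dom a ∩ G.dom b, τ a b x (σ b x) =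
    σ a x) {a : J} {x : M} (hx : x ∈ G.dom a) : G.rep τ a (G.glue τ σ) x = σ a x := by
  classical
  have h1 := h.exists_section hs hc
  rw [glue, dif_pos h1]
  exact h1.choose_spec a x hx

end Glue

lemma frameChange_self {a : J} {x : M} (hx : x ∈ G.dom a) : G.frameChange a a x = 1 := by
  ext i j
  rw [frameChange, G.frame_orthonormal a x hx, Matrix.one_apply]
  split_ifs with h1 h2 h2
  · rw [h1, sgn_mul_self]
  · exact absurd h1.symm h2
  · exact absurd h2.symm h1
  · exact mul_zero _

lemma frameChange_mul {a b c : J} {x : M} (hx : x ∈ G.dom a ∩ G.dom b ∩ G.dom c) :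
    G.frameChange a b x * G.frameChange b c x = G.frameChange a c x := by
  ext i k
  rw [mul_apply]
  have h := G.frame_change (b := c) hx.1.2 k
  conv_rhs => rw [frameChange, h, G.inner_sum_left, mul_sum]
  exact sum_ext fun j => by rw [frameChange]; ring

end SpinManifold

namespace SpecialGradedManifold

variable (G : SpecialGradedManifold K n M S J)

lemma isCocycle_spinorTrans : G.IsCocycle G.spinorTrans where
  self a x hx := by
    have h := G.trans_cocycle a a a x ⟨⟨hx, hx⟩, hx⟩
    rw [spinorTrans, mul_eq_left.mp h, Units.val_one, map_one]
    rfl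
  comp a b c x hx := by
    rw [spinorTrans, spinorTrans, spinorTrans, ← G.trans_cocycle a b c x hx, Units.val_mul, map_mul]
    rfl

lemma isCocycle_extTrans : G.IsCocycle G.extTrans where
  self a x hx := by
    rw [extTrans, G.isCocycle_spinorTrans.self a x hx, ExteriorAlgebra.map_id]
    rfl
  comp a b c x hx := by
    rw [extTrans, extTrans, extTrans, ← G.isCocycle_spinorTrans.comp a b c x hx,
      ← ExteriorAlgebra.map_comp_map]
    rfl

lemma isCocycle_vectorTrans : G.IsCocycle G.vectorTrans where
  self a x hx := by
    rw [vectorTrans, G.frameChange_self hx, Matrix.map_one _ RCLike.ofReal_zero RCLike.ofReal_one,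
      Matrix.mulVecLin_one]
  comp a b c x hx := by
    rw [vectorTrans, vectorTrans, vectorTrans, ← G.frameChange_mul hx, ← Matrix.mulVecLin_mul]
    congr 1
    exact (Matrix.map_mul (f := (algebraMap ℝ K))).symm

variable {G} {a b : J} {x : M}

section Derivatives

variable [Module.Finite K S]

lemma smoothOn_spinorTrans (a b : J) (s : S) :
    SmoothOn K n (fun y => G.spinorTrans a b y s) (G.dom a ∩ G.dom b) := by
  have h := SmoothOn.real_linear (K := K) (W' := End K S) G.ρ.toLinearMap
    (G.trans_smooth a b)
  exact h.comp_linear (LinearMap.applyₗ s : End K S →ₗ[K] S)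

lemma dirDeriv_spinorTrans (hx : x ∈ G.dom a ∩ G.dom b) (v : Tan(n) x) (s : S) : dirDeriv K (fun
    y => G.spinorTrans a b y s) x v = G.spinL (G.logDerivK K a b x v) (G.spinorTrans a b x s) := by
  have ho : IsOpen (G.dom a ∩ G.dom b) := (G.isOpen_dom a).inter (G.isOpen_dom b)
  have h := SmoothOn.real_linear (K := K) (W' := End K S) G.ρ.toLinearMap
    (G.trans_smooth a b)
  have h1 := dirDeriv_real_linear (K := K) (W' := End K S) G.ρ.toLinearMap ho
    (G.trans_smooth a b) hx v
  rw [G.dirDeriv_trans hx] at h1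
  refine (map_dirDeriv (LinearMap.applyₗ s : End K S →ₗ[K] S) ho h hx v).symm.trans ?_
  rw [h1]
  change G.ρ (_ * _) s = _
  rw [map_mul, G.ρ_quadElt, Module.End.mul_apply]
  congr 2
  funext p q
  simp [low]
  push_cast
  rfl

lemma smoothOn_extTrans (a b : J) (w : Ext K S) :
    SmoothOn K n (fun y => G.extTrans a b y w) (G.dom a ∩ G.dom b) := by
  induction w using ExteriorAlgebra.induction with
  | algebraMap r =>
    refine (SmoothOn.const (algebraMap K _ r) _).congr fun y _ => ?_
    exact AlgHom.commutes _ _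
  | ι s =>
    refine ((smoothOn_spinorTrans a b s).comp_linear (ExteriorAlgebra.ι K)).congr fun y _ => ?_
    exact ExteriorAlgebra.map_apply_ι _ _
  | mul c d hc hd =>
    exact (hc.mul hd).congr fun y _ => map_mul (ExteriorAlgebra.map (G.spinorTrans a b y)) c d
  | add c d hc hd =>
    exact (hc.add hd).congr fun y _ => map_add (G.extTrans a b y) c d

lemma dirDeriv_extTrans (hx : x ∈ G.dom a ∩ G.dom b) (v : Tan(n) x) (w : Ext K S) :
    dirDeriv K (fun y => G.extTrans a b y w) x v =
    derivExt (G.spinL (G.logDerivK K a b x v)) (G.extTrans a b x w) := by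
  have ho : IsOpen (G.dom a ∩ G.dom b) := (G.isOpen_dom a).inter (G.isOpen_dom b)
  induction w using ExteriorAlgebra.induction with
  | algebraMap r =>
    have h : ∀ y, G.extTrans a b y (algebraMap K _ r) = algebraMap K _ r := fun y =>
      AlgHom.commutes _ _
    simp [h, derivExt_alg]
    simp [dirDeriv, scalDeriv_const]
  | ι s =>
    have h : ∀ y, G.extTrans a b y (ExteriorAlgebra.ι K s) = ExteriorAlgebra.ι K (G.spinorTrans a b y s) :=
      fun y => ExteriorAlgebra.map_apply_ι _ _
    simp [h, derivExt_ι]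
    rw [← dirDeriv_spinorTrans hx, map_dirDeriv _ ho (smoothOn_spinorTrans a b s) hx]
  | mul c d hc hd =>
    have h : ∀ y, G.extTrans a b y (c * d) = G.extTrans a b y c * G.extTrans a b y d := fun y =>
      map_mul (ExteriorAlgebra.map (G.spinorTrans a b y)) c d
    simp [h, derivExt_mul]
    rw [← hc, ← hd]
    exact dirDeriv_bilin (LinearMap.mul K (Ext K S)) ho (smoothOn_extTrans a b c)
      (smoothOn_extTrans a b d) hx v
  | add c d hc hd =>
    simp
    rw [dirDeriv_add ho (smoothOn_extTrans a b c) (smoothOn_extTrans a b d) hx, hc, hd]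

lemma extTrans_mul_derivExt (hx : x ∈ G.dom a ∩ G.dom b)
    {N N' : Mat(n) K} (h : G.chK K a b x * N = N' * G.chK K a b x) (w : Ext K S) :
    G.extTrans a b x (derivExt (G.spinL N) w) = derivExt (G.spinL N') (G.extTrans a b x w) :=
  map_derivExt _ _ _ (fun s => LinearMap.congr_fun (spinorTrans_mul_spinL hx h) s) w

end Derivatives

lemma smoothOn_vectorTrans (a b : J) (w : Fin n → K) :
    SmoothOn K n (fun y => G.vectorTrans a b y w) (G.dom a ∩ G.dom b) := by
  have h : ∀ y, G.vectorTrans a b y w =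
      ∑ i, ∑ j, ((G.frameChange a b y i j : ℝ) : K) • (Pi.single i (w j) : Fin n → K) := fun y => by
    ext q
    simp only [vectorTrans, Matrix.mulVecLin_apply, Matrix.mulVec, dotProduct, Finset.sum_apply,
      Pi.smul_apply, smul_eq_mul, Pi.single_apply, Matrix.map_apply, mul_ite, mul_zero]
    rw [sum_comm]
    simp
  refine (SmoothOn.sum univ fun i => SmoothOn.sum univ fun j =>
    SmoothOn.smul_vec (CSmooth.cast (G.csmooth_frameChange a b i j))
      (Pi.single i (w j) : Fin n → K)).congr fun y _ => h y

lemma dirDeriv_vectorTrans (hx : x ∈ G.dom a ∩ G.dom b) (v : Tan(n) x) (w : Fin n → K) :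
    dirDeriv K (fun y => G.vectorTrans a b y w) x v =
    Matrix.toLin' (G.logDerivK K a b x v) (G.vectorTrans a b x w) := by
  have ho : IsOpen (G.dom a ∩ G.dom b) := (G.isOpen_dom a).inter (G.isOpen_dom b)
  have hL : ∀ i j, CSmooth n (fun y => ((G.frameChange a b y i j : ℝ) : K)) (G.dom a ∩ G.dom b) :=
    fun i j => CSmooth.cast (G.csmooth_frameChange a b i j)
  ext q
  have h1 := map_dirDeriv_dual (LinearMap.proj q : (Fin n → K) →ₗ[K] K) ho
    (smoothOn_vectorTrans a b w) hx v
  have hc : ∀ j, DiffAt n (fun _ : M => w j) x := fun j => CSmooth.diffAt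
    (U := Set.univ) contMDiffOn_const isOpen_univ trivial
  have h2 := (scalDeriv_sum univ (fun j => ((hL q j).diffAt ho hx).mul' (hc j)) v).2
  refine h1.trans (h2.trans ?_)
  have h3 := congrFun (congrArg (fun N : Mat(n) K => N.mulVec w) (G.logDerivK_mul (K := K) hx v)) q
  simp [← Matrix.mulVec_mulVec] at h3
  refine Eq.trans (sum_ext fun j => ?_) h3.symm
  rw [scalDeriv_mul' ((hL q j).diffAt ho hx) (hc j), scalDeriv_const, mul_zero, add_zero,
    scalDeriv_cast ((G.csmooth_frameChange a b q j).diffAt ho hx)]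

lemma vectorTrans_eq (a b : J) (x : M) : G.vectorTrans a b x = Matrix.toLin' (G.chK K a b x) :=
  rfl

/-! ### Covariance of the covariant derivatives -/

section Covariance

lemma covV_covariant (X : G.VectorFields) (hx : x ∈ G.dom a ∩ G.dom b) (j : Fin n) :
    G.vectorTrans a b x (G.covV b j (G.vectorRep X b) x) =
    ∑ i, G.chK K a b x i j • G.covV a i (G.vectorRep X a) x := by
  have h := G.cov_covariant (K := K) (T := G.vectorTrans a b) (a := a) (b := b)
    Matrix.toLin'.toLinearMap (smoothOn_vectorTrans a b) hx (dirDeriv_vectorTrans hx)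
    (fun N N' h => by
      have h2 := congrArg Matrix.toLin' h
      rw [Matrix.toLin'_mul, Matrix.toLin'_mul] at h2
      exact h2)
    (f := G.vectorRep X b) (g := G.vectorRep X a)
    ((X.2 b).mono Set.inter_subset_right)
    (fun y hy => (G.isCocycle_vectorTrans.rep_trans X.1 hy).symm) j
  exact h

variable [Module.Finite K S]

lemma covS_covariant (φ : G.Spinors) (hx : x ∈ G.dom a ∩ G.dom b) (j : Fin n) : G.spinorTrans a b x
    (G.covS b j (G.spinorRep φ b) x) = ∑ i, G.chK K a b x i j • G.covS a i (G.spinorRep φ a) x := by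
  simp only [covS, connS_eq]
  exact G.cov_covariant (K := K) (T := G.spinorTrans a b) G.spinL
    (smoothOn_spinorTrans a b) hx (dirDeriv_spinorTrans hx)
    (fun N N' h => spinorTrans_mul_spinL hx h)
    ((φ.2 b).mono Set.inter_subset_right)
    (fun y hy => (G.isCocycle_spinorTrans.rep_trans φ.1 hy).symm) j

lemma covFun_covariant (f : G.functions) (hx : x ∈ G.dom a ∩ G.dom b) (j : Fin n) : G.extTrans a b
    x (G.covFun b j (G.funRep f b) x) = ∑ i, G.chK K a b x i j • G.covFun a i (G.funRep f a) x := by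
  simp only [covFun, connS_eq]
  exact G.cov_covariant (K := K) (T := G.extTrans a b) (derivExtL K S ∘ₗ G.spinL)
    (smoothOn_extTrans a b) hx (dirDeriv_extTrans hx)
    (fun N N' h => LinearMap.ext fun w => extTrans_mul_derivExt hx h w)
    ((f.2 b).mono Set.inter_subset_right)
    (fun y hy => (G.isCocycle_extTrans.rep_trans f.1 hy).symm) j

end Covariance

end SpecialGradedManifold

namespace Sm

variable {U : TopologicalSpace.Opens M}

lemma val_list_prod {A : Type*} [Ring A] [Algebra K A] [Module.Finite K A] (l : List (Sm K n U A))
    {x : M} (hx : x ∈ U) : l.prod.val x = (l.map fun f => f.val x).prod := by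
  induction l with
  | nil => exact one_val hx
  | cons f l ih => rw [List.prod_cons, mul_val, ih, List.map_cons, List.prod_cons]

end Sm

namespace SpecialGradedManifold

variable (G : SpecialGradedManifold K n M S J)

lemma sgn_κ_mul_self : ((sgn G.κ : ℝ) : K) * ((sgn G.κ : ℝ) : K) = 1 := by
  rw [← RCLike.ofReal_mul, sgn_mul_self, RCLike.ofReal_one]

lemma spinL_commutator_gammaUp {N : Mat(n) K} (hN : IsSkewMat (G.εK K) N) (j : Fin n) :
    G.spinL N * G.gammaUp j - G.gammaUp j * G.spinL N = -∑ p, N j p • G.gammaUp p :=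
  G.isCliffordFamily_gammaUp.commutator_of_isSkew G.sgn_κ_mul_self (G.εK_mul_self K) hN j

lemma spinL_lie {N : Mat(n) K} (hN : IsSkewMat (G.εK K) N) (N' : Mat(n) K) (s : S) :
    G.spinL (N * N' - N' * N) s = G.spinL N (G.spinL N' s) - G.spinL N' (G.spinL N s) :=
  LinearMap.congr_fun (quadElt_commutator_of_commutator (κ := ((sgn G.κ : ℝ) : K))
    (fun j => G.spinL_commutator_gammaUp hN j) hN N').symm s

lemma C_spinL (N : Mat(n) K) (s t : S) : G.C (G.spinL N s) t + G.C s (G.spinL N t) = 0 := by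
  simp only [spinL_eq, spinEnd, LinearMap.sum_apply, map_sum, LinearMap.smul_apply, map_smul,
    smul_eq_mul, ← sum_add]
  refine sum_eq_zero fun p _ => sum_eq_zero fun q _ => ?_
  rw [← mul_add]
  by_cases h : p = q
  · subst h; simp
  · have h1 := G.C_invariant p q h s t
    rw [map_mul] at h1
    simp only [gammaUp, smul_mul_smul_comm, LinearMap.smul_apply, map_smul, smul_eq_mul]
    rw [← mul_add, h1, mul_zero, mul_zero]

variable [Module.Finite K S]

lemma action_spinL_val {U : TopologicalSpace.Opens M} (N : Mat(n) (Sm K n U K)) (s : Sm K n U S) (x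
    : M) : (Sm.action G.spinL N s).val x = G.spinL (Sm.matVal N x) (s.val x) := action_val _ _ _ _

lemma action_derivExt_val {U : TopologicalSpace.Opens M} (N : Mat(n) (Sm K n U K))
    (w : Sm K n U (Ext K S)) (x : M) : (Sm.action (derivExtL K S ∘ₗ G.spinL) N w).val x =
    derivExt (G.spinL (Sm.matVal N x)) (w.val x) :=
  action_val _ _ _ _

def sFrame (a : J) : SFrame (G.fCalc (K := K) (le_refl (G.domO a)))
    (Sm K n (G.domO a) S) (Sm K n (G.domO a) (Ext K S)) where
  E := G.frameModule (le_refl _) G.spinL fun N N' hN s => G.spinL_lie hN N' s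
  Λ := G.frameModule (le_refl _) (derivExtL K S ∘ₗ G.spinL) fun N N' hN w => by
    have h : G.spinL (N * N' - N' * N) = G.spinL N * G.spinL N' - G.spinL N' * G.spinL N :=
      LinearMap.ext fun s => G.spinL_lie hN N' s
    change derivExt (G.spinL (N * N' - N' * N)) w = _
    rw [h]
    exact derivExt_lie _ _ w
  γ i := Sm.mapL (G.gammaUp i)
  C := Sm.map₂L G.C
  ι := Sm.mapL (ExteriorAlgebra.ι K)
  int := Sm.map₂L (LinearMap.mk₂ K (fun s w => interior (G.C s) w)
    (fun s t w => by rw [map_add, interior_add]) (fun c s w => by rw [map_smul, interior_smul])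
    (fun s w w' => map_add _ _ _) (fun c s w => map_smul _ _ _))
  π := Sm.mapA gradeInv
  D_γ i j s := Sm.deriv_map (G.smField_frame' (le_refl _) i) _ _
  r_γ N hN j s := ext_on fun x hx => by
    have hN' : IsSkewMat (G.εK K) (Sm.matVal N x) := fun p q => by
      have h := congrArg (fun g => Sm.val g x) (hN p q)
      have h1 : ∀ i, ((G.fCalc (K := K) (le_refl (G.domO a))).ε i).val x = G.εK K i :=
        fun i => const_val _ hx
      simp only [add_val, mul_val, h1, zero_val] at h
      exact h
    have h := LinearMap.congr_fun (G.spinL_commutator_gammaUp hN' j) (s.val x)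
    rw [sub_val, sum_val]
    refine (action_val _ _ _ _).trans ?_
    rw [LinearMap.sub_apply, Module.End.mul_apply, Module.End.mul_apply, sub_eq_iff_eq_add'] at h
    refine h.trans ?_
    rw [LinearMap.neg_apply, ← sub_eq_add_neg, LinearMap.sum_apply, Sm.mapL_val]
    congr 1
    exact congrArg (G.gammaUp j) (action_val _ _ _ _).symm
  D_C i s t := Sm.deriv_map₂ (G.smField_frame' (le_refl _) i) _ _ _
  C_r N s t := ext_on fun x _ =>
    (congrArg₂ (· + ·) (congrArg (fun s' => G.C s' (t.val x)) (G.action_spinL_val N s x))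
      (congrArg (G.C (s.val x)) (G.action_spinL_val N t x))).trans
      (G.C_spinL (Sm.matVal N x) (s.val x) (t.val x))
  C_γ i s t := ext_on fun x _ => by
    change G.C (s.val x) (G.gammaUp i (t.val x)) = G.C (t.val x) (G.gammaUp i (s.val x))
    rw [gammaUp, LinearMap.smul_apply, LinearMap.smul_apply, map_smul, map_smul, G.C_susy]
  ι_mul s w := ext_on fun x _ => ι_mul_eq _ _
  π_ι s := ext_on fun x _ => gradeInv_ι _
  D_mul i v w := Sm.deriv_map₂ (G.smField_frame' (le_refl _) i) (LinearMap.mul K (Ext K S)) _ _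
  r_mul N v w := ext_on fun x _ => by
    refine (G.action_derivExt_val _ _ _).trans ((derivExt_mul _ _ _).trans ?_)
    rw [add_val, mul_val, mul_val]
    exact congrArg₂ (· + ·) (congrArg (· * w.val x) (G.action_derivExt_val _ _ _).symm)
      (congrArg (v.val x * ·) (G.action_derivExt_val _ _ _).symm)
  D_ι i s := Sm.deriv_map (G.smField_frame' (le_refl _) i) _ _
  r_ι N s := ext_on fun x _ => by
    refine (action_val _ _ _ _).trans ((derivExt_ι _ _).trans ?_)
    exact congrArg (ExteriorAlgebra.ι K) (G.action_spinL_val _ _ _).symm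
  D_π i w := Sm.deriv_map (G.smField_frame' (le_refl _) i) _ _
  r_π N w := ext_on fun x _ => by
    refine (action_val _ _ _ _).trans ((derivExt_gradeInv _ _).trans ?_)
    exact congrArg gradeInv (G.action_derivExt_val _ _ _).symm
  int_ι s t := ext_on fun x hx => by
    rw [Sm.algebraMap_val _ hx]
    exact interior_ι _ _
  int_mul s v w := ext_on fun x _ => interior_mul _ _ _
  int_int s t w := ext_on fun x _ => interior_interior _ _ _
  int_π s w := ext_on fun x _ => interior_gradeInv _ _
  D_int i s w := Sm.deriv_map₂ (G.smField_frame' (le_refl _) i) _ _ _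
  r_int N s w := ext_on fun x _ => by
    refine (action_val _ _ _ _).trans ((derivExt_interior _ _ _).trans ?_)
    have h : G.C (s.val x) ∘ₗ G.spinL (Sm.matVal N x) = -G.C (G.spinL (Sm.matVal N x) (s.val x)) :=
      LinearMap.ext fun t => eq_neg_of_add_eq_zero_right (G.C_spinL _ _ _)
    rw [h, add_val]
    have h2 : ∀ (d : Dual K S) (w : Ext K S), interior (-d) w = -interior d w :=
      fun d w => by rw [← neg_one_smul K, interior_smul, neg_one_smul]
    rw [h2, sub_neg_eq_add, add_comm]
    exact congrArg₂ (· + ·) (congrArg (fun s' => interior (G.C s') (w.val x))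
      (G.action_spinL_val _ _ _).symm)
      (congrArg (interior (G.C (s.val x))) (G.action_derivExt_val _ _ _).symm)

end SpecialGradedManifold

namespace Sm

variable {U : TopologicalSpace.Opens M}

def evalRing {x : M} (hx : x ∈ U) : Sm K n U K →+* K where
  toFun f := f.val x
  map_one' := one_val hx
  map_mul' _ _ := rfl
  map_zero' := rfl
  map_add' _ _ := rfl

end Sm

def IsLift {K : Type*} [RCLike K] {n : ℕ}
    {M : Type*} [TopologicalSpace M] [ChartedSpace (Model n) M] {U : TopologicalSpace.Opens M}
    {k : ℕ} (P : Tens n (Sm K n U K) k) (A : M → Tens n ℝ k) : Prop :=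
  ∀ x (hx : x ∈ U), Tens.map (Sm.evalRing hx) P = Tens.map (algebraMap ℝ K) (A x)

section Lift

variable {U : TopologicalSpace.Opens M} {k l : ℕ}

lemma isLift_iff {P : Tens n (Sm K n U K) k} {A : M → Tens n ℝ k} :
    IsLift P A ↔ ∀ x ∈ U, ∀ I q, (P I q).val x = ((A x I q : ℝ) : K) :=
  ⟨fun h x hx I q => congrFun (congrFun (h x hx) I) q,
    fun h x hx => funext fun I => funext fun q => h x hx I q⟩

namespace IsLift

variable {P : Tens n (Sm K n U K) k} {A : M → Tens n ℝ k}

lemma val (h : IsLift P A) {x : M} (hx : x ∈ U) (I : Fin k → Fin n) (q : Fin n) :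
    (P I q).val x = ((A x I q : ℝ) : K) := isLift_iff.mp h x hx I q

lemma csmooth (h : IsLift P A) (I : Fin k → Fin n) (q : Fin n) :
    CSmooth n (fun x => A x I q) (U : Set M) := by
  have h1 := CSmooth.clm (RCLike.reCLM (K := K)) (P I q).smooth.csmooth
  refine h1.congr fun x hx => ?_
  rw [h.val hx]
  simp

lemma unique {P' : Tens n (Sm K n U K) k} (h : IsLift P A) (h' : IsLift P' A) : P = P' :=
  funext fun I => funext fun q => ext_on fun x hx => by rw [h.val hx, h'.val hx]

lemma eq_realSm (h : IsLift P A) (I : Fin k → Fin n) (q : Fin n) :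
    P I q = SpinManifold.realSm n K U fun x => A x I q :=
  ext_on fun x hx => by rw [h.val hx, SpinManifold.realSm_val (h.csmooth I q) hx]

variable {T : Tens n (Sm K n U K) 3} {R : M → Tens n ℝ 3}

lemma contractR (hT : IsLift T R) (h : IsLift P A) :
    IsLift (Tens.contractR T P) fun x => Tens.contractR (R x) (A x) := fun x hx => by
  rw [Tens.map_contractR, Tens.map_contractR, hT x hx, h x hx]

variable {Q : Tens n (Sm K n U K) (l + 1)} {B : M → Tens n ℝ (l + 1)}

lemma contractR₂ {Q : Tens n (Sm K n U K) l} {B : M → Tens n ℝ l} (hT : IsLift T R)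
    (h : IsLift P A) (h' : IsLift Q B) : IsLift (Tens.contractR₂ T P Q) fun x => Tens.contractR₂ (R x) (A x) (B x) := fun x hx => by
  rw [Tens.map_contractR₂, Tens.map_contractR₂, hT x hx, h x hx, h' x hx]

lemma insert (h : IsLift P A) (h' : IsLift Q B) :
    IsLift (Tens.insert P Q) fun x => Tens.insert (A x) (B x) :=
  fun x hx => by rw [Tens.map_insert, Tens.map_insert, h x hx, h' x hx]

lemma circ (h : IsLift P A) (h' : IsLift Q B) :
    IsLift (Tens.circ P Q) fun x => Tens.circ (A x) (B x) :=
  fun x hx => by rw [Tens.map_circ, Tens.map_circ, h x hx, h' x hx]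

lemma bullet {P : Tens n (Sm K n U K) (k + 1)} {A : M → Tens n ℝ (k + 1)} (h : IsLift P A)
    (h' : IsLift Q B) : IsLift (Tens.bullet P Q) fun x => Tens.bullet (A x) (B x) :=
  fun x hx => by rw [Tens.map_bullet, Tens.map_bullet, h x hx, h' x hx]

lemma sub {P' : Tens n (Sm K n U K) k} {A' : M → Tens n ℝ k} (h : IsLift P A) (h' : IsLift P' A') :
    IsLift (P - P') fun x => A x - A' x := isLift_iff.mpr fun x hx I q => by
  rw [Pi.sub_apply, Pi.sub_apply, sub_val, h.val hx, h'.val hx, Pi.sub_apply, Pi.sub_apply,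
    RCLike.ofReal_sub]

lemma swap {P : Tens n (Sm K n U K) (l + k)} {A : M → Tens n ℝ (l + k)} (h : IsLift P A) :
    IsLift (Tens.swap P) fun x => Tens.swap (A x) :=
  isLift_iff.mpr fun _ hx _ q => h.val hx _ q

end IsLift

/-- The components of a real tensor as elements of the ring of smooth functions. -/
def liftT (K : Type*) [RCLike K] {n : ℕ} {M : Type*} [TopologicalSpace M] [ChartedSpace (Model n) M]
    [IsManifold Mod(n) ∞ M] (U : TopologicalSpace.Opens M) {k : ℕ} (A : M → Tens n ℝ k) : Tens n (Sm K n U K) k :=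
  fun I q => SpinManifold.realSm n K U fun x => A x I q

lemma isLift_liftT {A : M → Tens n ℝ k} (h : ∀ I q, CSmooth n (fun x => A x I q) (U : Set M)) :
    IsLift (liftT K U A) A :=
  isLift_iff.mpr fun _ hx I q => SpinManifold.realSm_val (h I q) hx

end Lift

namespace SpinManifold

variable (G : SpinManifold n M J)
  {U : TopologicalSpace.Opens M} {a : J} (hU : U ≤ G.domO a) {k : ℕ} {x : M}

variable {A : Tensor n M J k}

include hU in
lemma fCalc_Γ_val (i p q : Fin n) (hx : x ∈ U) : ((G.fCalc (K := K) hU).Γ i q p).val x = ((G.connUp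
    a i p q x : ℝ) : K) :=
  realSm_val ((G.csmooth_connUp a i p q).mono hU) hx

lemma fCalc_D_realSm (i : Fin n) {f : M → ℝ} (hf : CSmooth n f (U : Set M)) (hx : x ∈ U) :
    ((G.fCalc (K := K) hU).D i (realSm n K U f)).val x = ((G.partialDeriv a i f x : ℝ) : K) :=
  deriv_realSm hf _ hx

lemma isLift_nabla {P : Tens n (Sm K n U K) k} (h : IsLift P (A a)) : IsLift ((G.fCalc (K := K)
    hU).nabla P) (G.nabla A a) := isLift_iff.mpr fun x hx I q => by
  rw [FCalc.nabla, FCalc.tens_cov, nabla]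
  simp [add_val, sub_val, sum_val, mul_val, h.val hx, G.fCalc_Γ_val hU _ _ _ hx]
  rw [h.eq_realSm, G.fCalc_D_realSm hU _ (h.csmooth _ _) hx]
  push_cast
  ring

lemma isLift_curv : IsLift (G.fCalc (K := K) hU).curvT (G.curv a) :=
  isLift_iff.mpr fun x hx I q => by
    have hD : ∀ i j p q, ((G.fCalc (K := K) hU).D i ((G.fCalc (K := K) hU).Γ j q p)).val x =
        ((G.partialDeriv a i (G.connUp a j p q) x : ℝ) : K) := fun i j p q =>
      G.fCalc_D_realSm hU i ((G.csmooth_connUp a j p q).mono hU) hx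
    have hc : ∀ i j m, ((G.fCalc (K := K) hU).c i j m).val x =
        ((sgn (G.ε m) * G.bracketCoeff a i j m x : ℝ) : K) := fun i j m => by
      rw [FCalc.c, sub_val, G.fCalc_Γ_val hU _ _ _ hx, G.fCalc_Γ_val hU _ _ _ hx, ← G.connUp_sub]
      push_cast
      rfl
    simp only [FCalc.curvT, FCalc.curvM, Matrix.sub_apply, Matrix.add_apply, mDeriv_apply,
      mul_apply, Matrix.sum_apply, Matrix.smul_apply, smul_eq_mul, sub_val, add_val,
      sum_val, mul_val, hD, hc, G.fCalc_Γ_val hU _ _ _ hx, curv]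
    push_cast
    simp only [sum_sub_distrib]
    congr 3
    · exact sum_ext fun _ => mul_comm _ _
    · exact sum_ext fun _ => mul_comm _ _

/-- A tensor with smooth components which correspond to each other on the overlaps is a tensor
field. -/
lemma isTF_of_equivariant (P : ∀ (a : J) (U : TopologicalSpace.Opens M), U
    ≤ G.domO a → Tens n (Sm ℝ n U ℝ) k) (hP : ∀ a U hU, IsLift (P a U hU) (A a))
    (h : ∀ a b, Tens.Equivar (G.changeSm a b ℝ (G.domO a ⊓ G.domO b)) (P a (G.domO a ⊓ G.domO b)
    inf_le_left) (P b (G.domO a ⊓ G.domO b) inf_le_right)) : G.IsTensorField A := by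
  refine ⟨fun a i q => (hP a _ le_rfl).csmooth i q, fun a b x hx j q => ?_⟩
  have hx' : x ∈ G.domO a ⊓ G.domO b := hx
  have h1 := congrArg (Sm.evalRing hx') (Tens.equivariant_iff.mp (h a b) j q)
  have h2 : ∀ i j, Sm.evalRing hx' (G.changeSm a b ℝ _ i j) =
      G.frameChange a b x i j := fun i j => G.changeSm_val inf_le_left inf_le_right i j hx
  have h3 : ∀ c hc I q, Sm.evalRing hx' (P c (G.domO a ⊓ G.domO b) hc I q) = A c x I q :=
    fun c hc I q => (hP c _ hc).val hx' I q
  simp [h2] at h1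
  simp [h3 a, h3 b] at h1
  exact h1

lemma IsTensorField.equivariant {G : SpinManifold n M J} (hA : G.IsTensorField A)
    {b : J} (hx : x ∈ G.dom a ∩ G.dom b) : Tens.Equivar (G.frameChange a b x) (A a x) (A b x) :=
  Tens.equivariant_iff.mpr (hA.2 a b x hx)

lemma isTF_curv : G.IsTensorField G.curv := G.isTF_of_equivariant (fun _ _ hU => (G.fCalc hU).curvT)
    (fun _ _ hU => G.isLift_curv hU) fun a b => (G.change inf_le_left inf_le_right).curvT

variable {G}

lemma IsTensorField.isLift {A : Tensor n M J k} (hA : G.IsTensorField A) (hU : U ≤ G.domO a) :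
    IsLift (liftT K U (A a)) (A a) := isLift_liftT fun I q => (hA.1 a I q).mono hU

lemma IsTensorField.nabla {A : Tensor n M J k} (hA : G.IsTensorField A) :
    G.IsTensorField (G.nabla A) :=
  G.isTF_of_equivariant (fun a U hU => (G.fCalc hU).nabla (liftT ℝ U (A a)))
    (fun _ _ hU => G.isLift_nabla hU (hA.isLift hU)) fun a b =>
      (G.change inf_le_left inf_le_right).nabla <| by
        rw [Tens.equivariant_iff]
        refine fun j q => ext_on fun x hx => ?_
        have h1 := hA.2 a b x hx j q
        have h2 : ∀ i j, Sm.evalRing hx (G.changeSm a b ℝ (G.domO a ⊓ G.domO b) i j) =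
            G.frameChange a b x i j := fun i j => G.changeSm_val inf_le_left inf_le_right i j hx
        have h3 : ∀ (c : J) (hc : G.domO a ⊓ G.domO b ≤ G.domO c) I q,
            Sm.evalRing hx (liftT ℝ (G.domO a ⊓ G.domO b) (A c) I q) = A c x I q :=
          fun c hc I q => (hA.isLift hc).val hx I q
        change Sm.evalRing hx _ = Sm.evalRing hx _
        simpa only [map_sum, map_mul, map_prod, h2, h3 a inf_le_left, h3 b inf_le_right] using h1

lemma isTF_of_isLift {A : Tensor n M J k} (P : ∀ a : J, Tens n (Sm ℝ n (G.domO a) ℝ) k)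
    (hP : ∀ a, IsLift (P a) (A a)) (h : ∀ a b, ∀ x ∈ G.dom a ∩ G.dom b, Tens.Equivar
    (G.frameChange a b x) (A a x) (A b x)) : G.IsTensorField A :=
  ⟨fun a i q => (hP a).csmooth i q, fun a b x hx => Tens.equivariant_iff.mp (h a b x hx)⟩

variable {l : ℕ} {A : Tensor n M J k} (hA : G.IsTensorField A)

include hA

lemma IsTensorField.contractR : G.IsTensorField (G.contractR A) := isTF_of_isLift _
    (fun a => (G.isLift_curv (K := ℝ) (le_refl (G.domO a))).contractR (hA.isLift le_rfl))
    fun _ _ _ hx => Tens.Equivar.contractR (G.isTF_curv.equivariant hx)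
      (hA.equivariant hx)

lemma IsTensorField.contractR₂ {B : Tensor n M J l} (hB : G.IsTensorField B) :
    G.IsTensorField (G.contractR₂ A B) :=
  isTF_of_isLift _
    (fun a => (G.isLift_curv (K := ℝ) (le_refl (G.domO a))).contractR₂ (hA.isLift le_rfl)
      (hB.isLift le_rfl))
    fun _ _ _ hx => Tens.Equivar.contractR₂ (G.isTF_curv.equivariant hx)
      (hA.equivariant hx) (hB.equivariant hx)

lemma IsTensorField.nablaAlong {B : Tensor n M J l} (hB : G.IsTensorField B) :
    G.IsTensorField (G.nablaAlong A B) :=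
  isTF_of_isLift _
    (fun _ => (hA.isLift le_rfl).insert (hB.nabla.isLift le_rfl))
    fun _ _ _ hx => (hA.equivariant hx).insert (hB.nabla.equivariant hx)

lemma IsTensorField.circOp {B : Tensor n M J (l + 1)} (hB : G.IsTensorField B) :
    G.IsTensorField (circOp A B) :=
  isTF_of_isLift _
    (fun _ => (hA.isLift le_rfl).circ (hB.isLift le_rfl))
    fun _ _ _ hx => (hA.equivariant hx).circ (hB.equivariant hx)

omit hA in
lemma IsTensorField.bulletOp {A : Tensor n M J (k + 1)} {B : Tensor n M J (l + 1)}
    (hA : G.IsTensorField A) (hB : G.IsTensorField B) : G.IsTensorField (bulletOp A B) :=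
  isTF_of_isLift _
    (fun _ => (hA.isLift le_rfl).bullet (hB.isLift le_rfl))
    fun _ _ _ hx => (hA.equivariant hx).bullet (hB.equivariant hx)

end SpinManifold

namespace SpecialGradedManifold

variable (G : SpecialGradedManifold K n M S J) [Module.Finite K S]

/-! ### The tensors obtained from the curvature -/

abbrev fcalc (a : J) : FCalc n (Sm K n (G.domO a) K) := G.fCalc (le_refl (G.domO a))

/-- The properties of `End TM`-valued tensors needed for the fields `𝔅`. -/
structure IsGoodEnd {k : ℕ} (A : Tensor n M J (k + 1)) : Prop where
  isTF : G.IsTensorField A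
  two_le : 2 ≤ k
  good (a : J) : FCalc.GoodEnd (G.sFrame a).E (liftT K (G.domO a) (A a))

structure IsGoodVec {k : ℕ} (A : Tensor n M J k) : Prop where
  isTF : G.IsTensorField A
  two_le : 2 ≤ k
  good (a : J) : FCalc.GoodVec (G.fcalc a) (liftT K (G.domO a) (A a))

variable {G} {k l : ℕ} {a : J}

variable {A : Tensor n M J k} {B : Tensor n M J (l + 1)}

lemma liftT_curv : liftT K (G.domO a) (G.curv a) = (G.fcalc a).curvT :=
  (G.isTF_curv.isLift le_rfl).unique (G.isLift_curv le_rfl)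

lemma liftT_nabla (hA : G.IsTensorField A) :
    liftT K (G.domO a) (G.nabla A a) = (G.fcalc a).nabla (liftT K (G.domO a) (A a)) :=
  (hA.nabla.isLift le_rfl).unique (G.isLift_nabla le_rfl (hA.isLift le_rfl))

lemma liftT_contractR (hA : G.IsTensorField A) : liftT K (G.domO a) (G.contractR A a) =
    Tens.contractR (G.fcalc a).curvT (liftT K (G.domO a) (A a)) :=
  (hA.contractR.isLift le_rfl).unique ((G.isLift_curv le_rfl).contractR (hA.isLift le_rfl))

lemma liftT_contractR₂ (hA : G.IsTensorField A) {B : Tensor n M J l} (hB : G.IsTensorField B) :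
    liftT K (G.domO a) (G.contractR₂ A B a) =
    Tens.contractR₂ (G.fcalc a).curvT (liftT K (G.domO a) (A a)) (liftT K (G.domO a) (B a)) :=
  ((hA.contractR₂ hB).isLift le_rfl).unique
    ((G.isLift_curv le_rfl).contractR₂ (hA.isLift le_rfl) (hB.isLift le_rfl))

lemma liftT_nablaAlong (hA : G.IsTensorField A) {B : Tensor n M J l} (hB : G.IsTensorField B) :
    liftT K (G.domO a) (G.nablaAlong A B a) =
    Tens.insert (liftT K (G.domO a) (A a)) ((G.fcalc a).nabla (liftT K (G.domO a) (B a))) := by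
  rw [← liftT_nabla hB]
  exact ((hA.nablaAlong hB).isLift le_rfl).unique ((hA.isLift le_rfl).insert (hB.nabla.isLift le_rfl))

lemma liftT_circOp (hA : G.IsTensorField A) (hB : G.IsTensorField B) : liftT K (G.domO a)
    (SpinManifold.circOp A B a) = Tens.circ (liftT K (G.domO a) (A a)) (liftT K (G.domO a) (B a)) :=
  ((hA.circOp hB).isLift le_rfl).unique ((hA.isLift le_rfl).circ (hB.isLift le_rfl))

lemma liftT_bulletOp {A : Tensor n M J (k + 1)} (hA : G.IsTensorField A) (hB : G.IsTensorField B) :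
    liftT K (G.domO a) (SpinManifold.bulletOp A B a) =
    Tens.bullet (liftT K (G.domO a) (A a)) (liftT K (G.domO a) (B a)) :=
  ((hA.bulletOp hB).isLift le_rfl).unique ((hA.isLift le_rfl).bullet (hB.isLift le_rfl))

lemma liftT_sub_swap {A : Tensor n M J (k + l)}
    (hA : G.IsTensorField A) {B : Tensor n M J (l + k)} (hB : G.IsTensorField B) : IsLift (liftT K
    (G.domO a) (A a) - Tens.swap (liftT K (G.domO a) (B a))) ((A - SpinManifold.swapBlocks B) a) :=
  (hA.isLift le_rfl).sub (hB.isLift le_rfl).swap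

lemma isGoodEnd_curv : G.IsGoodEnd G.curv :=
  ⟨G.isTF_curv, le_rfl, fun a => by rw [liftT_curv]; exact FCalc.goodEnd_curvT⟩

lemma IsGoodEnd.isGoodVec {A : Tensor n M J (k + 1)} (hA : G.IsGoodEnd A) : G.IsGoodVec A :=
  ⟨hA.isTF, hA.two_le.trans (Nat.le_succ k), fun a => (hA.good a).toGoodVec⟩

lemma IsGoodEnd.nabla {A : Tensor n M J (k + 1)} (hA : G.IsGoodEnd A) : G.IsGoodEnd (k := k + 1)
    (G.nabla A) :=
  ⟨hA.isTF.nabla, hA.two_le.trans (Nat.le_succ k), fun a => by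
    rw [liftT_nabla hA.isTF]; exact (hA.good a).nabla⟩

lemma IsGoodVec.nabla (hA : G.IsGoodVec A) : G.IsGoodVec (G.nabla A) :=
  ⟨hA.isTF.nabla, hA.two_le.trans (Nat.le_succ k), fun a => by
    rw [liftT_nabla hA.isTF]; exact (hA.good a).nabla⟩

lemma IsGoodVec.contractR (hA : G.IsGoodVec A) : G.IsGoodEnd (k := k + 1) (G.contractR A) :=
  ⟨hA.isTF.contractR, hA.two_le.trans (Nat.le_succ k), fun a => by
    rw [liftT_contractR hA.isTF]; exact FCalc.GoodEnd.contractR (hA.good a)⟩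

lemma IsGoodEnd.bulletOp {A : Tensor n M J (k + 1)} (hA : G.IsGoodEnd A) (hB : G.IsGoodEnd B) :
    G.IsGoodEnd (k := k + l) (SpinManifold.bulletOp A B) :=
  ⟨hA.isTF.bulletOp hB.isTF, hA.two_le.trans (Nat.le_add_right k l), fun a => by
    rw [liftT_bulletOp hA.isTF hB.isTF]; exact (hA.good a).bullet (hB.good a)⟩

lemma IsGoodVec.contractR₂ (hA : G.IsGoodVec A) {B : Tensor n M J l} (hB : G.IsGoodVec B) :
    G.IsGoodEnd (k := k + l) (G.contractR₂ A B) :=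
  ⟨hA.isTF.contractR₂ hB.isTF, hA.two_le.trans (Nat.le_add_right k l), fun a => by
    rw [liftT_contractR₂ hA.isTF hB.isTF]
    exact FCalc.GoodEnd.contractR₂ (hA.good a) (hB.good a)⟩

lemma IsGoodVec.nablaAlong_end (hA : G.IsGoodVec A) (hB : G.IsGoodEnd B) : G.IsGoodEnd (k := k + l)
    (G.nablaAlong (l := l + 1) A B) :=
  ⟨hA.isTF.nablaAlong hB.isTF, hA.two_le.trans (Nat.le_add_right k l), fun a => by
    have h := liftT_nablaAlong (a := a) hA.isTF hB.isTF
    refine (congrArg (FCalc.GoodEnd (k := k + l) (G.sFrame a).E) h).mpr ?_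
    exact FCalc.GoodEnd.insert (hA.good a) (hB.good a).nabla⟩

lemma IsGoodVec.nablaAlong (hA : G.IsGoodVec A) {B : Tensor n M J l} (hB : G.IsGoodVec B) :
    G.IsGoodVec (G.nablaAlong A B) :=
  ⟨hA.isTF.nablaAlong hB.isTF, hA.two_le.trans (Nat.le_add_right k l), fun a => by
    rw [liftT_nablaAlong hA.isTF hB.isTF]
    exact (hA.good a).insert (hB.good a).nabla⟩

lemma IsGoodVec.circOp (hA : G.IsGoodVec A) (hB : G.IsGoodEnd B) :
    G.IsGoodVec (SpinManifold.circOp A B) :=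
  ⟨hA.isTF.circOp hB.isTF, hA.two_le.trans (Nat.le_add_right k l), fun a => by
    rw [liftT_circOp hA.isTF hB.isTF]
    exact (hA.good a).circ (hB.good a).toGoodVec⟩

lemma _root_.SGM.SpinManifold.CurvEnd.good {A : Tensor n M J (k + 1)} (hA : G.CurvEnd k A) : G.IsGoodEnd A :=
  SpinManifold.CurvEnd.rec (motive_1 := fun _ A _ => G.IsGoodEnd A)
    (motive_2 := fun _ A _ => G.IsGoodVec A) isGoodEnd_curv (fun _ h => h.nabla)
    (fun _ h => h.contractR) (fun _ _ h h' => h.bulletOp h') (fun _ _ h h' => h.contractR₂ h')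
    (fun _ _ h h' => h.nablaAlong_end h') (fun _ h => h.isGoodVec) (fun _ h => h.nabla)
    (fun _ _ h h' => h.nablaAlong h') (fun _ _ h h' => h.circOp h') hA

lemma _root_.SGM.SpinManifold.CurvVec.good (hA : G.CurvVec k A) : G.IsGoodVec A :=
  SpinManifold.CurvVec.rec (motive_1 := fun _ A _ => G.IsGoodEnd A)
    (motive_2 := fun _ A _ => G.IsGoodVec A) isGoodEnd_curv (fun _ h => h.nabla)
    (fun _ h => h.contractR) (fun _ _ h h' => h.bulletOp h') (fun _ _ h h' => h.contractR₂ h')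
    (fun _ _ h h' => h.nablaAlong_end h') (fun _ h => h.isGoodVec) (fun _ h => h.nabla)
    (fun _ _ h h' => h.nablaAlong h') (fun _ _ h h' => h.circOp h') hA

lemma IsGoodEnd.isSkewValued {A : Tensor n M J (k + 1)} (hA : G.IsGoodEnd A) : G.IsSkewValued A :=
    fun a x hx I p q => by
  have hx' : x ∈ G.domO a := hx
  have h := congrArg (fun f => Sm.val f x) ((hA.good a).skew I p q)
  have h1 : ∀ i, ((G.fcalc a).ε i).val x = ((sgn (G.ε i) : ℝ) : K) := fun i => const_val _ hx'
  have h2 := fun p q => (hA.isTF.isLift (K := K) (le_refl (G.domO a))).val hx' (snoc I p) q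
  simp [Tens.endM, add_val, mul_val, h1, h2, zero_val] at h
  exact_mod_cast h

/-! ### Expressions in a frame -/

variable (G)

def restF (a : J) (f : G.functions) : Sm K n (G.domO a) (Ext K S) := Sm.mk' (G.funRep f a) (f.2 a)

def restS (a : J) (φ : G.Spinors) : Sm K n (G.domO a) S := Sm.mk' (G.spinorRep φ a) (φ.2 a)

def restV (a : J) (X : G.VectorFields) (i : Fin n) : Sm K n (G.domO a) K :=
  Sm.mk' (fun x => G.vectorRep X a x i) ((X.2 a).comp_linear (LinearMap.proj i))

variable {G} {x : M}

variable {A : Tensor n M J (k + 1)}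

lemma restF_val (f : G.functions) (hx : x ∈ G.dom a) : (G.restF a f).val x = G.funRep f a x :=
  Sm.mk'_apply (U := G.domO a) _ _ hx

lemma restS_val (φ : G.Spinors) (hx : x ∈ G.dom a) : (G.restS a φ).val x = G.spinorRep φ a x :=
  Sm.mk'_apply (U := G.domO a) _ _ hx

lemma restV_val (X : G.VectorFields) (i : Fin n) (hx : x ∈ G.dom a) :
    (G.restV a X i).val x = G.vectorRep X a x i := Sm.mk'_apply (U := G.domO a) _ _ hx

lemma fcalc_Γ_val (i : Fin n) (hx : x ∈ G.dom a) :
    Sm.matVal ((G.fcalc a).Γ i) x = G.connM K a i x := by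
  ext q p
  exact G.fCalc_Γ_val (K := K) (le_refl (G.domO a)) i p q hx

lemma fcalc_c_val (i j m : Fin n) (hx : x ∈ G.dom a) :
    ((G.fcalc a).c i j m).val x = ((sgn (G.ε m) * G.bracketCoeff a i j m x : ℝ) : K) := by
  rw [FCalc.c, sub_val, G.fCalc_Γ_val le_rfl _ _ _ hx, G.fCalc_Γ_val le_rfl _ _ _ hx,
    ← G.connUp_sub]
  push_cast
  rfl

lemma cov_restF_val (f : Sm K n (G.domO a) (Ext K S)) (i : Fin n) (hx : x ∈ G.dom a) :
    ((G.sFrame a).Λ.cov i f).val x = G.covFun a i f.val x := by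
  rw [FMod.cov, add_val, covFun, connS_eq, ← fcalc_Γ_val i hx]
  exact congrArg₂ (· + ·) (deriv_val (U := G.domO a) (G.smField_frame' le_rfl i) _ hx) (G.action_derivExt_val _ _ _)

lemma cov_restS_val (s : Sm K n (G.domO a) S) (i : Fin n) (hx : x ∈ G.dom a) :
    ((G.sFrame a).E.cov i s).val x = G.covS a i s.val x := by
  rw [FMod.cov, add_val, covS, connS_eq, ← fcalc_Γ_val i hx]
  exact congrArg₂ (· + ·) (deriv_val (U := G.domO a) (G.smField_frame' le_rfl i) _ hx) (G.action_spinL_val _ _ _)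

lemma covFun_congr {f g : M → Ext K S} (h : ∀ y ∈ G.dom a, f y = g y)
    (i : Fin n) (hx : x ∈ G.dom a) : G.covFun a i f x = G.covFun a i g x := by
  rw [covFun, covFun, h x hx, dirDeriv_congr (G.isOpen_dom a) h hx]

lemma covS_congr {f g : M → S} (h : ∀ y ∈ G.dom a, f y = g y) (i : Fin n) (hx : x ∈ G.dom a) :
    G.covS a i f x = G.covS a i g x := by
  rw [covS, covS, h x hx, dirDeriv_congr (G.isOpen_dom a) h hx]

lemma D_restV_val (X : G.VectorFields) (i q : Fin n) (hx : x ∈ G.dom a) :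
    ((G.fcalc a).D i (G.restV a X q)).val x = dirDeriv K (G.vectorRep X a) x (G.frame a i x) q := by
  refine (deriv_val (U := G.domO a) (G.smField_frame' le_rfl i) _ hx).trans ?_
  rw [dirDeriv_congr (G.isOpen_dom a) (fun y hy => restV_val X q hy) hx]
  exact (map_dirDeriv (LinearMap.proj q : (Fin n → K) →ₗ[K] K) (G.isOpen_dom a) (X.2 a) hx _).symm

lemma cov_restV_val (X : G.VectorFields) (i q : Fin n) (hx : x ∈ G.dom a) :
    ((G.fcalc a).vec.cov i (G.restV a X) q).val x = G.covV a i (G.vectorRep X a) x q := by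
  rw [FCalc.vec_cov, add_val, D_restV_val X i q hx, sum_val, covV]
  congr 1
  exact sum_ext fun m => by rw [mul_val, G.fCalc_Γ_val le_rfl _ _ _ hx, restV_val X m hx]

lemma lieMat_restV_val (X : G.VectorFields) (l j : Fin n) (hx : x ∈ G.dom a) : ((G.fcalc a).lieMat
    (G.restV a X) l j).val x = ((sgn (G.ε l) : ℝ) : K) * G.lieFrame a (G.vectorRep X a) j l x := by
  have h : ((sgn (G.ε l) : ℝ) : K) * ((sgn (G.ε l) : ℝ) : K) = 1 := G.εK_mul_self K l
  rw [FCalc.lieMat_apply, sub_val, sum_val, D_restV_val X j l hx, lieFrame, mul_sub,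
    ← mul_assoc, h, one_mul, mul_sum]
  congr 1
  refine sum_ext fun m => ?_
  rw [mul_val, fcalc_c_val _ _ _ hx, restV_val X m hx]
  push_cast
  ring

lemma isKilling_iff (X : G.VectorFields) :
    X ∈ G.killing ↔ ∀ a, (G.fcalc a).IsKilling (G.restV a X) := by
  have h : ∀ a, (G.fcalc a).IsKilling (G.restV a X) ↔
      (G.fcalc a).IsSkew ((G.fcalc a).lieMat (G.restV a X)) := fun a => by
    refine ⟨fun h => h.isSkew_lieMat, fun h => ?_⟩
    have h1 := (FCalc.IsSkew.sum univ fun i _ =>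
      (FCalc.isSkew_Γ (F := G.fcalc a) i).smul (G.restV a X i)).sub h
    rwa [FCalc.lieMat, sub_sub_cancel] at h1
  have hs : ∀ (i : Fin n) (y : K), ((sgn (G.ε i) : ℝ) : K) * (((sgn (G.ε i) : ℝ) : K) * y) = y :=
    fun i y => by
      have h : ((sgn (G.ε i) : ℝ) : K) * ((sgn (G.ε i) : ℝ) : K) = 1 := G.εK_mul_self K i
      rw [← mul_assoc, h, one_mul]
  simp [h]
  have h2 : ∀ a, ∀ x ∈ G.dom a, ∀ i j, ((G.fcalc a).ε j * (G.fcalc a).lieMat (G.restV a X) j i +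
      (G.fcalc a).ε i * (G.fcalc a).lieMat (G.restV a X) i j).val x =
      G.lieFrame a (G.vectorRep X a) i j x + G.lieFrame a (G.vectorRep X a) j i x := fun a x hx i j => by
    have h1 : ∀ i, ((G.fcalc a).ε i).val x = ((sgn (G.ε i) : ℝ) : K) := fun i =>
      const_val (U := G.domO a) _ hx
    rw [add_val, mul_val, mul_val, h1, h1, lieMat_restV_val X _ _ hx,
      lieMat_restV_val X _ _ hx, hs, hs]
  constructor
  · intro hX a i j
    refine ext_on fun x hx => ?_
    rw [h2 a x hx, hX a x hx]
    rfl
  · intro hX a x hx i j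
    rw [← h2 a x hx, hX a i j]
    rfl

lemma isParallel_iff (φ : G.Spinors) :
    φ ∈ G.parallelSpinors ↔ ∀ a, (G.sFrame a).IsParallel (G.restS a φ) := by
  have h : ∀ a, ∀ x ∈ G.dom a, ∀ i, ((G.sFrame a).E.cov i (G.restS a φ)).val x =
      G.covS a i (G.spinorRep φ a) x := fun a x hx i =>
    (cov_restS_val _ i hx).trans (covS_congr (fun y hy => restS_val φ hy) i hx)
  constructor
  · intro hφ a i
    refine ext_on fun x hx => ?_
    rw [h a x hx, hφ a x hx i]
    rfl
  · intro hφ a x hx i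
    rw [← h a x hx, hφ a i]
    rfl

lemma nablaVS_eq (X : G.VectorFields) (hx : x ∈ G.dom a) :
    G.nablaVS a (G.vectorRep X a) x = G.spinL (Sm.matVal ((G.fcalc a).nablaV (G.restV a X)) x) := by
  rw [nablaVS, spinL_eq]
  congr 1
  funext p q
  rw [low]
  congr 1
  exact (cov_restV_val X p q hx).symm

lemma lieD_restS_val (X : G.VectorFields) (φ : G.Spinors) (hx : x ∈ G.dom a) :
    ((G.sFrame a).E.lieD (G.restV a X) (G.restS a φ)).val x = G.evenSpinorExpr X φ a x := by
  rw [FMod.lieD, sub_val, evenSpinorExpr, nablaVS_eq X hx, ← restS_val φ hx, sum_val]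
  congr 1
  · refine sum_ext fun i => ?_
    rw [Sm.smul_val, restV_val X i hx, cov_restS_val _ i hx,
      covS_congr (fun y hy => restS_val φ hy) i hx]
  · exact G.action_spinL_val _ _ _

lemma lieD_restF_val (X : G.VectorFields) (f : G.functions) (hx : x ∈ G.dom a) :
    ((G.sFrame a).Λ.lieD (G.restV a X) (G.restF a f)).val x = G.evenExpr X a (G.funRep f a) x := by
  rw [FMod.lieD, sub_val, evenExpr, nablaVS_eq X hx, ← restF_val f hx, sum_val]
  congr 1
  · refine sum_ext fun i => ?_
    rw [Sm.smul_val, restV_val X i hx, cov_restF_val _ i hx,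
      covFun_congr (fun y hy => restF_val f hy) i hx]
  · exact G.action_derivExt_val _ _ _

lemma lieD_restV_val (X Y : G.VectorFields) (q : Fin n) (hx : x ∈ G.dom a) :
    ((G.fcalc a).vec.lieD (G.restV a X) (G.restV a Y) q).val x = G.lieExpr X Y a x q := by
  have hs : ((sgn (G.ε q) : ℝ) : K) * ((sgn (G.ε q) : ℝ) : K) = 1 := G.εK_mul_self K q
  rw [FMod.lieD_eq, Pi.add_apply, Finset.sum_apply, add_val, sum_val, FCalc.vec_r,
    Matrix.mulVec, dotProduct, sum_val, lieExpr, sum_sub_distrib]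
  simp only [Pi.smul_apply, smul_eq_mul, mul_val, FCalc.vec_D, D_restV_val _ _ _ hx,
    restV_val _ _ hx, lieMat_restV_val _ _ _ hx, lieFrame]
  rw [sum_comm (f := fun i j => G.vectorRep X a x i * G.vectorRep Y a x j * _), sub_add,
    sub_eq_add_neg (∑ i, G.vectorRep X a x i * _), ← sum_sub_distrib, ← sum_neg_distrib]
  congr 1
  refine sum_ext fun j => ?_
  have h1 : ∀ i, G.vectorRep X a x i * G.vectorRep Y a x j *
      ((sgn (G.ε q) * G.bracketCoeff a i j q x : ℝ) : K) = ((sgn (G.ε q) : ℝ) : K) *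
      (G.vectorRep X a x i * ((G.bracketCoeff a i j q x : ℝ) : K)) * G.vectorRep Y a x j := by
    intro i; push_cast; ring
  simp only [h1]
  rw [← sum_mul, ← mul_sum]
  linear_combination (-(dirDeriv K (G.vectorRep X a) x (G.frame a j x) q * G.vectorRep Y a x j)) * hs

lemma u_restS_val (ξ : Fin k → G.Spinors) (I : Fin k → Fin n) (hx : x ∈ G.dom a) :
    ((G.sFrame a).u (fun α => G.restS a (ξ α)) I).val x = G.wedge ξ a I x := by
  rw [SFrame.u, SFrame.W_apply, Sm.val_list_prod (U := G.domO a) _ hx, List.map_ofFn, wedge,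
    ExteriorAlgebra.ιMulti_apply]
  congr 2
  funext α
  exact congrArg (fun s => ExteriorAlgebra.ι K (G.gammaUp (I α) s)) (restS_val (ξ α) hx)

lemma tensorS_eq (hA : G.IsTensorField A) (I : Fin k → Fin n) (hx : x ∈ G.dom a) :
    G.tensorS A a I x = G.spinL (Sm.matVal ((liftT K (G.domO a) (A a)).endM I) x) := by
  rw [tensorS, spinL_eq]
  congr 1
  funext p q
  rw [low, RCLike.ofReal_mul]
  congr 1
  exact ((hA.isLift le_rfl).val (U := G.domO a) hx (snoc I p) q).symm

lemma fB_val (hA : G.IsTensorField A) (ξ : Fin k → G.Spinors) (f : G.functions) (hx : x ∈ G.dom a) :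
    ((G.sFrame a).fB (liftT K (G.domO a) (A a)) (fun α => G.restS a (ξ α)) (G.restF a f)).val x =
    G.fieldBExpr k A ξ a (G.funRep f a) x := by
  rw [SFrame.fB, sum_val, fieldBExpr]
  refine sum_ext fun I => ?_
  rw [mul_val, u_restS_val ξ I hx, tensorS_eq hA I hx, ← restF_val f hx]
  exact congrArg (G.wedge ξ a I x * ·) (G.action_derivExt_val _ _ _)

lemma fD_val {A : Tensor n M J k} (hA : G.IsTensorField A) (ξ : Fin k → G.Spinors)
    (f : G.functions) (hx : x ∈ G.dom a) : ((G.sFrame a).fD (liftT K (G.domO a) (A a))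
    (fun α => G.restS a (ξ α)) (G.restF a f)).val x = G.fieldDExpr k A ξ a (G.funRep f a) x := by
  rw [SFrame.fD, sum_val, fieldDExpr]
  refine sum_ext fun I => ?_
  rw [mul_val, u_restS_val ξ I hx, SFrame.covL_apply, sum_val, mul_sum]
  refine sum_ext fun j => ?_
  rw [Sm.smul_val, (hA.isLift le_rfl).val (U := G.domO a) hx, cov_restF_val _ j hx,
    covFun_congr (fun y hy => restF_val f hy) j hx, mul_smul_comm]

lemma fO_val (φ : G.Spinors) (f : G.functions) (hx : x ∈ G.dom a) :
    ((G.sFrame a).fO (G.restS a φ) (G.restF a f)).val x = G.oddExpr φ a (G.funRep f a) x := by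
  rw [SFrame.fO, add_val, sum_val, oddExpr, ← restF_val f hx, ← restS_val φ hx]
  congr 1
  refine sum_ext fun i => ?_
  rw [mul_val, cov_restF_val _ i hx, covFun_congr (fun y hy => restF_val f hy) i hx]
  rfl

lemma susy_val (φ ψ : G.Spinors) (i : Fin n) (hx : x ∈ G.dom a) :
    ((fun i => 2 * (G.sFrame a).C (G.restS a φ) ((G.sFrame a).γ i (G.restS a ψ)))
    i : Sm K n (G.domO a) K).val x = G.susyExpr φ ψ a x i := by
  rw [susyExpr, ← restS_val φ hx, ← restS_val ψ hx, two_mul]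
  beta_reduce
  rw [two_mul, add_val]
  rfl

end SpecialGradedManifold

/-! ### Changes of bases in sums -/

section Transfer

variable {K : Type*} [Field K]

lemma sum_transfer {ι V V' Z : Type*} [Fintype ι] [DecidableEq ι]
    [AddCommGroup V] [Module K V] [AddCommGroup V'] [Module K V'] [AddCommGroup Z] [Module K Z]
    {L N : Matrix ι ι K} (h : L * N = 1) (β : V →ₗ[K] V' →ₗ[K] Z) (u : ι → V) (A : ι → V') :
    ∑ j, β (∑ i, N j i • u i) (∑ i, L i j • A i) = ∑ i, β (u i) (A i) := by
  have h1 : ∀ j, β (∑ i, N j i • u i) (∑ i, L i j • A i) =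
      ∑ m, ∑ i, (L m j * N j i) • β (u i) (A m) := fun j => by
    simp [LinearMap.sum_apply, smul_sum, smul_smul]
  have h2 : ∀ m i, ∑ j, (L m j * N j i) • β (u i) (A m) =
      (1 : Matrix ι ι K) m i • β (u i) (A m) := fun m i => by
    rw [← h, mul_apply, sum_smul]
  simp only [h1]
  rw [sum_comm]
  simp [sum_comm (s := univ (α := ι)) (f := fun j i => (L _ j * N j i) • _), h2]
  simp [Matrix.one_apply]

def powMat {n : ℕ} (k : ℕ) (L : Mat(n) K) : Matrix (Fin k → Fin n) (Fin k → Fin n) K := fun I J => ∏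
    α, L (I α) (J α)

lemma powMat_mul {n k : ℕ} (L N : Mat(n) K) : powMat k L * powMat k N = powMat k (L * N) := by
  ext I H
  simp [powMat, mul_apply, ← Finset.prod_mul_distrib]
  rw [Finset.prod_univ_sum, Fintype.piFinset_univ]

lemma powMat_one {n k : ℕ} : powMat k (1 : Mat(n) K) = 1 := by
  ext I H
  simp [powMat, Matrix.one_apply]
  rw [Finset.prod_ite_zero]
  simp [funext_iff]

end Transfer

namespace SpecialGradedManifold

variable (G : SpecialGradedManifold K n M S J) [Module.Finite K S] {a b : J} {x : M} {k : ℕ}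

/-! ### Operators given by sections -/

section Contract

variable {G}

lemma contractS_tmul (h f : Ext K S) (s : S) : G.contractS h (f ⊗ₜ s) = f * interior (G.C s) h :=
    rfl

lemma contractV_tmul (h : Fin n → Ext K S) (f : Ext K S) (X : Fin n → K) :
    contractV h (f ⊗ₜ X) = f * ∑ i, X i • h i := rfl

lemma contractS_add (h h' : Ext K S) (t : Ext K S ⊗[K] S) :
    G.contractS (h + h') t = G.contractS h t + G.contractS h' t := by
  induction t with
  | zero => simp
  | tmul f s => simp [contractS_tmul, mul_add]
  | add t t' ht ht' => rw [map_add, map_add, map_add, ht, ht']; abel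

lemma contractS_smul (c : K) (h : Ext K S) (t : Ext K S ⊗[K] S) :
    G.contractS (c • h) t = c • G.contractS h t := by
  induction t with
  | zero => simp
  | tmul f s => simp [contractS_tmul, mul_smul_comm]
  | add t t' ht ht' => rw [map_add, map_add, ht, ht', smul_add]

lemma contractV_add (h h' : Fin n → Ext K S) (t : Ext K S ⊗[K] (Fin n → K)) :
    contractV (fun i => h i + h' i) t = contractV h t + contractV h' t := by
  induction t with
  | zero => simp
  | tmul f s => simp [contractV, mul_add, sum_add]
  | add t t' ht ht' => rw [map_add, map_add, map_add, ht, ht']; abel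

lemma contractV_smul (c : K) (h : Fin n → Ext K S) (t : Ext K S ⊗[K] (Fin n → K)) :
    contractV (fun i => c • h i) t = c • contractV h t := by
  induction t with
  | zero => simp
  | tmul f s => simp [contractV, smul_sum, smul_comm c, mul_sum]
  | add t t' ht ht' => rw [map_add, map_add, ht, ht', smul_add]

lemma extTrans_mul (f h : Ext K S) :
    G.extTrans a b x (f * h) = G.extTrans a b x f * G.extTrans a b x h :=
  map_mul (ExteriorAlgebra.map (G.spinorTrans a b x)) f h

lemma extTrans_ι (s : S) :
    G.extTrans a b x (ExteriorAlgebra.ι K s) = ExteriorAlgebra.ι K (G.spinorTrans a b x s) :=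
  ExteriorAlgebra.map_apply_ι _ _

lemma extTrans_contractS (hx : x ∈ G.dom a ∩ G.dom b) (h : Ext K S) (t : Ext K S ⊗[K] S) :
    G.extTrans a b x (G.contractS h t) = G.contractS
    (G.extTrans a b x h) (TensorProduct.map (G.extTrans a b x) (G.spinorTrans a b x) t) := by
  induction t with
  | zero => simp
  | tmul f s =>
    refine (extTrans_mul f (interior (G.C s) h)).trans ?_
    exact congrArg (G.extTrans a b x f * ·)
      (map_interior (G.spinorTrans a b x) _ _ (fun t => G.C_trans a b x hx s t) h)
  | add t t' ht ht' => rw [map_add, map_add, map_add, map_add, ht, ht']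

lemma extTrans_contractV (h h' : Fin n → Ext K S) (hh : ∀ j, G.extTrans a b x (h j) =
    ∑ i, G.chK K a b x i j • h' i) (t : Ext K S ⊗[K] (Fin n → K)) : G.extTrans a b x (contractV h t)
    = contractV h' (TensorProduct.map (G.extTrans a b x) (G.vectorTrans a b x) t) := by
  induction t with
  | zero => simp
  | tmul f X =>
    refine (extTrans_mul f (∑ j, X j • h j)).trans (congrArg (G.extTrans a b x f * ·) ?_)
    simp [hh, smul_sum, smul_smul]
    rw [sum_comm]
    refine sum_ext fun i => ?_
    rw [← sum_smul]
    congr 1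
    exact sum_ext fun j => mul_comm _ _
  | add t t' ht ht' => rw [map_add, map_add, map_add, map_add, ht, ht']

lemma funRep_add (f h : G.functions) :
    G.funRep (f + h) a = fun x => G.funRep f a x + G.funRep h a x := G.rep_add _ a f.1 h.1

lemma funRep_smul (c : K) (f : G.functions) : G.funRep (c • f) a = fun x => c • G.funRep f a x :=
    G.rep_smul _ a c f.1

lemma covFun_funRep_add (f h : G.functions) (i : Fin n) (hx : x ∈ G.dom a) : G.covFun
    a i (G.funRep (f + h) a) x = G.covFun a i (G.funRep f a) x + G.covFun a i (G.funRep h a) x := by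
  rw [funRep_add, covFun, dirDeriv_add (G.isOpen_dom a) (f.2 a) (h.2 a) hx, map_add]
  exact add_add_add_comm _ _ _ _

lemma covFun_funRep_smul (c : K) (f : G.functions) (i : Fin n) (hx : x ∈ G.dom a) :
    G.covFun a i (G.funRep (c • f) a) x = c • G.covFun a i (G.funRep f a) x := by
  rw [funRep_smul, covFun, dirDeriv_smul (G.isOpen_dom a) (f.2 a) hx, map_smul, covFun, smul_add]

/-- The expressions of an operator given by sections of `ΛS ⊗ S` and `ΛS ⊗ TM` define a global
operator. -/
lemma isGivenBy_glueOp {F : J → (M → Ext K S) → M → Ext K S} (hs : ∀ (f : G.functions) a, SmoothOn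
    K n (F a (G.funRep f a)) (G.dom a)) (Φ : J → M → Ext K S ⊗[K] S) (Ψ : J → M → Ext K S
    ⊗[K] (Fin n → K)) (hF : ∀ (f : G.functions) a, ∀ x ∈ G.dom a, F a (G.funRep f a) x = G.contractS
    (G.funRep f a x) (Φ a x) + contractV (fun i => G.covFun a i (G.funRep f a) x) (Ψ a x))
    (hΦ : ∀ a b, ∀ x ∈ G.dom a ∩ G.dom b, TensorProduct.map (G.extTrans a b x)
    (G.spinorTrans a b x) (Φ b x) = Φ a x) (hΨ : ∀ a b, ∀ x ∈ G.dom a ∩ G.dom b, TensorProduct.map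
    (G.extTrans a b x) (G.vectorTrans a b x) (Ψ b x) = Ψ a x) : G.IsGivenBy (G.glueOp F) F := by
  classical
  have hc : ∀ (f : G.functions) a b, ∀ x ∈ G.dom a ∩ G.dom b,
      G.extTrans a b x (F b (G.funRep f b) x) = F a (G.funRep f a) x := fun f a b x hx => by
    rw [hF f b x hx.2, hF f a x hx.1, map_add, extTrans_contractS hx, hΦ a b x hx,
      extTrans_contractV _ _ (fun j => covFun_covariant f hx j), hΨ a b x hx,
      G.isCocycle_extTrans.rep_trans f.1 hx]
  choose s hs' using fun f : G.functions =>
    G.isCocycle_extTrans.exists_section (σ := fun a => F a (G.funRep f a)) (hs f) (hc f)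
  have hex : ∃ T, G.IsGivenBy T F := by
    refine ⟨{ toFun := fun f => ⟨(s f).1, (s f).2⟩, map_add' := fun f h => ?_,
              map_smul' := fun c f => ?_ }, fun f a x hx => hs' f a x hx⟩
    · refine Subtype.ext (congrArg Subtype.val (a₁ := s (f + h)) (a₂ := s f + s h)
        (G.isCocycle_extTrans.sections_ext fun a x hx => ?_))
      rw [hs' _ a x hx, hF _ a x hx]
      refine Eq.trans ?_ (congrFun (G.rep_add G.extTrans a (s f).1 (s h).1) x).symm
      rw [hs' _ a x hx, hs' _ a x hx, hF _ a x hx, hF _ a x hx]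
      simp [covFun_funRep_add _ _ _ hx]
      rw [contractV_add, congrFun (funRep_add f h) x, contractS_add]
      exact add_add_add_comm _ _ _ _
    · refine Subtype.ext (congrArg Subtype.val (a₁ := s (c • f)) (a₂ := c • s f)
        (G.isCocycle_extTrans.sections_ext fun a x hx => ?_))
      rw [hs' _ a x hx, hF _ a x hx]
      refine Eq.trans ?_ (congrFun (G.rep_smul G.extTrans a c (s f).1) x).symm
      rw [hs' _ a x hx, hF _ a x hx]
      simp only [covFun_funRep_smul _ _ _ hx]
      rw [contractV_smul, congrFun (funRep_smul c f) x, contractS_smul, smul_add]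
  rw [glueOp, dif_pos hex]
  exact hex.choose_spec

end Contract

/-! ### The spinor endomorphisms as tensors -/

lemma exists_dual_basis (c : Fin (Module.finrank K S)) : ∃ θ : S, G.C θ = (finBasis K S).coord c :=
    by
  have hi : Function.Injective G.C := (injective_iff_map_eq_zero _).mpr fun s hs =>
      G.C_nondegenerate.1 s fun t => by rw [hs, LinearMap.zero_apply]
  exact ((LinearMap.injective_iff_surjective_of_finrank_eq_finrank
    (Subspace.dual_finrank_eq (K := K) (V := S)).symm).mp hi) _

/-- The basis dual to the chosen basis of `S` with respect to the charge conjugation. -/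
def dualB (c : Fin (Module.finrank K S)) : S := (G.exists_dual_basis c).choose

lemma C_dualB (c : Fin (Module.finrank K S)) : G.C (G.dualB c) = (finBasis K S).coord c :=
    (G.exists_dual_basis c).choose_spec

def wedgeEnd : Ext K S →ₗ[K] End K S →ₗ[K] Ext K S ⊗[K] S :=
  LinearMap.mk₂ K (fun u Φ => ∑ c, (u * ExteriorAlgebra.ι K (Φ (finBasis K S c))) ⊗ₜ G.dualB c)
    (fun u u' Φ => by simp only [add_mul, TensorProduct.add_tmul, sum_add])
    (fun r u Φ => by simp only [smul_mul_assoc, TensorProduct.smul_tmul', smul_sum])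
    (fun u Φ Φ' => by
      simp only [LinearMap.add_apply, map_add, mul_add, TensorProduct.add_tmul, sum_add])
    (fun r u Φ => by
      simp only [LinearMap.smul_apply, map_smul, mul_smul_comm, TensorProduct.smul_tmul', smul_sum])

lemma wedgeEnd_apply (u : Ext K S) (Φ : End K S) :
    G.wedgeEnd u Φ = ∑ c, (u * ExteriorAlgebra.ι K (Φ (finBasis K S c))) ⊗ₜ G.dualB c := rfl

lemma contractS_wedgeEnd (u h : Ext K S) (Φ : End K S) :
    G.contractS h (G.wedgeEnd u Φ) = u * derivExt Φ h := by
  rw [wedgeEnd_apply, map_sum, derivExt_apply, mul_sum]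
  refine sum_ext fun c => ?_
  rw [contractS_tmul, C_dualB, mul_assoc]

variable {G}

lemma sum_spinorTrans_dualB (hx : x ∈ G.dom a ∩ G.dom b) : ∑ c, G.spinorTrans a b x (finBasis K S c)
    ⊗ₜ[K] G.spinorTrans a b x (G.dualB c) = ∑ c, finBasis K S c ⊗ₜ[K] G.dualB c := by
  have hi : Function.Injective G.C := (injective_iff_map_eq_zero _).mpr fun s hs =>
      G.C_nondegenerate.1 s fun t => by rw [hs, LinearMap.zero_apply]
  have h1 : ∀ t, t = ∑ c, G.C t (finBasis K S c) • G.dualB c := fun t => by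
    refine hi ((finBasis K S).ext fun d => ?_)
    simp only [map_sum, map_smul, C_dualB, LinearMap.sum_apply, LinearMap.smul_apply,
      Module.Basis.coord_apply, Module.Basis.repr_self, smul_eq_mul]
    simp [Finsupp.single_apply]
  have h2 : ∀ d, ∑ c, G.C (G.spinorTrans a b x (G.dualB c)) (finBasis K S d) •
      G.spinorTrans a b x (finBasis K S c) = finBasis K S d := fun d => by
    obtain ⟨s, hs⟩ : ∃ s, G.spinorTrans a b x s = finBasis K S d :=
      ⟨G.spinorTrans b a x (finBasis K S d), by
        have h := LinearMap.congr_fun (G.isCocycle_spinorTrans.comp a b a x ⟨hx, hx.1⟩)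
          (finBasis K S d)
        rwa [G.isCocycle_spinorTrans.self a x hx.1] at h⟩
    have h3 : ∀ c, G.C (G.spinorTrans a b x (G.dualB c)) (finBasis K S d) =
        (finBasis K S).repr s c := fun c => by
      rw [← hs]
      refine (G.C_trans a b x hx _ _).trans ?_
      rw [C_dualB, Module.Basis.coord_apply]
    simp only [h3, ← map_smul, ← map_sum]
    rw [(finBasis K S).sum_repr, hs]
  have h4 : ∀ c, G.spinorTrans a b x (finBasis K S c) ⊗ₜ[K]
      G.spinorTrans a b x (G.dualB c) = ∑ d, (G.C (G.spinorTrans a b x (G.dualB c))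
      (finBasis K S d) • G.spinorTrans a b x (finBasis K S c)) ⊗ₜ G.dualB d := fun c => by
    conv_lhs => rw [h1 (G.spinorTrans a b x (G.dualB c)), TensorProduct.tmul_sum]
    simp [TensorProduct.smul_tmul']
  simp [h4]
  rw [sum_comm]
  simp [← TensorProduct.sum_tmul, h2]

lemma map_wedgeEnd (hx : x ∈ G.dom a ∩ G.dom b) (u : Ext K S) {Φ Φ' : End K S}
    (h : G.spinorTrans a b x * Φ = Φ' * G.spinorTrans a b x) : TensorProduct.map (G.extTrans a b x)
    (G.spinorTrans a b x) (G.wedgeEnd u Φ) = G.wedgeEnd (G.extTrans a b x u) Φ' := by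
  have h1 : ∀ s, G.spinorTrans a b x (Φ s) = Φ' (G.spinorTrans a b x s) := LinearMap.congr_fun h
  have h2 := congrArg (TensorProduct.map (LinearMap.mulLeft K (G.extTrans a b x u) ∘ₗ
    ExteriorAlgebra.ι K ∘ₗ Φ') (LinearMap.id : S →ₗ[K] S)) (sum_spinorTrans_dualB hx)
  simp at h2
  simp [wedgeEnd_apply, extTrans_mul, extTrans_ι, h1]
  exact h2

/-! ### Covariance -/

variable {A : Tensor n M J (k + 1)}
variable (K) in
def coChange (G : SpecialGradedManifold K n M S J) (a b : J) (x : M) : Mat(n) K :=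
  fun j i => G.εK K j * G.chK K a b x i j * G.εK K i

lemma chK_mul_coChange (hx : x ∈ G.dom a ∩ G.dom b) : G.chK K a b x * G.coChange K a b x = 1 := by
  ext i k
  have h := congrArg (· * G.εK K k) (G.chK_orth' (K := K) hx i k)
  simp only [sum_mul] at h
  rw [mul_apply, Matrix.one_apply]
  refine (sum_ext fun j => ?_).trans (h.trans ?_)
  · rw [coChange]; ring
  · split_ifs with h1
    · rw [h1, G.εK_mul_self]
    · exact zero_mul _

lemma spinorTrans_gammaUp (φ : G.Spinors) (hx : x ∈ G.dom a ∩ G.dom b) (p : Fin n) :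
    G.spinorTrans a b x (G.gammaUp p (G.spinorRep φ b x)) =
    ∑ i, G.coChange K a b x p i • G.gammaUp i (G.spinorRep φ a x) := by
  have h := LinearMap.congr_fun (spinorTrans_mul_gammaUp (K := K) hx p) (G.spinorRep φ b x)
  rw [Module.End.mul_apply, Module.End.mul_apply, LinearMap.sum_apply,
    G.isCocycle_spinorTrans.rep_trans φ.1 hx] at h
  exact h

lemma extTrans_wedge (ξ : Fin k → G.Spinors) (hx : x ∈ G.dom a ∩ G.dom b) (I : Fin k → Fin n) :
    G.extTrans a b x (G.wedge ξ b I x) = ∑ H, powMat k (G.coChange K a b x) I H • G.wedge ξ a H x :=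
    by
  refine (ExteriorAlgebra.map_apply_ιMulti _ _).trans ?_
  have h : (⇑(G.spinorTrans a b x) ∘ fun α => G.gammaUp (I α) (G.spinorRep (ξ α) b x)) =
      fun α => ∑ i, G.coChange K a b x (I α) i • G.gammaUp i (G.spinorRep (ξ α) a x) :=
    funext fun α => spinorTrans_gammaUp (ξ α) hx (I α)
  rw [h]
  refine ((ExteriorAlgebra.ιMulti K k).toMultilinearMap.map_sum _).trans ?_
  exact sum_ext fun H => MultilinearMap.map_smul_univ _ _ _

def endK (K : Type*) [RCLike K] (A : Tensor n M J (k + 1)) (a : J) (I : Fin k → Fin n) (x : M) :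
    Mat(n) K := fun q p => ((A a x (snoc I p) q : ℝ) : K)

lemma tensorS_eq_spinL (A : Tensor n M J (k + 1)) (I : Fin k → Fin n) :
    G.tensorS A a I x = G.spinL (endK K A a I x) := by
  rw [tensorS, spinL_eq]
  congr 1
  funext p q
  rw [low, RCLike.ofReal_mul]
  rfl

lemma vectorTrans_tensor {A : Tensor n M J k} (hA : G.IsTensorField A) (hx : x ∈ G.dom a ∩ G.dom b)
    (I : Fin k → Fin n) : G.vectorTrans a b x (fun q => ((A b x I q : ℝ) : K)) =
    ∑ H, powMat k (G.chK K a b x) H I • fun q => ((A a x H q : ℝ) : K) := by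
  ext q
  have h := congrArg (RCLike.ofReal (K := K)) (hA.2 a b x hx I q)
  simp at h
  rw [Finset.sum_apply]
  exact h.symm

lemma spinorTrans_mul_tensorS (hA : G.IsTensorField A)
    (hx : x ∈ G.dom a ∩ G.dom b) (I : Fin k → Fin n) : G.spinorTrans a b x * G.tensorS A b I x =
    (∑ H, powMat k (G.chK K a b x) H I • G.tensorS A a H x) * G.spinorTrans a b x := by
  simp only [tensorS_eq_spinL, ← map_smul, ← map_sum]
  refine spinorTrans_mul_spinL hx ?_
  ext q p
  have h := congrFun (vectorTrans_tensor (K := K) hA hx (snoc I p)) q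
  rw [sum_snoc] at h
  simp at h
  rw [mul_apply, mul_apply]
  refine h.trans ?_
  simp [Matrix.sum_apply, sum_mul]
  rw [sum_comm]
  refine sum_ext fun m => sum_ext fun H => ?_
  simp [powMat, Fin.prod_univ_castSucc, endK]
  ring

def sectionB (A : Tensor n M J (k + 1)) (ξ : Fin k → G.Spinors) (a : J) (x : M) : Ext K S ⊗[K] S :=
    ∑ I, G.wedgeEnd (G.wedge ξ a I x) (G.tensorS A a I x)

def sectionD (A : Tensor n M J k) (ξ : Fin k → G.Spinors) (a : J) (x : M) :
    Ext K S ⊗[K] (Fin n → K) :=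
  ∑ I, G.wedge ξ a I x ⊗ₜ fun q => ((A a x I q : ℝ) : K)

lemma sectionB_trans (hA : G.IsTensorField A) (ξ : Fin k → G.Spinors) (hx : x ∈ G.dom a ∩ G.dom b) :
    TensorProduct.map (G.extTrans a b x) (G.spinorTrans a b x) (sectionB A ξ b x) =
    sectionB A ξ a x := by
  rw [sectionB, map_sum]
  refine (sum_ext fun I => by
    rw [map_wedgeEnd hx _ (spinorTrans_mul_tensorS hA hx I), extTrans_wedge ξ hx]).trans ?_
  exact sum_transfer (L := powMat k (G.chK K a b x)) (N := powMat k (G.coChange K a b x))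
    (by rw [powMat_mul, chK_mul_coChange hx, powMat_one]) G.wedgeEnd _ _

lemma sectionD_trans {A : Tensor n M J k} (hA : G.IsTensorField A)
    (ξ : Fin k → G.Spinors) (hx : x ∈ G.dom a ∩ G.dom b) : TensorProduct.map
    (G.extTrans a b x) (G.vectorTrans a b x) (sectionD A ξ b x) = sectionD A ξ a x := by
  simp [sectionD, vectorTrans_tensor hA hx, extTrans_wedge ξ hx]
  exact sum_transfer (L := powMat k (G.chK K a b x)) (N := powMat k (G.coChange K a b x))
    (by rw [powMat_mul, chK_mul_coChange hx, powMat_one])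
    (TensorProduct.mk K (Ext K S) (Fin n → K)) _ _

lemma fieldBExpr_eq (A : Tensor n M J (k + 1)) (ξ : Fin k → G.Spinors) (f : M → Ext K S) :
    G.fieldBExpr k A ξ a f x = G.contractS (f x) (sectionB A ξ a x) := by
  simp [fieldBExpr, sectionB, contractS_wedgeEnd]

lemma fieldDExpr_eq (A : Tensor n M J k) (ξ : Fin k → G.Spinors) (f : M → Ext K S) :
    G.fieldDExpr k A ξ a f x = contractV (fun i => G.covFun a i f x) (sectionD A ξ a x) := by
  simp [fieldDExpr, sectionD]
  refine sum_ext fun I => ?_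
  rw [contractV_tmul, mul_sum]
  exact sum_ext fun j => (mul_smul_comm _ _ _).symm

lemma smoothOn_of_val {f : M → Ext K S} (g : Sm K n (G.domO a) (Ext K S))
    (h : ∀ x ∈ G.dom a, g.val x = f x) : SmoothOn K n f (G.dom a) :=
  g.smooth.congr fun x hx => (h x hx).symm

lemma isGivenBy_fieldB (hA : G.IsTensorField A) (ξ : Fin k → G.Spinors) :
    G.IsGivenBy (G.fieldB k A ξ) (G.fieldBExpr k A ξ) :=
  isGivenBy_glueOp (fun f _ => smoothOn_of_val _ fun _ hx => fB_val hA ξ f hx) (sectionB A ξ)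
    (fun _ _ => 0) (fun f a x _ => by rw [map_zero, add_zero, fieldBExpr_eq])
    (fun _ _ _ hx => sectionB_trans hA ξ hx) (fun _ _ _ _ => map_zero _)

lemma isGivenBy_fieldD {A : Tensor n M J k} (hA : G.IsTensorField A) (ξ : Fin k → G.Spinors) :
    G.IsGivenBy (G.fieldD k A ξ) (G.fieldDExpr k A ξ) :=
  isGivenBy_glueOp (fun f _ => smoothOn_of_val _ fun _ hx => fD_val hA ξ f hx) (fun _ _ => 0)
    (sectionD A ξ) (fun f a x _ => by rw [map_zero, zero_add, fieldDExpr_eq])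
    (fun _ _ _ _ => map_zero _) (fun _ _ _ hx => sectionD_trans hA ξ hx)

lemma isGivenBy_odd (φ : G.Spinors) : G.IsGivenBy (G.odd φ) (G.oddExpr φ) := by
  refine isGivenBy_glueOp (fun f _ => smoothOn_of_val _ fun _ hx => fO_val φ f hx)
    (fun a x => 1 ⊗ₜ G.spinorRep φ a x) (fun a x => ∑ i,
      ExteriorAlgebra.ι K (G.gammaUp i (G.spinorRep φ a x)) ⊗ₜ (Pi.single i 1 : Fin n → K))
    (fun f a x _ => ?_) (fun a b x hx => ?_) (fun a b x hx => ?_)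
  · rw [oddExpr, contractS_tmul, one_mul, map_sum]
    congr 1
    refine sum_ext fun i => ?_
    rw [contractV_tmul, sum_eq_single i]
    · rw [Pi.single_eq_same, one_smul]
    · intro j _ hj; rw [Pi.single_eq_of_ne hj, zero_smul]
    · simp
  · rw [TensorProduct.map_tmul, G.isCocycle_spinorTrans.rep_trans φ.1 hx]
    congr 1
    exact map_one (ExteriorAlgebra.map (G.spinorTrans a b x))
  · have h : ∀ j, G.vectorTrans a b x (Pi.single j 1) =
        ∑ i, G.chK K a b x i j • (Pi.single i 1 : Fin n → K) := fun j => by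
      ext q
      simp [vectorTrans_eq, Finset.sum_apply, Pi.single_apply]
    simp [extTrans_ι, spinorTrans_gammaUp φ hx, h]
    exact sum_transfer (chK_mul_coChange hx)
      (TensorProduct.mk K (Ext K S) (Fin n → K)) _ _

lemma spinorTrans_mul_nablaVS (X : G.VectorFields) (hx : x ∈ G.dom a ∩ G.dom b) : G.spinorTrans a
    b x * G.nablaVS b (G.vectorRep X b) x = G.nablaVS a (G.vectorRep X a) x * G.spinorTrans a b x :=
    by
  have h1 : ∀ c, G.nablaVS c (G.vectorRep X c) x =
      G.spinL (fun q p => G.covV c p (G.vectorRep X c) x q) := fun c => rfl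
  rw [h1, h1]
  refine spinorTrans_mul_spinL hx ?_
  ext q p
  have h := congrFun (covV_covariant X hx p) q
  rw [Finset.sum_apply] at h
  refine h.trans (sum_ext fun i => ?_)
  exact mul_comm _ _

lemma sum_vectorRep_covariant {W : Type*} [AddCommGroup W] [Module K W] (T : W →ₗ[K] W) (X :
    G.VectorFields) (hx : x ∈ G.dom a ∩ G.dom b) (h h' : Fin n → W) (hh : ∀ j, T (h j) = ∑ i, G.chK
    K a b x i j • h' i) : T (∑ j, G.vectorRep X b x j • h j) = ∑ i, G.vectorRep X a x i • h' i := by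
  simp [hh, smul_sum, smul_smul]
  rw [sum_comm]
  refine sum_ext fun i => ?_
  rw [← sum_smul]
  congr 1
  exact (sum_ext fun j => mul_comm _ _).trans
    (congrFun (G.isCocycle_vectorTrans.rep_trans X.1 hx) i)

lemma isGivenBy_even (X : G.VectorFields) : G.IsGivenBy (G.even X) (G.evenExpr X) := by
  refine isGivenBy_glueOp (fun f _ => smoothOn_of_val _ fun _ hx => lieD_restF_val X f hx)
    (fun a x => G.wedgeEnd (-1) (G.nablaVS a (G.vectorRep X a) x))
    (fun a x => 1 ⊗ₜ G.vectorRep X a x) (fun f a x _ => ?_) (fun a b x hx => ?_)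
    (fun a b x hx => ?_)
  · rw [evenExpr, contractS_wedgeEnd, neg_one_mul, contractV_tmul, one_mul, neg_add_eq_sub]
  · rw [map_wedgeEnd hx _ (spinorTrans_mul_nablaVS X hx)]
    congr 2
    exact (map_neg _ _).trans
      (congrArg Neg.neg (map_one (ExteriorAlgebra.map (G.spinorTrans a b x))))
  · rw [TensorProduct.map_tmul, G.isCocycle_vectorTrans.rep_trans X.1 hx]
    congr 1
    exact map_one (ExteriorAlgebra.map (G.spinorTrans a b x))

lemma spinorRep_evenSpinor (X : G.VectorFields) (φ : G.Spinors) (hx : x ∈ G.dom a) :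
    G.spinorRep (G.evenSpinor X φ) a x = G.evenSpinorExpr X φ a x := by
  refine G.isCocycle_spinorTrans.rep_glue (fun a => ?_) (fun a b x hx => ?_) hx
  · exact ((G.sFrame a).E.lieD (G.restV a X) (G.restS a φ)).smooth.congr fun y hy =>
      (lieD_restS_val X φ hy).symm
  · rw [evenSpinorExpr, evenSpinorExpr, map_sub, sum_vectorRep_covariant _ X hx _ _
      (fun j => covS_covariant φ hx j)]
    congr 1
    refine (LinearMap.congr_fun (spinorTrans_mul_nablaVS X hx) _).trans ?_
    rw [Module.End.mul_apply, G.isCocycle_spinorTrans.rep_trans φ.1 hx]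

lemma smoothOn_pi {f : M → Fin n → K} (g : Fin n → Sm K n (G.domO a) K)
    (h : ∀ q, ∀ x ∈ G.dom a, (g q).val x = f x q) : SmoothOn K n f (G.dom a) := by
  refine (SmoothOn.sum univ fun q => SmoothOn.smul_vec (g q).smooth.csmooth
    (Pi.single q 1 : Fin n → K)).congr fun x hx => ?_
  ext p
  simp [Finset.sum_apply, Pi.single_apply, h _ x hx]

lemma lieExpr_eq (X Y : G.VectorFields) (x : M) : G.lieExpr X Y a x = ∑ i, G.vectorRep X a x i •
    G.covV a i (G.vectorRep Y a) x - ∑ i, G.vectorRep Y a x i • G.covV a i (G.vectorRep X a) x := by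
  ext q
  have h : ∑ i, ∑ j, G.vectorRep X a x i * G.vectorRep Y a x j *
      ((sgn (G.ε q) * G.bracketCoeff a i j q x : ℝ) : K) =
      ∑ i, G.vectorRep X a x i * ∑ j, ((G.connUp a i j q x : ℝ) : K) * G.vectorRep Y a x j -
      ∑ i, G.vectorRep Y a x i * ∑ j, ((G.connUp a i j q x : ℝ) : K) * G.vectorRep X a x j := by
    simp [← G.connUp_sub, mul_sum]
    rw [sum_comm (f := fun i j => G.vectorRep Y a x i * _), ← sum_sub_distrib]
    refine sum_ext fun i => ?_
    rw [← sum_sub_distrib]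
    refine sum_ext fun j => ?_
    push_cast
    ring
  rw [lieExpr, h]
  simp [covV, mul_add, sum_add]
  ring

lemma vectorRep_lie (X Y : G.VectorFields) (hx : x ∈ G.dom a) :
    G.vectorRep (G.lie X Y) a x = G.lieExpr X Y a x := by
  refine G.isCocycle_vectorTrans.rep_glue (fun a => smoothOn_pi _ fun q x hx =>
    lieD_restV_val X Y q hx) (fun a b x hx => ?_) hx
  rw [lieExpr_eq, lieExpr_eq, map_sub, sum_vectorRep_covariant _ X hx _ _
    (fun j => covV_covariant Y hx j), sum_vectorRep_covariant _ Y hx _ _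
    (fun j => covV_covariant X hx j)]

lemma vectorRep_susy (φ ψ : G.Spinors) (hx : x ∈ G.dom a) :
    G.vectorRep (G.susy φ ψ) a x = G.susyExpr φ ψ a x := by
  refine G.isCocycle_vectorTrans.rep_glue (fun a => smoothOn_pi _ fun q x hx =>
    susy_val φ ψ q hx) (fun a b x hx => ?_) hx
  ext q
  have h : ∀ p, G.C (G.spinorRep φ b x) (G.gammaUp p (G.spinorRep ψ b x)) =
      ∑ i, G.coChange K a b x p i * G.C (G.spinorRep φ a x) (G.gammaUp i (G.spinorRep ψ a x)) := fun p => by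
    rw [← G.C_trans a b x hx]
    change G.C (G.spinorTrans a b x _) (G.spinorTrans a b x _) = _
    rw [G.isCocycle_spinorTrans.rep_trans φ.1 hx, spinorTrans_gammaUp ψ hx, map_sum]
    simp
  have h2 : G.chK K a b x * G.coChange K a b x = 1 := chK_mul_coChange hx
  rw [vectorTrans_eq, Matrix.toLin'_apply]
  have h3 : G.susyExpr φ ψ b x = (G.coChange K a b x).mulVec (G.susyExpr φ ψ a x) := by
    ext p
    rw [susyExpr, h, mul_sum]
    refine sum_ext fun i => ?_
    rw [susyExpr]
    ring
  rw [h3, Matrix.mulVec_mulVec, h2, Matrix.one_mulVec]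

end SpecialGradedManifold

/-! ### Parity and degree of the fields -/

namespace SFrame

variable {n : ℕ} {R : Type*} [CommRing R] {F : FCalc n R}
  {S O : Type*} [AddCommGroup S] [Module R S] [Ring O] [Algebra R O] {Q : SFrame F S O} {k l : ℕ}

lemma W_mul_eq (z : Fin k → S) (a : O) : Q.W k z * a = (Q.π ^ k) a * Q.W k z := by
  induction k generalizing a with
  | zero => simp [W_apply]
  | succ k ih =>
    rw [← Fin.cons_self_tail z, W_cons, mul_assoc, ih, ← mul_assoc, Q.ι_mul, pow_succ',
      AlgHom.mul_apply, mul_assoc]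

variable (Q) in
def IsSuperDer (k : ℕ) (P : O → O) : Prop :=
  (∀ a b, P (a * b) = P a * b + (Q.π ^ k) a * P b) ∧ ∀ a, P (Q.π a) = (-1 : R) ^ k • Q.π (P a)

lemma IsDer.isSuperDer {P : O →+ O} (hP : Q.IsDer P) : Q.IsSuperDer 0 P :=
  ⟨fun a b => by rw [hP.1, pow_zero, AlgHom.one_apply], fun a => by rw [hP.2, pow_zero, one_smul]⟩

lemma IsSuperDer.sum {ι : Type*} {s : Finset ι} {P : ι → O → O} (h : ∀ i, Q.IsSuperDer k (P i)) :
    Q.IsSuperDer k fun a => ∑ i ∈ s, P i a :=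
  ⟨fun a b => by
    simp [(h _).1, sum_add, sum_mul, mul_sum], fun a => by
    simp [(h _).2, smul_sum]⟩

lemma IsSuperDer.add {P P' : O → O} (h : Q.IsSuperDer k P) (h' : Q.IsSuperDer k P') :
    Q.IsSuperDer k fun a => P a + P' a :=
  ⟨fun a b => by beta_reduce; rw [h.1, h'.1, add_mul, mul_add]; abel, fun a => by
    beta_reduce; rw [h.2, h'.2, map_add, smul_add]⟩

lemma IsDer.W_mul {P : O →+ O} (hP : Q.IsDer P) (z : Fin k → S) :
    Q.IsSuperDer k fun a => Q.W k z * P a :=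
  ⟨fun a b => by
    beta_reduce
    rw [hP.1, mul_add, ← mul_assoc, ← mul_assoc, ← mul_assoc, W_mul_eq z a], fun a => by
    beta_reduce
    rw [hP.2, map_mul, π_W, smul_mul_assoc, smul_smul, ← mul_pow, neg_one_mul, neg_neg, one_pow,
      one_smul]⟩

lemma isSuperDer_fB (A : Tens n R (k + 1)) (ξ : Fin k → S) : Q.IsSuperDer k (Q.fB A ξ) :=
  IsSuperDer.sum fun I => (isDer_rHom _ (A.endM I)).W_mul _

lemma isSuperDer_fD (A : Tens n R k) (ξ : Fin k → S) : Q.IsSuperDer k (Q.fD A ξ) :=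
  IsSuperDer.sum fun I => (isDer_covHom _ (A I)).W_mul _

lemma isSuperDer_fO (φ : S) : Q.IsSuperDer 1 (Q.fO φ) := by
  refine IsSuperDer.add ⟨fun a b => ?_, fun a => ?_⟩ (IsSuperDer.sum fun i => ?_)
  · rw [Q.int_mul, pow_one]
  · rw [Q.int_π, pow_one, neg_one_smul]
  · have h := (isDer_covHom Q (Pi.single i 1)).W_mul (k := 1) fun _ => Q.γ i φ
    simpa only [W_apply, List.ofFn_succ, List.ofFn_zero, List.prod_cons, List.prod_nil, mul_one,
      covHom_single] using h

lemma isSuperDer_lieD (X : Fin n → R) : Q.IsSuperDer 0 (Q.Λ.lieD X) := (isDer_lieHom _ X).isSuperDer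

variable (Q) in
structure IsNumberOp (N : O →ₗ[R] O) : Prop where
  mul (a b : O) : N (a * b) = N a * b + a * N b
  ι (s : S) : N (Q.ι s) = Q.ι s
  D (i : Fin n) (a : O) : N (Q.Λ.D i a) = Q.Λ.D i (N a)
  r (B : Mat(n) R) (a : O) : N (Q.Λ.r B a) = Q.Λ.r B (N a)
  int (s : S) (a : O) : N (Q.int s a) = Q.int s (N a) - Q.int s a

section Number

variable {N : O →ₗ[R] O} (hN : Q.IsNumberOp N)
include hN

lemma IsNumberOp.W (z : Fin k → S) : N (Q.W k z) = (k : R) • Q.W k z := by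
  induction k with
  | zero =>
    have h := hN.mul 1 1
    rw [mul_one, mul_one, one_mul, left_eq_add] at h
    simp [W_apply, h]
  | succ k ih =>
    rw [← Fin.cons_self_tail z, W_cons, hN.mul, hN.ι, ih, mul_smul_comm, Nat.cast_succ, add_smul,
      one_smul, add_comm]

lemma IsNumberOp.cov (i : Fin n) (a : O) : N (Q.Λ.cov i a) = Q.Λ.cov i (N a) := by
  rw [FMod.cov, map_add, hN.D, hN.r, FMod.cov]

lemma IsNumberOp.fB (A : Tens n R (k + 1)) (ξ : Fin k → S) (f : O) :
    N (Q.fB A ξ f) = Q.fB A ξ (N f) + (k : R) • Q.fB A ξ f := by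
  simp [SFrame.fB, u, hN.mul, hN.W, hN.r, smul_sum, smul_mul_assoc, sum_add]
  exact add_comm _ _

lemma IsNumberOp.fD (A : Tens n R k) (ξ : Fin k → S) (f : O) :
    N (Q.fD A ξ f) = Q.fD A ξ (N f) + (k : R) • Q.fD A ξ f := by
  simp [SFrame.fD, u, hN.mul, hN.W, covL_apply, hN.cov, smul_sum, smul_mul_assoc, sum_add]
  exact add_comm _ _

lemma IsNumberOp.lieD (X : Fin n → R) (f : O) : N (Q.Λ.lieD X f) = Q.Λ.lieD X (N f) := by
  simp [FMod.lieD, hN.cov, hN.r]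

lemma IsNumberOp.fO (φ : S) (f : O) :
    N (N (Q.fO φ f)) + Q.fO φ (N (N f)) = 2 • N (Q.fO φ (N f)) + Q.fO φ f := by
  have h : ∀ g, N (Q.fO φ g) = Q.fO φ (N g) - Q.int φ g +
      ∑ i, Q.ι (Q.γ i φ) * Q.Λ.cov i g := fun g => by
    simp [SFrame.fO, hN.mul, hN.ι, hN.cov, hN.int, sum_add]
    abel
  have h2 : ∀ g, N (∑ i, Q.ι (Q.γ i φ) * Q.Λ.cov i g) = ∑ i, Q.ι (Q.γ i φ) * Q.Λ.cov i g +
      ∑ i, Q.ι (Q.γ i φ) * Q.Λ.cov i (N g) := fun g => by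
    simp [hN.mul, hN.ι, hN.cov, sum_add]
  rw [h f, h (N f), map_add, map_sub, h, h2, hN.int]
  simp only [SFrame.fO]
  abel

end Number

end SFrame

namespace SpecialGradedManifold

variable {G : SpecialGradedManifold K n M S J} [Module.Finite K S] {a : J} {x : M} {k l : ℕ}

/-! ### Functions and their expressions -/

lemma restF_ext {f h : G.functions} (hfh : ∀ a, G.restF a f = G.restF a h) : f = h :=
  Subtype.ext (congrArg Subtype.val (a₁ := (⟨f.1, f.2⟩ : G.sections G.extTrans))
    (a₂ := ⟨h.1, h.2⟩) (G.isCocycle_extTrans.sections_ext fun a x hx => by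
      exact (restF_val f hx).symm.trans ((congrArg (fun g => Sm.val g x) (hfh a)).trans
        (restF_val h hx))))

lemma restF_add (f h : G.functions) : G.restF a (f + h) = G.restF a f + G.restF a h :=
  ext_on fun x hx => by rw [add_val, restF_val _ hx, restF_val _ hx, restF_val _ hx, funRep_add]

lemma restF_neg (f : G.functions) : G.restF a (-f) = -G.restF a f := by
  have h := restF_add (a := a) f (-f)
  have h0 := restF_add (a := a) (0 : G.functions) 0
  rw [add_zero, left_eq_add] at h0
  rw [add_neg_cancel, h0] at h
  exact (neg_eq_of_add_eq_zero_right h.symm).symm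

lemma restF_sum {ι : Type*} (s : Finset ι) (f : ι → G.functions) :
    G.restF a (∑ i ∈ s, f i) = ∑ i ∈ s, G.restF a (f i) :=
  map_sum (AddMonoidHom.mk' (G.restF a) restF_add) f s

lemma restF_sub (f h : G.functions) : G.restF a (f - h) = G.restF a f - G.restF a h := by
  rw [sub_eq_add_neg, restF_add, restF_neg, ← sub_eq_add_neg]

lemma restF_neg_one_pow_smul (m : ℕ) (f : G.functions) :
    G.restF a ((-1 : K) ^ m • f) = (-1 : Sm K n (G.domO a) K) ^ m • G.restF a f := by
  rcases Nat.even_or_odd m with h | h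
  · rw [h.neg_one_pow, h.neg_one_pow, one_smul, one_smul]
  · rw [h.neg_one_pow, h.neg_one_pow, neg_one_smul, neg_one_smul, restF_neg]

lemma restF_mul (f h : G.functions) : G.restF a (f * h) = G.restF a f * G.restF a h :=
  ext_on fun x hx => by
    rw [mul_val, restF_val _ hx, restF_val _ hx, restF_val _ hx]
    exact map_mul (ExteriorAlgebra.map (G.spinorTrans a (G.idx x) x)) _ _

lemma restF_parity (f : G.functions) : G.restF a (G.parity f) = (G.sFrame a).π (G.restF a f) :=
  ext_on fun x hx => by
    rw [restF_val _ hx]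
    refine (map_gradeInv _ _).trans ?_
    exact congrArg gradeInv (restF_val f hx).symm

lemma π_π (g : Sm K n (G.domO a) (Ext K S)) : (G.sFrame a).π ((G.sFrame a).π g) = g := ext_on fun x
    _ => gradeInv_gradeInv _

variable {P : ∀ a, Sm K n (G.domO a) (Ext K S) → Sm K n (G.domO a) (Ext K S)} {T : End K G.functions} {A : Tensor n M J (k + 1)}
variable (G) in
def numOp : End K G.functions where
  toFun f := ⟨fun x => derivExt LinearMap.id (f.1 x), fun a => by
    refine (SmoothOn.comp_linear (derivExt LinearMap.id) (f.2 a)).congr fun x _ => ?_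
    exact map_derivExt (G.spinorTrans a (G.idx x) x) LinearMap.id LinearMap.id (fun _ => rfl)
      (f.1 x)⟩
  map_add' f h := Subtype.ext (funext fun x => map_add _ (f.1 x) (h.1 x))
  map_smul' c f := Subtype.ext (funext fun x => map_smul _ c (f.1 x))

abbrev numberSm (a : J) : Sm K n (G.domO a) (Ext K S) →ₗ[Sm K n (G.domO a) K]
    Sm K n (G.domO a) (Ext K S) := Sm.mapL (derivExt LinearMap.id)

lemma restF_numOp (f : G.functions) : G.restF a (G.numOp f) = numberSm a (G.restF a f) :=
  ext_on fun x hx => by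
    rw [restF_val _ hx]
    refine (map_derivExt (G.spinorTrans a (G.idx x) x) LinearMap.id LinearMap.id (fun _ => rfl)
      (f.1 x)).trans ?_
    exact congrArg (derivExt LinearMap.id) (restF_val f hx).symm

lemma isNumberOp_numberSm : (G.sFrame a).IsNumberOp (numberSm a) where
  mul g h := ext_on fun x _ => derivExt_mul _ _ _
  ι s := ext_on fun x _ => derivExt_ι _ _
  D i g := (Sm.deriv_map (G.smField_frame' (le_refl _) i) _ _).symm
  r B g := ext_on fun x _ => by
    refine (congrArg (derivExt LinearMap.id) (G.action_derivExt_val _ _ _)).trans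
      (Eq.trans ?_ (G.action_derivExt_val _ _ _).symm)
    rw [Sm.mapL_val, ← sub_eq_zero, ← derivExt_lie]
    simp [derivExt]
  int s g := ext_on fun x _ => by
    rw [sub_val]
    refine (derivExt_interior _ _ _).trans ?_
    rfl

/-! ### Operators given by their expressions -/

/-- The operator `T` on functions is given by the operators `P a` in the frames. -/
def IsRep (T : End K G.functions)
    (P : ∀ a, Sm K n (G.domO a) (Ext K S) → Sm K n (G.domO a) (Ext K S)) : Prop :=
  ∀ a f, G.restF a (T f) = P a (G.restF a f)

lemma isRep_of_isGivenBy {E : J → (M → Ext K S) → M → Ext K S} (h : G.IsGivenBy T E)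
    (hP : ∀ a f, ∀ x ∈ G.dom a, (P a (G.restF a f)).val x = E a (G.funRep f a) x) : IsRep T P :=
  fun a f => ext_on fun x hx => by rw [restF_val _ hx, hP a f x hx]; exact h f a x hx

lemma isRep_even (X : G.VectorFields) :
    IsRep (G.even X) fun a => (G.sFrame a).Λ.lieD (G.restV a X) :=
  isRep_of_isGivenBy (isGivenBy_even X) fun _ f _ hx => lieD_restF_val X f hx

lemma isRep_odd (φ : G.Spinors) : IsRep (G.odd φ) fun a => (G.sFrame a).fO (G.restS a φ) :=
  isRep_of_isGivenBy (isGivenBy_odd φ) fun _ f _ hx => fO_val φ f hx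

lemma isRep_fieldB (hA : G.IsTensorField A) (ξ : Fin k → G.Spinors) : IsRep
    (G.fieldB k A ξ) fun a => (G.sFrame a).fB (liftT K (G.domO a) (A a)) fun α => G.restS a (ξ α) :=
  isRep_of_isGivenBy (isGivenBy_fieldB hA ξ) fun _ f _ hx => fB_val hA ξ f hx

lemma isRep_fieldD {A : Tensor n M J k} (hA : G.IsTensorField A) (ξ : Fin k → G.Spinors) : IsRep
    (G.fieldD k A ξ) fun a => (G.sFrame a).fD (liftT K (G.domO a) (A a)) fun α => G.restS a (ξ α) :=
  isRep_of_isGivenBy (isGivenBy_fieldD hA ξ) fun _ f _ hx => fD_val hA ξ f hx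

lemma IsRep.mem_fieldsOfParity (hT : IsRep T P) (hP : ∀ a, (G.sFrame a).IsSuperDer k (P a)) :
    T ∈ G.fieldsOfParity k := by
  have hπ : ∀ (a : J) (m : ℕ) g, ((G.sFrame a).π ^ (m + m)) g = g := fun a m g => by
    induction m with
    | zero => simp
    | succ m ih =>
      rw [show m + 1 + (m + 1) = m + m + 1 + 1 by ring, pow_succ, pow_succ, AlgHom.mul_apply,
        AlgHom.mul_apply, π_π, ih]
  rcases Nat.even_or_odd k with h | h
  · rw [fieldsOfParity, if_pos h]
    refine ⟨fun f => restF_ext fun a => ?_, fun f g => restF_ext fun a => ?_⟩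
    · rw [hT, restF_parity, (hP a).2, h.neg_one_pow, one_smul, restF_parity, hT]
    · obtain ⟨m, rfl⟩ := h
      rw [hT, restF_mul, (hP a).1, restF_add, restF_mul, restF_mul, hT, hT, hπ]
  · rw [fieldsOfParity, if_neg (Nat.not_even_iff_odd.mpr h)]
    refine ⟨fun f => restF_ext fun a => ?_, fun f g => restF_ext fun a => ?_⟩
    · rw [restF_add, hT, restF_parity, (hP a).2, h.neg_one_pow, neg_one_smul, restF_parity, hT,
        neg_add_cancel, ← add_left_cancel_iff (a := G.restF a 0), ← restF_add, add_zero, add_zero]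
    · obtain ⟨m, rfl⟩ := h
      rw [hT, restF_mul, (hP a).1, restF_add, restF_mul, restF_mul, hT, hT, restF_parity, two_mul,
        pow_succ, AlgHom.mul_apply, hπ]

lemma fieldB_mem (hA : G.IsTensorField A) (ξ : Fin k → G.Spinors) :
    G.fieldB k A ξ ∈ G.fieldsOfParity k :=
  (isRep_fieldB hA ξ).mem_fieldsOfParity fun _ => SFrame.isSuperDer_fB _ _

lemma fieldD_mem {A : Tensor n M J k} (hA : G.IsTensorField A) (ξ : Fin k → G.Spinors) :
    G.fieldD k A ξ ∈ G.fieldsOfParity k :=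
  (isRep_fieldD hA ξ).mem_fieldsOfParity fun _ => SFrame.isSuperDer_fD _ _

lemma odd_mem (φ : G.Spinors) : G.odd φ ∈ G.fieldsOfParity 1 :=
  (isRep_odd φ).mem_fieldsOfParity fun _ => SFrame.isSuperDer_fO _

lemma even_mem (X : G.VectorFields) : G.even X ∈ G.fieldsOfParity 0 :=
  (isRep_even X).mem_fieldsOfParity fun _ => SFrame.isSuperDer_lieD _

/-! ### Super commutators -/

lemma parity_parity [Module.Finite K S] (f : G.functions) : G.parity (G.parity f) = f :=
  Subtype.ext (funext fun x => gradeInv_gradeInv (f.1 x))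

lemma oddPart_of_even (hT : T ∈ G.evenFields) : G.oddPart T = 0 := by
  refine LinearMap.ext fun f => ?_
  have h := hT.1 (G.parity f)
  rw [parity_parity] at h
  simp [oddPart, ← h]

lemma oddPart_of_odd (hT : T ∈ G.oddFields) : G.oddPart T = T := by
  refine LinearMap.ext fun f => ?_
  have h := hT.1 (G.parity f)
  rw [parity_parity, add_comm, ← eq_neg_iff_add_eq_zero] at h
  simp only [oddPart, LinearMap.smul_apply, LinearMap.sub_apply, Module.End.mul_apply, h,
    sub_neg_eq_add, ← two_smul K (T f), smul_smul]
  norm_num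

lemma bracket_apply {T U : End K G.functions}
    (hT : T ∈ G.fieldsOfParity k) (hU : U ∈ G.fieldsOfParity l) (f : G.functions) :
    G.bracket T U f = T (U f) - (-1 : K) ^ (k * l) • U (T f) := by
  have h0 : ∀ m V, Even m → V ∈ G.fieldsOfParity m → G.oddPart V = 0 := fun m V hm hV =>
    oddPart_of_even (by rwa [fieldsOfParity, if_pos hm] at hV)
  have h1 : ∀ m V, Odd m → V ∈ G.fieldsOfParity m → G.oddPart V = V := fun m V hm hV =>
    oddPart_of_odd (by rwa [fieldsOfParity, if_neg (Nat.not_even_iff_odd.mpr hm)] at hV)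
  rw [bracket, LinearMap.add_apply, LinearMap.sub_apply, LinearMap.smul_apply]
  rcases Nat.even_or_odd k with hk | hk
  · rw [h0 k T hk hT, (hk.mul_right l).neg_one_pow, mul_zero, LinearMap.zero_apply, smul_zero,
      add_zero, one_smul]
    rfl
  rcases Nat.even_or_odd l with hl | hl
  · rw [h0 l U hl hU, (hl.mul_left k).neg_one_pow, zero_mul, LinearMap.zero_apply, smul_zero,
      add_zero, one_smul]
    rfl
  · rw [h1 k T hk hT, h1 l U hl hU, (hk.mul hl).neg_one_pow, neg_one_smul, two_smul]
    simp only [Module.End.mul_apply]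
    abel

lemma restF_bracket {T U : End K G.functions} {P P' : ∀ a, Sm K n (G.domO a) (Ext K S)
    → Sm K n (G.domO a) (Ext K S)} (hT : T ∈ G.fieldsOfParity k) (hU : U ∈ G.fieldsOfParity l)
    (hTP : IsRep T P) (hUP : IsRep U P') (f : G.functions) : G.restF a (G.bracket T U f) =
    P a (P' a (G.restF a f)) - (-1 : Sm K n (G.domO a) K) ^ (k * l) • P' a (P a (G.restF a f)) := by
  rw [bracket_apply hT hU, restF_sub, restF_neg_one_pow_smul, hTP, hUP, hUP, hTP]

end SpecialGradedManifold

namespace SFrame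

variable {n : ℕ} {R : Type*} [CommRing R] {F : FCalc n R}
  {S O : Type*} [AddCommGroup S] [Module R S] [Ring O] [Algebra R O] {Q : SFrame F S O} {k l : ℕ}

lemma fD_swap (B : Tens n R (l + k)) (ξ : Fin k → S) (η : Fin l → S) (f : O) :
    Q.fD (Tens.swap B) (append ξ η) f = (-1 : R) ^ (k * l) • Q.fD B (append η ξ) f := by
  simp [fD]
  rw [sum_append, sum_append, sum_comm, smul_sum]
  refine sum_ext fun J => ?_
  rw [smul_sum]
  refine sum_ext fun I => ?_
  have e : Tens.swap B (append I J) = B (append J I) := by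
    ext q
    simp [Tens.swap]
  rw [e, u_append, u_append, u_mul η J _ (π_u ξ I), smul_mul_assoc, smul_smul, ← mul_pow,
    neg_one_mul, neg_neg, one_pow, one_smul]

lemma fD_sub (A B : Tens n R k) (ξ : Fin k → S) (f : O) :
    Q.fD (A - B) ξ f = Q.fD A ξ f - Q.fD B ξ f := by
  simp [fD, mul_sub]

end SFrame

namespace SpecialGradedManifold

variable {G : SpecialGradedManifold K n M S J} {a : J} {x : M} {k l : ℕ}

/-! ### Interchange of blocks of indices -/

lemma _root_.SGM.SpinManifold.IsTensorField.sub_swap {A : Tensor n M J (k + l)}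
    (hA : G.IsTensorField A) {B : Tensor n M J (l + k)} (hB : G.IsTensorField B) :
    G.IsTensorField (A - SpinManifold.swapBlocks B) := by
  refine ⟨fun a i q => (hA.1 a i q).sub (hB.1 a _ q), fun a b x hx j q => ?_⟩
  have h := hB.2 a b x hx (append (sndIdx j) (fstIdx j)) q
  have h2 : ∑ i : Fin (k + l) → Fin n, (∏ α, G.frameChange a b x (i α) (j α)) *
      SpinManifold.swapBlocks B a x i q =
      ∑ r, G.frameChange a b x q r * SpinManifold.swapBlocks B b x j r := by
    refine Eq.trans ?_ h
    rw [sum_append, sum_append, sum_comm]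
    refine sum_ext fun H => sum_ext fun I => ?_
    simp only [SpinManifold.swapBlocks, fstIdx_append_eq, sndIdx_append_eq, Fin.prod_univ_add,
      Fin.append_left, Fin.append_right]
    rw [mul_comm (∏ α, _) (∏ β, _)]
    rfl
  have h1 := hA.2 a b x hx j q
  simp [mul_sub, h1, h2]

variable [Module.Finite K S]

variable {ξ : Fin k → G.Spinors} {X : G.VectorFields} {A : Tensor n M J k} {η : Fin l → G.Spinors} {B : Tensor n M J (l + k)} {φ : G.Spinors}

lemma liftT_sub_swapBlocks {A : Tensor n M J (k + l)} (hA : G.IsTensorField A)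
    (hB : G.IsTensorField B) : liftT K (G.domO a) ((A - SpinManifold.swapBlocks B) a) =
    liftT K (G.domO a) (A a) - Tens.swap (liftT K (G.domO a) (B a)) :=
  ((hA.sub_swap hB).isLift le_rfl).unique (liftT_sub_swap hA hB)

/-! ### Spinor fields and vector fields in frames -/

lemma restV_lie (X Y : G.VectorFields) :
    G.restV a (G.lie X Y) = (G.fcalc a).vec.lieD (G.restV a X) (G.restV a Y) :=
  funext fun q => ext_on fun x hx => by
    rw [restV_val _ q hx, vectorRep_lie X Y hx, lieD_restV_val X Y q hx]

lemma restS_evenSpinor (X : G.VectorFields) (φ : G.Spinors) :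
    G.restS a (G.evenSpinor X φ) = (G.sFrame a).E.lieD (G.restV a X) (G.restS a φ) :=
  ext_on fun x hx => by rw [restS_val _ hx, spinorRep_evenSpinor X φ hx, lieD_restS_val X φ hx]

lemma restV_susy (φ ψ : G.Spinors) : G.restV a (G.susy φ ψ) =
    fun i => 2 * (G.sFrame a).C (G.restS a φ) ((G.sFrame a).γ i (G.restS a ψ)) :=
  funext fun q => ext_on fun x hx => by
    rw [restV_val _ q hx, vectorRep_susy φ ψ hx]
    exact (susy_val φ ψ q hx).symm

lemma restS_update [DecidableEq (Fin k)] (ξ : Fin k → G.Spinors) (α : Fin k) (φ : G.Spinors) :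
    (fun β => G.restS a (update ξ α φ β)) = update (fun β => G.restS a (ξ β)) α (G.restS a φ) :=
  Function.comp_update (G.restS a) ξ α φ

lemma restS_append (ξ : Fin k → G.Spinors) (η : Fin l → G.Spinors) : (fun α
    => G.restS a (append ξ η α)) = append (fun α => G.restS a (ξ α)) fun β => G.restS a (η β) := by
  funext α
  refine Fin.addCases (fun α => ?_) (fun β => ?_) α <;> simp

lemma restS_cons (φ : G.Spinors) (ξ : Fin k → G.Spinors) : (fun α => G.restS a ((Fin.cons
    φ ξ : Fin (k + 1) → G.Spinors) α)) = Fin.cons (G.restS a φ) fun α => G.restS a (ξ α) := by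
  funext α
  refine Fin.cases ?_ (fun α => ?_) α <;> simp

lemma restS_snoc (ξ : Fin k → G.Spinors) (φ : G.Spinors) : (fun α => G.restS a
    ((snoc ξ φ : Fin (k + 1) → G.Spinors) α)) = snoc (fun α => G.restS a (ξ α)) (G.restS a φ) := by
  funext α
  refine Fin.lastCases ?_ (fun α => ?_) α <;> simp

/-! ### Parallel spinors and Killing vector fields -/

lemma lie_mem_killing {X Y : G.VectorFields} (hX : X ∈ G.killing) (hY : Y ∈ G.killing) :
    G.lie X Y ∈ G.killing :=
  (isKilling_iff _).mpr fun a => by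
    rw [restV_lie]
    exact FCalc.IsKilling.lie ((isKilling_iff X).mp hX a) ((isKilling_iff Y).mp hY a)

lemma evenSpinor_mem (hX : X ∈ G.killing) (hφ : φ ∈ G.parallelSpinors) :
    G.evenSpinor X φ ∈ G.parallelSpinors :=
  (isParallel_iff _).mpr fun a => by
    rw [restS_evenSpinor]
    exact SFrame.IsParallel.lieD ((isKilling_iff X).mp hX a) ((isParallel_iff φ).mp hφ a)

lemma susy_mem {φ ψ : G.Spinors} (hφ : φ ∈ G.parallelSpinors) (hψ : ψ ∈ G.parallelSpinors) :
    G.susy φ ψ ∈ G.killing :=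
  (isKilling_iff _).mpr fun a => by
    rw [restV_susy]
    refine FCalc.isKilling_of_parallel fun i => ?_
    have h := ((isParallel_iff φ).mp hφ a).parallel_susy ((isParallel_iff ψ).mp hψ a) i
    have h2 := FMod.cov_add (G.fcalc a).vec i
      (fun m => (G.sFrame a).C (G.restS a φ) ((G.sFrame a).γ m (G.restS a ψ)))
      (fun m => (G.sFrame a).C (G.restS a φ) ((G.sFrame a).γ m (G.restS a ψ)))
    rw [h, add_zero] at h2
    refine Eq.trans (congrArg _ (funext fun m => ?_)) h2
    exact two_mul _

lemma isParallel_restS (hξ : ∀ α, ξ α ∈ G.parallelSpinors) (a : J)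
    (α : Fin k) : (G.sFrame a).IsParallel (G.restS a (ξ α)) := (isParallel_iff _).mp (hξ α) a

/-! ### Super commutators of the fields -/

lemma bracket_ext {T U V : End K G.functions} {P P' P'' : ∀ a, Sm K n (G.domO a) (Ext K S)
    → Sm K n (G.domO a) (Ext K S)} (hT : T ∈ G.fieldsOfParity k) (hU : U ∈ G.fieldsOfParity l)
    (hTP : IsRep T P) (hUP : IsRep U P') (hVP : IsRep V P'') (h : ∀ a g, P a
    (P' a g) - (-1 : Sm K n (G.domO a) K) ^ (k * l) • P' a (P a g) = P'' a g) : G.bracket T U = V :=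
  LinearMap.ext fun f => restF_ext fun a => by rw [restF_bracket hT hU hTP hUP, h, hVP]

lemma IsRep.add {T U : End K G.functions} {P P' : ∀ a, Sm K n (G.domO a) (Ext K S) → Sm K n (G.domO
    a) (Ext K S)} (hT : IsRep T P) (hU : IsRep U P') : IsRep (T + U) fun a g => P a g + P' a g :=
  fun a f => by rw [LinearMap.add_apply, restF_add, hT, hU]

lemma IsRep.neg_one_pow_smul {T : End K G.functions}
    {P : ∀ a, Sm K n (G.domO a) (Ext K S) → Sm K n (G.domO a) (Ext K S)} (hT : IsRep T P) (m : ℕ) :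
    IsRep ((-1 : K) ^ m • T) fun a g => (-1 : Sm K n (G.domO a) K) ^ m • P a g :=
  fun a f => by rw [LinearMap.smul_apply, restF_neg_one_pow_smul, hT]

lemma IsRep.sum {ι : Type*} [Fintype ι] {T : ι → End K G.functions}
    {P : ι → ∀ a, Sm K n (G.domO a) (Ext K S) → Sm K n (G.domO a) (Ext K S)}
    (hT : ∀ i, IsRep (T i) (P i)) : IsRep (∑ i, T i) fun a g => ∑ i, P i a g :=
  fun a f => by
    rw [LinearMap.sum_apply, restF_sum]
    exact sum_ext fun i => hT i a f

lemma bracket_even_even (hX : X ∈ G.killing) (Y : G.VectorFields) :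
    G.bracket (G.even X) (G.even Y) = G.even (G.lie X Y) :=
  bracket_ext (even_mem X) (even_mem Y) (isRep_even X) (isRep_even Y) (isRep_even _) fun a g => by
    rw [mul_zero, pow_zero, one_smul, restV_lie]
    exact FMod.lieD_lieD _ ((isKilling_iff X).mp hX a) g

lemma bracket_even_odd (hX : X ∈ G.killing) (φ : G.Spinors) :
    G.bracket (G.even X) (G.odd φ) = G.odd (G.evenSpinor X φ) :=
  bracket_ext (even_mem X) (odd_mem φ) (isRep_even X) (isRep_odd φ) (isRep_odd _) fun a g => by
    rw [zero_mul, pow_zero, one_smul, restS_evenSpinor]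
    exact SFrame.bracket_lieD_fO ((isKilling_iff X).mp hX a) _ g

lemma bracket_odd_odd {φ ψ : G.Spinors} (hφ : φ ∈ G.parallelSpinors) (hψ : ψ ∈ G.parallelSpinors) :
    G.bracket (G.odd φ) (G.odd ψ) = G.even (G.susy φ ψ) + G.fieldB 2 G.curv ![φ, ψ] :=
  bracket_ext (odd_mem φ) (odd_mem ψ) (isRep_odd φ) (isRep_odd ψ)
    ((isRep_even _).add (isRep_fieldB isGoodEnd_curv.isTF _)) fun a g => by
    have h : (fun α => G.restS a ((![φ, ψ] : Fin 2 → G.Spinors) α)) =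
        ![G.restS a φ, G.restS a ψ] := by
      funext α
      fin_cases α <;> rfl
    rw [mul_one, pow_one, neg_one_smul, sub_neg_eq_add, restV_susy, h, liftT_curv]
    exact SFrame.bracket_fO_fO ((isParallel_iff φ).mp hφ a) ((isParallel_iff ψ).mp hψ a) g

lemma bracket_even_fieldB
    (hX : X ∈ G.killing) {A : Tensor n M J (k + 1)} (hA : G.IsGoodEnd A) (ξ : Fin k → G.Spinors) :
    G.bracket (G.even X) (G.fieldB k A ξ) = ∑ α, G.fieldB k A (update ξ α (G.evenSpinor X (ξ α))) :=
  bracket_ext (even_mem X) (fieldB_mem hA.isTF ξ) (isRep_even X)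
    (isRep_fieldB hA.isTF ξ) (IsRep.sum fun _ => isRep_fieldB hA.isTF _)
    fun a g => by
    simp only [restS_update, restS_evenSpinor]
    rw [zero_mul, pow_zero, one_smul]
    have hXa := (isKilling_iff X).mp hX a
    exact SFrame.bracket_lieD_fB hXa ((hA.good a).lie _ hXa) _ g

lemma bracket_even_fieldD (hX : X ∈ G.killing) (hA : G.IsGoodVec A) (ξ : Fin k → G.Spinors) :
    G.bracket (G.even X) (G.fieldD k A ξ) = ∑ α, G.fieldD k A (update ξ α (G.evenSpinor X (ξ α))) :=
  bracket_ext (even_mem X) (fieldD_mem hA.isTF ξ) (isRep_even X)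
    (isRep_fieldD hA.isTF ξ) (IsRep.sum fun _ => isRep_fieldD hA.isTF _)
    fun a g => by
    simp only [restS_update, restS_evenSpinor]
    rw [zero_mul, pow_zero, one_smul]
    have hXa := (isKilling_iff X).mp hX a
    exact SFrame.bracket_lieD_fD hXa ((hA.good a).lie _ hXa) _ g

lemma bracket_odd_fieldB (hφ : φ ∈ G.parallelSpinors) {A : Tensor n M J (k + 1)}
    (hA : G.IsGoodEnd A) (hξ : ∀ α, ξ α ∈ G.parallelSpinors) : G.bracket (G.odd φ) (G.fieldB k A ξ)
    = G.fieldB (k + 1) (G.nabla A) (Fin.cons φ ξ) + (-1 : K) ^ k • G.fieldD (k + 1) A (snoc ξ φ) :=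
  bracket_ext (odd_mem φ) (fieldB_mem hA.isTF ξ) (isRep_odd φ)
    (isRep_fieldB hA.isTF ξ) ((isRep_fieldB hA.isTF.nabla _).add
      ((isRep_fieldD hA.isTF _).neg_one_pow_smul k)) fun a g => by
    rw [one_mul, restS_cons, restS_snoc, liftT_nabla hA.isTF]
    exact SFrame.bracket_fO_fB (hA.good a) ((isParallel_iff φ).mp hφ a)
      (isParallel_restS hξ a) g

lemma bracket_odd_fieldD (hφ : φ ∈ G.parallelSpinors) (hA : G.IsGoodVec A)
    (hξ : ∀ α, ξ α ∈ G.parallelSpinors) : G.bracket (G.odd φ) (G.fieldD k A ξ) = G.fieldD (k + 1)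
    (G.nabla A) (Fin.cons φ ξ) + (-1 : K) ^ k • G.fieldB (k + 1) (G.contractR A) (snoc ξ φ) :=
  bracket_ext (odd_mem φ) (fieldD_mem hA.isTF ξ) (isRep_odd φ)
    (isRep_fieldD hA.isTF ξ) ((isRep_fieldD hA.isTF.nabla _).add
      ((isRep_fieldB hA.isTF.contractR _).neg_one_pow_smul k)) fun a g => by
    rw [one_mul, restS_cons, restS_snoc, liftT_nabla hA.isTF, liftT_contractR hA.isTF]
    exact SFrame.bracket_fO_fD (hA.good a) ((isParallel_iff φ).mp hφ a)
      (isParallel_restS hξ a) g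

lemma bracket_fieldB_fieldB {A : Tensor n M J (k + 1)} {B : Tensor n M J (l + 1)}
    (hA : G.IsGoodEnd A) (hB : G.IsGoodEnd B) (hξ : ∀ α, ξ α ∈ G.parallelSpinors)
    (hη : ∀ β, η β ∈ G.parallelSpinors) : G.bracket (G.fieldB k A ξ) (G.fieldB l B η) =
    G.fieldB (k + l) (SpinManifold.bulletOp A B) (append ξ η) :=
  bracket_ext (fieldB_mem hA.isTF ξ) (fieldB_mem hB.isTF η)
    (isRep_fieldB hA.isTF ξ) (isRep_fieldB hB.isTF η)
    (isRep_fieldB (hA.isTF.bulletOp hB.isTF) _) fun a g => by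
    rw [restS_append, liftT_bulletOp hA.isTF hB.isTF]
    exact SFrame.bracket_fB_fB (hA.good a) (hB.good a) (isParallel_restS hξ a)
      (isParallel_restS hη a) g

lemma bracket_fieldD_fieldD {B : Tensor n M J l} (hA : G.IsTensorField A) (hB : G.IsTensorField B)
    (hξ : ∀ α, ξ α ∈ G.parallelSpinors) (hη : ∀ β, η β ∈ G.parallelSpinors) :
    G.bracket (G.fieldD k A ξ) (G.fieldD l B η) = G.fieldB (k + l) (G.contractR₂ A B) (append ξ η) +
    G.fieldD (k + l) (G.nablaAlong A B - SpinManifold.swapBlocks (G.nablaAlong B A)) (append ξ η) :=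
  bracket_ext (fieldD_mem hA ξ) (fieldD_mem hB η) (isRep_fieldD hA ξ) (isRep_fieldD hB η)
    ((isRep_fieldB (hA.contractR₂ hB) _).add
      (isRep_fieldD ((hA.nablaAlong hB).sub_swap (hB.nablaAlong hA)) _)) fun a g => by
    rw [restS_append, liftT_contractR₂ hA hB, liftT_sub_swapBlocks (hA.nablaAlong hB)
      (hB.nablaAlong hA), liftT_nablaAlong hA hB, liftT_nablaAlong hB hA]
    exact SFrame.bracket_fD_fD _ _ (isParallel_restS hξ a) (isParallel_restS hη a) g

lemma bracket_fieldD_fieldB {B : Tensor n M J (l + 1)} (hA : G.IsTensorField A) (hB : G.IsGoodEnd B)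
    (hξ : ∀ α, ξ α ∈ G.parallelSpinors) (hη : ∀ β, η β ∈ G.parallelSpinors) : G.bracket (G.fieldD
    k A ξ) (G.fieldB l B η) = G.fieldB (k + l) (G.nablaAlong (l := l + 1) A B) (append ξ η) +
        G.fieldD (k + l) (SpinManifold.circOp A B) (append ξ η) :=
  bracket_ext (fieldD_mem hA ξ) (fieldB_mem hB.isTF η) (isRep_fieldD hA ξ)
    (isRep_fieldB hB.isTF η)
    ((isRep_fieldB (k := k + l) (hA.nablaAlong hB.isTF) _).add
      (isRep_fieldD (hA.circOp hB.isTF) _)) fun a g => by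
    rw [restS_append, liftT_circOp hA hB.isTF]
    have h : liftT K (G.domO a) (G.nablaAlong (l := l + 1) A B a) = _ := liftT_nablaAlong hA hB.isTF
    rw [h]
    exact SFrame.bracket_fD_fB _ (hB.good a) (isParallel_restS hξ a) (isParallel_restS hη a) g

lemma fieldD_sub_swap {A : Tensor n M J (k + l)} (hA : G.IsTensorField A)
    (hB : G.IsTensorField B) (ξ : Fin k → G.Spinors) (η : Fin l → G.Spinors) :
    G.fieldD (k + l) (A - SpinManifold.swapBlocks B) (append ξ η) =
    G.fieldD (k + l) A (append ξ η) + -(-1 : K) ^ (k * l) • G.fieldD (l + k) B (append η ξ) :=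
  LinearMap.ext fun f => restF_ext fun a => by
    rw [LinearMap.add_apply, LinearMap.smul_apply, neg_smul, ← sub_eq_add_neg, restF_sub,
      restF_neg_one_pow_smul,
      isRep_fieldD (hA.sub_swap hB), isRep_fieldD hA, isRep_fieldD hB]
    beta_reduce
    rw [restS_append, restS_append, liftT_sub_swapBlocks hA hB, SFrame.fD_sub, SFrame.fD_swap]

end SpecialGradedManifold

namespace SpecialGradedManifold

variable {G : SpecialGradedManifold K n M S J} {a : J} {x : M} {k l : ℕ} [Module.Finite K S]

variable {A : Tensor n M J (k + 1)}

/-! ### s-like and v-like fields -/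

lemma wedge_mem (ξ : Fin k → G.Spinors) (I : Fin k → Fin n) : G.wedge ξ a I x ∈ ⋀[K]^k S :=
  ExteriorAlgebra.ιMulti_range K k ⟨_, rfl⟩

lemma tmul_mem_range
    {d : ℕ} {W : Type*} [AddCommGroup W] [Module K W] {u : Ext K S} (hu : u ∈ ⋀[K]^d S) (w : W) :
    u ⊗ₜ[K] w ∈ LinearMap.range (TensorProduct.map (⋀[K]^d S).subtype (LinearMap.id : W →ₗ[K] W)) :=
  ⟨(⟨u, hu⟩ : ⋀[K]^d S) ⊗ₜ w, rfl⟩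

lemma smoothOn_wedge (ξ : Fin k → G.Spinors) (I : Fin k → Fin n) :
    SmoothOn K n (G.wedge ξ a I) (G.dom a) := smoothOn_of_val _ fun _ hx => u_restS_val ξ I hx

lemma _root_.SGM.SpinManifold.IsTensorField.smoothOn_ofReal
    {A : Tensor n M J k} (hA : G.IsTensorField A) (I : Fin k → Fin n) (q : Fin n) :
    SmoothOn K n (fun x => ((A a x I q : ℝ) : K)) (G.dom a) :=
  (SpinManifold.realSm n K (G.domO a) fun x => A a x I q).smooth.congr fun _ hx =>
    (SpinManifold.realSm_val (U := G.domO a) (hA.1 a I q) hx).symm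

lemma smoothOn_tensorS (hA : G.IsTensorField A) (I : Fin k → Fin n) :
    SmoothOn K n (G.tensorS A a I) (G.dom a) := by
  have h : ∀ x, G.tensorS A a I x = ∑ q, ∑ p, ((A a x (snoc I p) q : ℝ) : K) •
      G.spinL (Matrix.single q p 1) := fun x => by
    rw [tensorS_eq_spinL, Matrix.matrix_eq_sum_single (endK K A a I x)]
    simp only [map_sum, ← map_smul, Matrix.smul_single, smul_eq_mul, mul_one]
    rfl
  exact (SmoothOn.sum _ fun q => SmoothOn.sum _ fun p =>
    SmoothOn.smul_vec (hA.smoothOn_ofReal _ _).csmooth _).congr fun x _ => h x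

lemma isSLike_fieldB (hA : G.IsTensorField A) (ξ : Fin k → G.Spinors) :
    G.IsSLike (k + 1) (G.fieldB k A ξ) := by
  obtain ⟨Φ, hΦ⟩ := (G.isCocycle_extTrans.tensor G.isCocycle_spinorTrans).exists_section
    (σ := sectionB A ξ) (fun a => SmoothOn.sum _ fun I =>
      SmoothOn.bilin G.wedgeEnd (smoothOn_wedge ξ I) (smoothOn_tensorS hA I))
    fun a b x hx => sectionB_trans hA ξ hx
  refine ⟨Φ, fun a x hx => ?_⟩
  rw [hΦ a x hx]
  refine ⟨Submodule.sum_mem _ fun I _ => ?_, fun f => ?_⟩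
  · rw [wedgeEnd_apply]
    refine Submodule.sum_mem _ fun c _ => tmul_mem_range ?_ _
    change _ ∈ LinearMap.range (ExteriorAlgebra.ι K) ^ (k + 1)
    rw [pow_succ]
    exact Submodule.mul_mem_mul (wedge_mem ξ I) ⟨_, rfl⟩
  · rw [← fieldBExpr_eq]
    exact isGivenBy_fieldB hA ξ f a x hx

lemma isVLike_fieldD {A : Tensor n M J k} (hA : G.IsTensorField A) (ξ : Fin k → G.Spinors) :
    G.IsVLike k (G.fieldD k A ξ) := by
  obtain ⟨Φ, hΦ⟩ := (G.isCocycle_extTrans.tensor G.isCocycle_vectorTrans).exists_section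
    (σ := sectionD A ξ) (fun a => SmoothOn.sum _ fun I =>
      SmoothOn.bilin (TensorProduct.mk K _ _) (smoothOn_wedge ξ I) (smoothOn_pi
        (fun q => liftT K (G.domO a) (A a) I q)
        fun q x hx => (hA.isLift le_rfl).val (U := G.domO a) hx I q))
    fun a b x hx => sectionD_trans hA ξ hx
  refine ⟨Φ, fun a x hx => ?_⟩
  rw [hΦ a x hx]
  refine ⟨Submodule.sum_mem _ fun I _ => tmul_mem_range (wedge_mem ξ I) _, fun f => ?_⟩
  rw [← fieldDExpr_eq]
  exact isGivenBy_fieldD hA ξ f a x hx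

/-! ### Multilinearity -/

lemma IsGivenBy.ext
    {T U : End K G.functions} {E : J → (M → Ext K S) → M → Ext K S} (hT : G.IsGivenBy T E)
    (h : ∀ (f : G.functions) a, ∀ x ∈ G.dom a, E a (G.funRep f a) x = G.funRep (U f) a x) : T = U :=
  LinearMap.ext fun f => restF_ext fun a => ext_on fun x hx => by
    rw [restF_val _ hx, restF_val _ hx]
    exact (hT f a x hx).trans (h f a x hx)

section Wedge

variable [DecidableEq (Fin k)] (ξ : Fin k → G.Spinors) (α : Fin k)

lemma wedge_update (φ : G.Spinors) (I : Fin k → Fin n) : G.wedge (update ξ α φ) a I x =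
    ExteriorAlgebra.ιMulti K k (update (fun β => G.gammaUp (I β) (G.spinorRep (ξ β) a x))
    α (G.gammaUp (I α) (G.spinorRep φ a x))) := by
  rw [wedge]
  congr 1
  funext β
  rcases eq_or_ne β α with rfl | h
  · rw [update_self, update_self]
  · rw [update_of_ne h, update_of_ne h]

lemma wedge_update_add (φ ψ : G.Spinors) (I : Fin k → Fin n) : G.wedge (update ξ α (φ + ψ)) a I x =
    G.wedge (update ξ α φ) a I x + G.wedge (update ξ α ψ) a I x := by
  rw [wedge_update, wedge_update, wedge_update, ← AlternatingMap.map_update_add, ← map_add]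
  congr 4
  exact congrFun (G.rep_add G.spinorTrans a φ.1 ψ.1) x

lemma wedge_update_smul (c : K) (φ : G.Spinors) (I : Fin k → Fin n) :
    G.wedge (update ξ α (c • φ)) a I x = c • G.wedge (update ξ α φ) a I x := by
  rw [wedge_update, wedge_update, ← AlternatingMap.map_update_smul, ← map_smul]
  congr 4
  exact congrFun (G.rep_smul G.spinorTrans a c φ.1) x

end Wedge

variable {ξ : Fin k → G.Spinors} {T : End K G.functions} {A : Tensor n M J k} {p : Submodule K G.Spinors} {η : Fin l → G.Spinors}

lemma funRep_add_apply (T U : End K G.functions) (f : G.functions) :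
    G.funRep ((T + U) f) a x = G.funRep (T f) a x + G.funRep (U f) a x := by
  rw [LinearMap.add_apply, funRep_add]

lemma funRep_smul_apply (c : K) (T : End K G.functions) (f : G.functions) :
    G.funRep ((c • T) f) a x = c • G.funRep (T f) a x := by
  rw [LinearMap.smul_apply, funRep_smul]

def fieldBM {A : Tensor n M J (k + 1)} (hA : G.IsTensorField A) :
    MultilinearMap K (fun _ : Fin k => G.Spinors) (End K G.functions) where
  toFun ξ := G.fieldB k A ξ
  map_update_add' ξ α φ ψ := (isGivenBy_fieldB hA _).ext fun f a x hx => by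
    refine Eq.trans ?_ (funRep_add_apply _ _ f).symm
    rw [isGivenBy_fieldB hA _ f a x hx, isGivenBy_fieldB hA _ f a x hx]
    simp only [fieldBExpr, wedge_update_add, add_mul, sum_add]
  map_update_smul' ξ α c φ := (isGivenBy_fieldB hA _).ext fun f a x hx => by
    refine Eq.trans ?_ (funRep_smul_apply _ _ f).symm
    rw [isGivenBy_fieldB hA _ f a x hx]
    simp only [fieldBExpr, wedge_update_smul, smul_mul_assoc, smul_sum]

def fieldDM (hA : G.IsTensorField A) :
    MultilinearMap K (fun _ : Fin k => G.Spinors) (End K G.functions) where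
  toFun ξ := G.fieldD k A ξ
  map_update_add' ξ α φ ψ := (isGivenBy_fieldD hA _).ext fun f a x hx => by
    refine Eq.trans ?_ (funRep_add_apply _ _ f).symm
    rw [isGivenBy_fieldD hA _ f a x hx, isGivenBy_fieldD hA _ f a x hx]
    simp only [fieldDExpr, wedge_update_add, add_mul, smul_add, sum_add]
  map_update_smul' ξ α c φ := (isGivenBy_fieldD hA _).ext fun f a x hx => by
    refine Eq.trans ?_ (funRep_smul_apply _ _ f).symm
    rw [isGivenBy_fieldD hA _ f a x hx]
    simp only [fieldDExpr, wedge_update_smul, smul_mul_assoc, smul_sum, smul_comm c]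

lemma vectorRep_add (X Y : G.VectorFields) :
    G.vectorRep (X + Y) a x = G.vectorRep X a x + G.vectorRep Y a x :=
  congrFun (G.rep_add G.vectorTrans a X.1 Y.1) x

lemma vectorRep_smul (c : K) (X : G.VectorFields) :
    G.vectorRep (c • X) a x = c • G.vectorRep X a x :=
  congrFun (G.rep_smul G.vectorTrans a c X.1) x

lemma spinorRep_add (φ ψ : G.Spinors) :
    G.spinorRep (φ + ψ) a x = G.spinorRep φ a x + G.spinorRep ψ a x :=
  congrFun (G.rep_add G.spinorTrans a φ.1 ψ.1) x

lemma spinorRep_smul (c : K) (φ : G.Spinors) : G.spinorRep (c • φ) a x = c • G.spinorRep φ a x :=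
  congrFun (G.rep_smul G.spinorTrans a c φ.1) x

lemma covV_add (X Y : G.VectorFields) (i q : Fin n) (hx : x ∈ G.dom a) : G.covV a i (G.vectorRep
    (X + Y) a) x q = G.covV a i (G.vectorRep X a) x q + G.covV a i (G.vectorRep Y a) x q := by
  have h : G.vectorRep (X + Y) a = fun x => G.vectorRep X a x + G.vectorRep Y a x :=
    G.rep_add _ a X.1 Y.1
  rw [h, covV, dirDeriv_add (G.isOpen_dom a) (X.2 a) (Y.2 a) hx, covV, covV]
  simp [mul_add, sum_add]
  exact add_add_add_comm _ _ _ _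

lemma covV_smul (c : K) (X : G.VectorFields) (i q : Fin n) (hx : x ∈ G.dom a) :
    G.covV a i (G.vectorRep (c • X) a) x q = c * G.covV a i (G.vectorRep X a) x q := by
  have h : G.vectorRep (c • X) a = fun x => c • G.vectorRep X a x := G.rep_smul _ a c X.1
  rw [h, covV, dirDeriv_smul (G.isOpen_dom a) (X.2 a) hx, covV]
  simp [mul_add, mul_sum, mul_left_comm c]

lemma nablaVS_add (X Y : G.VectorFields) (hx : x ∈ G.dom a) : G.nablaVS a
    (G.vectorRep (X + Y) a) x = G.nablaVS a (G.vectorRep X a) x + G.nablaVS a (G.vectorRep Y a) x :=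
  Eq.trans (congrArg G.spinL (by ext q p; exact covV_add X Y p q hx))
    (map_add G.spinL (fun q p => G.covV a p (G.vectorRep X a) x q)
      (fun q p => G.covV a p (G.vectorRep Y a) x q))

lemma nablaVS_smul (c : K) (X : G.VectorFields) (hx : x ∈ G.dom a) :
    G.nablaVS a (G.vectorRep (c • X) a) x = c • G.nablaVS a (G.vectorRep X a) x :=
  Eq.trans (congrArg G.spinL (by ext q p; exact covV_smul c X p q hx))
    (map_smul G.spinL c (fun q p => G.covV a p (G.vectorRep X a) x q))

lemma isLinearMap_even : IsLinearMap K G.even where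
  map_add X Y := (isGivenBy_even _).ext fun f a x hx => by
    rw [funRep_add_apply, isGivenBy_even X f a x hx, isGivenBy_even Y f a x hx, evenExpr,
      nablaVS_add X Y hx, derivExt_add, vectorRep_add,
      evenExpr, evenExpr]
    simp [add_smul, sum_add]
    exact add_sub_add_comm _ _ _ _
  map_smul c X := (isGivenBy_even _).ext fun f a x hx => by
    rw [funRep_smul_apply, isGivenBy_even X f a x hx, evenExpr, nablaVS_smul c X hx, derivExt_smul,
      vectorRep_smul, evenExpr, smul_sub,
      smul_sum]
    simp [mul_smul]

lemma isLinearMap_odd : IsLinearMap K G.odd where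
  map_add φ ψ := (isGivenBy_odd _).ext fun f a x hx => by
    rw [funRep_add_apply, isGivenBy_odd φ f a x hx, isGivenBy_odd ψ f a x hx, oddExpr,
      spinorRep_add, oddExpr, oddExpr]
    simp [interior_add, add_mul, sum_add]
    exact add_add_add_comm _ _ _ _
  map_smul c φ := (isGivenBy_odd _).ext fun f a x hx => by
    rw [funRep_smul_apply, isGivenBy_odd φ f a x hx, oddExpr, spinorRep_smul, oddExpr, smul_add,
      smul_sum]
    simp [interior_smul, smul_mul_assoc]

/-! ### The centre -/

lemma fieldB_mem_center {A : Tensor n M J (k + 1)}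
    (hA : G.CurvEnd k A) (hξ : ∀ α, ξ α ∈ G.parallelSpinors) : G.fieldB k A ξ ∈ G.center :=
  Submodule.subset_span (Or.inl ⟨k, A, ξ, hA, hξ, rfl⟩)

lemma fieldD_mem_center (hA : G.CurvVec k A) (hξ : ∀ α, ξ α ∈ G.parallelSpinors) :
    G.fieldD k A ξ ∈ G.center :=
  Submodule.subset_span (Or.inr ⟨k, A, ξ, hA, hξ, rfl⟩)

lemma center_induction {p : End K G.functions → Prop} (hB : ∀ (k : ℕ) (A : Tensor n M J (k + 1))
    (ξ : Fin k → G.Spinors), G.CurvEnd k A → (∀ α, ξ α ∈ G.parallelSpinors) → p (G.fieldB k A ξ))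
    (hD : ∀ (k : ℕ) (A : Tensor n M J k) (ξ : Fin k → G.Spinors), G.CurvVec
    k A → (∀ α, ξ α ∈ G.parallelSpinors) → p (G.fieldD k A ξ)) (h0 : p 0) (hadd : ∀ T U, p
    T → p U → p (T + U)) (hsmul : ∀ (c : K) T, p T → p (c • T)) (hT : T ∈ G.center) : p T := by
  refine Submodule.span_induction ?_ h0 (fun T U _ _ => hadd T U) (fun c T _ => hsmul c T) hT
  rintro T (⟨k, A, ξ, hA, hξ, rfl⟩ | ⟨k, A, ξ, hA, hξ, rfl⟩)
  · exact hB k A ξ hA hξ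
  · exact hD k A ξ hA hξ

lemma bracket_def_apply (T U : End K G.functions) (f : G.functions) :
    G.bracket T U f = T (U f) - U (T f) + (2 : K) • G.oddPart U (G.oddPart T f) := rfl

lemma oddPart_apply (T : End K G.functions) (f : G.functions) :
    G.oddPart T f = (1 / 2 : K) • (T f - G.parity (T (G.parity f))) := rfl

lemma bracket_add (T U V : End K G.functions) :
    G.bracket T (U + V) = G.bracket T U + G.bracket T V :=
  LinearMap.ext fun f => by
    simp [bracket_def_apply, oddPart_apply]
    module

lemma bracket_smul (c : K) (T U : End K G.functions) : G.bracket T (c • U) = c • G.bracket T U :=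
  LinearMap.ext fun f => by
    simp [bracket_def_apply, oddPart_apply]
    module

lemma add_bracket (T U V : End K G.functions) :
    G.bracket (T + U) V = G.bracket T V + G.bracket U V :=
  LinearMap.ext fun f => by
    simp [bracket_def_apply, oddPart_apply]
    module

lemma smul_bracket (c : K) (T U : End K G.functions) : G.bracket (c • T) U = c • G.bracket T U :=
  LinearMap.ext fun f => by
    simp [bracket_def_apply, oddPart_apply]
    module

lemma bracket_mem_center (hB : ∀ (k : ℕ) (A : Tensor n M J (k + 1)) (ξ : Fin k → G.Spinors),
    G.CurvEnd k A → (∀ α, ξ α ∈ G.parallelSpinors) → G.bracket T (G.fieldB k A ξ) ∈ G.center)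
    (hD : ∀ (k : ℕ) (A : Tensor n M J k) (ξ : Fin k → G.Spinors), G.CurvVec
    k A → (∀ α, ξ α ∈ G.parallelSpinors) → G.bracket T (G.fieldD k A ξ) ∈ G.center)
    {U : End K G.functions} (hU : U ∈ G.center) : G.bracket T U ∈ G.center := by
  refine center_induction (p := fun U => G.bracket T U ∈ G.center) hB hD ?_ (fun U V hU hV => ?_)
    (fun c U hU => ?_) hU
  · rw [← zero_smul K (0 : End K G.functions), bracket_smul, zero_smul]
    exact Submodule.zero_mem _
  · rw [bracket_add]; exact Submodule.add_mem _ hU hV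
  · rw [bracket_smul]; exact Submodule.smul_mem _ c hU

lemma bracket_comm {T U : End K G.functions} (hT : T ∈ G.fieldsOfParity k)
    (hU : U ∈ G.fieldsOfParity l) : G.bracket T U = -(-1 : K) ^ (k * l) • G.bracket U T :=
  LinearMap.ext fun f => by
    rw [LinearMap.smul_apply, bracket_apply hT hU, bracket_apply hU hT, mul_comm l k, smul_sub,
      smul_smul, neg_mul, ← mul_pow, neg_one_mul, neg_neg, one_pow, neg_smul, neg_smul, one_smul]
    abel

lemma append_mem (hξ : ∀ α, ξ α ∈ p) (hη : ∀ β, η β ∈ p) (γ : Fin (k + l)) : append ξ η γ ∈ p := by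
  refine Fin.addCases (fun α => ?_) (fun β => ?_) γ
  · rw [Fin.append_left]; exact hξ α
  · rw [Fin.append_right]; exact hη β

lemma update_mem (hξ : ∀ α, ξ α ∈ p)
    {φ : G.Spinors} (hφ : φ ∈ p) (α β : Fin k) : update ξ α φ β ∈ p := by
  rcases eq_or_ne β α with rfl | h
  · rwa [update_self]
  · rw [update_of_ne h]; exact hξ β

lemma even_center {X : G.VectorFields} (hX : X ∈ G.killing) (hT : T ∈ G.center) :
    G.bracket (G.even X) T ∈ G.center := by
  refine bracket_mem_center (fun k A ξ hA hξ => ?_) (fun k A ξ hA hξ => ?_) hT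
  · rw [bracket_even_fieldB hX hA.good]
    exact Submodule.sum_mem _ fun α _ => fieldB_mem_center hA
      fun β => update_mem hξ (evenSpinor_mem hX (hξ α)) α β
  · rw [bracket_even_fieldD hX hA.good]
    exact Submodule.sum_mem _ fun α _ => fieldD_mem_center hA
      fun β => update_mem hξ (evenSpinor_mem hX (hξ α)) α β

lemma odd_center {φ : G.Spinors} (hφ : φ ∈ G.parallelSpinors) (hT : T ∈ G.center) :
    G.bracket (G.odd φ) T ∈ G.center := by
  have hc : ∀ {k : ℕ} {ξ : Fin k → G.Spinors}, (∀ α, ξ α ∈ G.parallelSpinors) →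
      ∀ β, (Fin.cons φ ξ : Fin (k + 1) → G.Spinors) β ∈ G.parallelSpinors := fun hξ β => by
    refine Fin.cases ?_ (fun β => ?_) β
    · exact hφ
    · exact hξ β
  have hs : ∀ {k : ℕ} {ξ : Fin k → G.Spinors}, (∀ α, ξ α ∈ G.parallelSpinors) →
      ∀ β, (snoc ξ φ : Fin (k + 1) → G.Spinors) β ∈ G.parallelSpinors := fun hξ β => by
    refine Fin.lastCases ?_ (fun β => ?_) β
    · rw [snoc_last]; exact hφ
    · rw [snoc_castSucc]; exact hξ β
  refine bracket_mem_center (fun k A ξ hA hξ => ?_) (fun k A ξ hA hξ => ?_) hT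
  · rw [bracket_odd_fieldB hφ hA.good hξ]
    exact Submodule.add_mem _ (fieldB_mem_center hA.nabla (hc hξ))
      (Submodule.smul_mem _ _ (fieldD_mem_center (.ofEnd hA) (hs hξ)))
  · rw [bracket_odd_fieldD hφ hA.good hξ]
    exact Submodule.add_mem _ (fieldD_mem_center hA.nabla (hc hξ))
      (Submodule.smul_mem _ _ (fieldB_mem_center (.contractR hA) (hs hξ)))

lemma bracket_fieldD_fieldB_mem {B : Tensor n M J (l + 1)} (hA : G.CurvVec k A)
    (hB : G.CurvEnd l B) (hξ : ∀ α, ξ α ∈ G.parallelSpinors) (hη : ∀ β, η β ∈ G.parallelSpinors) :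
    G.bracket (G.fieldD k A ξ) (G.fieldB l B η) ∈ G.center := by
  rw [bracket_fieldD_fieldB hA.good.isTF hB.good hξ hη]
  exact Submodule.add_mem _ (fieldB_mem_center (.nablaAlong hA hB) (append_mem hξ hη))
    (fieldD_mem_center (.circOp hA hB) (append_mem hξ hη))

lemma center_center {T U : End K G.functions} (hT : T ∈ G.center) (hU : U ∈ G.center) :
    G.bracket T U ∈ G.center := by
  refine center_induction (p := fun T => G.bracket T U ∈ G.center) (fun k A ξ hA hξ => ?_)
    (fun k A ξ hA hξ => ?_) ?_ (fun T V hT hV => ?_) (fun c T hT => ?_) hT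
  · refine bracket_mem_center (fun l B η hB hη => ?_) (fun l B η hB hη => ?_) hU
    · rw [bracket_fieldB_fieldB hA.good hB.good hξ hη]
      exact fieldB_mem_center (.bulletOp hA hB) (append_mem hξ hη)
    · rw [bracket_comm (fieldB_mem hA.good.isTF ξ) (fieldD_mem hB.good.isTF η)]
      exact Submodule.smul_mem _ _ (bracket_fieldD_fieldB_mem hB hA hη hξ)
  · refine bracket_mem_center (fun l B η hB hη => bracket_fieldD_fieldB_mem hA hB hξ hη)
      (fun l B η hB hη => ?_) hU
    have hA' := hA.good.isTF
    have hB' := hB.good.isTF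
    rw [bracket_fieldD_fieldD hA' hB' hξ hη, fieldD_sub_swap (hA'.nablaAlong hB')
      (hB'.nablaAlong hA')]
    exact Submodule.add_mem _ (fieldB_mem_center (.contractR₂ hA hB) (append_mem hξ hη))
      (Submodule.add_mem _ (fieldD_mem_center (.nablaAlong hA hB) (append_mem hξ hη))
        (Submodule.smul_mem _ _ (fieldD_mem_center (.nablaAlong hB hA) (append_mem hη hξ))))
  · rw [← zero_smul K (0 : End K G.functions), smul_bracket, zero_smul]
    exact Submodule.zero_mem _
  · rw [add_bracket]; exact Submodule.add_mem _ hT hV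
  · rw [smul_bracket]; exact Submodule.smul_mem _ c hT

lemma center_graded : G.center = (G.center ⊓ G.evenFields) ⊔ (G.center ⊓ G.oddFields) := by
  refine le_antisymm (fun T hT => ?_) (sup_le inf_le_left inf_le_left)
  have h : ∀ (k : ℕ) (T : End K G.functions), T ∈ G.center → T ∈ G.fieldsOfParity k →
      T ∈ (G.center ⊓ G.evenFields) ⊔ (G.center ⊓ G.oddFields) := fun k T hT hk => by
    rw [fieldsOfParity] at hk
    split_ifs at hk
    · exact Submodule.mem_sup_left ⟨hT, hk⟩
    · exact Submodule.mem_sup_right ⟨hT, hk⟩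
  exact center_induction (fun k A ξ hA hξ => h k _ (fieldB_mem_center hA hξ)
      (fieldB_mem hA.good.isTF ξ))
    (fun k A ξ hA hξ => h k _ (fieldD_mem_center hA hξ) (fieldD_mem hA.good.isTF ξ))
    (Submodule.zero_mem _) (fun _ _ => Submodule.add_mem _) (fun c _ => Submodule.smul_mem _ c) hT

/-! ### The degree of the fields -/

variable {T : End K G.functions}
variable (G) in
def adNumber : End K (G.functions → M → Ext K S) where
  toFun w f x := derivExt LinearMap.id (w f x) - w (G.numOp f) x
  map_add' w w' := by
    funext f x
    simp only [Pi.add_apply, map_add]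
    exact add_sub_add_comm _ _ _ _
  map_smul' c w := by
    funext f x
    simp only [Pi.smul_apply, map_smul, RingHom.id_apply, smul_sub]

def values (T : End K G.functions) : G.functions → M → Ext K S := fun f x => (T f).1 x

lemma eq_zero_of_values (h : values T = 0) : T = 0 :=
  LinearMap.ext fun f => Subtype.ext (congrFun h f)

lemma adNumber_values_apply (T : End K G.functions) (f : G.functions) (x : M) :
    G.adNumber (values T) f x = (G.numOp (T f)).1 x - (T (G.numOp f)).1 x := rfl

lemma adNumber_eq_smul {P : ∀ a, Sm K n (G.domO a) (Ext K S) → Sm K n (G.domO a) (Ext K S)}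
    (hT : IsRep T P) {d : ℕ} (h : ∀ a g, numberSm a (P a g) = P a (numberSm a g) +
    (d : Sm K n (G.domO a) K) • P a g) : G.adNumber (values T) = (d : K) • values T := by
  have h1 : ∀ f, G.numOp (T f) = T (G.numOp f) + (d : K) • T f := fun f =>
    restF_ext fun a => by
      rw [restF_numOp, hT, h, restF_add, hT, restF_numOp, Nat.cast_smul_eq_nsmul,
        Nat.cast_smul_eq_nsmul, ← hT]
      exact congrArg _ (map_nsmul (AddMonoidHom.mk' (G.restF a) restF_add) d (T f)).symm
  funext f x
  rw [adNumber_values_apply, h1]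
  exact add_sub_cancel_left ((T (G.numOp f)).1 x) ((d : K) • (T f).1 x)

lemma adNumber_even (X : G.VectorFields) : G.adNumber (values (G.even X)) = 0 := by
  have h := adNumber_eq_smul (d := 0) (isRep_even X) fun a g => by
    rw [isNumberOp_numberSm.lieD, Nat.cast_zero, zero_smul, add_zero]
  rwa [Nat.cast_zero, zero_smul] at h

lemma adNumber_fieldB {A : Tensor n M J (k + 1)} (hA : G.IsTensorField A) (ξ : Fin k → G.Spinors) :
    G.adNumber (values (G.fieldB k A ξ)) = (k : K) • values (G.fieldB k A ξ) :=
  adNumber_eq_smul (isRep_fieldB hA ξ) fun _ g => isNumberOp_numberSm.fB _ _ g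

lemma adNumber_fieldD {A : Tensor n M J k} (hA : G.IsTensorField A) (ξ : Fin k → G.Spinors) :
    G.adNumber (values (G.fieldD k A ξ)) = (k : K) • values (G.fieldD k A ξ) :=
  adNumber_eq_smul (isRep_fieldD hA ξ) fun _ g => isNumberOp_numberSm.fD _ _ g

lemma adNumber_adNumber_odd (φ : G.Spinors) :
    G.adNumber (G.adNumber (values (G.odd φ))) = values (G.odd φ) := by
  have h : ∀ f, G.numOp (G.numOp (G.odd φ f)) + G.odd φ (G.numOp (G.numOp f)) =
      2 • G.numOp (G.odd φ (G.numOp f)) + G.odd φ f := fun f => restF_ext fun a => by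
    have h := isNumberOp_numberSm.fO (G.restS a φ) (G.restF a f)
    have h2 := isRep_odd φ
    simp [two_smul, restF_add, restF_numOp, h2 _ _]
    rw [two_smul] at h
    exact h
  funext f x
  have h1 : (G.numOp (G.numOp (G.odd φ f))).1 x +
      (G.odd φ (G.numOp (G.numOp f))).1 x = (G.numOp (G.odd φ (G.numOp f))).1 x +
        (G.numOp (G.odd φ (G.numOp f))).1 x + (G.odd φ f).1 x :=
    congrArg (fun g : G.functions => g.1 x) ((h f).trans (by rw [two_smul]))
  change derivExt LinearMap.id (derivExt LinearMap.id ((G.odd φ f).1 x) -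
    (G.odd φ (G.numOp f)).1 x) - ((G.numOp (G.odd φ (G.numOp f))).1 x -
      (G.odd φ (G.numOp (G.numOp f))).1 x) = (G.odd φ f).1 x
  rw [map_sub]
  change (G.numOp (G.numOp (G.odd φ f))).1 x - (G.numOp (G.odd φ (G.numOp f))).1 x -
    ((G.numOp (G.odd φ (G.numOp f))).1 x - (G.odd φ (G.numOp (G.numOp f))).1 x) = (G.odd φ f).1 x
  rw [← sub_eq_zero] at h1 ⊢
  rw [← h1]
  abel

lemma direct_sum {X : G.VectorFields} {φ : G.Spinors}
    (hT : T ∈ G.center) (h : G.even X + T + G.odd φ = 0) : G.even X = 0 ∧ T = 0 ∧ G.odd φ = 0 := by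
  have hind := Module.End.eigenspaces_iSupIndep G.adNumber
  set E := G.adNumber.eigenspace with hE
  have he : values (G.even X) ∈ E 0 := by
    rw [hE, Module.End.mem_eigenspace_iff, adNumber_even, zero_smul]
  have hTE : values T ∈ ⨆ d : ℕ, E (d + 2 : K) := by
    have h1 : ∀ (k : ℕ) (U : End K G.functions), 2 ≤ k →
        G.adNumber (values U) = (k : K) • values U → values U ∈ ⨆ d : ℕ, E (d + 2 : K) := fun k U hk hU => by
      obtain ⟨d, rfl⟩ := Nat.exists_eq_add_of_le' hk
      refine Submodule.mem_iSup_of_mem d ?_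
      rw [hE, Module.End.mem_eigenspace_iff, hU]
      push_cast
      rfl
    exact center_induction (p := fun U => values U ∈ ⨆ d : ℕ, E (d + 2 : K))
      (fun k A ξ hA hξ => h1 k _ hA.good.two_le (adNumber_fieldB hA.good.isTF ξ))
      (fun k A ξ hA hξ => h1 k _ hA.good.two_le (adNumber_fieldD hA.good.isTF ξ))
      (Submodule.zero_mem _) (fun _ _ => Submodule.add_mem _) (fun c _ => Submodule.smul_mem _ c) hT
  set o := values (G.odd φ)
  set e := values (G.even X)
  set t := values T
  set o' := G.adNumber o with ho'
  have hoo : G.adNumber o' = o := adNumber_adNumber_odd φ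
  have h1 : o + o' ∈ E 1 := by
    rw [hE, Module.End.mem_eigenspace_iff, map_add, hoo, ← ho', one_smul, add_comm]
  have h2 : o - o' ∈ E (-1) := by
    rw [hE, Module.End.mem_eigenspace_iff, map_sub, hoo, ← ho', neg_one_smul, neg_sub]
  have hsum : e + t + (2⁻¹ : K) • (o + o') + (2⁻¹ : K) • (o - o') = 0 := by
    have h' : e + t + o = 0 := congrArg values h
    rw [← h', add_assoc, ← smul_add, add_add_sub_cancel, ← two_smul K o, smul_smul,
      inv_mul_cancel₀ two_ne_zero, one_smul]
  have hle : ∀ c : K, (∀ d : ℕ, (d + 2 : K) ≠ c) → (⨆ d : ℕ, E (d + 2 : K)) ≤ ⨆ j ≠ c, E j :=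
    fun c hc => iSup_le fun d => le_iSup₂_of_le _ (hc d) le_rfl
  have hmem : ∀ {c d : K} {U}, d ≠ c → U ∈ E d → U ∈ ⨆ j ≠ c, E j := fun {c d U} hd hU =>
    (le_iSup₂_of_le (f := fun j (_ : j ≠ c) => E j) d hd le_rfl) hU
  have hz : ∀ {c : K} {U V}, U ∈ E c → V ∈ ⨆ j ≠ c, E j → U + V = 0 → U = 0 :=
    fun {c U V} hU hV huv => by
      have := (Submodule.disjoint_def.mp (hind c)) U hU (by
        rw [eq_neg_of_add_eq_zero_left huv]; exact Submodule.neg_mem _ hV)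
      exact this
  have hne : ∀ (d : ℕ) (m : ℤ), m < 2 → (d + 2 : K) ≠ (m : K) := fun d m hm hd => by
    have : ((d + 2 : ℤ) : K) = (m : K) := by push_cast; exact hd
    have := Int.cast_injective (α := K) this
    omega
  have n0 : ∀ d : ℕ, (d + 2 : K) ≠ 0 := fun d => by simpa using hne d 0 (by norm_num)
  have n1 : ∀ d : ℕ, (d + 2 : K) ≠ 1 := fun d => by simpa using hne d 1 (by norm_num)
  have n2 : ∀ d : ℕ, (d + 2 : K) ≠ -1 := fun d => by simpa using hne d (-1) (by norm_num)
  have m1 : (1 : K) ≠ -1 := fun h => by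
    have : (2 : K) = 0 := by linear_combination h
    exact two_ne_zero this
  have e0 : e = 0 := by
    refine hz he (V := t + (2⁻¹ : K) • (o + o') + (2⁻¹ : K) • (o - o')) ?_ (by rw [← hsum]; abel)
    exact Submodule.add_mem _ (Submodule.add_mem _ (hle 0 n0 hTE)
      (Submodule.smul_mem _ _ (hmem one_ne_zero h1)))
      (Submodule.smul_mem _ _ (hmem (neg_ne_zero.mpr one_ne_zero) h2))
  have e1 : (2⁻¹ : K) • (o + o') = 0 := by
    refine hz (Submodule.smul_mem _ _ h1) (V := t + e + (2⁻¹ : K) • (o - o')) ?_ (by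
      rw [← hsum]; abel)
    exact Submodule.add_mem _ (Submodule.add_mem _ (hle 1 n1 hTE) (hmem one_ne_zero.symm he))
      (Submodule.smul_mem _ _ (hmem m1.symm h2))
  have e2 : (2⁻¹ : K) • (o - o') = 0 := by
    refine hz (Submodule.smul_mem _ _ h2) (V := t + e + (2⁻¹ : K) • (o + o')) ?_ (by
      rw [← hsum]; abel)
    exact Submodule.add_mem _ (Submodule.add_mem _ (hle _ n2 hTE)
      (hmem (neg_ne_zero.mpr one_ne_zero).symm he)) (Submodule.smul_mem _ _ (hmem m1 h1))
  rw [e1, e2, e0, zero_add, add_zero, add_zero] at hsum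
  have e0' := eq_zero_of_values e0
  have ht := eq_zero_of_values hsum
  rw [e0', ht, zero_add, zero_add] at h
  exact ⟨e0', ht, h⟩

lemma isSSKS : G.IsSSKS G.killing G.parallelSpinors G.center G.even G.odd where
  linear_e := isLinearMap_even
  linear_o := isLinearMap_odd
  e_mem X := even_mem X
  o_mem φ := odd_mem φ
  Z_graded := center_graded
  lie_mem X Y hX hY := lie_mem_killing hX hY
  e_e X Y hX _ := bracket_even_even hX Y
  e_o X φ hX hφ := ⟨_, evenSpinor_mem hX hφ, bracket_even_odd hX φ⟩
  o_o φ ψ hφ hψ := ⟨_, susy_mem hφ hψ, _, fieldB_mem_center .curv (by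
    intro α; fin_cases α; exacts [hφ, hψ]), bracket_odd_odd hφ hψ⟩
  o_Z φ hφ T hT := odd_center hφ hT
  e_Z X hX T hT := even_center hX hT
  Z_Z T U hT hU := center_center hT hU
  direct X φ T _ _ hT h := direct_sum hT h

end SpecialGradedManifold

end SGM

end

theorem theorem6 {𝕜 : Type*} [RCLike 𝕜] {n : ℕ} {M : Type*} [TopologicalSpace M] [T2Space M]
    [SecondCountableTopology M] [ChartedSpace (SGM.Model n) M]
    [IsManifold 𝓘(ℝ, SGM.Model n) ∞ M] {S : Type*} [AddCommGroup S] [Module 𝕜 S] [Module ℝ S]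
    [IsScalarTower ℝ 𝕜 S] [Module.Finite 𝕜 S] {J : Type*}
    (G : SGM.SpecialGradedManifold 𝕜 n M S J) :
    -- the objects given by expressions in frames are globally well defined
    (∀ X, G.IsGivenBy (G.even X) (G.evenExpr X)) ∧
    (∀ φ, G.IsGivenBy (G.odd φ) (G.oddExpr φ)) ∧
    (∀ X φ, ∀ a, ∀ x ∈ G.dom a, G.spinorRep (G.evenSpinor X φ) a x = G.evenSpinorExpr X φ a x) ∧
    (∀ X Y, ∀ a, ∀ x ∈ G.dom a, G.vectorRep (G.lie X Y) a x = G.lieExpr X Y a x) ∧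
    (∀ φ ψ, ∀ a, ∀ x ∈ G.dom a, G.vectorRep (G.susy φ ψ) a x = G.susyExpr φ ψ a x) ∧
    -- the fields `𝔅` are s-like, have the parity of `k` and are multilinear in the spinors
    (∀ (k : ℕ) (A : SGM.Tensor n M J (k + 1)), G.CurvEnd k A →
      G.IsTensorField A ∧ G.IsSkewValued A ∧
      (∀ ξ, G.IsGivenBy (G.fieldB k A ξ) (G.fieldBExpr k A ξ) ∧
        G.IsSLike (k + 1) (G.fieldB k A ξ) ∧ G.fieldB k A ξ ∈ G.fieldsOfParity k) ∧
      ∃ m : MultilinearMap 𝕜 (fun _ : Fin k => G.Spinors) (Module.End 𝕜 G.functions),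
        ∀ ξ, m ξ = G.fieldB k A ξ) ∧
    -- the fields `𝔇` are v-like, have the parity of `k` and are multilinear in the spinors
    (∀ (k : ℕ) (A : SGM.Tensor n M J k), G.CurvVec k A →
      G.IsTensorField A ∧
      (∀ ξ, G.IsGivenBy (G.fieldD k A ξ) (G.fieldDExpr k A ξ) ∧
        G.IsVLike k (G.fieldD k A ξ) ∧ G.fieldD k A ξ ∈ G.fieldsOfParity k) ∧
      ∃ m : MultilinearMap 𝕜 (fun _ : Fin k => G.Spinors) (Module.End 𝕜 G.functions),
        ∀ ξ, m ξ = G.fieldD k A ξ) ∧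
    -- the supersymmetric Killing structure and its usual brackets
    G.IsSSKS G.killing G.parallelSpinors G.center G.even G.odd ∧
    (∀ X ∈ G.killing, ∀ φ ∈ G.parallelSpinors, G.evenSpinor X φ ∈ G.parallelSpinors ∧
      G.bracket (G.even X) (G.odd φ) = G.odd (G.evenSpinor X φ)) ∧
    (∀ φ ∈ G.parallelSpinors, ∀ ψ ∈ G.parallelSpinors, G.susy φ ψ ∈ G.killing ∧
      G.bracket (G.odd φ) (G.odd ψ) = G.even (G.susy φ ψ) + G.fieldB 2 G.curv ![φ, ψ]) ∧
    -- (1)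
    (∀ X ∈ G.killing, ∀ (k : ℕ) (A : SGM.Tensor n M J (k + 1)) (ξ : Fin k → G.Spinors),
      G.CurvEnd k A → (∀ α, ξ α ∈ G.parallelSpinors) →
      G.bracket (G.even X) (G.fieldB k A ξ) =
        ∑ α, G.fieldB k A (Function.update ξ α (G.evenSpinor X (ξ α)))) ∧
    -- (2)
    (∀ X ∈ G.killing, ∀ (k : ℕ) (A : SGM.Tensor n M J k) (ξ : Fin k → G.Spinors),
      G.CurvVec k A → (∀ α, ξ α ∈ G.parallelSpinors) →
      G.bracket (G.even X) (G.fieldD k A ξ) =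
        ∑ α, G.fieldD k A (Function.update ξ α (G.evenSpinor X (ξ α)))) ∧
    -- (3)
    (∀ φ ∈ G.parallelSpinors, ∀ (k : ℕ) (A : SGM.Tensor n M J (k + 1)) (ξ : Fin k → G.Spinors),
      G.CurvEnd k A → (∀ α, ξ α ∈ G.parallelSpinors) →
      G.bracket (G.odd φ) (G.fieldB k A ξ) =
        G.fieldB (k + 1) (G.nabla A) (Fin.cons φ ξ) +
          (-1 : 𝕜) ^ k • G.fieldD (k + 1) A (Fin.snoc ξ φ)) ∧
    -- (4)
    (∀ φ ∈ G.parallelSpinors, ∀ (k : ℕ) (A : SGM.Tensor n M J k) (ξ : Fin k → G.Spinors),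
      G.CurvVec k A → (∀ α, ξ α ∈ G.parallelSpinors) →
      G.bracket (G.odd φ) (G.fieldD k A ξ) =
        G.fieldD (k + 1) (G.nabla A) (Fin.cons φ ξ) +
          (-1 : 𝕜) ^ k • G.fieldB (k + 1) (G.contractR A) (Fin.snoc ξ φ)) ∧
    -- (5)
    (∀ (k l : ℕ) (A : SGM.Tensor n M J (k + 1)) (B : SGM.Tensor n M J (l + 1))
      (ξ : Fin k → G.Spinors) (η : Fin l → G.Spinors), G.CurvEnd k A → G.CurvEnd l B →
      (∀ α, ξ α ∈ G.parallelSpinors) → (∀ β, η β ∈ G.parallelSpinors) →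
      G.bracket (G.fieldB k A ξ) (G.fieldB l B η) =
        G.fieldB (k + l) (SGM.SpinManifold.bulletOp A B) (Fin.append ξ η)) ∧
    -- (6)
    (∀ (k l : ℕ) (A : SGM.Tensor n M J k) (B : SGM.Tensor n M J l)
      (ξ : Fin k → G.Spinors) (η : Fin l → G.Spinors), G.CurvVec k A → G.CurvVec l B →
      (∀ α, ξ α ∈ G.parallelSpinors) → (∀ β, η β ∈ G.parallelSpinors) →
      G.bracket (G.fieldD k A ξ) (G.fieldD l B η) =
        G.fieldB (k + l) (G.contractR₂ A B) (Fin.append ξ η) +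
          G.fieldD (k + l)
            (G.nablaAlong A B - SGM.SpinManifold.swapBlocks (G.nablaAlong B A))
            (Fin.append ξ η)) ∧
    -- (7)
    (∀ (k l : ℕ) (A : SGM.Tensor n M J k) (B : SGM.Tensor n M J (l + 1))
      (ξ : Fin k → G.Spinors) (η : Fin l → G.Spinors), G.CurvVec k A → G.CurvEnd l B →
      (∀ α, ξ α ∈ G.parallelSpinors) → (∀ β, η β ∈ G.parallelSpinors) →
      G.bracket (G.fieldD k A ξ) (G.fieldB l B η) =
        G.fieldB (k + l) (G.nablaAlong (l := l + 1) A B) (Fin.append ξ η) +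
          G.fieldD (k + l) (SGM.SpinManifold.circOp A B) (Fin.append ξ η)) := by
  open SGM.SpecialGradedManifold in
  exact ⟨isGivenBy_even, isGivenBy_odd, fun X φ a x hx => spinorRep_evenSpinor X φ hx,
    fun X Y a x hx => vectorRep_lie X Y hx, fun φ ψ a x hx => vectorRep_susy φ ψ hx,
    fun k A hA => have h := hA.good.isTF
      ⟨h, hA.good.isSkewValued, fun ξ => ⟨isGivenBy_fieldB h ξ, isSLike_fieldB h ξ, fieldB_mem h ξ⟩,
        fieldBM h, fun _ => rfl⟩,
    fun k A hA => have h := hA.good.isTF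
      ⟨h, fun ξ => ⟨isGivenBy_fieldD h ξ, isVLike_fieldD h ξ, fieldD_mem h ξ⟩, fieldDM h, fun _ => rfl⟩,
    isSSKS, fun X hX φ hφ => ⟨evenSpinor_mem hX hφ, bracket_even_odd hX φ⟩,
    fun φ hφ ψ hψ => ⟨susy_mem hφ hψ, bracket_odd_odd hφ hψ⟩,
    fun X hX k A ξ hA hξ => bracket_even_fieldB hX hA.good ξ,
    fun X hX k A ξ hA hξ => bracket_even_fieldD hX hA.good ξ,
    fun φ hφ k A ξ hA hξ => bracket_odd_fieldB hφ hA.good hξ,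
    fun φ hφ k A ξ hA hξ => bracket_odd_fieldD hφ hA.good hξ,
    fun k l A B ξ η hA hB hξ hη => bracket_fieldB_fieldB hA.good hB.good hξ hη,
    fun k l A B ξ η hA hB hξ hη => bracket_fieldD_fieldD hA.good.isTF
      hB.good.isTF hξ hη,
    fun k l A B ξ η hA hB hξ hη => bracket_fieldD_fieldB hA.good.isTF hB.good hξ hη⟩
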